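/- Let $(W_t)_{t\ge 0}$ be a Wiener process with continuous paths and let $Y_1,Y_2,\ldots\ge 0$ be i.i.d. service times with $\mathbb E[Y_i^2]<\infty$, independent of $W$. A sampling policy is a sequence $\pi=(S_0,S_1,\ldots)$ of random times with $0=S_0\le S_1\le S_2\le\cdots$. Sample $i\ge 1$, of value $W_{S_i}$, is generated at time $S_i$ and joins a FIFO queue with a single server: its service starts at $G_i=\max(S_i,D_{i-1})$ and it is delivered at $D_i=G_i+Y_i$, where $D_0=0$. The estimator uses $\hat W_t=W_{S_i}$ for $t\in[D_i,D_{i+1})$, $i=0,1,2,\ldots$ Let $\Pi$ be the class of the policies with the following two properties. (i) Causality: for all $i\ge1$ and $t\ge0$, $\{S_i\le t\}\in\bigcap_{u>t}\mathcal N^{(i)}_u$, where $\mathcal N^{(i)}_u$ is the $\sigma$-field generated by the signal $W_s$, the idle/busy state of the server and the number of acknowledged deliveries at the times $s\le u$, the state and the deliveries being those of the samples $1,\ldots,i-1$ (which are the only samples in the system before sample $i$ is generated). (ii) The inter-sampling times $T_i=S_{i+1}-S_i$ form a regenerative process: there are random integers $0\le k_1<k_2<\cdots$ such that, for every $j\ge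 1$, the post-$k_j$ process $\big((T_{k_j+i})_{i\ge0},(k_{j+i+1}-k_{j+i})_{i\ge0}\big)$ has the same distribution as the post-$k_1$ process and is independent of the pre-$k_j$ process $\big(k_1,\ldots,k_j,(T_i)_{i<k_j}\big)$; moreover $\mathbb E[k_{j+1}-k_j]<\infty$, $\mathbb E[S_{k_1}^2]<\infty$ and $0<\mathbb E[(S_{k_{j+1}}-S_{k_j})^2]<\infty$. Let $\Pi_1=\{\pi\in\Pi: S_i\ge D_{i-1}\text{ for all }i\ge1\}$ be the class of the policies that never take a sample before the previous sample is delivered. For $0<f_{\max}\le\infty$ consider the MSE-minimization problem $$\mathsf{mse}_{\rm opt}=\inf_{\pi\in\Pi}\ \mathsf{mse}(\pi)\quad\text{subject to}\quad \liminf_{n\to\infty}\frac1n\mathbb E[S_n]\ge\frac1{f_{\max}},\qquad \mathsf{mse}(\pi)=\limsup_{T\to\infty}\frac1T\,\mathbb E\Big[\int_0^T(W_t-\hat W_t)^2\,dt\Big].$$ Then it is suboptimal to take a new sample before the previous sample is delivered: for every policy $\pi\in\Pi$ that satisfies the rate constraint there is a policy $\pi'\in\Pi_1$ that satisfies the rate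 constraint and has $\mathsf{mse}(\pi')\le\mathsf{mse}(\pi)$. Consequently, $\mathsf{mse}_{\rm opt}$ equals the infimum of $\mathsf{mse}(\pi)$ over the policies in $\Pi_1$ that satisfy the rate constraint. -/

import Mathlib

open MeasureTheory ProbabilityTheory Filter
open scoped NNReal ENNReal

noncomputable section

namespace RemoteEstimation

variable {Ω : Type*}

/-- Delivery times `D i` of a FIFO queue with a single server. `S i` is the generation time of
sample `i`, and `Y i` is the service time of sample `i + 1` (so `Y 0, Y 1, …` are the service times
of the samples `1, 2, …`). Sample `0` stands for the initial value of the signal, which the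
estimator has at time `0`. The service of sample `i + 1` starts once the sample has been generated
and the previous sample has been delivered. -/
def deliveryTime (Y : ℕ → Ω → ℝ≥0) (S : ℕ → Ω → ℝ≥0∞) : ℕ → Ω → ℝ≥0∞
  | 0, _ => 0
  | i + 1, ω => max (S (i + 1) ω) (deliveryTime Y S i ω) + (Y i ω : ℝ≥0∞)

/-- Service starting time of sample `i + 1`. -/
def serviceStart (Y : ℕ → Ω → ℝ≥0) (S : ℕ → Ω → ℝ≥0∞) (i : ℕ) (ω : Ω) : ℝ≥0∞ :=
  max (S (i + 1) ω) (deliveryTime Y S i ω)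

open Classical in
/-- Busy (`1`) or idle (`0`) state at time `s` of the server, as far as the samples `1, …, m` are
concerned. -/
def serverState (Y : ℕ → Ω → ℝ≥0) (S : ℕ → Ω → ℝ≥0∞) (m : ℕ) (s : ℝ≥0) (ω : Ω) : ℕ :=
  if ∃ i < m, serviceStart Y S i ω ≤ s ∧ (s : ℝ≥0∞) < deliveryTime Y S (i + 1) ω then 1 else 0

open Classical in
/-- Number of acknowledgements received by time `s` for the samples `1, …, m`. -/
def ackCount (Y : ℕ → Ω → ℝ≥0) (S : ℕ → Ω → ℝ≥0∞) (m : ℕ) (s : ℝ≥0) (ω : Ω) : ℕ :=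
  ((Finset.range m).filter fun i => deliveryTime Y S (i + 1) ω ≤ s).card

/-- The information that is available to the sampler at time `t` for the choice of sample `m + 1`:
the signal, the server state and the acknowledgements up to time `t`. Only the samples `1, …, m`
are in the system before sample `m + 1` is generated. -/
abbrev samplerInfo (W : ℝ≥0 → Ω → ℝ) (Y : ℕ → Ω → ℝ≥0) (S : ℕ → Ω → ℝ≥0∞) (m : ℕ) (t : ℝ≥0) :
    MeasurableSpace Ω :=
  ⨆ s ≤ t, (MeasurableSpace.comap (W s) inferInstance ⊔
    MeasurableSpace.comap (serverState Y S m s) ⊤ ⊔ MeasurableSpace.comap (ackCount Y S m s) ⊤)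

/-- The right-continuous version of `samplerInfo`. -/
abbrev samplerInfoPlus (W : ℝ≥0 → Ω → ℝ) (Y : ℕ → Ω → ℝ≥0) (S : ℕ → Ω → ℝ≥0∞) (m : ℕ) (t : ℝ≥0) :
    MeasurableSpace Ω :=
  ⨅ u > t, samplerInfo W Y S m u

/-- Inter-sampling times `T i = S (i + 1) - S i`. -/
def interSampling (S : ℕ → Ω → ℝ≥0∞) (i : ℕ) (ω : Ω) : ℝ≥0∞ :=
  S (i + 1) ω - S i ω

/-- The process before the regeneration index `k j`: the regeneration indices `k 0, …, k j` and the
entries `T 0, …, T (k j - 1)` (padded with zeros). -/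
def preProcess (T : ℕ → Ω → ℝ≥0∞) (k : ℕ → Ω → ℕ) (j : ℕ) (ω : Ω) :
    (Fin (j + 1) → ℕ) × (ℕ → ℝ≥0∞) :=
  (fun i => k i ω, fun i => if i < k j ω then T i ω else 0)

/-- The process from the regeneration index `k j` on: the entries `T (k j), T (k j + 1), …` and the
lengths `k (j + 1) - k j, k (j + 2) - k (j + 1), …` of the subsequent cycles. -/
def postProcess (T : ℕ → Ω → ℝ≥0∞) (k : ℕ → Ω → ℕ) (j : ℕ) (ω : Ω) :
    (ℕ → ℝ≥0∞) × (ℕ → ℕ) :=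
  (fun i => T (k j ω + i) ω, fun i => k (j + i + 1) ω - k (j + i) ω)

/-- The inter-sampling times form a regenerative process, with regeneration indices
`k 0 < k 1 < …` and the moment conditions of the sampling problem. -/
def IsRegenerativeSampling [MeasurableSpace Ω] (P : Measure Ω) (S : ℕ → Ω → ℝ≥0∞) : Prop :=
  ∃ k : ℕ → Ω → ℕ,
    (∀ j, Measurable (k j)) ∧
    (∀ j ω, k j ω < k (j + 1) ω) ∧
    (∀ j, IdentDistrib (postProcess (interSampling S) k j)
      (postProcess (interSampling S) k 0) P P) ∧
    (∀ j, IndepFun (preProcess (interSampling S) k j)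
      (postProcess (interSampling S) k j) P) ∧
    (∀ j, ∫⁻ ω, ((k (j + 1) ω - k j ω : ℕ) : ℝ≥0∞) ∂P < ∞) ∧
    ∫⁻ ω, (S (k 0 ω) ω) ^ 2 ∂P < ∞ ∧
    ∀ j, 0 < ∫⁻ ω, (S (k (j + 1) ω) ω - S (k j ω) ω) ^ 2 ∂P ∧
      ∫⁻ ω, (S (k (j + 1) ω) ω - S (k j ω) ω) ^ 2 ∂P < ∞

/-- The class `Π` of online sampling policies. The sampling times are allowed to be infinite on a
null set (they are almost surely finite by the moment conditions). -/
structure IsOnlinePolicy [MeasurableSpace Ω] (P : Measure Ω) (W : ℝ≥0 → Ω → ℝ) (Y : ℕ → Ω → ℝ≥0)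
    (S : ℕ → Ω → ℝ≥0∞) : Prop where
  zero : ∀ ω, S 0 ω = 0
  mono : ∀ i ω, S i ω ≤ S (i + 1) ω
  causal : ∀ (m : ℕ) (t : ℝ≥0), MeasurableSet[samplerInfoPlus W Y S m t] {ω | S (m + 1) ω ≤ t}
  regenerative : IsRegenerativeSampling P S

/-- The class `Π₁` of the online policies that take no sample before the previous sample is
delivered. -/
structure IsNonQueueingPolicy [MeasurableSpace Ω] (P : Measure Ω) (W : ℝ≥0 → Ω → ℝ)
    (Y : ℕ → Ω → ℝ≥0) (S : ℕ → Ω → ℝ≥0∞) : Prop extends IsOnlinePolicy P W Y S where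
  idle : ∀ i ω, deliveryTime Y S i ω ≤ S (i + 1) ω

/-- The sampling rate constraint `liminf E[S n] / n ≥ 1 / fmax`; there is no constraint if
`fmax = ∞`. -/
def RateConstraint [MeasurableSpace Ω] (P : Measure Ω) (fmax : ℝ≥0∞) (S : ℕ → Ω → ℝ≥0∞) : Prop :=
  1 / fmax ≤ liminf (fun n : ℕ => (∫⁻ ω, S n ω ∂P) / (n : ℝ≥0∞)) atTop

/-- The estimate at time `t`: the value `W (S i)` of the freshest delivered sample, that is,
`D i ≤ t < D (i + 1)`. -/
def estimate (W : ℝ≥0 → Ω → ℝ) (Y : ℕ → Ω → ℝ≥0) (S : ℕ → Ω → ℝ≥0∞) (t : ℝ≥0) (ω : Ω) : ℝ :=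
  W (S (sSup {i : ℕ | deliveryTime Y S i ω ≤ t}) ω).toNNReal ω

/-- The time-average mean-square error `limsup (1 / T) E[∫₀ᵀ (W t - Ŵ t)² dt]`. -/
def mse [MeasurableSpace Ω] (P : Measure Ω) (W : ℝ≥0 → Ω → ℝ) (Y : ℕ → Ω → ℝ≥0)
    (S : ℕ → Ω → ℝ≥0∞) : ℝ≥0∞ :=
  limsup (fun T : ℝ => (∫⁻ ω, (∫⁻ t in Set.Icc (0 : ℝ) T,
    ENNReal.ofReal ((W t.toNNReal ω - estimate W Y S t.toNNReal ω) ^ 2)) ∂P) / ENNReal.ofReal T)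
    atTop

/-- The optimal value of the sampling problem. -/
def mseOpt [MeasurableSpace Ω] (P : Measure Ω) (W : ℝ≥0 → Ω → ℝ) (Y : ℕ → Ω → ℝ≥0)
    (fmax : ℝ≥0∞) : ℝ≥0∞ :=
  ⨅ S ∈ {S : ℕ → Ω → ℝ≥0∞ | IsOnlinePolicy P W Y S ∧ RateConstraint P fmax S}, mse P W Y S

/-- The optimal value of the sampling problem over the policies that never take a sample before
the previous one is delivered. -/
def mseOptNonQueueing [MeasurableSpace Ω] (P : Measure Ω) (W : ℝ≥0 → Ω → ℝ) (Y : ℕ → Ω → ℝ≥0)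
    (fmax : ℝ≥0∞) : ℝ≥0∞ :=
  ⨅ S ∈ {S : ℕ → Ω → ℝ≥0∞ | IsNonQueueingPolicy P W Y S ∧ RateConstraint P fmax S}, mse P W Y S

end RemoteEstimation

end

/-!
The idea is to bound the error of every causal policy from below by a quantity that depends on the
policy only through its sampling rate, and to find a policy without queueing that attains this bound
at an admissible rate.

*Lower bound.* Fix `β ≥ 0`. While the server is idle, the corrector `((β - x²)⁺)² / 6` of the
estimation error `x` turns the cost `x²` into a cost of at least `β / 3` per unit of time
(`IsBrownianWith.waiting_le`, by Dynkin's formula); while it is busy, the next sample has already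
been taken, and the cost of the service period is explicit, because the service time is independent
of the signal and of the past (`IsBrownianWith.discInt_service`). A shift of a Gaussian variable
only decreases the mean of the corrector (`integral_corrector_shift_le`), so an early sample, whose
error at the start of its service is not zero, cannot improve the bound. Adding up all samples with
a discount factor `exp (-α t)` and letting `α → 0` gives `E Y + β / 3 + cycleExcess P β Y * κ ≤ mse`
if the excess is nonpositive and `κ` bounds the discounted number of samples per unit of time
(`IsOnlinePolicy.lower_bound`). Discounting, that is stopping at an independent exponential time,
makes all sums finite and avoids moment conditions on the policy. Regeneration yields such a `κ`:
the mean number of samples in a cycle over the mean length of a cycle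
(`IsOnlinePolicy.eventually_totalDisc_le`), while the rate constraint forces `κ ≤ fmax`
(`IsRegenerationIndex.liminf_le`).

*Attainment.* The threshold policy waits after each delivery until the squared error exceeds `β`. By
the strong Markov property its inter-sampling times are independent and, after the first one,
identically distributed, so that it is admissible (`isNonQueueingPolicy_thresholdPolicy`), and its
error is at most the mean cost over the mean length of a cycle, which is
`E Y + β / 3 + cycleExcess P β Y / meanCycle P β Y` (`mse_thresholdPolicy_le_ofReal`). By the
intermediate value theorem `β` can be chosen such that either the excess vanishes, and with it the
influence of the rate, or `meanCycle P β Y = 1 / κ` (`exists_threshold`). In both cases the two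
bounds agree.

If all service times vanish, the threshold could degenerate to `β = 0`; but then delaying each
sample to the preceding delivery changes the policy on a null set only
(`exists_nonQueueing_of_no_service`).

The signal is treated relative to the filtrations `pathInfo W 𝒴`, the history of `W` enlarged by an
independent σ-algebra `𝒴` of service times. Causal sampling times are optional times of these
filtrations (`isOptional_sampling_and_delivery`), for which the strong Markov property
(`IsBrownianWith.indep_shiftPath`, `IsBrownianWith.identDistrib_shiftPath`) and Dynkin's formula
(`IsBrownianWith.dynkin_le`) are proved by approximation from above by dyadic times.
-/

noncomputable section

namespace RemoteEstimation

open ENNReal (ofReal)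

/-! ### Independence of σ-algebras -/

/-- If `A` is independent of `B` and `C` is independent of `A ⊔ B`, then `A` is independent of
`B ⊔ C`. -/
lemma indep_sup_right {Ω : Type*} {A B C mΩ : MeasurableSpace Ω} {P : Measure Ω}
    [IsProbabilityMeasure P] (hA : A ≤ mΩ) (hB : B ≤ mΩ) (hC : C ≤ mΩ)
    (hAB : Indep A B P) (hABC : Indep (A ⊔ B) C P) : Indep A (B ⊔ C) P := by
  set p : Set (Set Ω) := Set.image2 (· ∩ ·) {b | MeasurableSet[B] b} {c | MeasurableSet[C] c}
  have hgen : B ⊔ C = MeasurableSpace.generateFrom p := by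
    refine le_antisymm (sup_le ?_ ?_) (MeasurableSpace.generateFrom_le ?_)
    · intro b hb
      exact MeasurableSpace.measurableSet_generateFrom ⟨b, hb, Set.univ, .univ, by simp⟩
    · intro c hc
      exact MeasurableSpace.measurableSet_generateFrom ⟨Set.univ, .univ, c, hc, by simp⟩
    · rintro _ ⟨b, hb, c, hc, rfl⟩
      exact MeasurableSet.inter (le_sup_left (a := B) _ hb) (le_sup_right (a := B) _ hc)
  have hpi : IsPiSystem p := by
    rintro _ ⟨b, hb, c, hc, rfl⟩ _ ⟨b', hb', c', hc', rfl⟩ -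
    exact ⟨b ∩ b', MeasurableSet.inter hb hb', c ∩ c', MeasurableSet.inter hc hc',
      Set.inter_inter_inter_comm _ _ _ _⟩
  refine IndepSets.indep hA (sup_le hB hC) (@MeasurableSpace.isPiSystem_measurableSet _ A) hpi
    (@MeasurableSpace.generateFrom_measurableSet _ A).symm hgen ?_
  rw [IndepSets_iff]
  rintro a _ ha ⟨b, hb, c, hc, rfl⟩
  rw [Indep_iff] at hAB hABC
  have hb' : MeasurableSet[A ⊔ B] b := le_sup_right (a := A) _ hb
  have ha' : MeasurableSet[A ⊔ B] a := le_sup_left (a := A) _ ha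
  show P (a ∩ (b ∩ c)) = P a * P (b ∩ c)
  rw [← Set.inter_assoc, hABC _ _ (MeasurableSet.inter ha' hb') hc, hABC _ _ hb' hc, hAB _ _ ha hb,
    mul_assoc]

/-! ### Optional times -/

section Optional

variable {Ω : Type*} {mΩ : MeasurableSpace Ω}

/-- `τ` is an optional time of `F`: the event `τ < u` belongs to `F u` for all `u`. -/
def IsOptional (F : ℝ≥0 → MeasurableSpace Ω) (τ : Ω → ℝ≥0∞) : Prop :=
  ∀ u : ℝ≥0, MeasurableSet[F u] {ω | τ ω < u}

variable {F : ℝ≥0 → MeasurableSpace Ω} {σ τ : Ω → ℝ≥0∞}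

/-- The events that are known right after the optional time `τ`. -/
@[reducible] def pastOf {mΩ : MeasurableSpace Ω} {F : ℝ≥0 → MeasurableSpace Ω} {τ : Ω → ℝ≥0∞}
    (hτ : IsOptional F τ) : MeasurableSpace Ω where
  MeasurableSet' A := MeasurableSet[mΩ] A ∧ ∀ u : ℝ≥0, MeasurableSet[F u] (A ∩ {ω | τ ω < u})
  measurableSet_empty := by simp
  measurableSet_compl A hA := by
    refine ⟨hA.1.compl, fun u => ?_⟩
    have : Aᶜ ∩ {ω | τ ω < u} = {ω | τ ω < u} \ (A ∩ {ω | τ ω < u}) := by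
      ext ω; simp; tauto
    rw [this]
    exact (hτ u).diff (hA.2 u)
  measurableSet_iUnion f hf := by
    refine ⟨.iUnion fun i => (hf i).1, fun u => ?_⟩
    rw [Set.iUnion_inter]
    exact .iUnion fun i => (hf i).2 u

lemma measurableSet_pastOf (hτ : IsOptional F τ) {A : Set Ω} :
    MeasurableSet[pastOf (mΩ := mΩ) hτ] A ↔
      MeasurableSet[mΩ] A ∧ ∀ u : ℝ≥0, MeasurableSet[F u] (A ∩ {ω | τ ω < u}) := Iff.rfl

lemma pastOf_le (hτ : IsOptional F τ) : pastOf (mΩ := mΩ) hτ ≤ mΩ := fun _ h => h.1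

lemma pastOf_mono (hσ : IsOptional F σ) (hτ : IsOptional F τ) (h : ∀ ω, σ ω ≤ τ ω) :
    pastOf (mΩ := mΩ) hσ ≤ pastOf (mΩ := mΩ) hτ := by
  rintro A ⟨hA, hA'⟩
  refine ⟨hA, fun u => ?_⟩
  have : A ∩ {ω | τ ω < u} = (A ∩ {ω | σ ω < u}) ∩ {ω | τ ω < u} := by
    ext ω; simp only [Set.mem_inter_iff, Set.mem_ofPred_eq]
    exact ⟨fun ⟨a, b⟩ => ⟨⟨a, (h ω).trans_lt b⟩, b⟩, fun ⟨⟨a, _⟩, b⟩ => ⟨a, b⟩⟩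
  rw [this]
  exact (hA' u).inter (hτ u)

lemma IsOptional.mono {F' : ℝ≥0 → MeasurableSpace Ω} (hτ : IsOptional F τ)
    (h : ∀ u, F u ≤ F' u) : IsOptional F' τ := fun u => h u _ (hτ u)

lemma IsOptional.measurableSet_lt (hF : Monotone F) (hτ : IsOptional F τ) {s u : ℝ≥0}
    (h : s ≤ u) : MeasurableSet[F u] {ω | τ ω < s} := hF h _ (hτ s)

lemma lt_iff_exists_rat_nnreal {x y : ℝ≥0∞} :
    x < y ↔ ∃ q : ℚ, x < (Real.toNNReal q : ℝ≥0∞) ∧ (Real.toNNReal q : ℝ≥0∞) < y :=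
  ⟨fun h => by
    obtain ⟨q, _, h1, h2⟩ := ENNReal.lt_iff_exists_rat_btwn.1 h
    exact ⟨q, h1, h2⟩, fun ⟨_, h1, h2⟩ => h1.trans h2⟩

lemma le_iff_forall_rat_nnreal {x : ℝ≥0∞} {s u : ℝ≥0} (h : s < u) :
    x ≤ s ↔ ∀ q : ℚ, s < Real.toNNReal q → Real.toNNReal q < u →
      x < (Real.toNNReal q : ℝ≥0∞) := by
  refine ⟨fun hx q hq _ => hx.trans_lt (by exact_mod_cast hq), fun hx => ?_⟩
  by_contra! hlt
  obtain ⟨q, h1, h2⟩ := lt_iff_exists_rat_nnreal.1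
    (lt_min hlt (ENNReal.coe_lt_coe.2 h) : (s : ℝ≥0∞) < min x u)
  exact lt_asymm (h2.trans_le (min_le_left _ _))
    (hx q (by exact_mod_cast h1) (by exact_mod_cast h2.trans_le (min_le_right _ _)))

lemma IsOptional.measurableSet_le (hF : Monotone F) (hτ : IsOptional F τ) {s u : ℝ≥0}
    (h : s < u) : MeasurableSet[F u] {ω | τ ω ≤ s} := by
  have : {ω | τ ω ≤ s} = ⋂ q : ℚ, ⋂ (_ : s < Real.toNNReal q), ⋂ (_ : Real.toNNReal q < u),
      {ω | τ ω < (Real.toNNReal q : ℝ≥0∞)} := by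
    ext ω; simp only [Set.mem_ofPred_eq, Set.mem_iInter]; exact le_iff_forall_rat_nnreal h
  rw [this]
  exact .iInter fun q => .iInter fun _ => .iInter fun h2 => hτ.measurableSet_lt hF h2.le

lemma isOptional_of_le
    (h : ∀ t u : ℝ≥0, t < u → MeasurableSet[F u] {ω | τ ω ≤ t}) : IsOptional F τ := by
  intro u
  have : {ω | τ ω < u} = ⋃ q : ℚ, ⋃ (_ : Real.toNNReal q < u),
      {ω | τ ω ≤ (Real.toNNReal q : ℝ≥0∞)} := by
    ext ω; simp only [Set.mem_ofPred_eq, Set.mem_iUnion]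
    refine ⟨fun h => ?_, fun ⟨q, h1, h2⟩ => h2.trans_lt (by exact_mod_cast h1)⟩
    obtain ⟨q, h1, h2⟩ := lt_iff_exists_rat_nnreal.1 h
    exact ⟨q, by exact_mod_cast h2, h1.le⟩
  rw [this]
  exact .iUnion fun q => .iUnion fun h1 => h _ _ h1

lemma isOptional_const (c : ℝ≥0∞) : IsOptional F (fun _ => c) := fun u => by simp

lemma IsOptional.min (hσ : IsOptional F σ) (hτ : IsOptional F τ) :
    IsOptional F (fun ω => min (σ ω) (τ ω)) := fun u => by
  simp only [min_lt_iff]; exact (hσ u).union (hτ u)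

lemma IsOptional.max (hσ : IsOptional F σ) (hτ : IsOptional F τ) :
    IsOptional F (fun ω => max (σ ω) (τ ω)) := fun u => by
  simp only [max_lt_iff]; exact (hσ u).inter (hτ u)

/-- A random delay that is known right after `τ` turns `τ` into an optional time. -/
lemma IsOptional.add (hF : Monotone F) (hτ : IsOptional F τ) {η : Ω → ℝ≥0∞}
    (hη : Measurable[pastOf (mΩ := mΩ) hτ] η) : IsOptional F (fun ω => τ ω + η ω) := by
  intro u
  have : {ω | τ ω + η ω < u} = ⋃ q : ℚ, ⋃ (_ : Real.toNNReal q ≤ u),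
      ({ω | η ω < (u - Real.toNNReal q : ℝ≥0)} ∩ {ω | τ ω < (Real.toNNReal q : ℝ≥0∞)}) := by
    ext ω
    simp only [Set.mem_ofPred_eq, Set.mem_iUnion, Set.mem_inter_iff, exists_prop]
    constructor
    · intro h
      have h1 : τ ω < u - η ω := lt_tsub_iff_right.2 h
      obtain ⟨q, hq1, hq2⟩ := lt_iff_exists_rat_nnreal.1 h1
      have hq3 := lt_tsub_iff_right.1 hq2
      refine ⟨q, ?_, ?_, hq1⟩
      · exact_mod_cast (hq2.trans_le tsub_le_self).le
      · rw [ENNReal.coe_sub]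
        refine lt_tsub_iff_right.2 ?_
        rwa [add_comm]
    · rintro ⟨q, hq, h1, h2⟩
      calc τ ω + η ω < (Real.toNNReal q : ℝ≥0∞) + (u - Real.toNNReal q : ℝ≥0) :=
            ENNReal.add_lt_add h2 h1
        _ = u := by rw [← ENNReal.coe_add, add_tsub_cancel_of_le hq]
  rw [this]
  refine .iUnion fun q => .iUnion fun hq => hF hq _ ?_
  exact ((measurableSet_pastOf hτ).1 (hη measurableSet_Iio)).2 _

lemma IsOptional.measurable_pastOf (hF : Monotone F) (hFm : ∀ u, F u ≤ mΩ)
    (hτ : IsOptional F τ) : Measurable[pastOf (mΩ := mΩ) hτ] τ := by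
  refine @measurable_of_Iio ℝ≥0∞ Ω _ _ _ (pastOf (mΩ := mΩ) hτ) _ _ _ _ fun x => ?_
  have h1 : τ ⁻¹' Set.Iio x = ⋃ q : ℚ, ⋃ (_ : (Real.toNNReal q : ℝ≥0∞) < x),
      {ω | τ ω < (Real.toNNReal q : ℝ≥0∞)} := by
    ext ω
    simp only [Set.mem_preimage, Set.mem_Iio, Set.mem_iUnion, Set.mem_ofPred_eq]
    rw [lt_iff_exists_rat_nnreal]
    simp only [exists_prop, and_comm]
  rw [h1]
  refine MeasurableSet.iUnion fun q => MeasurableSet.iUnion fun _ => ⟨hFm _ _ (hτ _), fun u => ?_⟩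
  have : {ω | τ ω < (Real.toNNReal q : ℝ≥0∞)} ∩ {ω | τ ω < u} =
      {ω | τ ω < (Min.min (Real.toNNReal q) u : ℝ≥0)} := by
    ext ω; simp
  rw [this]
  exact hτ.measurableSet_lt hF (min_le_right _ _)

lemma IsOptional.measurable (hF : Monotone F) (hFm : ∀ u, F u ≤ mΩ)
    (hτ : IsOptional F τ) : Measurable τ :=
  (hτ.measurable_pastOf hF hFm).mono (pastOf_le hτ) le_rfl

lemma measurable_pastOf_of_zero (hF : Monotone F) (hFm : ∀ u, F u ≤ mΩ) (hτ : IsOptional F τ)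
    {E : Type*} [MeasurableSpace E] {f : Ω → E} (hf : Measurable[F 0] f) :
    Measurable[pastOf (mΩ := mΩ) hτ] f := fun _ hs =>
  ⟨hFm 0 _ (hf hs), fun u => MeasurableSet.inter (hF zero_le _ (hf hs)) (hτ u)⟩

/-- The value of a continuous adapted process at an optional time `τ` is known right after `τ`. -/
lemma measurable_pastOf_eval (hF : Monotone F) (hFm : ∀ u, F u ≤ mΩ) {W : ℝ≥0 → Ω → ℝ}
    (hWc : ∀ ω, Continuous fun t => W t ω) (hWF : ∀ s, Measurable[F s] (W s))
    (hτ : IsOptional F τ) :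
    Measurable[pastOf (mΩ := mΩ) hτ] fun ω => W (τ ω).toNNReal ω := by
  have hjoint : Measurable (Function.uncurry W) :=
    measurable_uncurry_of_continuous_of_measurable hWc fun s => (hWF s).mono (hFm s) le_rfl
  intro B hB
  refine ⟨?_, fun u => ?_⟩
  · have h1 : Measurable fun ω => W (τ ω).toNNReal ω :=
      hjoint.comp ((hτ.measurable hF hFm).ennreal_toNNReal.prodMk measurable_id)
    exact h1 hB
  · have h2 : Measurable[F u] fun ω => min (τ ω) u := by
      refine @measurable_of_Iio ℝ≥0∞ Ω _ _ _ (F u) _ _ _ _ fun x => ?_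
      rcases le_or_gt x u with hx | hx
      · lift x to ℝ≥0 using ne_top_of_le_ne_top ENNReal.coe_ne_top hx
        have : (fun ω => Min.min (τ ω) (u : ℝ≥0∞)) ⁻¹' Set.Iio (x : ℝ≥0∞) = {ω | τ ω < x} := by
          ext ω; simp only [Set.mem_preimage, Set.mem_Iio, min_lt_iff, Set.mem_ofPred_eq, hx.not_gt,
            or_false]
        rw [this]
        exact hτ.measurableSet_lt hF (by exact_mod_cast hx)
      · have : (fun ω => Min.min (τ ω) (u : ℝ≥0∞)) ⁻¹' Set.Iio x = Set.univ := by
          ext ω; simp [hx]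
        rw [this]; exact .univ
    have h3 : Measurable[Prod.instMeasurableSpace (m₂ := F u)]
        (Function.uncurry fun s ω => W (Min.min s u) ω) :=
      @measurable_uncurry_of_continuous_of_measurable _ _ _ _ _ _ _ _ _ _ _ _ (F u) _
        (fun ω => (hWc ω).comp (continuous_id.min continuous_const))
        fun s => (hWF _).mono (hF (min_le_right _ _)) le_rfl
    have h4 : Measurable[F u] fun ω => W (Min.min (Min.min (τ ω) u).toNNReal u) ω := by
      exact h3.comp ((Measurable.ennreal_toNNReal h2).prodMk
        (@measurable_id _ (F u)))
    have : (fun ω => W (τ ω).toNNReal ω) ⁻¹' B ∩ {ω | τ ω < u} =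
        (fun ω => W (Min.min (Min.min (τ ω) u).toNNReal u) ω) ⁻¹' B ∩ {ω | τ ω < u} := by
      ext ω
      simp only [Set.mem_inter_iff, Set.mem_preimage, Set.mem_ofPred_eq]
      refine and_congr_left fun hlt => ?_
      rw [min_eq_left hlt.le, min_eq_left]
      simpa using ENNReal.toNNReal_mono ENNReal.coe_ne_top hlt.le
    rw [this]
    exact MeasurableSet.inter (h4 hB) (hτ u)

end Optional

/-! ### Brownian motion relative to an enlarged filtration and the strong Markov property -/

section StrongMarkov

variable {Ω : Type*}

/-- The information on the process `W` up to time `t`, enlarged by the events of `𝒴`. -/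
@[reducible] def pathInfo (W : ℝ≥0 → Ω → ℝ) (𝒴 : MeasurableSpace Ω) (t : ℝ≥0) :
    MeasurableSpace Ω :=
  (⨆ s ≤ t, MeasurableSpace.comap (W s) inferInstance) ⊔ 𝒴

/-- A Brownian motion with measurable marginals and continuous paths that is independent of the
events of `𝒴`. -/
structure IsBrownianWith (𝒴 : MeasurableSpace Ω) [mΩ : MeasurableSpace Ω] (P : Measure Ω)
    (W : ℝ≥0 → Ω → ℝ) : Prop where
  brownian : IsBrownianReal W P
  meas : ∀ t, Measurable (W t)
  cont : ∀ ω, Continuous fun t => W t ω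
  le : 𝒴 ≤ mΩ
  indep : Indep (MeasurableSpace.comap (fun ω t => W t ω) inferInstance) 𝒴 P

/-- The increments of `W` after the random time `τ`. -/
def shiftPath (W : ℝ≥0 → Ω → ℝ) (τ : Ω → ℝ≥0∞) (ω : Ω) (s : ℝ≥0) : ℝ :=
  W ((τ ω).toNNReal + s) ω - W (τ ω).toNNReal ω

variable {W : ℝ≥0 → Ω → ℝ} {𝒴 : MeasurableSpace Ω}

lemma pathInfo_mono : Monotone (pathInfo W 𝒴) := fun _ _ h =>
  sup_le_sup_right (biSup_mono fun _ hs => le_trans hs h) _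

lemma measurable_pathInfo (s : ℝ≥0) : Measurable[pathInfo W 𝒴 s] (W s) :=
  Measurable.of_comap_le (le_sup_of_le_left (le_iSup₂_of_le s le_rfl le_rfl))

lemma le_pathInfo (s : ℝ≥0) : 𝒴 ≤ pathInfo W 𝒴 s := le_sup_right

variable [mΩ : MeasurableSpace Ω] {P : Measure Ω}

namespace IsBrownianWith

lemma isProbabilityMeasure (h : IsBrownianWith 𝒴 P W) : IsProbabilityMeasure P :=
  have hb := h.brownian
  hb.isGaussianProcess.isProbabilityMeasure

lemma pathInfo_le (h : IsBrownianWith 𝒴 P W) (t : ℝ≥0) : pathInfo W 𝒴 t ≤ mΩ :=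
  sup_le (iSup₂_le fun s _ => (h.meas s).comap_le) h.le

lemma measurable_uncurry (h : IsBrownianWith 𝒴 P W) : Measurable (Function.uncurry W) :=
  measurable_uncurry_of_continuous_of_measurable h.cont h.meas

lemma measurable_eval (h : IsBrownianWith 𝒴 P W) {τ : Ω → ℝ≥0} (hτ : Measurable τ) :
    Measurable fun ω => W (τ ω) ω :=
  h.measurable_uncurry.comp (hτ.prodMk measurable_id)

lemma measurable_shiftPath (h : IsBrownianWith 𝒴 P W) {τ : Ω → ℝ≥0∞} (hτ : Measurable τ) :
    Measurable (shiftPath W τ) :=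
  measurable_pi_lambda _ fun s => (h.measurable_eval (hτ.ennreal_toNNReal.add_const s)).sub
    (h.measurable_eval hτ.ennreal_toNNReal)

/-- The increments of `W` after a fixed time are independent of the information up to that time. -/
lemma indep_shift (h : IsBrownianWith 𝒴 P W) (t : ℝ≥0) :
    Indep (pathInfo W 𝒴 t)
      (MeasurableSpace.comap (fun ω s => W (t + s) ω - W t ω) inferInstance) P := by
  have := h.isProbabilityMeasure
  have h1 := h.brownian.indepFun_shift t
  have hm : Measurable fun ω s => W (t + s) ω - W t ω :=
    measurable_pi_lambda _ fun s => (h.meas _).sub (h.meas _)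
  have e : (⨆ s ≤ t, MeasurableSpace.comap (W s) inferInstance) =
      MeasurableSpace.comap (fun ω (s : Set.Iic t) => W s ω) inferInstance := by
    rw [MeasurableSpace.pi, MeasurableSpace.comap_iSup]
    simp_rw [MeasurableSpace.comap_comp]
    rw [iSup_subtype]
    rfl
  have hp : Measurable fun ω (s : Set.Iic t) => W s ω :=
    measurable_pi_lambda _ fun s => h.meas _
  unfold pathInfo
  rw [e]
  refine (indep_sup_right hm.comap_le hp.comap_le h.le h1 ?_).symm
  refine indep_of_indep_of_le_left h.indep (sup_le ?_ ?_)
  · have : Measurable[MeasurableSpace.comap (fun ω t => W t ω) inferInstance]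
        fun ω s => W (t + s) ω - W t ω := by
      have hc := comap_measurable (m := MeasurableSpace.pi) fun ω t => W t ω
      exact @measurable_pi_lambda _ _ _ (MeasurableSpace.comap (fun ω t => W t ω) _) _ _ fun s =>
        ((measurable_pi_apply (t + s)).comp hc).sub
        ((measurable_pi_apply t).comp hc)
    exact this.comap_le
  · have : Measurable[MeasurableSpace.comap (fun ω t => W t ω) inferInstance]
        fun ω (s : Set.Iic t) => W s ω := by
      have hc := comap_measurable (m := MeasurableSpace.pi) fun ω t => W t ω
      exact @measurable_pi_lambda _ _ _ (MeasurableSpace.comap (fun ω t => W t ω) _) _ _ fun s =>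
        ((measurable_pi_apply (s : ℝ≥0)).comp hc)
    exact this.comap_le

/-- The law of the increments of `W` after a fixed time is the law of `W`. -/
lemma identDistrib_shift (h : IsBrownianWith 𝒴 P W) (t : ℝ≥0) :
    IdentDistrib (fun ω s => W (t + s) ω - W t ω) (fun ω s => W s ω) P P := by
  have := h.isProbabilityMeasure
  have hm : Measurable fun ω s => W (t + s) ω - W t ω :=
    measurable_pi_lambda _ fun s => (h.meas _).sub (h.meas _)
  refine (identDistrib_iff_forall_finset_identDistrib (X := fun s ω => W (t + s) ω - W t ω)
    (Y := W) hm.aemeasurable (measurable_pi_lambda _ h.meas).aemeasurable).2 fun I => ?_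
  have h1 := (h.brownian.shift t).hasLaw I
  have h2 := h.brownian.hasLaw I
  exact ⟨h1.aemeasurable, h2.aemeasurable, h1.map_eq.trans h2.map_eq.symm⟩

end IsBrownianWith

/-- The first point of the grid of mesh `1 / 2 ^ n` after `t`. -/
def gridUp (n : ℕ) (t : ℝ≥0) : ℝ≥0 := (⌊t * 2 ^ n⌋₊ + 1 : ℕ) / 2 ^ n

lemma lt_gridUp (n : ℕ) (t : ℝ≥0) : t < gridUp n t := by
  unfold gridUp
  rw [lt_div_iff₀ (by positivity)]
  exact_mod_cast Nat.lt_floor_add_one (t * 2 ^ n)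

lemma gridUp_le (n : ℕ) (t : ℝ≥0) : gridUp n t ≤ t + 1 / 2 ^ n := by
  unfold gridUp
  rw [div_le_iff₀ (by positivity), add_mul, div_mul_cancel₀ _ (by positivity)]
  push_cast
  gcongr
  exact Nat.floor_le zero_le

lemma tendsto_gridUp (t : ℝ≥0) : Tendsto (fun n => gridUp n t) atTop (nhds t) := by
  refine tendsto_of_tendsto_of_tendsto_of_le_of_le tendsto_const_nhds ?_
    (fun n => (lt_gridUp n t).le) fun n => gridUp_le n t
  have : Tendsto (fun n : ℕ => (1 / 2 : ℝ≥0) ^ n) atTop (nhds 0) :=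
    tendsto_pow_atTop_nhds_zero_of_lt_one zero_le (by
      rw [← NNReal.coe_lt_coe]; norm_num)
  simpa [one_div] using this.const_add t

lemma gridUp_mono (n : ℕ) : Monotone (gridUp n) := fun s t h => by
  unfold gridUp; gcongr

/-- The grid approximation of `t` is the `k`-th grid point or an earlier one iff `t` is before that
point. -/
lemma gridUp_le_iff (n k : ℕ) (t : ℝ≥0) : gridUp n t ≤ (k : ℝ≥0) / 2 ^ n ↔ t < k / 2 ^ n := by
  unfold gridUp
  rw [div_le_div_iff_of_pos_right (by positivity), lt_div_iff₀ (by positivity), Nat.cast_le,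
    Nat.add_one_le_iff, Nat.floor_lt zero_le]

lemma measurable_gridUp (n : ℕ) : Measurable (gridUp n) := (gridUp_mono n).measurable

lemma gridUp_eq_iff (n k : ℕ) (t : ℝ≥0) :
    gridUp n t = ((k + 1 : ℕ) : ℝ≥0) / 2 ^ n ↔
      t < ((k + 1 : ℕ) : ℝ≥0) / 2 ^ n ∧ ¬ t < (k : ℝ≥0) / 2 ^ n := by
  rw [← gridUp_le_iff, ← gridUp_le_iff]
  unfold gridUp
  simp only [div_le_div_iff_of_pos_right (show (0 : ℝ≥0) < 2 ^ n by positivity),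
    div_left_inj' (show (2 : ℝ≥0) ^ n ≠ 0 by positivity), Nat.cast_le, Nat.cast_inj]
  omega

omit mΩ in
lemma tendsto_shift_gridUp (hW : ∀ ω, Continuous fun t => W t ω) (t s : ℝ≥0) (ω : Ω) :
    Tendsto (fun n => W (gridUp n t + s) ω - W (gridUp n t) ω) atTop
      (nhds (W (t + s) ω - W t ω)) :=
  (((hW ω).tendsto _).comp ((tendsto_gridUp t).add_const s)).sub
    (((hW ω).tendsto _).comp (tendsto_gridUp t))

lemma IsBrownianWith.setIntegral_shiftPath {τ : Ω → ℝ≥0∞} (h : IsBrownianWith 𝒴 P W)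
    (hτ : IsOptional (pathInfo W 𝒴) τ) (hfin : ∀ᵐ ω ∂P, τ ω ≠ ∞) {A : Set Ω}
    (hA : MeasurableSet[pastOf (mΩ := mΩ) hτ] A) (I : Finset ℝ≥0)
    (f : BoundedContinuousFunction ((s : I) → ℝ) ℝ) :
    ∫ ω in A, f (fun s => shiftPath W τ ω s) ∂P = P.real A * ∫ ω, f (fun s => W s ω) ∂P := by
  have := h.isProbabilityMeasure
  have hτm : Measurable τ := hτ.measurable pathInfo_mono h.pathInfo_le
  set σ : Ω → ℝ≥0 := fun ω => (τ ω).toNNReal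
  have hσm : Measurable σ := hτm.ennreal_toNNReal
  set A' := A ∩ {ω | τ ω ≠ ∞}
  have hAA' : A =ᵐ[P] A' := by
    filter_upwards [hfin] with ω hω
    apply propext
    exact ⟨fun h => ⟨h, hω⟩, fun h => h.1⟩
  rw [setIntegral_congr_set hAA', measureReal_congr hAA']
  -- the identity for the grid approximations of `τ`
  have key : ∀ n, ∫ ω in A', f (fun s => W (gridUp n (σ ω) + s) ω - W (gridUp n (σ ω)) ω) ∂P =
      P.real A' * ∫ ω, f (fun s => W s ω) ∂P := by
    intro n
    set B : ℕ → Set Ω := fun k => A' ∩ {ω | gridUp n (σ ω) = ((k + 1 : ℕ) : ℝ≥0) / 2 ^ n}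
    have hBm : ∀ k, MeasurableSet[pathInfo W 𝒴 (((k + 1 : ℕ) : ℝ≥0) / 2 ^ n)] (B k) := by
      intro k
      have : B k = (A ∩ {ω | τ ω < (((k + 1 : ℕ) : ℝ≥0) / 2 ^ n : ℝ≥0)}) \
          {ω | τ ω < ((k : ℝ≥0) / 2 ^ n : ℝ≥0)} := by
        ext ω
        simp only [B, A', Set.mem_inter_iff, Set.mem_ofPred_eq, gridUp_eq_iff, Set.mem_sdiff]
        rcases eq_or_ne (τ ω) ∞ with htop | htop
        · simp [htop]
        · have e : τ ω = (σ ω : ℝ≥0∞) := (ENNReal.coe_toNNReal htop).symm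
          rw [e]
          simp only [ENNReal.coe_lt_coe, ne_eq, ENNReal.coe_ne_top, not_false_eq_true, and_true]
          tauto
      rw [this]
      refine MeasurableSet.diff (hA.2 _) (hτ.measurableSet_lt pathInfo_mono ?_)
      gcongr; simp
    have hBU : A' = ⋃ k, B k := by
      ext ω
      simp only [B, Set.mem_iUnion, Set.mem_inter_iff, Set.mem_ofPred_eq]
      exact ⟨fun h => ⟨⌊σ ω * 2 ^ n⌋₊, h, rfl⟩, fun ⟨_, h, _⟩ => h⟩
    have hBd : Pairwise (Function.onFun Disjoint B) := by
      intro i j hij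
      refine Set.disjoint_left.2 fun ω hi hj => hij ?_
      have h1 := hi.2.symm.trans hj.2
      rw [div_left_inj' (by positivity)] at h1
      simpa using h1
    have hstep : ∀ k, ∫ ω in B k,
        f (fun s => W (gridUp n (σ ω) + s) ω - W (gridUp n (σ ω)) ω) ∂P =
        P.real (B k) * ∫ ω, f (fun s => W s ω) ∂P := by
      intro k
      set t : ℝ≥0 := ((k + 1 : ℕ) : ℝ≥0) / 2 ^ n
      have e1 : ∫ ω in B k, f (fun s => W (gridUp n (σ ω) + s) ω - W (gridUp n (σ ω)) ω) ∂P =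
          ∫ ω in B k, f (fun s => W (t + s) ω - W t ω) ∂P := by
        refine setIntegral_congr_fun (h.pathInfo_le _ _ (hBm k)) fun ω hω => ?_
        have : gridUp n (σ ω) = t := hω.2
        simp only [this]
      have hfm : Measurable fun x : ℝ≥0 → ℝ => f (fun s : I => x s) :=
        f.continuous.measurable.comp (measurable_pi_lambda _ fun s => measurable_pi_apply _)
      have e2 : ∫ ω, f (fun s => W (t + s) ω - W t ω) ∂P = ∫ ω, f (fun s => W s ω) ∂P :=
        ((h.identDistrib_shift t).comp hfm).integral_eq
      rw [e1, ← e2]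
      exact Indep.setIntegral_eq_mul (X := fun ω (s : ℝ≥0) => W (t + s) ω - W t ω)
        (f := fun x => f (fun s : I => x s)) (h.pathInfo_le _) (h.indep_shift t)
        (measurable_pi_lambda _ fun s => (h.meas _).sub (h.meas _)).aemeasurable
        (hBm k) hfm.aestronglyMeasurable
    have hBm' : ∀ k, MeasurableSet (B k) := fun k => h.pathInfo_le _ _ (hBm k)
    have hint : Integrable
        (fun ω => f (fun s => W (gridUp n (σ ω) + s) ω - W (gridUp n (σ ω)) ω)) P := by
      refine Integrable.of_bound (C := ‖f‖) (Measurable.aestronglyMeasurable ?_)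
        (ae_of_all _ fun ω => f.norm_coe_le_norm _)
      refine f.continuous.measurable.comp (measurable_pi_lambda _ fun s => ?_)
      have hg := (measurable_gridUp n).comp hσm
      exact (h.measurable_eval (hg.add_const _)).sub (h.measurable_eval hg)
    have h3 := hasSum_integral_iUnion hBm' hBd hint.integrableOn
    rw [← hBU] at h3
    rw [← h3.tsum_eq]
    simp_rw [hstep]
    rw [tsum_mul_right]
    congr 1
    have h4 := measure_iUnion hBd hBm' (μ := P)
    rw [← hBU] at h4
    rw [measureReal_def, h4, ENNReal.tsum_toReal_eq fun k => measure_ne_top _ _]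
    rfl
  have hlim : Tendsto (fun n : ℕ =>
      ∫ ω in A', f (fun s => W (gridUp n (σ ω) + s) ω - W (gridUp n (σ ω)) ω) ∂P) atTop
      (nhds (∫ ω in A', f (fun s => shiftPath W τ ω s) ∂P)) := by
    refine tendsto_integral_of_dominated_convergence (fun _ => ‖f‖) (fun n => ?_)
      (integrable_const _) (fun n => ae_of_all _ fun ω => f.norm_coe_le_norm _)
      (ae_of_all _ fun ω => ?_)
    · refine (f.continuous.measurable.comp
        (measurable_pi_lambda _ fun s => ?_)).aestronglyMeasurable
      have hg := (measurable_gridUp n).comp hσm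
      exact (h.measurable_eval (hg.add_const _)).sub (h.measurable_eval hg)
    · exact (f.continuous.tendsto _).comp
        (tendsto_pi_nhds.2 fun s => tendsto_shift_gridUp h.cont _ _ _)
  simp_rw [key] at hlim
  exact (tendsto_nhds_unique hlim tendsto_const_nhds)

/-- **Strong Markov property**: the increments after an almost surely finite optional time are
independent of the information that is known right after this time. -/
theorem IsBrownianWith.indep_shiftPath {τ : Ω → ℝ≥0∞} (h : IsBrownianWith 𝒴 P W)
    (hτ : IsOptional (pathInfo W 𝒴) τ) (hfin : ∀ᵐ ω ∂P, τ ω ≠ ∞) :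
    Indep (pastOf (mΩ := mΩ) hτ) (MeasurableSpace.comap (shiftPath W τ) inferInstance) P := by
  have := h.isProbabilityMeasure
  have hZ := h.measurable_shiftPath (hτ.measurable pathInfo_mono h.pathInfo_le)
  refine indep_comap_process_of_bcf (X := fun s ω => shiftPath W τ ω s) (pastOf_le (mΩ := mΩ) hτ)
    (fun s => ((measurable_pi_apply s).comp hZ).aemeasurable) fun A hA I f => ?_
  have e := h.setIntegral_shiftPath hτ hfin MeasurableSet.univ I f
  simp only [setIntegral_univ, probReal_univ, one_mul] at e
  rw [h.setIntegral_shiftPath hτ hfin hA, e]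

/-- **Strong Markov property**: the increments after an almost surely finite optional time have the
law of the Brownian motion. -/
theorem IsBrownianWith.identDistrib_shiftPath {τ : Ω → ℝ≥0∞} (h : IsBrownianWith 𝒴 P W)
    (hτ : IsOptional (pathInfo W 𝒴) τ) (hfin : ∀ᵐ ω ∂P, τ ω ≠ ∞) :
    IdentDistrib (shiftPath W τ) (fun ω s => W s ω) P P := by
  have := h.isProbabilityMeasure
  have hZ := h.measurable_shiftPath (hτ.measurable pathInfo_mono h.pathInfo_le)
  have hW : Measurable fun ω s => W s ω := measurable_pi_lambda _ h.meas
  refine (identDistrib_iff_forall_finset_identDistrib (X := fun s ω => shiftPath W τ ω s)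
    (Y := W) hZ.aemeasurable hW.aemeasurable).2 fun I => ?_
  have m1 : Measurable fun ω => I.restrict (fun s => shiftPath W τ ω s) :=
    (Finset.measurable_restrict (X := fun _ => ℝ) I).comp hZ
  have m2 : Measurable fun ω => I.restrict (fun s => W s ω) :=
    (Finset.measurable_restrict (X := fun _ => ℝ) I).comp hW
  refine ⟨m1.aemeasurable, m2.aemeasurable, ?_⟩
  have := Measure.isFiniteMeasure_map P (fun ω => I.restrict (shiftPath W τ ω))
  have := Measure.isFiniteMeasure_map P (fun ω => I.restrict (fun s => W s ω))
  refine ext_of_forall_integral_eq_of_IsFiniteMeasure fun f => ?_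
  rw [integral_map m1.aemeasurable f.continuous.aestronglyMeasurable,
    integral_map m2.aemeasurable f.continuous.aestronglyMeasurable]
  have e := h.setIntegral_shiftPath hτ hfin MeasurableSet.univ I f
  simp only [setIntegral_univ, probReal_univ, one_mul] at e
  exact e

end StrongMarkov

/-! ### Moments of the Gaussian law -/

section Gaussian

lemma iteratedDeriv_mgf_gaussian (v : ℝ≥0) :
    iteratedDeriv 1 (mgf id (gaussianReal 0 v)) =
      (fun t => (v * t) * Real.exp (v * t ^ 2 / 2)) ∧
    iteratedDeriv 2 (mgf id (gaussianReal 0 v)) =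
      (fun t => (v + v ^ 2 * t ^ 2) * Real.exp (v * t ^ 2 / 2)) ∧
    iteratedDeriv 3 (mgf id (gaussianReal 0 v)) =
      (fun t => (3 * v ^ 2 * t + v ^ 3 * t ^ 3) * Real.exp (v * t ^ 2 / 2)) ∧
    iteratedDeriv 4 (mgf id (gaussianReal 0 v)) =
      (fun t => (3 * v ^ 2 + 6 * v ^ 3 * t ^ 2 + v ^ 4 * t ^ 4) * Real.exp (v * t ^ 2 / 2)) := by
  have he : ∀ t : ℝ, HasDerivAt (fun t => Real.exp (v * t ^ 2 / 2))
      (Real.exp (v * t ^ 2 / 2) * (v * t)) t := fun t => by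
    have : HasDerivAt (fun t : ℝ => v * t ^ 2 / 2) (v * t) t := by
      convert! ((hasDerivAt_pow 2 t).const_mul (v : ℝ)).div_const 2 using 1
      push_cast; ring
    exact this.exp
  have h0 : mgf id (gaussianReal 0 v) = fun t => Real.exp (v * t ^ 2 / 2) := by
    rw [mgf_id_gaussianReal]; simp
  have h1 : iteratedDeriv 1 (mgf id (gaussianReal 0 v)) =
      (fun t => (v * t) * Real.exp (v * t ^ 2 / 2)) := by
    rw [iteratedDeriv_one, h0]
    ext t; rw [(he t).deriv]; ring
  have h2 : iteratedDeriv 2 (mgf id (gaussianReal 0 v)) =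
      (fun t => (v + v ^ 2 * t ^ 2) * Real.exp (v * t ^ 2 / 2)) := by
    rw [iteratedDeriv_succ, h1]
    ext t
    have := ((hasDerivAt_id t).const_mul (v : ℝ)).mul (he t)
    refine this.deriv.trans ?_
    simp; ring
  have h3 : iteratedDeriv 3 (mgf id (gaussianReal 0 v)) =
      (fun t => (3 * v ^ 2 * t + v ^ 3 * t ^ 3) * Real.exp (v * t ^ 2 / 2)) := by
    rw [iteratedDeriv_succ, h2]
    ext t
    have := (((hasDerivAt_pow 2 t).const_mul ((v : ℝ) ^ 2)).const_add (v : ℝ)).mul (he t)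
    refine this.deriv.trans ?_
    simp; ring
  refine ⟨h1, h2, h3, ?_⟩
  rw [iteratedDeriv_succ, h3]
  ext t
  have := (((hasDerivAt_id t).const_mul (3 * (v : ℝ) ^ 2)).add
    ((hasDerivAt_pow 3 t).const_mul ((v : ℝ) ^ 3))).mul (he t)
  refine this.deriv.trans ?_
  simp; ring

lemma integral_pow_gaussian (v : ℝ≥0) (n : ℕ) :
    ∫ y, y ^ n ∂gaussianReal 0 v = iteratedDeriv n (mgf id (gaussianReal 0 v)) 0 := by
  rw [iteratedDeriv_mgf_zero (by simp)]
  rfl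

lemma integral_pow_one_gaussian (v : ℝ≥0) : ∫ y, y ∂gaussianReal 0 v = 0 := by simp

lemma integral_pow_two_gaussian (v : ℝ≥0) : ∫ y, y ^ 2 ∂gaussianReal 0 v = v := by
  rw [integral_pow_gaussian, (iteratedDeriv_mgf_gaussian v).2.1]; simp

lemma integral_pow_three_gaussian (v : ℝ≥0) : ∫ y, y ^ 3 ∂gaussianReal 0 v = 0 := by
  rw [integral_pow_gaussian, (iteratedDeriv_mgf_gaussian v).2.2.1]; simp

lemma integral_pow_four_gaussian (v : ℝ≥0) : ∫ y, y ^ 4 ∂gaussianReal 0 v = 3 * v ^ 2 := by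
  rw [integral_pow_gaussian, (iteratedDeriv_mgf_gaussian v).2.2.2]; simp

lemma integrable_pow_gaussian (v : ℝ≥0) (n : ℕ) :
    Integrable (fun y : ℝ => y ^ n) (gaussianReal 0 v) := by
  have := (memLp_id_gaussianReal (μ := 0) (v := v) n).integrable_norm_pow'
  refine (integrable_norm_iff (by fun_prop)).1 ?_
  simpa using this

lemma integral_cubic_gaussian (v : ℝ≥0) (a b c d e : ℝ) :
    ∫ y, (a + b * y + c * y ^ 2 + d * y ^ 3 + e * y ^ 4) ∂gaussianReal 0 v =
      a + c * v + e * (3 * v ^ 2) := by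
  have i1 : Integrable (fun y : ℝ => b * y) (gaussianReal 0 v) := by
    simpa using (integrable_pow_gaussian v 1).const_mul b
  have i2 := (integrable_pow_gaussian v 2).const_mul c
  have i3 := (integrable_pow_gaussian v 3).const_mul d
  have i4 := (integrable_pow_gaussian v 4).const_mul e
  have i0 := integrable_const (μ := gaussianReal 0 v) a
  have i01 := i0.add i1
  have i02 := i01.add i2
  have i03 := i02.add i3
  simp only [Pi.add_def] at i01 i02 i03
  rw [integral_add i03 i4, integral_add i02 i3, integral_add i01 i2, integral_add i0 i1]
  have e1 : ∫ y, b * y ∂gaussianReal 0 v = 0 := by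
    rw [integral_const_mul, integral_pow_one_gaussian, mul_zero]
  simp only [e1, integral_const_mul, integral_pow_two_gaussian,
    integral_pow_three_gaussian, integral_pow_four_gaussian]
  simp

end Gaussian

/-! ### Integrability of the running maximum of Brownian motion -/

section RunningMax

variable {Ω : Type*} {𝒴 : MeasurableSpace Ω} [mΩ : MeasurableSpace Ω] {P : Measure Ω}
  {W : ℝ≥0 → Ω → ℝ}

lemma pow_six_tangent (x b : ℝ) : x ^ 6 + 6 * x ^ 5 * b ≤ (x + b) ^ 6 := by
  have : (x + b) ^ 6 - (x ^ 6 + 6 * x ^ 5 * b) =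
      b ^ 2 * ((b ^ 2 + 3 * x * b + 14 / 5 * x ^ 2) ^ 2 +
        x ^ 2 * (2 / 5 * (b + 4 * x) ^ 2 + 19 / 25 * x ^ 2)) := by ring
  have h2 : 0 ≤ b ^ 2 * ((b ^ 2 + 3 * x * b + 14 / 5 * x ^ 2) ^ 2 +
        x ^ 2 * (2 / 5 * (b + 4 * x) ^ 2 + 19 / 25 * x ^ 2)) := by positivity
  linarith

namespace IsBrownianWith

lemma memLp_eval (h : IsBrownianWith 𝒴 P W) (t : ℝ≥0) (p : ℝ≥0) : MemLp (W t) p P := by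
  have h1 := h.brownian.hasLaw_eval t
  have h2 := memLp_id_gaussianReal (μ := 0) (v := t) p
  rw [← h1.map_eq] at h2
  exact (memLp_map_measure_iff aestronglyMeasurable_id h1.aemeasurable).1 h2

lemma integrable_pow_eval (h : IsBrownianWith 𝒴 P W) (t : ℝ≥0) (n : ℕ) :
    Integrable (fun ω => W t ω ^ n) P := by
  have := h.isProbabilityMeasure
  have := (h.memLp_eval t n).integrable_norm_pow'
  refine (integrable_norm_iff ((h.meas t).pow_const n).aestronglyMeasurable).1 ?_
  simpa using this

lemma hasLaw_increment (h : IsBrownianWith 𝒴 P W) {s t : ℝ≥0} (hst : s ≤ t) :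
    P.map (fun ω => W t ω - W s ω) = gaussianReal 0 (t - s) := by
  have h1 := (h.brownian.hasLaw_sub t s).map_eq
  convert! h1 using 2
  have : nndist (t : ℝ≥0) s = t - s := by
    rw [NNReal.nndist_eq]
    simp [tsub_eq_zero_of_le hst]
  exact this.symm

lemma indepFun_increment (h : IsBrownianWith 𝒴 P W) {s t : ℝ≥0} (hst : s ≤ t)
    {E : Type*} [MeasurableSpace E] {V : Ω → E} (hV : Measurable[pathInfo W 𝒴 s] V) :
    IndepFun V (fun ω => W t ω - W s ω) P := by
  have h1 := h.indep_shift s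
  refine indep_of_indep_of_le_left (indep_of_indep_of_le_right h1 ?_) hV.comap_le
  have : Measurable[MeasurableSpace.comap (fun ω r => W (s + r) ω - W s ω) inferInstance]
      fun ω => W t ω - W s ω := by
    have hc := comap_measurable (m := MeasurableSpace.pi) fun ω r => W (s + r) ω - W s ω
    have h2 := (measurable_pi_apply (t - s)).comp hc
    simpa [Function.comp_def, add_tsub_cancel_of_le hst] using h2
  exact this.comap_le

lemma integral_increment (h : IsBrownianWith 𝒴 P W) (s t : ℝ≥0) :
    ∫ ω, (W t ω - W s ω) ∂P = 0 := by
  rw [integral_sub (h.brownian.integrable_eval t) (h.brownian.integrable_eval s),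
    h.brownian.integral_eval, h.brownian.integral_eval, sub_zero]

lemma setIntegral_pow_six_le (h : IsBrownianWith 𝒴 P W) {s t : ℝ≥0} (hst : s ≤ t)
    {A : Set Ω} (hA : MeasurableSet[pathInfo W 𝒴 s] A) :
    ∫ ω in A, W s ω ^ 6 ∂P ≤ ∫ ω in A, W t ω ^ 6 ∂P := by
  have := h.isProbabilityMeasure
  have hAm := h.pathInfo_le _ _ hA
  have i1 : Integrable (fun ω => W s ω ^ 5 * (W t ω - W s ω)) P :=
    (h.indepFun_increment hst ((measurable_pathInfo s).pow_const 5)).integrable_mul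
      (h.integrable_pow_eval s 5)
      ((h.brownian.integrable_eval t).sub (h.brownian.integrable_eval s))
  have e1 : ∫ ω in A, W s ω ^ 5 * (W t ω - W s ω) ∂P = 0 := by
    have hV : Measurable[pathInfo W 𝒴 s] fun ω => A.indicator (fun ω => W s ω ^ 5) ω :=
      ((measurable_pathInfo s).pow_const 5).indicator hA
    have hi := h.indepFun_increment hst hV
    have := hi.integral_fun_mul_eq_mul_integral
      (hV.mono (h.pathInfo_le _) le_rfl).aestronglyMeasurable
      ((h.meas t).sub (h.meas s)).aestronglyMeasurable
    rw [h.integral_increment, mul_zero] at this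
    rw [← integral_indicator hAm, ← this]
    congr 1 with ω
    by_cases hω : ω ∈ A <;> simp [hω]
  calc ∫ ω in A, W s ω ^ 6 ∂P
      = ∫ ω in A, (W s ω ^ 6 + 6 * (W s ω ^ 5 * (W t ω - W s ω))) ∂P := by
        rw [integral_add (h.integrable_pow_eval s 6).integrableOn
          (i1.const_mul 6).integrableOn, integral_const_mul, e1]
        simp
    _ ≤ _ := by
        refine integral_mono ((h.integrable_pow_eval s 6).add (i1.const_mul 6)).integrableOn
          (h.integrable_pow_eval t 6).integrableOn fun ω => ?_
        have := pow_six_tangent (W s ω) (W t ω - W s ω)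
        simp only [add_sub_cancel] at this
        simpa [mul_assoc] using this

/-- Doob's maximal inequality for the sixth power of a Brownian motion on a grid. -/
lemma measure_max_grid_le (h : IsBrownianWith 𝒴 P W) (T : ℝ≥0) {N : ℕ} (hN : 0 < N)
    (r : ℝ≥0) :
    (r : ℝ≥0∞) ^ 6 * P {ω | ∃ k ≤ N, (r : ℝ) ≤ |W (k * (T / N)) ω|} ≤
      ofReal (∫ ω, W T ω ^ 6 ∂P) := by
  have := h.isProbabilityMeasure
  set g : ℕ → ℝ≥0 := fun k => k * (T / N)
  have hg : Monotone g := fun i j hij => by simp only [g]; gcongr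
  let 𝒢 : Filtration ℕ mΩ := ⟨fun k => pathInfo W 𝒴 (g k), pathInfo_mono.comp hg,
    fun k => h.pathInfo_le _⟩
  have hsub : Submartingale (fun k ω => W (g k) ω ^ 6) 𝒢 P :=
    submartingale_of_setIntegral_le_succ
      (fun k => (((measurable_pathInfo (g k)).pow_const 6)).stronglyMeasurable)
      (fun k => h.integrable_pow_eval _ 6)
      (fun k A hA => h.setIntegral_pow_six_le (hg (Nat.le_succ k)) hA)
  have := maximal_ineq hsub (fun k ω => by positivity) (ε := r ^ 6) N
  have e : {ω | ((r ^ 6 : ℝ≥0) : ℝ) ≤ (Finset.range (N + 1)).sup' Finset.nonempty_range_add_one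
      fun k => W (g k) ω ^ 6} = {ω | ∃ k ≤ N, (r : ℝ) ≤ |W (k * (T / N)) ω|} := by
    ext ω
    simp only [Set.mem_ofPred_eq, Finset.le_sup'_iff, Finset.mem_range, Nat.lt_succ_iff]
    refine exists_congr fun k => and_congr_right fun _ => ?_
    have e2 : W (g k) ω ^ 6 = |W (g k) ω| ^ 6 := by rw [← abs_pow, abs_of_nonneg (by positivity)]
    rw [e2]
    push_cast
    exact pow_le_pow_iff_left₀ r.coe_nonneg (abs_nonneg _) (by norm_num)
  rw [e] at this
  push_cast at this
  refine this.trans (ENNReal.ofReal_le_ofReal ?_)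
  have e3 : g N = T := by simp only [g]; field_simp
  rw [e3]
  exact setIntegral_le_integral (h.integrable_pow_eval T 6) (ae_of_all _ fun ω => by positivity)

end IsBrownianWith

/-- The maximum of `|W|` on the time interval `[0, T]`. -/
def runMax (W : ℝ≥0 → Ω → ℝ) (T : ℕ) (ω : Ω) : ℝ :=
  sSup ((fun t => |W t ω|) '' Set.Icc 0 (T : ℝ≥0))

omit mΩ in
lemma abs_le_runMax (hW : ∀ ω, Continuous fun t => W t ω) {T : ℕ} {t : ℝ≥0} (ht : t ≤ T)
    (ω : Ω) : |W t ω| ≤ runMax W T ω :=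
  le_csSup (isCompact_Icc.image (hW ω).abs).bddAbove ⟨t, ⟨zero_le, ht⟩, rfl⟩

omit mΩ in
lemma lt_runMax_iff (hW : ∀ ω, Continuous fun t => W t ω) {T : ℕ} {r : ℝ} (ω : Ω) :
    r < runMax W T ω ↔ ∃ n, ∃ k ≤ T * 2 ^ n, r < |W (k * (1 / 2 ^ n)) ω| := by
  constructor
  · intro hr
    obtain ⟨_, ⟨t, ht, rfl⟩, hlt⟩ := exists_lt_of_lt_csSup
      ((Set.nonempty_Icc.2 zero_le).image (fun t => |W t ω|)) hr
    rcases ht.2.lt_or_eq with h1 | h1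
    · have h2 : Tendsto (fun n => |W (gridUp n t) ω|) atTop (nhds |W t ω|) :=
        ((hW ω).abs.tendsto t).comp (tendsto_gridUp t)
      obtain ⟨n, hn⟩ := (h2.eventually (lt_mem_nhds hlt)).exists
      refine ⟨n, ⌊t * 2 ^ n⌋₊ + 1, ?_, ?_⟩
      · rw [Nat.add_one_le_iff, Nat.floor_lt zero_le]
        push_cast
        gcongr
      · simpa [gridUp, div_eq_mul_inv] using hn
    · exact ⟨0, T, by simp, by simpa [← h1] using hlt⟩
  · rintro ⟨n, k, hk, hr⟩
    refine hr.trans_le (abs_le_runMax hW ?_ ω)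
    rw [mul_one_div, div_le_iff₀ (by positivity)]
    exact_mod_cast hk

namespace IsBrownianWith

lemma measurable_runMax (h : IsBrownianWith 𝒴 P W) (T : ℕ) : Measurable (runMax W T) := by
  refine measurable_of_Ioi fun r => ?_
  have : runMax W T ⁻¹' Set.Ioi r =
      ⋃ n : ℕ, ⋃ k : ℕ, ⋃ (_ : k ≤ T * 2 ^ n), {ω | r < |W (k * (1 / 2 ^ n)) ω|} := by
    ext ω
    simp only [Set.mem_preimage, Set.mem_Ioi, lt_runMax_iff h.cont, Set.mem_iUnion,
      Set.mem_ofPred_eq, exists_prop]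
  rw [this]
  exact .iUnion fun n => .iUnion fun k => .iUnion fun _ =>
    measurableSet_lt measurable_const (h.meas _).abs

lemma measure_lt_runMax_le (h : IsBrownianWith 𝒴 P W) {T : ℕ} (hT : 0 < T) (r : ℝ≥0) :
    (r : ℝ≥0∞) ^ 6 * P {ω | r < runMax W T ω} ≤ ofReal (∫ ω, W T ω ^ 6 ∂P) := by
  set B : ℕ → Set Ω := fun n => {ω | ∃ k ≤ T * 2 ^ n, (r : ℝ) < |W (k * (1 / 2 ^ n)) ω|}
  have hB : Monotone B := by
    refine monotone_nat_of_le_succ fun n ω ⟨k, hk, hr⟩ => ⟨2 * k, ?_, ?_⟩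
    · rw [pow_succ, ← mul_assoc, mul_comm 2]
      exact Nat.mul_le_mul_right 2 hk
    · have : ((2 * k : ℕ) : ℝ≥0) * (1 / 2 ^ (n + 1)) = k * (1 / 2 ^ n) := by
        push_cast; field_simp; ring
      rwa [this]
  have e : {ω | (r : ℝ) < runMax W T ω} = ⋃ n, B n := by
    ext ω
    simp only [Set.mem_ofPred_eq, lt_runMax_iff h.cont, Set.mem_iUnion, B]
  rw [e, hB.measure_iUnion, ENNReal.mul_iSup]
  refine iSup_le fun n => le_trans ?_
    (h.measure_max_grid_le (T : ℝ≥0) (N := T * 2 ^ n) (by positivity) r)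
  gcongr
  rintro ω ⟨k, hk, hr⟩
  refine ⟨k, hk, hr.le.trans_eq ?_⟩
  congr 3
  push_cast; field_simp

lemma memLp_runMax (h : IsBrownianWith 𝒴 P W) {T : ℕ} (hT : 0 < T) :
    MemLp (runMax W T) 4 P := by
  have := h.isProbabilityMeasure
  have hm := h.measurable_runMax T
  have hnn : ∀ ω, 0 ≤ runMax W T ω := fun ω =>
    (abs_nonneg _).trans (abs_le_runMax h.cont zero_le ω (t := 0))
  set K : ℝ := ∫ ω, W T ω ^ 6 ∂P
  have hK : 0 ≤ K := integral_nonneg fun ω => by positivity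
  -- the tail of the running maximum is of order `r⁻⁶`
  have htail : ∀ t : ℝ, 0 < t →
      P {ω | t < runMax W T ω} * ofReal (t ^ ((4 : ℝ) - 1)) ≤
        ofReal (K * t ^ (-3 : ℝ)) := by
    intro t ht
    have h1 := h.measure_lt_runMax_le hT t.toNNReal
    rw [Real.coe_toNNReal t ht.le] at h1
    change ofReal t ^ 6 * _ ≤ _ at h1
    rw [← ENNReal.ofReal_pow ht.le] at h1
    have e2 : t ^ ((4 : ℝ) - 1) = t ^ 6 * t ^ (-3 : ℝ) := by
      rw [← Real.rpow_natCast t 6, ← Real.rpow_add ht]; norm_num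
    rw [e2, ENNReal.ofReal_mul (by positivity), ENNReal.ofReal_mul hK, ← mul_assoc,
      mul_comm (P _)]
    gcongr
  have hfin : ∫⁻ ω, ofReal (runMax W T ω ^ (4 : ℝ)) ∂P < ∞ := by
    rw [lintegral_rpow_eq_lintegral_meas_lt_mul P (ae_of_all _ hnn) hm.aemeasurable
      (by norm_num : (0 : ℝ) < 4)]
    refine ENNReal.mul_lt_top ENNReal.ofReal_lt_top ?_
    rw [← Set.Ioc_union_Ioi_eq_Ioi (zero_le_one : (0 : ℝ) ≤ 1)]
    refine (lintegral_union_le _ _ _).trans_lt (ENNReal.add_lt_top.2 ⟨?_, ?_⟩)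
    · calc _ ≤ ∫⁻ _ in Set.Ioc (0 : ℝ) 1, 1 := by
            refine setLIntegral_mono measurable_const fun t ht => ?_
            refine mul_le_one' prob_le_one ?_
            rw [ENNReal.ofReal_le_one]
            exact Real.rpow_le_one ht.1.le ht.2 (by norm_num)
        _ < ∞ := by simp
    · calc _ ≤ ∫⁻ t in Set.Ioi (1 : ℝ), ofReal (K * t ^ (-3 : ℝ)) :=
            setLIntegral_mono' measurableSet_Ioi fun t ht =>
              htail t (zero_lt_one.trans (Set.mem_Ioi.1 ht))
        _ < ∞ := ((integrableOn_Ioi_rpow_of_lt (by norm_num : (-3 : ℝ) < -1)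
            zero_lt_one).const_mul K).lintegral_lt_top
  refine ⟨hm.aestronglyMeasurable, ?_⟩
  rw [eLpNorm_lt_top_iff_lintegral_rpow_enorm_lt_top (by norm_num) (by norm_num)]
  convert! hfin using 3 with ω
  rw [Real.enorm_eq_ofReal (hnn ω), ENNReal.ofReal_rpow_of_nonneg (hnn ω) (by norm_num)]
  norm_num

end IsBrownianWith
end RunningMax

/-! ### Dynkin's formula for Brownian motion -/

section Dynkin

variable {Ω : Type*} {𝒴 : MeasurableSpace Ω} [mΩ : MeasurableSpace Ω] {P : Measure Ω}
  {W : ℝ≥0 → Ω → ℝ} {ψ : ℝ → ℝ} {C p q : ℝ}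

lemma sub_sq_le (a b : ℝ) : (a - b) ^ 2 ≤ 2 * (a ^ 2 + b ^ 2) := by
  nlinarith [sq_nonneg (a + b)]

lemma sub_pow_four_le (a b : ℝ) : (a - b) ^ 4 ≤ 8 * (a ^ 4 + b ^ 4) := by
  nlinarith [sub_sq_le a b, sq_nonneg (a - b), sq_nonneg (a ^ 2 - b ^ 2), sq_nonneg (a + b),
    pow_le_pow_left₀ (sq_nonneg (a - b)) (sub_sq_le a b) 2]

lemma integrable_pow_four {f : Ω → ℝ} (hf : MemLp f 4 P) [IsFiniteMeasure P] :
    Integrable (fun ω => f ω ^ 4) P := by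
  have := hf.integrable_norm_rpow (by norm_num) (by norm_num)
  refine this.congr (ae_of_all _ fun ω => ?_)
  have h4 : ((4 : ℝ≥0∞).toReal) = ((4 : ℕ) : ℝ) := by norm_num
  simp only [h4, Real.rpow_natCast]
  rw [Real.norm_eq_abs, ← abs_pow, abs_of_nonneg (by positivity)]

lemma integrable_pow_two {f : Ω → ℝ} (hf : MemLp f 4 P) [IsFiniteMeasure P] :
    Integrable (fun ω => f ω ^ 2) P := (hf.mono_exponent (by norm_num)).integrable_sq

lemma integrable_growth [IsFiniteMeasure P] (hψ : Measurable ψ)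
    (hC : ∀ x, |ψ x| ≤ C * (1 + x ^ 4)) {f : Ω → ℝ} (hfm : Measurable f) (hf : MemLp f 4 P) :
    Integrable (fun ω => ψ (f ω)) P :=
  (((integrable_const 1).add (integrable_pow_four hf)).const_mul C).mono'
    (hψ.comp hfm).aestronglyMeasurable (ae_of_all _ fun ω => hC (f ω))

lemma integral_indepFun_pair [IsProbabilityMeasure P] {E G : Type*} [MeasurableSpace E]
    [MeasurableSpace G] {V : Ω → E} {D : Ω → G} (hV : Measurable V) (hD : Measurable D)
    (hind : IndepFun V D P) {ν : Measure G} (hν : P.map D = ν) {f : E → G → ℝ}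
    (hf : Measurable (Function.uncurry f)) (hint : Integrable (fun ω => f (V ω) (D ω)) P) :
    ∫ ω, f (V ω) (D ω) ∂P = ∫ ω, ∫ y, f (V ω) y ∂ν ∂P := by
  have : IsProbabilityMeasure (P.map V) := Measure.isProbabilityMeasure_map hV.aemeasurable
  have : IsProbabilityMeasure ν := hν ▸ Measure.isProbabilityMeasure_map hD.aemeasurable
  have h1 : P.map (fun ω => (V ω, D ω)) = (P.map V).prod ν := by
    rw [← hν]; exact (indepFun_iff_map_prod_eq_prod_map_map hV.aemeasurable hD.aemeasurable).1 hind
  have hVD := hV.prodMk hD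
  have h2 : Integrable (Function.uncurry f) ((P.map V).prod ν) := by
    rw [← h1]
    exact (integrable_map_measure hf.aestronglyMeasurable hVD.aemeasurable).2 hint
  calc ∫ ω, f (V ω) (D ω) ∂P = ∫ z, Function.uncurry f z ∂(P.map (fun ω => (V ω, D ω))) :=
        (integral_map hVD.aemeasurable hf.aestronglyMeasurable).symm
    _ = ∫ x, ∫ y, f x y ∂ν ∂(P.map V) := by rw [h1, integral_prod _ h2]; rfl
    _ = _ := integral_map hV.aemeasurable
        (hf.stronglyMeasurable.integral_prod_right (ν := ν)).aestronglyMeasurable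

namespace IsBrownianWith

lemma memLp_sub (h : IsBrownianWith 𝒴 P W) (t : ℝ≥0) {X : Ω → ℝ} (hX4 : MemLp X 4 P) :
    MemLp (fun ω => W t ω - X ω) 4 P := (h.memLp_eval t 4).sub hX4

/-- The Markov property: the expectation of a function of `W` at time `t` on an event known at time
`s ≤ t` is obtained by averaging over the Gaussian law of the increment. -/
lemma setIntegral_eval_eq (h : IsBrownianWith 𝒴 P W) (hψ : Continuous ψ)
    (hC : ∀ x, |ψ x| ≤ C * (1 + x ^ 4)) {s t : ℝ≥0} (hst : s ≤ t) {A : Set Ω}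
    (hA : MeasurableSet[pathInfo W 𝒴 s] A) {X : Ω → ℝ} (hX : Measurable[pathInfo W 𝒴 s] X)
    (hX4 : MemLp X 4 P) :
    ∫ ω in A, ψ (W t ω - X ω) ∂P =
      ∫ ω in A, ∫ y, ψ (W s ω - X ω + y) ∂gaussianReal 0 (t - s) ∂P := by
  have := h.isProbabilityMeasure
  have hAm := h.pathInfo_le _ _ hA
  have hXm := hX.mono (h.pathInfo_le _) le_rfl
  set V : Ω → ℝ × ℝ := fun ω => (A.indicator 1 ω, W s ω - X ω)
  have hV : Measurable[pathInfo W 𝒴 s] V :=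
    (Measurable.indicator (@measurable_const _ _ _ (pathInfo W 𝒴 s) _) hA).prodMk
      ((measurable_pathInfo s).sub hX)
  have hi := h.indepFun_increment hst hV
  have hint : Integrable (fun ω => ψ (W t ω - X ω)) P :=
    integrable_growth hψ.measurable hC ((h.meas t).sub hXm) (h.memLp_sub t hX4)
  have e := integral_indepFun_pair (f := fun (v : ℝ × ℝ) y => v.1 * ψ (v.2 + y))
    (hV.mono (h.pathInfo_le _) le_rfl) ((h.meas t).sub (h.meas s)) hi (h.hasLaw_increment hst)
    (by fun_prop) (by
      refine (hint.indicator hAm).congr (ae_of_all _ fun ω => ?_)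
      by_cases hω : ω ∈ A <;> simp [V, hω])
  rw [← integral_indicator hAm, ← integral_indicator hAm]
  convert! e using 2 with ω
  · ext ω; by_cases hω : ω ∈ A <;> simp [V, hω]
  · ext ω; by_cases hω : ω ∈ A <;> simp [V, hω]

lemma gaussian_quadratic (p q x : ℝ) (v : ℝ≥0) :
    ∫ y, (p * (x + y) ^ 2 + q) ∂gaussianReal 0 v = p * (x ^ 2 + v) + q := by
  have := integral_cubic_gaussian v (p * x ^ 2 + q) (2 * p * x) p 0 0
  calc _ = _ := by congr 1 with y; ring
    _ = _ := this
    _ = _ := by ring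

lemma quadratic_growth (p q x : ℝ) : |p * x ^ 2 + q| ≤ (|p| + |q|) * (1 + x ^ 4) := by
  have h1 : x ^ 2 ≤ 1 + x ^ 4 := by nlinarith [sq_nonneg (x ^ 2 - 1)]
  have h2 : (1 : ℝ) ≤ 1 + x ^ 4 := by nlinarith [sq_nonneg (x ^ 2)]
  calc |p * x ^ 2 + q| ≤ |p * x ^ 2| + |q| := abs_add_le _ _
    _ = |p| * x ^ 2 + |q| := by rw [abs_mul, abs_of_nonneg (sq_nonneg x)]
    _ ≤ |p| * (1 + x ^ 4) + |q| * (1 + x ^ 4) := by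
      gcongr
      nlinarith [abs_nonneg q]
    _ = _ := by ring

lemma measurable_uncurry_real (h : IsBrownianWith 𝒴 P W) :
    Measurable fun z : ℝ × Ω => W z.1.toNNReal z.2 :=
  h.measurable_uncurry.comp ((measurable_real_toNNReal.comp measurable_fst).prodMk measurable_snd)

lemma measurable_quadratic (h : IsBrownianWith 𝒴 P W) (p q : ℝ) {X : Ω → ℝ} (hX : Measurable X) :
    Measurable (Function.uncurry fun (r : ℝ) (ω : Ω) => p * (W r.toNNReal ω - X ω) ^ 2 + q) :=
  (((h.measurable_uncurry_real.sub (hX.comp measurable_snd)).pow_const 2).const_mul p).add_const q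

lemma setIntegral_time_integral (h : IsBrownianWith 𝒴 P W) (p q : ℝ) {s t : ℝ≥0} (hst : s ≤ t)
    {A : Set Ω} (hA : MeasurableSet[pathInfo W 𝒴 s] A) {X : Ω → ℝ}
    (hX : Measurable[pathInfo W 𝒴 s] X) (hX4 : MemLp X 4 P) :
    ∫ ω in A, (∫ r in (s : ℝ)..t, (p * (W r.toNNReal ω - X ω) ^ 2 + q)) ∂P =
      ∫ ω in A, (p * ((W s ω - X ω) ^ 2 * (t - s) + (t - s) ^ 2 / 2) + q * (t - s)) ∂P := by
  have := h.isProbabilityMeasure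
  have hXm := hX.mono (h.pathInfo_le _) le_rfl
  have hst' : (s : ℝ) ≤ t := hst
  obtain ⟨N, hN⟩ := exists_nat_gt t
  have hN0 : 0 < N := by exact_mod_cast (zero_le (a := t)).trans_lt hN
  have hM := h.memLp_runMax hN0
  have hjm := h.measurable_quadratic p q hXm
  have hbound : Integrable (fun ω => |p| * (2 * (runMax W N ω ^ 2 + X ω ^ 2)) + |q|) P :=
    ((((integrable_pow_two hM).add (integrable_pow_two hX4)).const_mul 2).const_mul |p|).add
      (integrable_const _)
  have hint : Integrable (fun z : ℝ × Ω => p * (W z.1.toNNReal z.2 - X z.2) ^ 2 + q)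
      ((volume.restrict (Set.Ioc (s : ℝ) t)).prod (P.restrict A)) := by
    have hb2 : Integrable (fun z : ℝ × Ω => (1 : ℝ) *
        (|p| * (2 * (runMax W N z.2 ^ 2 + X z.2 ^ 2)) + |q|))
        ((volume.restrict (Set.Ioc (s : ℝ) t)).prod (P.restrict A)) :=
      Integrable.mul_prod (integrable_const (1 : ℝ)) hbound.integrableOn
    refine hb2.mono' hjm.aestronglyMeasurable ?_
    have : ∀ᵐ z ∂((volume.restrict (Set.Ioc (s : ℝ) t)).prod (P.restrict A)),
        z.1 ∈ Set.Ioc (s : ℝ) t :=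
      Measure.quasiMeasurePreserving_fst.ae (ae_restrict_mem measurableSet_Ioc)
    filter_upwards [this] with z hz
    rw [one_mul, Real.norm_eq_abs]
    have hle : |W z.1.toNNReal z.2| ≤ runMax W N z.2 := by
      refine abs_le_runMax h.cont ?_ _
      refine (Real.toNNReal_le_iff_le_coe.2 hz.2).trans hN.le
    refine (abs_add_le _ _).trans ?_
    rw [abs_mul, abs_of_nonneg (sq_nonneg (W z.1.toNNReal z.2 - X z.2))]
    gcongr
    refine (sub_sq_le _ _).trans ?_
    gcongr 2 * (?_ + _)
    exact sq_le_sq.2 (hle.trans (le_abs_self _))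
  have hswap : ∫ ω in A, (∫ r in (s : ℝ)..t, (p * (W r.toNNReal ω - X ω) ^ 2 + q)) ∂P =
      ∫ r in (s : ℝ)..t, ∫ ω in A, (p * (W r.toNNReal ω - X ω) ^ 2 + q) ∂P := by
    simp_rw [intervalIntegral.integral_of_le hst']
    exact (integral_integral_swap hint).symm
  rw [hswap]
  have hinner : ∀ r ∈ Set.uIcc (s : ℝ) t,
      ∫ ω in A, (p * (W r.toNNReal ω - X ω) ^ 2 + q) ∂P =
      (∫ ω in A, (p * (W s ω - X ω) ^ 2 + q) ∂P) + P.real A * p * (r - s) := by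
    intro r hr
    rw [Set.uIcc_of_le hst'] at hr
    have hr0 : (0 : ℝ) ≤ r := s.coe_nonneg.trans hr.1
    have hsr : s ≤ r.toNNReal := NNReal.le_toNNReal_of_coe_le hr.1
    rw [h.setIntegral_eval_eq (ψ := fun x => p * x ^ 2 + q) (by fun_prop)
      (quadratic_growth p q) hsr hA hX hX4]
    simp_rw [gaussian_quadratic]
    have e3 : ((r.toNNReal - s : ℝ≥0) : ℝ) = r - s := by
      rw [NNReal.coe_sub hsr, Real.coe_toNNReal _ hr0]
    rw [e3]
    have i1 : IntegrableOn (fun ω => p * (W s ω - X ω) ^ 2 + q) A P :=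
      (((integrable_pow_two (h.memLp_sub s hX4)).const_mul p).add
        (integrable_const q)).integrableOn
    calc _ = ∫ ω in A, ((p * (W s ω - X ω) ^ 2 + q) + p * (r - s)) ∂P := by
          congr 1 with ω; ring
      _ = _ := by
        rw [integral_add i1 (integrable_const _)]
        simp [mul_assoc]
  rw [intervalIntegral.integral_congr hinner]
  have i2 : IntegrableOn (fun ω => p * (W s ω - X ω) ^ 2 + q) A P :=
      (((integrable_pow_two (h.memLp_sub s hX4)).const_mul p).add
        (integrable_const q)).integrableOn
  have e4 : ∫ ω in A, (p * ((W s ω - X ω) ^ 2 * (t - s) + (t - s) ^ 2 / 2) + q * (t - s)) ∂P =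
      (t - s) * (∫ ω in A, (p * (W s ω - X ω) ^ 2 + q) ∂P) +
        P.real A * p * ((t - s) ^ 2 / 2) := by
    calc _ = ∫ ω in A, ((t - s) * (p * (W s ω - X ω) ^ 2 + q) + p * ((t - s) ^ 2 / 2)) ∂P := by
          congr 1 with ω; ring
      _ = _ := by
        rw [integral_add (i2.const_mul _) (integrable_const _), integral_const_mul]
        simp [mul_assoc]
  rw [e4, intervalIntegral.integral_add (by simp) (by
    apply Continuous.intervalIntegrable; fun_prop), intervalIntegral.integral_const,
    intervalIntegral.integral_const_mul, intervalIntegral.integral_sub (by simp) (by simp),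
    integral_id, intervalIntegral.integral_const]
  simp only [smul_eq_mul]
  ring

/-- One step of Dynkin's formula, on an event that is known at the beginning of the step. -/
lemma setIntegral_step_le (h : IsBrownianWith 𝒴 P W) (hψ : Continuous ψ)
    (hC : ∀ x, |ψ x| ≤ C * (1 + x ^ 4))
    (hstep : ∀ (x : ℝ) (v : ℝ≥0),
      ∫ y, ψ (x + y) ∂gaussianReal 0 v ≤ ψ x + p * (x ^ 2 * v + v ^ 2 / 2) + q * v)
    {s t : ℝ≥0} (hst : s ≤ t) {A : Set Ω} (hA : MeasurableSet[pathInfo W 𝒴 s] A) {X : Ω → ℝ}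
    (hX : Measurable[pathInfo W 𝒴 s] X) (hX4 : MemLp X 4 P) :
    ∫ ω in A, ψ (W t ω - X ω) ∂P ≤ ∫ ω in A, ψ (W s ω - X ω) ∂P +
      ∫ ω in A, (∫ r in (s : ℝ)..t, (p * (W r.toNNReal ω - X ω) ^ 2 + q)) ∂P := by
  have := h.isProbabilityMeasure
  have hXm := hX.mono (h.pathInfo_le _) le_rfl
  rw [h.setIntegral_time_integral p q hst hA hX hX4, h.setIntegral_eval_eq hψ hC hst hA hX hX4]
  have i1 : Integrable (fun ω => ψ (W s ω - X ω)) P :=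
    integrable_growth hψ.measurable hC ((h.meas s).sub hXm) (h.memLp_sub s hX4)
  have i2 : Integrable (fun ω => p * ((W s ω - X ω) ^ 2 * (t - s) + (t - s) ^ 2 / 2) +
      q * (t - s)) P :=
    ((((integrable_pow_two (h.memLp_sub s hX4)).mul_const _).add
      (integrable_const _)).const_mul p).add (integrable_const _)
  rw [← integral_add i1.integrableOn i2.integrableOn]
  have hE := integrable_pow_four (h.memLp_sub s hX4)
  have i3 : Integrable (fun ω => ∫ y, ψ (W s ω - X ω + y) ∂gaussianReal 0 (t - s)) P := by
    have hm : Measurable fun ω => ∫ y, ψ (W s ω - X ω + y) ∂gaussianReal 0 (t - s) := by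
      have : Measurable (Function.uncurry fun (x : ℝ) y => ψ (x + y)) := by fun_prop
      exact (this.stronglyMeasurable.integral_prod_right
        (ν := gaussianReal 0 (t - s))).measurable.comp ((h.meas s).sub hXm)
    refine ((((hE.const_mul 8).add (integrable_const
      (1 + 24 * ((t - s : ℝ≥0) : ℝ) ^ 2))).const_mul C)).mono' hm.aestronglyMeasurable
      (ae_of_all _ fun ω => ?_)
    have hC0 : 0 ≤ C := by
      have := (abs_nonneg _).trans (hC 0)
      simpa using this
    set x := W s ω - X ω
    have := integral_cubic_gaussian (t - s) (1 + 8 * x ^ 4) 0 0 0 8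
    refine (norm_integral_le_of_norm_le (g := fun y => C * (1 + 8 * x ^ 4 + 0 * y + 0 * y ^ 2 +
      0 * y ^ 3 + 8 * y ^ 4)) ?_ (ae_of_all _ fun y => ?_)).trans_eq ?_
    · refine Integrable.const_mul ?_ _
      simp only [zero_mul, add_zero]
      exact (integrable_const _).add ((integrable_pow_gaussian _ 4).const_mul 8)
    · refine (hC _).trans (mul_le_mul_of_nonneg_left ?_ hC0)
      have := sub_pow_four_le x (-y)
      simp only [sub_neg_eq_add] at this
      nlinarith [this]
    · rw [integral_const_mul, this]; simp only [Pi.add_apply]; ring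
  refine integral_mono i3.integrableOn (i1.add i2).integrableOn fun ω => ?_
  refine (hstep _ _).trans_eq ?_
  rw [NNReal.coe_sub hst, add_assoc]

end IsBrownianWith

lemma measurable_indicator_of_pastOf {F : ℝ≥0 → MeasurableSpace Ω} {σ : Ω → ℝ≥0∞}
    (hσ : IsOptional F σ) {X : Ω → ℝ} (hX : Measurable[pastOf (mΩ := mΩ) hσ] X) (u : ℝ≥0) :
    Measurable[F u] ({ω | σ ω < u}.indicator X) := by
  intro B hB
  rw [Set.indicator_preimage]
  have h1 := (hX hB).2 u
  have : {ω | σ ω < u}.ite (X ⁻¹' B) (0 ⁻¹' B) =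
      (X ⁻¹' B ∩ {ω | σ ω < u}) ∪ ((fun _ : Ω => (0 : ℝ)) ⁻¹' B \ {ω | σ ω < u}) := rfl
  rw [this]
  exact h1.union (MeasurableSet.diff (@measurable_const _ _ _ (F u) _ B hB) (hσ u))

lemma sum_range_ite_sub (a : ℕ → ℝ) {i j K : ℕ} (hij : i ≤ j) (hj : j ≤ K) :
    ∑ k ∈ Finset.range K, (if i ≤ k ∧ k < j then a (k + 1) - a k else 0) = a j - a i := by
  rw [← Finset.sum_filter, ← Finset.sum_Ico_sub a hij]
  congr 1
  ext k; simp; omega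

omit mΩ in
lemma indicator_range_sum (hW : ∀ ω, Continuous fun t => W t ω) (ψ : ℝ → ℝ) (p q : ℝ)
    (σ τ : Ω → ℝ≥0) (X : Ω → ℝ) (n T : ℕ) (ω : Ω) (hστ : σ ω ≤ τ ω) (hT : τ ω ≤ T) :
    ∑ k ∈ Finset.range ((T + 1) * 2 ^ n),
      ({ω | σ ω < (k : ℝ≥0) / 2 ^ n} \ {ω | τ ω < (k : ℝ≥0) / 2 ^ n}).indicator
        (fun ω => ψ (W (((k + 1 : ℕ) : ℝ≥0) / 2 ^ n) ω - X ω) - ψ (W ((k : ℝ≥0) / 2 ^ n) ω - X ω) -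
          ∫ r in (((k : ℝ≥0) / 2 ^ n : ℝ≥0) : ℝ)..((((k + 1 : ℕ) : ℝ≥0) / 2 ^ n : ℝ≥0) : ℝ),
            (p * (W r.toNNReal ω - X ω) ^ 2 + q)) ω =
    ψ (W (gridUp n (τ ω)) ω - X ω) - ψ (W (gridUp n (σ ω)) ω - X ω) -
      ∫ r in (gridUp n (σ ω) : ℝ)..gridUp n (τ ω), (p * (W r.toNNReal ω - X ω) ^ 2 + q) := by
  set t : ℕ → ℝ≥0 := fun k => (k : ℝ≥0) / 2 ^ n with ht
  set f : ℝ → ℝ := fun r => p * (W r.toNNReal ω - X ω) ^ 2 + q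
  have hfc : Continuous f := by
    have : Continuous fun r : ℝ => W r.toNNReal ω := (hW ω).comp continuous_real_toNNReal
    fun_prop
  have hfi : ∀ a b : ℝ, IntervalIntegrable f volume a b := fun a b => hfc.intervalIntegrable a b
  set a : ℕ → ℝ := fun k => ψ (W (t k) ω - X ω) - ∫ r in (0 : ℝ)..t k, f r with ha
  set i := ⌊σ ω * 2 ^ n⌋₊ + 1
  set j := ⌊τ ω * 2 ^ n⌋₊ + 1
  have hij : i ≤ j := by simp only [i, j]; gcongr
  have hj : j ≤ (T + 1) * 2 ^ n := by
    have : ⌊τ ω * 2 ^ n⌋₊ ≤ T * 2 ^ n :=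
      Nat.floor_le_of_le (by push_cast; gcongr)
    have h2 : 1 ≤ 2 ^ n := Nat.one_le_two_pow
    simp only [j, add_mul, one_mul]
    omega
  have h3 : ∀ x : ℝ≥0, ∀ k : ℕ, x < (k : ℝ≥0) / 2 ^ n ↔ ⌊x * 2 ^ n⌋₊ + 1 ≤ k := fun x k => by
    rw [lt_div_iff₀ (by positivity), Nat.add_one_le_iff, Nat.floor_lt zero_le]
  have key := sum_range_ite_sub a hij hj
  have e1 : ∀ x y : ℝ, ∫ r in x..y, f r = (∫ r in (0 : ℝ)..y, f r) - ∫ r in (0 : ℝ)..x, f r :=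
    fun x y => (intervalIntegral.integral_interval_sub_left (hfi _ _) (hfi _ _)).symm
  have hgi : gridUp n (σ ω) = t i := rfl
  have hgj : gridUp n (τ ω) = t j := rfl
  rw [hgi, hgj, e1]
  have e2 : ψ (W (t j) ω - X ω) - ψ (W (t i) ω - X ω) -
      ((∫ r in (0 : ℝ)..(t j), f r) - ∫ r in (0 : ℝ)..(t i), f r) = a j - a i := by
    simp only [ha]; ring
  rw [e2, ← key]
  refine Finset.sum_congr rfl fun k _ => ?_
  by_cases hk : i ≤ k ∧ k < j
  · rw [if_pos hk, Set.indicator_of_mem, e1]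
    · simp only [ha, ht]; ring
    · exact ⟨(h3 _ _).2 hk.1, fun hc => absurd ((h3 _ _).1 hc) (by simp only [j] at hk; omega)⟩
  · rw [if_neg hk, Set.indicator_of_notMem]
    rintro ⟨h1, h2⟩
    refine hk ⟨(h3 _ _).1 h1, ?_⟩
    by_contra hc
    exact h2 ((h3 _ _).2 (by simp only [j] at hc; omega))

lemma measurable_intervalIntegral_of_le {f : ℝ → Ω → ℝ} (hf : Measurable (Function.uncurry f))
    {a b : Ω → ℝ} (ha : Measurable a) (hb : Measurable b) (hab : ∀ ω, a ω ≤ b ω) :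
    Measurable fun ω => ∫ r in a ω..b ω, f r ω := by
  have e : (fun ω => ∫ r in a ω..b ω, f r ω) =
      fun ω => ∫ r, (Set.Ioc (a ω) (b ω)).indicator (fun r => f r ω) r := by
    ext ω
    rw [intervalIntegral.integral_of_le (hab ω), integral_indicator measurableSet_Ioc]
  rw [e]
  have hm : Measurable (Function.uncurry fun (ω : Ω) (r : ℝ) =>
      (Set.Ioc (a ω) (b ω)).indicator (fun r => f r ω) r) := by
    have : (Function.uncurry fun (ω : Ω) (r : ℝ) =>
        (Set.Ioc (a ω) (b ω)).indicator (fun r => f r ω) r) =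
        {z : Ω × ℝ | a z.1 < z.2 ∧ z.2 ≤ b z.1}.indicator (fun z => f z.2 z.1) := by
      ext ⟨ω, r⟩
      by_cases hr : a ω < r ∧ r ≤ b ω <;> simp [Function.uncurry, Set.indicator, Set.mem_Ioc]
    rw [this]
    refine Measurable.indicator (hf.comp measurable_swap) ?_
    exact (measurableSet_lt (ha.comp measurable_fst) measurable_snd).inter
      (measurableSet_le measurable_snd (hb.comp measurable_fst))
  exact hm.stronglyMeasurable.integral_prod_right.measurable

namespace IsBrownianWith

lemma abs_dynkin_le (h : IsBrownianWith 𝒴 P W) (hC : ∀ x, |ψ x| ≤ C * (1 + x ^ 4)) (p q : ℝ)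
    {T : ℕ} {a b : ℝ≥0} (hab : a ≤ b) (hb : b ≤ T) (X : Ω → ℝ) (ω : Ω) :
    |ψ (W b ω - X ω) - ψ (W a ω - X ω) -
      ∫ r in (a : ℝ)..b, (p * (W r.toNNReal ω - X ω) ^ 2 + q)| ≤
    2 * (C * (1 + 8 * (runMax W T ω ^ 4 + X ω ^ 4))) +
      T * (|p| * (2 * (runMax W T ω ^ 2 + X ω ^ 2)) + |q|) := by
  have hC0 : 0 ≤ C := by
    have := (abs_nonneg _).trans (hC 0)
    simpa using this
  have hM : ∀ s : ℝ≥0, s ≤ T → |W s ω| ≤ runMax W T ω := fun s hs => abs_le_runMax h.cont hs ω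
  have h1 : ∀ s : ℝ≥0, s ≤ T → |ψ (W s ω - X ω)| ≤
      C * (1 + 8 * (runMax W T ω ^ 4 + X ω ^ 4)) := fun s hs => by
    refine (hC _).trans (mul_le_mul_of_nonneg_left ?_ hC0)
    have h2 : W s ω ^ 4 ≤ runMax W T ω ^ 4 := by
      have := pow_le_pow_left₀ (abs_nonneg _) (hM s hs) 4
      rwa [← abs_pow, abs_of_nonneg (by positivity)] at this
    have := sub_pow_four_le (W s ω) (X ω)
    linarith
  have h3 : |∫ r in (a : ℝ)..b, (p * (W r.toNNReal ω - X ω) ^ 2 + q)| ≤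
      T * (|p| * (2 * (runMax W T ω ^ 2 + X ω ^ 2)) + |q|) := by
    have := intervalIntegral.norm_integral_le_of_norm_le_const
      (C := |p| * (2 * (runMax W T ω ^ 2 + X ω ^ 2)) + |q|) (a := (a : ℝ)) (b := b)
      (f := fun r => p * (W r.toNNReal ω - X ω) ^ 2 + q) (fun r hr => by
        rw [Set.uIoc_of_le (by exact_mod_cast hab)] at hr
        refine (abs_add_le _ _).trans ?_
        rw [abs_mul, abs_of_nonneg (sq_nonneg (W r.toNNReal ω - X ω))]
        gcongr
        refine (sub_sq_le _ _).trans ?_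
        gcongr 2 * (?_ + _)
        refine sq_le_sq.2 ((hM _ ?_).trans (le_abs_self _))
        exact (Real.toNNReal_le_iff_le_coe.2 hr.2).trans hb)
    rw [Real.norm_eq_abs] at this
    refine this.trans ?_
    rw [mul_comm]
    gcongr
    rw [abs_of_nonneg (by simpa using hab)]
    linarith [a.coe_nonneg]
  refine (abs_sub _ _).trans (add_le_add ((abs_sub _ _).trans ?_) h3)
  rw [two_mul]
  exact add_le_add (h1 b hb) (h1 a (hab.trans hb))

/-- **Dynkin's formula** as an inequality, between two bounded optional times. The generator of `ψ`
is bounded above by the quadratic function `p * x ^ 2 + q`, in the integrated form `hstep`. -/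
theorem dynkin_le (h : IsBrownianWith 𝒴 P W) (hψ : Continuous ψ)
    (hC : ∀ x, |ψ x| ≤ C * (1 + x ^ 4))
    (hstep : ∀ (x : ℝ) (v : ℝ≥0),
      ∫ y, ψ (x + y) ∂gaussianReal 0 v ≤ ψ x + p * (x ^ 2 * v + v ^ 2 / 2) + q * v)
    {σ τ : Ω → ℝ≥0} (hσ : IsOptional (pathInfo W 𝒴) (fun ω => (σ ω : ℝ≥0∞)))
    (hτ : IsOptional (pathInfo W 𝒴) (fun ω => (τ ω : ℝ≥0∞))) (hστ : ∀ ω, σ ω ≤ τ ω) {T : ℕ}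
    (hT : ∀ ω, τ ω ≤ T) {X : Ω → ℝ} (hX : Measurable[pastOf (mΩ := mΩ) hσ] X)
    (hX4 : MemLp X 4 P) :
    ∫ ω, (ψ (W (τ ω) ω - X ω) - ψ (W (σ ω) ω - X ω) -
      ∫ r in (σ ω : ℝ)..τ ω, (p * (W r.toNNReal ω - X ω) ^ 2 + q)) ∂P ≤ 0 := by
  have := h.isProbabilityMeasure
  have hXm : Measurable X := hX.mono (pastOf_le hσ) le_rfl
  have hσm : Measurable σ := measurable_coe_nnreal_ennreal_iff.1
    (hσ.measurable pathInfo_mono h.pathInfo_le)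
  have hτm : Measurable τ := measurable_coe_nnreal_ennreal_iff.1
    (hτ.measurable pathInfo_mono h.pathInfo_le)
  set B : Ω → ℝ := fun ω => 2 * (C * (1 + 8 * (runMax W (T + 1) ω ^ 4 + X ω ^ 4))) +
      ((T + 1 : ℕ) : ℝ) * (|p| * (2 * (runMax W (T + 1) ω ^ 2 + X ω ^ 2)) + |q|)
  have hM := h.memLp_runMax (Nat.succ_pos T)
  have hBi : Integrable B P := by
    have i4 := (integrable_pow_four hM).add (integrable_pow_four hX4)
    have i2 := (integrable_pow_two hM).add (integrable_pow_two hX4)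
    exact ((((integrable_const 1).add (i4.const_mul 8)).const_mul C).const_mul 2).add
      ((((i2.const_mul 2).const_mul |p|).add (integrable_const |q|)).const_mul _)
  have hjm := h.measurable_quadratic p q hXm
  have hmeas : ∀ a b : Ω → ℝ≥0, Measurable a → Measurable b → (∀ ω, a ω ≤ b ω) →
      Measurable fun ω => ψ (W (b ω) ω - X ω) - ψ (W (a ω) ω - X ω) -
        ∫ r in (a ω : ℝ)..b ω, (p * (W r.toNNReal ω - X ω) ^ 2 + q) := fun a b ha hb hab =>
    ((hψ.measurable.comp ((h.measurable_eval hb).sub hXm)).sub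
      (hψ.measurable.comp ((h.measurable_eval ha).sub hXm))).sub
      (measurable_intervalIntegral_of_le hjm ha.coe_nnreal_real hb.coe_nnreal_real
        fun ω => by exact_mod_cast hab ω)
  have hgT : ∀ n ω, gridUp n (τ ω) ≤ (T + 1 : ℕ) := fun n ω => by
    refine (gridUp_le n _).trans ?_
    push_cast
    refine add_le_add (hT ω) (div_le_one_of_le₀ (one_le_pow₀ ?_) zero_le)
    exact one_le_two
  -- the inequality for the grid approximations
  have hgrid : ∀ n, ∫ ω, (ψ (W (gridUp n (τ ω)) ω - X ω) - ψ (W (gridUp n (σ ω)) ω - X ω) -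
      ∫ r in (gridUp n (σ ω) : ℝ)..gridUp n (τ ω), (p * (W r.toNNReal ω - X ω) ^ 2 + q)) ∂P
      ≤ 0 := by
    intro n
    rw [← integral_congr_ae (ae_of_all _ fun ω =>
      indicator_range_sum h.cont ψ p q σ τ X n T ω (hστ ω) (hT ω))]
    have hAF : ∀ k : ℕ, MeasurableSet[pathInfo W 𝒴 ((k : ℝ≥0) / 2 ^ n)]
        ({ω | σ ω < (k : ℝ≥0) / 2 ^ n} \ {ω | τ ω < (k : ℝ≥0) / 2 ^ n}) := fun k => by
      have h1 := hσ ((k : ℝ≥0) / 2 ^ n)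
      have h2 := hτ ((k : ℝ≥0) / 2 ^ n)
      simp only [ENNReal.coe_lt_coe] at h1 h2
      exact h1.diff h2
    have hkk : ∀ k : ℕ, (k : ℝ≥0) / 2 ^ n ≤ ((k + 1 : ℕ) : ℝ≥0) / 2 ^ n := fun k => by
      gcongr; simp
    have hint : ∀ k ∈ Finset.range ((T + 1) * 2 ^ n), Integrable
        (fun ω => ψ (W (((k + 1 : ℕ) : ℝ≥0) / 2 ^ n) ω - X ω) -
          ψ (W ((k : ℝ≥0) / 2 ^ n) ω - X ω) -
          ∫ r in (((k : ℝ≥0) / 2 ^ n : ℝ≥0) : ℝ)..((((k + 1 : ℕ) : ℝ≥0) / 2 ^ n : ℝ≥0) : ℝ),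
            (p * (W r.toNNReal ω - X ω) ^ 2 + q)) P := by
      intro k hk
      refine hBi.mono' (hmeas (fun _ => _) (fun _ => _) measurable_const measurable_const
        fun _ => hkk k).aestronglyMeasurable (ae_of_all _ fun ω => ?_)
      refine h.abs_dynkin_le hC p q (hkk k) ?_ X ω
      rw [div_le_iff₀ (by positivity)]
      exact_mod_cast Finset.mem_range.1 hk
    rw [integral_finsetSum _ fun k hk => (hint k hk).indicator (h.pathInfo_le _ _ (hAF k))]
    refine Finset.sum_nonpos fun k hk => ?_
    rw [integral_indicator (h.pathInfo_le _ _ (hAF k))]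
    set t : ℝ≥0 := (k : ℝ≥0) / 2 ^ n
    set t' : ℝ≥0 := ((k + 1 : ℕ) : ℝ≥0) / 2 ^ n
    set A := {ω | σ ω < t} \ {ω | τ ω < t}
    set X' : Ω → ℝ := {ω | (σ ω : ℝ≥0∞) < t}.indicator X with hX'
    have hX'm : Measurable[pathInfo W 𝒴 t] X' := measurable_indicator_of_pastOf hσ hX t
    have hX'4 : MemLp X' 4 P := hX4.indicator (h.pathInfo_le _ _ (hσ t))
    have hXX' : ∀ ω ∈ A, X ω = X' ω := fun ω hω => by
      rw [hX', Set.indicator_of_mem]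
      simpa using hω.1
    have hs := h.setIntegral_step_le hψ hC hstep (hkk k) (hAF k) hX'm hX'4
    have e1 : ∫ ω in A, (ψ (W t' ω - X ω) - ψ (W t ω - X ω) -
        ∫ r in (t : ℝ)..t', (p * (W r.toNNReal ω - X ω) ^ 2 + q)) ∂P =
        ∫ ω in A, (ψ (W t' ω - X' ω) - ψ (W t ω - X' ω) -
        ∫ r in (t : ℝ)..t', (p * (W r.toNNReal ω - X' ω) ^ 2 + q)) ∂P :=
      setIntegral_congr_fun (h.pathInfo_le _ _ (hAF k)) fun ω hω => by
        simp only [hXX' ω hω]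
    have hX'm' := hX'm.mono (h.pathInfo_le _) le_rfl
    have i1 : Integrable (fun ω => ψ (W t' ω - X' ω)) P :=
      integrable_growth hψ.measurable hC ((h.meas t').sub hX'm') (h.memLp_sub t' hX'4)
    have i2 : Integrable (fun ω => ψ (W t ω - X' ω)) P :=
      integrable_growth hψ.measurable hC ((h.meas t).sub hX'm') (h.memLp_sub t hX'4)
    have i3 : IntegrableOn
        (fun ω => ∫ r in (t : ℝ)..t', (p * (W r.toNNReal ω - X' ω) ^ 2 + q)) A P := by
      have i4 : IntegrableOn
          (fun ω => ∫ r in (t : ℝ)..t', (p * (W r.toNNReal ω - X ω) ^ 2 + q)) A P := by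
        have i5 : Integrable (fun ω => ψ (W t' ω - X ω)) P :=
          integrable_growth hψ.measurable hC ((h.meas t').sub hXm) (h.memLp_sub t' hX4)
        have i6 : Integrable (fun ω => ψ (W t ω - X ω)) P :=
          integrable_growth hψ.measurable hC ((h.meas t).sub hXm) (h.memLp_sub t hX4)
        have := (i5.sub i6).sub (hint k hk)
        refine (this.congr (ae_of_all _ fun ω => ?_)).integrableOn
        simp only [Pi.sub_apply]
        ring
      refine i4.congr_fun (fun ω hω => ?_) (h.pathInfo_le _ _ (hAF k))
      simp only [hXX' ω hω]
    have i12 : IntegrableOn (fun ω => ψ (W t' ω - X' ω) - ψ (W t ω - X' ω)) A P :=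
      (i1.sub i2).integrableOn
    have hs' : ∫ ω in A, ψ (W t' ω - X' ω) ∂P ≤ ∫ ω in A, ψ (W t ω - X' ω) ∂P +
      ∫ ω in A, (∫ r in (t : ℝ)..t', (p * (W r.toNNReal ω - X' ω) ^ 2 + q)) ∂P := hs
    rw [e1, integral_sub i12 i3, integral_sub i1.integrableOn i2.integrableOn]
    linarith
  refine le_of_tendsto' (tendsto_integral_of_dominated_convergence B (fun n => ?_) hBi
    (fun n => ae_of_all _ fun ω => ?_) (ae_of_all _ fun ω => ?_)) hgrid
  · exact (hmeas _ _ ((measurable_gridUp n).comp hσm) ((measurable_gridUp n).comp hτm)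
      fun ω => gridUp_mono n (hστ ω)).aestronglyMeasurable
  · exact h.abs_dynkin_le hC p q (gridUp_mono n (hστ ω)) (hgT n ω) X ω
  · have hc := h.cont ω
    have tσ := tendsto_gridUp (σ ω)
    have tτ := tendsto_gridUp (τ ω)
    have c1 : Continuous fun s : ℝ≥0 => ψ (W s ω - X ω) := by fun_prop
    set f : ℝ → ℝ := fun r => p * (W r.toNNReal ω - X ω) ^ 2 + q
    have hfc : Continuous f := by
      have : Continuous fun r : ℝ => W r.toNNReal ω := hc.comp continuous_real_toNNReal
      fun_prop
    have e1 : ∀ x y : ℝ, ∫ r in x..y, f r = (∫ r in (0 : ℝ)..y, f r) - ∫ r in (0 : ℝ)..x, f r :=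
      fun x y => (intervalIntegral.integral_interval_sub_left (hfc.intervalIntegrable _ _)
        (hfc.intervalIntegrable _ _)).symm
    have c2 : Continuous fun s : ℝ≥0 => ∫ r in (0 : ℝ)..s, f r :=
      (intervalIntegral.continuous_primitive (fun a b => hfc.intervalIntegrable a b) 0).comp
        NNReal.continuous_coe
    have hlim := (((c1.tendsto _).comp tτ).sub ((c1.tendsto _).comp tσ)).sub
      (((c2.tendsto _).comp tτ).sub ((c2.tendsto _).comp tσ))
    rw [← e1 (σ ω) (τ ω)] at hlim
    refine hlim.congr fun n => ?_
    rw [e1 (gridUp n (σ ω)) (gridUp n (τ ω))]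
    rfl

end IsBrownianWith

end Dynkin

/-! ### The corrector of the threshold rule -/

section Corrector

/-- The bounded function `((β - x²)⁺)² / 6`. It measures, for the error `x`, the expected gain of
waiting until the squared error reaches `β` over acting at once. -/
def corrector (β x : ℝ) : ℝ := (max (β - x ^ 2) 0) ^ 2 / 6

lemma corrector_nonneg (β x : ℝ) : 0 ≤ corrector β x := by unfold corrector; positivity

lemma continuous_corrector (β : ℝ) : Continuous (corrector β) := by unfold corrector; fun_prop

lemma corrector_antitone {β x y : ℝ} (h : |x| ≤ |y|) : corrector β y ≤ corrector β x := by
  unfold corrector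
  have := sq_le_sq.2 h
  gcongr

lemma corrector_le (β x : ℝ) (hβ : 0 ≤ β) : corrector β x ≤ β ^ 2 / 6 := by
  unfold corrector
  gcongr
  exact max_le (by nlinarith [sq_nonneg x]) hβ

/-- The quartic polynomial `(β - y²)² / 6` bounds the corrector from above, and the two agree where
`y² ≤ β`. -/
lemma corrector_le_quartic (β y : ℝ) : corrector β y ≤ (β - y ^ 2) ^ 2 / 6 := by
  unfold corrector
  gcongr ?_ / 6
  refine sq_le_sq.2 ?_
  rw [abs_of_nonneg (le_max_right _ _)]
  exact max_le (le_abs_self _) (abs_nonneg _)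

/-- Where the corrector vanishes, its growth is at most quadratic. -/
lemma corrector_add_le_of_lt {β x : ℝ} (hβ : 0 ≤ β) (hx : β < x ^ 2) (b : ℝ) :
    corrector β (x + b) ≤ 2 * β / 3 * b ^ 2 := by
  rcases le_or_gt (β - (x + b) ^ 2) 0 with h | h
  · unfold corrector
    rw [max_eq_right h]; simp; positivity
  unfold corrector
  rw [max_eq_left h.le]
  set s := Real.sqrt β
  have hs : s ^ 2 = β := Real.sq_sqrt hβ
  have hs0 : 0 ≤ s := Real.sqrt_nonneg _
  have hx' : s < |x| := by
    rw [← abs_of_nonneg hs0]; exact sq_lt_sq.1 (by rw [hs]; exact hx)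
  have hy : |x + b| < s := by
    rw [← abs_of_nonneg hs0]; exact sq_lt_sq.1 (by rw [hs]; linarith)
  have h1 : s - |x + b| ≤ |b| := by
    have : |x| ≤ |x + b| + |b| := by
      calc |x| = |(x + b) - b| := by ring_nf
        _ ≤ _ := abs_sub _ _
    linarith
  have h2 : s + |x + b| ≤ 2 * s := by linarith
  have h3 : β - (x + b) ^ 2 = (s - |x + b|) * (s + |x + b|) := by
    rw [← hs, ← sq_abs (x + b)]; ring
  have h4 : β - (x + b) ^ 2 ≤ |b| * (2 * s) := by
    rw [h3]; exact mul_le_mul h1 h2 (by positivity) (abs_nonneg _)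
  calc (β - (x + b) ^ 2) ^ 2 / 6 ≤ (|b| * (2 * s)) ^ 2 / 6 := by gcongr
    _ = 2 * β / 3 * b ^ 2 := by rw [mul_pow, sq_abs, mul_pow, hs]; ring

lemma integrable_corrector_gaussian (β x : ℝ) (v : ℝ≥0) :
    Integrable (fun y => corrector β (x + y)) (gaussianReal 0 v) := by
  refine Integrable.mono' (g := fun _ => max β 0 ^ 2 / 6) (integrable_const _)
    ((continuous_corrector β).comp (by fun_prop)).aestronglyMeasurable (ae_of_all _ fun y => ?_)
  rw [Real.norm_of_nonneg (corrector_nonneg _ _)]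
  unfold corrector
  gcongr
  nlinarith [sq_nonneg (x + y)]

/-- The generator of Brownian motion applied to the corrector is at most `x² - β / 3`, in integrated
form. -/
lemma integral_corrector_gaussian_le {β : ℝ} (hβ : 0 ≤ β) (x : ℝ) (v : ℝ≥0) :
    ∫ y, corrector β (x + y) ∂gaussianReal 0 v ≤
      corrector β x + 1 * (x ^ 2 * v + v ^ 2 / 2) + (-(β / 3)) * v := by
  have hi := integrable_corrector_gaussian β x v
  rcases le_or_gt (x ^ 2) β with hx | hx
  · have e := integral_cubic_gaussian v ((β - x ^ 2) ^ 2 / 6) (-(2 / 3) * x * (β - x ^ 2))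
      (x ^ 2 - β / 3) (2 / 3 * x) (1 / 6)
    have hp : Integrable (fun y : ℝ => (β - x ^ 2) ^ 2 / 6 + -(2 / 3) * x * (β - x ^ 2) * y +
        (x ^ 2 - β / 3) * y ^ 2 + 2 / 3 * x * y ^ 3 + 1 / 6 * y ^ 4) (gaussianReal 0 v) := by
      have i1 := integrable_pow_gaussian v 1
      simp only [pow_one] at i1
      exact ((((integrable_const _).add (i1.const_mul _)).add
        ((integrable_pow_gaussian v 2).const_mul _)).add
        ((integrable_pow_gaussian v 3).const_mul _)).add
        ((integrable_pow_gaussian v 4).const_mul _)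
    have h1 := integral_mono hi hp fun y => by
      refine (corrector_le_quartic β (x + y)).trans_eq ?_
      ring
    rw [e] at h1
    refine h1.trans_eq ?_
    unfold corrector
    rw [max_eq_left (by linarith)]
    ring
  · have h1 := integral_mono hi ((integrable_pow_gaussian v 2).const_mul (2 * β / 3)) fun y =>
      corrector_add_le_of_lt hβ hx y
    rw [integral_const_mul, integral_pow_two_gaussian] at h1
    refine h1.trans ?_
    have h2 := corrector_nonneg β x
    have hv : (0 : ℝ) ≤ v := v.coe_nonneg
    nlinarith [mul_nonneg hv (sub_nonneg.2 hx.le), sq_nonneg (v : ℝ)]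

/-- A shift of a centred Gaussian variable decreases the expectation of the corrector: the product
of the two differences in the symmetrised integral is nonnegative, as the corrector and the density
are both decreasing in the absolute value. -/
lemma integral_corrector_shift_le (β a : ℝ) (v : ℝ≥0) :
    ∫ y, corrector β (a + y) ∂gaussianReal 0 v ≤ ∫ y, corrector β y ∂gaussianReal 0 v := by
  rcases eq_or_ne v 0 with rfl | hv
  · simp only [gaussianReal_zero_var, integral_dirac, add_zero]
    exact corrector_antitone (by simp)
  set g : ℝ → ℝ := gaussianPDFReal 0 v with hg
  set w := corrector β
  have hganti : ∀ {x y : ℝ}, |x| ≤ |y| → g y ≤ g x := fun {x y} h => by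
    simp only [hg, gaussianPDFReal, sub_zero]
    have := sq_le_sq.2 h
    gcongr
  have hgi : Integrable g := integrable_gaussianPDFReal 0 v
  have hwb : ∀ x, ‖w x‖ ≤ max β 0 ^ 2 / 6 := fun x => by
    rw [Real.norm_of_nonneg (corrector_nonneg _ _)]
    simp only [corrector]
    gcongr
    nlinarith [sq_nonneg x]
  have hwc : Continuous w := continuous_corrector β
  have hmul : ∀ {u k : ℝ → ℝ}, Continuous u → (∀ x, ‖u x‖ ≤ max β 0 ^ 2 / 6) → Integrable k →
      Integrable fun z => u z * k z := fun hu hub hk =>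
    hk.bdd_mul hu.aestronglyMeasurable (ae_of_all _ hub)
  have hgi' : Integrable fun z => g (a - z) := hgi.comp_sub_left a
  have hwc' : Continuous fun z => w (a - z) := hwc.comp (by fun_prop)
  have i1 : Integrable fun z => w z * g z := hmul hwc hwb hgi
  have i2 : Integrable fun z => w z * g (a - z) := hmul hwc hwb hgi'
  have i3 : Integrable fun z => w (a - z) * g z := hmul hwc' (fun _ => hwb _) hgi
  have i4 : Integrable fun z => w (a - z) * g (a - z) := hmul hwc' (fun _ => hwb _) hgi'
  have hpos : 0 ≤ ∫ z, (w z - w (a - z)) * (g z - g (a - z)) := by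
    refine integral_nonneg fun z => ?_
    rcases le_total |z| |a - z| with h | h
    · exact mul_nonneg (sub_nonneg.2 (corrector_antitone h)) (sub_nonneg.2 (hganti h))
    · exact mul_nonneg_of_nonpos_of_nonpos (sub_nonpos.2 (corrector_antitone h))
        (sub_nonpos.2 (hganti h))
  have e4 : ∫ z, w (a - z) * g (a - z) = ∫ z, w z * g z :=
    integral_sub_left_eq_self (fun z => w z * g z) volume a
  have e2 : ∫ z, w z * g (a - z) = ∫ z, w (a - z) * g z := by
    rw [← integral_sub_left_eq_self (fun z => w z * g (a - z)) volume a]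
    simp
  have e3 : ∫ z, w (a - z) * g z = ∫ z, w (a + z) * g z := by
    rw [← integral_neg_eq_self (fun z => w (a - z) * g z) volume]
    congr 1 with z
    have : g (-z) = g z := by simp [hg, gaussianPDFReal]
    rw [this, sub_neg_eq_add]
  have e : ∫ z, (w z - w (a - z)) * (g z - g (a - z)) =
      (∫ z, w z * g z) - (∫ z, w z * g (a - z)) - ((∫ z, w (a - z) * g z) -
        ∫ z, w (a - z) * g (a - z)) := by
    have e5 := integral_sub (i1.sub i2) (i3.sub i4)
    simp only [Pi.sub_apply] at e5
    rw [← integral_sub i1 i2, ← integral_sub i3 i4, ← e5]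
    congr 1 with z
    ring
  rw [integral_gaussianReal_eq_integral_smul hv, integral_gaussianReal_eq_integral_smul hv]
  simp only [smul_eq_mul]
  simp_rw [mul_comm (gaussianPDFReal 0 v _)]
  rw [e, e4, e2, e3] at hpos
  linarith

end Corrector

/-! ### Waiting periods up to a deterministic time -/

section Waiting

variable {Ω : Type*} {𝒴 : MeasurableSpace Ω} [mΩ : MeasurableSpace Ω] {P : Measure Ω}
  {W : ℝ≥0 → Ω → ℝ}

/-- The random time `τ`, stopped at the deterministic time `T`. -/
def trunc (T : ℝ≥0) (τ : Ω → ℝ≥0∞) (ω : Ω) : ℝ≥0 := (min (τ ω) T).toNNReal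

omit mΩ in
lemma coe_trunc (T : ℝ≥0) (τ : Ω → ℝ≥0∞) (ω : Ω) : (trunc T τ ω : ℝ≥0∞) = min (τ ω) T :=
  ENNReal.coe_toNNReal (ne_top_of_le_ne_top ENNReal.coe_ne_top (min_le_right _ _))

omit mΩ in
lemma trunc_le (T : ℝ≥0) (τ : Ω → ℝ≥0∞) (ω : Ω) : trunc T τ ω ≤ T := by
  rw [← ENNReal.coe_le_coe, coe_trunc]; exact min_le_right _ _

omit mΩ in
lemma trunc_mono (T : ℝ≥0) {σ τ : Ω → ℝ≥0∞} {ω : Ω} (h : σ ω ≤ τ ω) :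
    trunc T σ ω ≤ trunc T τ ω := by
  rw [← ENNReal.coe_le_coe, coe_trunc, coe_trunc]; exact min_le_min_right _ h

omit mΩ in
lemma trunc_of_le {T : ℝ≥0} {τ : Ω → ℝ≥0∞} {ω : Ω} (h : τ ω ≤ T) :
    trunc T τ ω = (τ ω).toNNReal := by rw [trunc, min_eq_left h]

omit mΩ in
lemma trunc_of_ge {T : ℝ≥0} {τ : Ω → ℝ≥0∞} {ω : Ω} (h : T ≤ τ ω) : trunc T τ ω = T := by
  rw [trunc, min_eq_right h, ENNReal.toNNReal_coe]

omit mΩ in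
lemma IsOptional.trunc {F : ℝ≥0 → MeasurableSpace Ω} {τ : Ω → ℝ≥0∞} (hτ : IsOptional F τ)
    (T : ℝ≥0) : IsOptional F (fun ω => (trunc T τ ω : ℝ≥0∞)) := by
  simp only [coe_trunc]; exact hτ.min (isOptional_const _)

namespace IsBrownianWith

lemma measurable_of_isOptional (h : IsBrownianWith 𝒴 P W) {τ : Ω → ℝ≥0∞}
    (hτ : IsOptional (pathInfo W 𝒴) τ) : Measurable τ := hτ.measurable pathInfo_mono h.pathInfo_le

lemma measurable_trunc (h : IsBrownianWith 𝒴 P W) {τ : Ω → ℝ≥0∞}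
    (hτ : IsOptional (pathInfo W 𝒴) τ) (T : ℝ≥0) : Measurable (trunc T τ) :=
  ((h.measurable_of_isOptional hτ).min measurable_const).ennreal_toNNReal

/-- The value of the Brownian motion at a bounded random time has a fourth moment. -/
lemma memLp_eval_of_le (h : IsBrownianWith 𝒴 P W) {τ : Ω → ℝ≥0} (hτ : Measurable τ) {T : ℕ}
    (hT : ∀ ω, τ ω ≤ T) : MemLp (fun ω => W (τ ω) ω) 4 P := by
  refine (h.memLp_runMax (Nat.succ_pos T)).mono' (h.measurable_eval hτ).aestronglyMeasurable
    (ae_of_all _ fun ω => ?_)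
  refine abs_le_runMax h.cont ((hT ω).trans ?_) ω
  push_cast; simp

lemma measurable_pastOf_eval_trunc (h : IsBrownianWith 𝒴 P W) {σ τ : Ω → ℝ≥0∞}
    (hσ : IsOptional (pathInfo W 𝒴) σ) (hτ : IsOptional (pathInfo W 𝒴) τ)
    (hστ : ∀ ω, σ ω ≤ τ ω) (T : ℝ≥0) :
    Measurable[pastOf (mΩ := mΩ) (hτ.trunc T)] fun ω => W (trunc T σ ω) ω := by
  have h1 := measurable_pastOf_eval (mΩ := mΩ) pathInfo_mono h.pathInfo_le h.cont
    measurable_pathInfo (hσ.trunc T)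
  refine h1.mono (pastOf_mono _ _ fun ω => ?_) le_rfl
  exact_mod_cast trunc_mono T (hστ ω)

/-- Between bounded times, the time integral in Dynkin's formula is integrable. -/
lemma integrable_timeIntegral (h : IsBrownianWith 𝒴 P W) (p q : ℝ) {σ τ : Ω → ℝ≥0}
    (hσ : Measurable σ) (hτ : Measurable τ) (hστ : ∀ ω, σ ω ≤ τ ω) {T : ℕ} (hT : ∀ ω, τ ω ≤ T)
    {X : Ω → ℝ} (hXm : Measurable X) (hX4 : MemLp X 4 P) :
    Integrable (fun ω => ∫ r in (σ ω : ℝ)..τ ω, (p * (W r.toNNReal ω - X ω) ^ 2 + q)) P := by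
  have := h.isProbabilityMeasure
  have hjm := h.measurable_quadratic p q hXm
  have hM := h.memLp_runMax (Nat.succ_pos T)
  have i2 := (integrable_pow_two hM).add (integrable_pow_two hX4)
  have hB : Integrable (fun ω => 2 * ((0 : ℝ) * (1 + 8 * (runMax W (T + 1) ω ^ 4 + X ω ^ 4))) +
      ((T + 1 : ℕ) : ℝ) * (|p| * (2 * (runMax W (T + 1) ω ^ 2 + X ω ^ 2)) + |q|)) P := by
    simp only [zero_mul, mul_zero, zero_add]
    exact (((i2.const_mul 2).const_mul |p|).add (integrable_const |q|)).const_mul _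
  refine hB.mono' (measurable_intervalIntegral_of_le hjm hσ.coe_nnreal_real hτ.coe_nnreal_real
        fun ω => by exact_mod_cast hστ ω).aestronglyMeasurable (ae_of_all _ fun ω => ?_)
  have := h.abs_dynkin_le (ψ := fun _ => 0) (C := 0) (by simp) p q (hστ ω)
    ((hT ω).trans (by push_cast; simp)) X ω (T := T + 1)
  simpa using this

lemma intervalIntegrable_error (h : IsBrownianWith 𝒴 P W) (ω : Ω) (x a b : ℝ) :
    IntervalIntegrable (fun r : ℝ => (W r.toNNReal ω - x) ^ 2) volume a b := by
  have : Continuous fun r : ℝ => W r.toNNReal ω := (h.cont ω).comp continuous_real_toNNReal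
  exact ((this.sub continuous_const).pow 2).intervalIntegrable _ _

/-- For the squared error, Dynkin's formula is an identity. -/
lemma integral_sq_sub (h : IsBrownianWith 𝒴 P W) {σ τ : Ω → ℝ≥0}
    (hσ : IsOptional (pathInfo W 𝒴) (fun ω => (σ ω : ℝ≥0∞)))
    (hτ : IsOptional (pathInfo W 𝒴) (fun ω => (τ ω : ℝ≥0∞))) (hστ : ∀ ω, σ ω ≤ τ ω) {T : ℕ}
    (hT : ∀ ω, τ ω ≤ T) {X : Ω → ℝ} (hX : Measurable[pastOf (mΩ := mΩ) hσ] X)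
    (hX4 : MemLp X 4 P) :
    ∫ ω, ((W (τ ω) ω - X ω) ^ 2 - (W (σ ω) ω - X ω) ^ 2 - ((τ ω : ℝ) - σ ω)) ∂P = 0 := by
  have hg : ∀ c x : ℝ, |c * x ^ 2| ≤ |c| * (1 + x ^ 4) := fun c x => by
    have := quadratic_growth c 0 x
    simpa using this
  have h1 := h.dynkin_le (ψ := fun x => 1 * x ^ 2) (C := |1|) (p := 0) (q := 1) (by fun_prop)
    (hg 1) (fun x v => by
      have := gaussian_quadratic 1 0 x v
      simp only [add_zero] at this
      rw [this]; ring_nf; rfl) hσ hτ hστ hT hX hX4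
  have h2 := h.dynkin_le (ψ := fun x => (-1) * x ^ 2) (C := |(-1)|) (p := 0) (q := -1)
    (by fun_prop) (hg (-1)) (fun x v => by
      have := gaussian_quadratic (-1) 0 x v
      simp only [add_zero] at this
      rw [this]; ring_nf; rfl) hσ hτ hστ hT hX hX4
  simp only [zero_mul, zero_add, intervalIntegral.integral_const, smul_eq_mul, mul_one,
    one_mul] at h1 h2
  refine le_antisymm h1 ?_
  have e : ∀ ω, (-1) * (W (τ ω) ω - X ω) ^ 2 - (-1) * (W (σ ω) ω - X ω) ^ 2 -
      ((τ ω : ℝ) - σ ω) * (-1) =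
      -((W (τ ω) ω - X ω) ^ 2 - (W (σ ω) ω - X ω) ^ 2 - ((τ ω : ℝ) - σ ω)) := fun ω => by ring
  simp_rw [e, integral_neg] at h2
  linarith

end IsBrownianWith

/-- The time interval `(a, b]`, for possibly infinite times `a, b`. -/
def period (a b : ℝ≥0∞) : Set ℝ := {r | a < ofReal r ∧ ofReal r ≤ b}

/-- The squared error at time `r` of an estimator that uses the sample taken at time `S`. -/
def sqError (W : ℝ≥0 → Ω → ℝ) (S : Ω → ℝ≥0∞) (r : ℝ) (ω : Ω) : ℝ≥0∞ :=
  ofReal ((W r.toNNReal ω - W (S ω).toNNReal ω) ^ 2)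

lemma period_inter_Iic (a b : ℝ≥0∞) (T : ℝ≥0) :
    period a b ∩ Set.Iic (T : ℝ) =
      Set.Ioc (((min a T).toNNReal : ℝ≥0) : ℝ) ((min b T).toNNReal : ℝ≥0) := by
  ext r
  have ha : ((min a T).toNNReal : ℝ≥0∞) = min a T :=
    ENNReal.coe_toNNReal (ne_top_of_le_ne_top ENNReal.coe_ne_top (min_le_right _ _))
  have hb : ((min b T).toNNReal : ℝ≥0∞) = min b T :=
    ENNReal.coe_toNNReal (ne_top_of_le_ne_top ENNReal.coe_ne_top (min_le_right _ _))
  simp only [period, Set.mem_inter_iff, Set.mem_ofPred_eq, Set.mem_Iic, Set.mem_Ioc]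
  rcases le_or_gt r 0 with hr | hr
  · rw [ENNReal.ofReal_of_nonpos hr]
    constructor
    · rintro ⟨⟨h, -⟩, -⟩; exact absurd h not_lt_zero
    · rintro ⟨h, -⟩; exact absurd (h.trans_le hr) (not_lt.2 (NNReal.coe_nonneg _))
  · lift r to ℝ≥0 using hr.le
    rw [NNReal.coe_lt_coe, NNReal.coe_le_coe, NNReal.coe_le_coe, ← ENNReal.coe_lt_coe,
      ← ENNReal.coe_le_coe, ← ENNReal.coe_le_coe, ha, hb, ENNReal.ofReal_coe_nnreal, le_min_iff,
      min_lt_iff]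
    constructor
    · rintro ⟨⟨h1, h2⟩, h3⟩; exact ⟨Or.inl h1, h2, h3⟩
    · rintro ⟨h1 | h1, h2, h3⟩
      · exact ⟨⟨h1, h2⟩, h3⟩
      · exact absurd h1 (not_lt.2 h3)

lemma measurableSet_period (a b : ℝ≥0∞) : MeasurableSet (period a b) :=
  (measurableSet_lt measurable_const ENNReal.measurable_ofReal).inter
    (measurableSet_le ENNReal.measurable_ofReal measurable_const)

namespace IsBrownianWith

lemma memLp_eval_trunc (h : IsBrownianWith 𝒴 P W) {τ : Ω → ℝ≥0∞}
    (hτ : IsOptional (pathInfo W 𝒴) τ) (T : ℝ≥0) : MemLp (fun ω => W (trunc T τ ω) ω) 4 P :=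
  h.memLp_eval_of_le (h.measurable_trunc hτ T) (T := ⌈T⌉₊)
    fun ω => (trunc_le T τ ω).trans (Nat.le_ceil T)

lemma measurable_eval_trunc (h : IsBrownianWith 𝒴 P W) {τ : Ω → ℝ≥0∞}
    (hτ : IsOptional (pathInfo W 𝒴) τ) (T : ℝ≥0) : Measurable (fun ω => W (trunc T τ ω) ω) :=
  h.measurable_eval (h.measurable_trunc hτ T)

lemma integrable_trunc (h : IsBrownianWith 𝒴 P W) {τ : Ω → ℝ≥0∞}
    (hτ : IsOptional (pathInfo W 𝒴) τ) (T : ℝ≥0) : Integrable (fun ω => (trunc T τ ω : ℝ)) P := by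
  have := h.isProbabilityMeasure
  exact (integrable_const (T : ℝ)).mono'
    (h.measurable_trunc hτ T).coe_nnreal_real.aestronglyMeasurable (ae_of_all _ fun ω => by
      rw [Real.norm_of_nonneg (NNReal.coe_nonneg _)]; exact_mod_cast trunc_le T _ ω)

/-- A bounded time `τ ≥ σ` costs at least `β / 3` per unit of time, up to the correction at the
time `σ`. -/
lemma waiting_le (h : IsBrownianWith 𝒴 P W) {β : ℝ} (hβ : 0 ≤ β) {S D G : Ω → ℝ≥0∞}
    (hS : IsOptional (pathInfo W 𝒴) S) (hD : IsOptional (pathInfo W 𝒴) D)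
    (hG : IsOptional (pathInfo W 𝒴) G) (hSD : ∀ ω, S ω ≤ D ω) (hDG : ∀ ω, D ω ≤ G ω) (T : ℝ≥0) :
    ofReal (β / 3) * ∫⁻ ω, volume (period (D ω) (G ω) ∩ Set.Iic (T : ℝ)) ∂P ≤
      ∫⁻ ω, (∫⁻ r in period (D ω) (G ω) ∩ Set.Iic (T : ℝ), sqError W S r ω) ∂P +
      ∫⁻ ω, {ω | D ω < T}.indicator (fun ω => ofReal
        (corrector β (W (D ω).toNNReal ω - W (S ω).toNNReal ω))) ω ∂P := by
  have := h.isProbabilityMeasure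
  set X : Ω → ℝ := fun ω => W (trunc T S ω) ω
  have hX4 : MemLp X 4 P := h.memLp_eval_trunc hS T
  have hXm : Measurable X := h.measurable_eval_trunc hS T
  have hσm := h.measurable_trunc hD T
  have hτm := h.measurable_trunc hG T
  have hστ : ∀ ω, trunc T D ω ≤ trunc T G ω := fun ω => trunc_mono T (hDG ω)
  have hτT : ∀ ω, trunc T G ω ≤ (⌈T⌉₊ : ℝ≥0) := fun ω => (trunc_le T G ω).trans (Nat.le_ceil T)
  have hbd : ∀ x, |corrector β x| ≤ β ^ 2 / 6 * (1 + x ^ 4) := fun x => by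
    rw [abs_of_nonneg (corrector_nonneg _ _)]
    have := corrector_le β x hβ
    nlinarith [sq_nonneg β, mul_nonneg (sq_nonneg β) (sq_nonneg (x ^ 2))]
  have key := h.dynkin_le (continuous_corrector β) hbd (integral_corrector_gaussian_le hβ)
    (hD.trunc T) (hG.trunc T) hστ hτT (h.measurable_pastOf_eval_trunc hS hD hSD T) hX4
  have hDm := h.measurable_of_isOptional hD
  -- the correction before the deterministic time `T`
  set V : Ω → ℝ := {ω | D ω < T}.indicator
    fun ω => corrector β (W (D ω).toNNReal ω - W (S ω).toNNReal ω)
  have hset : MeasurableSet {ω | D ω < (T : ℝ≥0∞)} := measurableSet_lt hDm measurable_const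
  have hVm : Measurable V := ((continuous_corrector β).measurable.comp
    ((h.measurable_eval hDm.ennreal_toNNReal).sub (h.measurable_eval
      (h.measurable_of_isOptional hS).ennreal_toNNReal))).indicator hset
  have hV0 : ∀ ω, 0 ≤ V ω := fun ω => Set.indicator_nonneg (fun _ _ => corrector_nonneg _ _) ω
  have hVi : Integrable V P := by
    refine (integrable_const (β ^ 2 / 6)).mono' hVm.aestronglyMeasurable (ae_of_all _ fun ω => ?_)
    rw [Real.norm_of_nonneg (hV0 ω)]
    refine Set.indicator_le' (fun _ _ => corrector_le β _ hβ) (fun _ _ => by positivity) ω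
  have hV : ∀ ω, -V ω ≤ corrector β (W (trunc T G ω) ω - X ω) -
      corrector β (W (trunc T D ω) ω - X ω) := fun ω => by
    rcases lt_or_ge (D ω) T with hd | hd
    · have e1 : V ω = corrector β (W (D ω).toNNReal ω - W (S ω).toNNReal ω) :=
        Set.indicator_of_mem (s := {ω | D ω < (T : ℝ≥0∞)}) hd _
      simp only [X]
      rw [e1, trunc_of_le hd.le, trunc_of_le ((hSD ω).trans hd.le)]
      linarith [corrector_nonneg β (W (trunc T G ω) ω - W (S ω).toNNReal ω)]
    · rw [trunc_of_ge hd, trunc_of_ge (hd.trans (hDG ω)), sub_self]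
      linarith [hV0 ω]
  have hI1 := h.integrable_timeIntegral 1 0 hσm hτm hστ hτT hXm hX4
  have hsp : ∀ ω, ∫ r in (trunc T D ω : ℝ)..trunc T G ω,
      (1 * (W r.toNNReal ω - X ω) ^ 2 + -(β / 3)) =
      (∫ r in (trunc T D ω : ℝ)..trunc T G ω, (1 * (W r.toNNReal ω - X ω) ^ 2 + 0)) -
        β / 3 * ((trunc T G ω : ℝ) - trunc T D ω) := fun ω => by
    simp only [one_mul, add_zero]
    rw [intervalIntegral.integral_add (h.intervalIntegrable_error ω _ _ _)
      intervalIntegrable_const, intervalIntegral.integral_const, smul_eq_mul]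
    ring
  have hdi : Integrable (fun ω => β / 3 * ((trunc T G ω : ℝ) - trunc T D ω)) P :=
    ((h.integrable_trunc hG T).sub (h.integrable_trunc hD T)).const_mul _
  have hcost : ∀ ω, 0 ≤ ∫ r in (trunc T D ω : ℝ)..trunc T G ω,
      (1 * (W r.toNNReal ω - X ω) ^ 2 + 0) := fun ω =>
    intervalIntegral.integral_nonneg (by exact_mod_cast hστ ω) fun r _ => by positivity
  have main : ∫ ω, β / 3 * ((trunc T G ω : ℝ) - trunc T D ω) ∂P ≤
      ∫ ω, (∫ r in (trunc T D ω : ℝ)..trunc T G ω, (1 * (W r.toNNReal ω - X ω) ^ 2 + 0)) ∂P +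
        ∫ ω, V ω ∂P := by
    have h2 : ∫ ω, (β / 3 * ((trunc T G ω : ℝ) - trunc T D ω) -
        (∫ r in (trunc T D ω : ℝ)..trunc T G ω, (1 * (W r.toNNReal ω - X ω) ^ 2 + 0)) -
        V ω) ∂P ≤ 0 := by
      refine (integral_mono ((hdi.sub hI1).sub hVi) ?_ fun ω => ?_).trans key
      · have hc1 := integrable_growth (P := P) (continuous_corrector β).measurable hbd
          ((h.measurable_eval_trunc hG T).sub hXm) ((h.memLp_eval_trunc hG T).sub hX4)
        have hc2 := integrable_growth (P := P) (continuous_corrector β).measurable hbd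
          ((h.measurable_eval_trunc hD T).sub hXm) ((h.memLp_eval_trunc hD T).sub hX4)
        refine (hc1.sub hc2).sub ((hI1.sub hdi).congr (ae_of_all _ fun ω => ?_))
        simp only [Pi.sub_apply]
        rw [hsp]
      · simp only [Pi.sub_apply]
        rw [hsp]
        linarith [hV ω]
    have h3 := integral_sub (hdi.sub hI1) hVi
    have h4 := integral_sub hdi hI1
    simp only [Pi.sub_apply] at h3
    linarith
  -- translation to Lebesgue integrals
  have e1 : ofReal (β / 3) * ∫⁻ ω, volume (period (D ω) (G ω) ∩ Set.Iic (T : ℝ)) ∂P =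
      ofReal (∫ ω, β / 3 * ((trunc T G ω : ℝ) - trunc T D ω) ∂P) := by
    rw [ofReal_integral_eq_lintegral_ofReal hdi (ae_of_all _ fun ω => mul_nonneg (by positivity)
      (sub_nonneg.2 (by exact_mod_cast hστ ω))), ← lintegral_const_mul' _ _ ENNReal.ofReal_ne_top]
    refine lintegral_congr fun ω => ?_
    rw [period_inter_Iic, Real.volume_Ioc, ← ENNReal.ofReal_mul (by positivity)]; rfl
  have e2 : ∫⁻ ω, (∫⁻ r in period (D ω) (G ω) ∩ Set.Iic (T : ℝ), sqError W S r ω) ∂P =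
      ofReal
        (∫ ω, (∫ r in (trunc T D ω : ℝ)..trunc T G ω,
          (1 * (W r.toNNReal ω - X ω) ^ 2 + 0)) ∂P) := by
    rw [ofReal_integral_eq_lintegral_ofReal hI1 (ae_of_all _ hcost)]
    refine lintegral_congr fun ω => ?_
    simp only [one_mul, add_zero]
    rw [intervalIntegral.integral_of_le (by exact_mod_cast hστ ω),
      ofReal_integral_eq_lintegral_ofReal (h.intervalIntegrable_error ω _ _ _).1
        (ae_of_all _ fun r => by positivity), period_inter_Iic]
    rcases lt_or_ge (D ω) T with hd | hd
    · simp only [X, sqError]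
      rw [trunc_of_le ((hSD ω).trans hd.le)]; rfl
    · rw [min_eq_right hd, min_eq_right (hd.trans (hDG ω)), trunc_of_ge hd,
        trunc_of_ge (hd.trans (hDG ω))]; simp
  have e3 : ∫⁻ ω, {ω | D ω < T}.indicator (fun ω => ofReal
      (corrector β (W (D ω).toNNReal ω - W (S ω).toNNReal ω))) ω ∂P =
      ofReal (∫ ω, V ω ∂P) := by
    rw [ofReal_integral_eq_lintegral_ofReal hVi (ae_of_all _ hV0)]
    refine lintegral_congr fun ω => ?_
    by_cases hd : D ω < T
    · simp [V, hd]
    · simp [V, hd]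
  rw [e1, e2, e3, ← ENNReal.ofReal_add (integral_nonneg hcost) (integral_nonneg hV0)]
  exact ENNReal.ofReal_le_ofReal main

/-- The balance of the squared error over a period: at the end it equals the squared error at the
beginning plus the elapsed time. -/
lemma sqError_balance (h : IsBrownianWith 𝒴 P W) {S D G : Ω → ℝ≥0∞}
    (hS : IsOptional (pathInfo W 𝒴) S) (hD : IsOptional (pathInfo W 𝒴) D)
    (hG : IsOptional (pathInfo W 𝒴) G) (hSD : ∀ ω, S ω ≤ D ω) (hDG : ∀ ω, D ω ≤ G ω) (T : ℝ≥0) :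
    ∫⁻ ω, {ω | G ω < T}.indicator (fun ω => sqError W S (G ω).toReal ω) ω ∂P +
      ∫⁻ ω, {ω | (T : ℝ) ∈ period (D ω) (G ω)}.indicator (fun ω => sqError W S T ω) ω ∂P =
    ∫⁻ ω, {ω | D ω < T}.indicator (fun ω => sqError W S (D ω).toReal ω) ω ∂P +
      ∫⁻ ω, volume (period (D ω) (G ω) ∩ Set.Iic (T : ℝ)) ∂P := by
  have := h.isProbabilityMeasure
  set X : Ω → ℝ := fun ω => W (trunc T S ω) ω
  have hX4 : MemLp X 4 P := h.memLp_eval_trunc hS T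
  have hστ : ∀ ω, trunc T D ω ≤ trunc T G ω := fun ω => trunc_mono T (hDG ω)
  have hτT : ∀ ω, trunc T G ω ≤ (⌈T⌉₊ : ℝ≥0) := fun ω => (trunc_le T G ω).trans (Nat.le_ceil T)
  have key := h.integral_sq_sub (hD.trunc T) (hG.trunc T) hστ hτT
    (h.measurable_pastOf_eval_trunc hS hD hSD T) hX4
  have hDm := h.measurable_of_isOptional hD
  have hGm := h.measurable_of_isOptional hG
  have hset : MeasurableSet {ω | D ω < (T : ℝ≥0∞)} := measurableSet_lt hDm measurable_const
  have hset' : MeasurableSet {ω | G ω < (T : ℝ≥0∞)} := measurableSet_lt hGm measurable_const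
  set A : (Ω → ℝ≥0∞) → Ω → ℝ := fun τ => {ω | D ω < T}.indicator
    fun ω => (W (trunc T τ ω) ω - X ω) ^ 2
  have hA0 : ∀ τ ω, 0 ≤ A τ ω := fun τ ω => Set.indicator_nonneg (fun _ _ => sq_nonneg _) ω
  have hAi : ∀ {τ}, IsOptional (pathInfo W 𝒴) τ → Integrable (A τ) P := fun hτ =>
    (integrable_pow_two ((h.memLp_eval_trunc hτ T).sub hX4)).indicator hset
  have hdi : Integrable (fun ω => (trunc T G ω : ℝ) - trunc T D ω) P :=
    (h.integrable_trunc hG T).sub (h.integrable_trunc hD T)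
  have main : ∫ ω, A G ω ∂P = ∫ ω, A D ω ∂P + ∫ ω, ((trunc T G ω : ℝ) - trunc T D ω) ∂P := by
    have e : ∀ ω, (W (trunc T G ω) ω - X ω) ^ 2 - (W (trunc T D ω) ω - X ω) ^ 2 -
        ((trunc T G ω : ℝ) - trunc T D ω) =
        A G ω - A D ω - ((trunc T G ω : ℝ) - trunc T D ω) := fun ω => by
      by_cases hd : D ω < T
      · simp [A, hd]
      · rw [not_lt] at hd
        simp [A, hd, trunc_of_ge hd, trunc_of_ge (hd.trans (hDG ω))]
    have h2 : ∫ ω, (A G ω - A D ω - ((trunc T G ω : ℝ) - trunc T D ω)) ∂P = 0 := by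
      rw [← key]; exact integral_congr_ae (ae_of_all _ fun ω => (e ω).symm)
    have h3 := integral_sub ((hAi hG).sub (hAi hD)) hdi
    have h4 := integral_sub (hAi hG) (hAi hD)
    simp only [Pi.sub_apply] at h3
    linarith
  have e1 : ∫⁻ ω, volume (period (D ω) (G ω) ∩ Set.Iic (T : ℝ)) ∂P =
      ofReal (∫ ω, ((trunc T G ω : ℝ) - trunc T D ω) ∂P) := by
    rw [ofReal_integral_eq_lintegral_ofReal hdi (ae_of_all _ fun ω =>
      (sub_nonneg.2 (by exact_mod_cast hστ ω)))]
    refine lintegral_congr fun ω => ?_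
    rw [period_inter_Iic, Real.volume_Ioc]; rfl
  have e2 : ∫⁻ ω, {ω | D ω < T}.indicator (fun ω => sqError W S (D ω).toReal ω) ω ∂P =
      ofReal (∫ ω, A D ω ∂P) := by
    rw [ofReal_integral_eq_lintegral_ofReal (hAi hD) (ae_of_all _ (hA0 D))]
    refine lintegral_congr fun ω => ?_
    by_cases hd : D ω < T
    · simp only [A, X, Set.indicator, Set.mem_ofPred_eq, hd, if_true, sqError]
      rw [trunc_of_le hd.le, trunc_of_le ((hSD ω).trans hd.le)]
      simp [ENNReal.toReal, Real.toNNReal_coe]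
    · simp [A, hd]
  have e3 : ∫⁻ ω, {ω | G ω < T}.indicator (fun ω => sqError W S (G ω).toReal ω) ω ∂P +
      ∫⁻ ω, {ω | (T : ℝ) ∈ period (D ω) (G ω)}.indicator (fun ω => sqError W S T ω) ω ∂P =
      ofReal (∫ ω, A G ω ∂P) := by
    have hm : Measurable fun ω => {ω | G ω < (T : ℝ≥0∞)}.indicator
        (fun ω => sqError W S (G ω).toReal ω) ω := by
      refine Measurable.indicator ?_ hset'
      refine ENNReal.measurable_ofReal.comp ((Measurable.sub ?_ ?_).pow_const 2)
      · exact h.measurable_eval (measurable_real_toNNReal.comp hGm.ennreal_toReal)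
      · exact h.measurable_eval (h.measurable_of_isOptional hS).ennreal_toNNReal
    rw [ofReal_integral_eq_lintegral_ofReal (hAi hG) (ae_of_all _ (hA0 G)),
      ← lintegral_add_left hm]
    refine lintegral_congr fun ω => ?_
    by_cases hd : D ω < T
    · by_cases hg : G ω < T
      · have : ¬ (T : ℝ≥0∞) ≤ G ω := not_le.2 hg
        simp only [A, X, Set.indicator, Set.mem_ofPred_eq, hd, hg, if_true, sqError, period,
          ENNReal.ofReal_coe_nnreal, this, and_false, if_false, add_zero]
        rw [trunc_of_le hg.le, trunc_of_le ((hSD ω).trans hd.le)]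
        simp [ENNReal.toReal, Real.toNNReal_coe]
      · have h' := not_lt.1 hg
        simp only [A, X, Set.indicator, Set.mem_ofPred_eq, hd, hg, if_true, sqError, period,
          ENNReal.ofReal_coe_nnreal, h', and_true, if_false, zero_add]
        rw [trunc_of_ge h', trunc_of_le ((hSD ω).trans hd.le), Real.toNNReal_coe]
    · have hg : ¬ G ω < T := not_lt.2 ((not_lt.1 hd).trans (hDG ω))
      simp [A, hd, hg, period]
  rw [e1, e2, e3, main, ENNReal.ofReal_add (integral_nonneg (hA0 D))
    (integral_nonneg fun ω => sub_nonneg.2 (by exact_mod_cast hστ ω))]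

end IsBrownianWith

end Waiting

/-! ### Discounting -/

section Discount

variable {Ω : Type*} {𝒴 : MeasurableSpace Ω} [mΩ : MeasurableSpace Ω] {P : Measure Ω}
  {W : ℝ≥0 → Ω → ℝ} {α : ℝ}

/-- The discount factor `exp (-α t)`, which is zero for `t = ∞`. -/
def disc (α : ℝ) (t : ℝ≥0∞) : ℝ≥0∞ :=
  if t = ∞ then 0 else ofReal (Real.exp (-α * t.toReal))

/-- The law of an exponential time with rate `α`. -/
def clock (α : ℝ) : Measure ℝ :=
  (volume.restrict (Set.Ioi 0)).withDensity fun T => ofReal (α * Real.exp (-α * T))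

lemma disc_top (α : ℝ) : disc α ∞ = 0 := by simp [disc]

lemma disc_of_ne_top {t : ℝ≥0∞} (h : t ≠ ∞) :
    disc α t = ofReal (Real.exp (-α * t.toReal)) := by simp [disc, h]

lemma disc_zero (α : ℝ) : disc α 0 = 1 := by simp [disc]

lemma disc_add (α : ℝ) (s t : ℝ≥0∞) : disc α (s + t) = disc α s * disc α t := by
  rcases eq_or_ne s ∞ with rfl | hs
  · simp [disc_top]
  rcases eq_or_ne t ∞ with rfl | ht
  · simp [disc_top]
  rw [disc_of_ne_top hs, disc_of_ne_top ht, disc_of_ne_top (ENNReal.add_ne_top.2 ⟨hs, ht⟩),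
    ENNReal.toReal_add hs ht, mul_add, Real.exp_add, ENNReal.ofReal_mul (Real.exp_pos _).le]

lemma disc_antitone (hα : 0 ≤ α) {s t : ℝ≥0∞} (h : s ≤ t) : disc α t ≤ disc α s := by
  rcases eq_or_ne t ∞ with rfl | ht
  · simp [disc_top]
  rw [disc_of_ne_top ht, disc_of_ne_top (ne_top_of_le_ne_top ht h)]
  refine ENNReal.ofReal_le_ofReal (Real.exp_le_exp.2 ?_)
  have := ENNReal.toReal_mono ht h
  nlinarith

lemma disc_le_one (hα : 0 ≤ α) (t : ℝ≥0∞) : disc α t ≤ 1 :=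
  (disc_antitone hα zero_le).trans (disc_zero α).le

lemma disc_ofReal {r : ℝ} (hr : 0 ≤ r) :
    disc α (ofReal r) = ofReal (Real.exp (-α * r)) := by
  rw [disc_of_ne_top ENNReal.ofReal_ne_top, ENNReal.toReal_ofReal hr]

lemma measurable_disc (α : ℝ) : Measurable (disc α) :=
  Measurable.ite (measurableSet_singleton _) measurable_const
    (ENNReal.measurable_ofReal.comp (Real.measurable_exp.comp
      (ENNReal.measurable_toReal.const_mul _)))

lemma clock_Ioi (hα : 0 < α) {r : ℝ} (hr : 0 ≤ r) :
    clock α (Set.Ioi r) = ofReal (Real.exp (-α * r)) := by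
  have hneg : -α < 0 := by linarith
  rw [clock, withDensity_apply _ measurableSet_Ioi, Measure.restrict_restrict measurableSet_Ioi,
    Set.inter_eq_left.2 (Set.Ioi_subset_Ioi hr), ← ofReal_integral_eq_lintegral_ofReal
      ((integrableOn_exp_mul_Ioi hneg r).const_mul α)
      (ae_of_all _ fun x => by positivity), integral_const_mul, integral_exp_mul_Ioi hneg]
  congr 1
  field_simp

lemma clock_Ici (hα : 0 < α) {r : ℝ} (hr : 0 ≤ r) :
    clock α (Set.Ici r) = ofReal (Real.exp (-α * r)) := by
  rw [← clock_Ioi hα hr]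
  refine measure_congr ?_
  exact ((withDensity_absolutelyContinuous _ _).ae_eq Ioi_ae_eq_Ici).symm

lemma clock_lt (hα : 0 < α) (t : ℝ≥0∞) : clock α {T | t < ofReal T} = disc α t := by
  rcases eq_or_ne t ∞ with rfl | ht
  · simp [disc_top]
  · rw [disc_of_ne_top ht, ← clock_Ioi hα ENNReal.toReal_nonneg]
    congr 1
    ext T
    simp only [Set.mem_ofPred_eq, Set.mem_Ioi]
    exact ENNReal.lt_ofReal_iff_toReal_lt ht

lemma ae_clock_pos : ∀ᵐ T ∂clock α, 0 < T :=
  (withDensity_absolutelyContinuous _ _).ae_le (ae_restrict_mem measurableSet_Ioi)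

lemma lintegral_clock {f : ℝ → ℝ≥0∞} (hf : Measurable f) :
    ∫⁻ T, f T ∂clock α =
      ∫⁻ T in Set.Ioi 0, ofReal (α * Real.exp (-α * T)) * f T := by
  rw [clock, lintegral_withDensity_eq_lintegral_mul _ (by fun_prop) hf]; rfl

instance : SFinite (clock α) := by unfold clock; infer_instance

lemma period_subset_Ioi (a b : ℝ≥0∞) : period a b ⊆ Set.Ioi 0 := fun _ hr =>
  ENNReal.ofReal_pos.1 (lt_of_le_of_lt zero_le hr.1)

lemma measurableSet_period_prod {D G : Ω → ℝ≥0∞} (hD : Measurable D) (hG : Measurable G) :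
    MeasurableSet {z : ℝ × Ω | z.1 ∈ period (D z.2) (G z.2)} :=
  (measurableSet_lt (hD.comp measurable_snd) (ENNReal.measurable_ofReal.comp measurable_fst)).inter
    (measurableSet_le (ENNReal.measurable_ofReal.comp measurable_fst) (hG.comp measurable_snd))

/-- The discounted integral over a random period, of a rate that is `f r ω` at time `r`. -/
def discInt (α : ℝ) (P : Measure Ω) (D G : Ω → ℝ≥0∞) (f : ℝ → Ω → ℝ≥0∞) : ℝ≥0∞ :=
  ∫⁻ ω, (∫⁻ r in period (D ω) (G ω), ofReal (Real.exp (-α * r)) * f r ω) ∂P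

variable {D G : Ω → ℝ≥0∞} {f : ℝ → Ω → ℝ≥0∞}

lemma measurable_period_indicator (hD : Measurable D) (hG : Measurable G)
    (hf : Measurable (Function.uncurry f)) :
    Measurable fun z : ℝ × Ω => (period (D z.2) (G z.2)).indicator (fun r => f r z.2) z.1 :=
  hf.indicator (measurableSet_period_prod hD hG)

/-- An integral up to an exponential time is a discounted integral. -/
lemma lintegral_clock_period [SFinite P] (hα : 0 < α) (hD : Measurable D) (hG : Measurable G)
    (hf : Measurable (Function.uncurry f)) :
    ∫⁻ T, ∫⁻ ω, (∫⁻ r in period (D ω) (G ω) ∩ Set.Iic T, f r ω) ∂P ∂clock α =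
      discInt α P D G f := by
  have hm := measurable_period_indicator hD hG hf
  have e : ∀ (T : ℝ) ω, ∫⁻ r in period (D ω) (G ω) ∩ Set.Iic T, f r ω =
      ∫⁻ r, (Set.Ici r).indicator
        (fun _ => (period (D ω) (G ω)).indicator (fun r => f r ω) r) T := fun T ω => by
    rw [← lintegral_indicator ((measurableSet_period _ _).inter measurableSet_Iic)]
    refine lintegral_congr fun r => ?_
    by_cases h1 : r ∈ period (D ω) (G ω) <;> by_cases h2 : r ≤ T <;> simp [Set.indicator, h1, h2]
  have hmT : Measurable fun z : (ℝ × Ω) × ℝ => (Set.Ici z.2).indicator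
      (fun _ => (period (D z.1.2) (G z.1.2)).indicator (fun r => f r z.1.2) z.2) z.1.1 := by
    have h1 : Measurable fun z : (ℝ × Ω) × ℝ =>
        (period (D z.1.2) (G z.1.2)).indicator (fun r => f r z.1.2) z.2 :=
      hm.comp (measurable_snd.prodMk (measurable_snd.comp measurable_fst))
    exact h1.indicator (s := {z : (ℝ × Ω) × ℝ | z.2 ≤ z.1.1})
      (measurableSet_le measurable_snd (measurable_fst.comp measurable_fst))
  simp_rw [e]
  rw [lintegral_lintegral_swap
    (Measurable.lintegral_prod_right' (f := fun z : (ℝ × Ω) × ℝ => (Set.Ici z.2).indicator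
      (fun _ => (period (D z.1.2) (G z.1.2)).indicator (fun r => f r z.1.2) z.2) z.1.1)
        hmT).aemeasurable]
  refine lintegral_congr fun ω => ?_
  have hmω : Measurable (Function.uncurry fun (T r : ℝ) => (Set.Ici r).indicator
      (fun _ => (period (D ω) (G ω)).indicator (fun r => f r ω) r) T) :=
    hmT.comp (f := fun z : ℝ × ℝ => ((z.1, ω), z.2)) (by fun_prop)
  rw [lintegral_lintegral_swap hmω.aemeasurable, ← lintegral_indicator (measurableSet_period _ _)]
  refine lintegral_congr fun r => ?_
  rw [show (fun T => (Set.Ici r).indicator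
      (fun _ => (period (D ω) (G ω)).indicator (fun r => f r ω) r) T) =
    (Set.Ici r).indicator fun _ => (period (D ω) (G ω)).indicator (fun r => f r ω) r from rfl,
    lintegral_indicator measurableSet_Ici, setLIntegral_const]
  by_cases h1 : r ∈ period (D ω) (G ω)
  · rw [clock_Ici hα (period_subset_Ioi _ _ h1).le]
    simp [h1, mul_comm]
  · simp [h1]

lemma measurable_lt_indicator (hD : Measurable D) {g : Ω → ℝ≥0∞} (hg : Measurable g) :
    Measurable (Function.uncurry fun (T : ℝ) ω => {ω | D ω < ofReal T}.indicator g ω) :=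
  (hg.comp measurable_snd).indicator (s := {z : ℝ × Ω | D z.2 < ofReal z.1})
    (measurableSet_lt (hD.comp measurable_snd) (ENNReal.measurable_ofReal.comp measurable_fst))

lemma lintegral_clock_lt [SFinite P] (hα : 0 < α) (hD : Measurable D) {g : Ω → ℝ≥0∞}
    (hg : Measurable g) :
    ∫⁻ T, ∫⁻ ω, {ω | D ω < ofReal T}.indicator g ω ∂P ∂clock α =
      ∫⁻ ω, disc α (D ω) * g ω ∂P := by
  rw [lintegral_lintegral_swap (measurable_lt_indicator hD hg).aemeasurable]
  refine lintegral_congr fun ω => ?_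
  have hs : MeasurableSet {T | D ω < ofReal T} :=
    measurableSet_lt measurable_const ENNReal.measurable_ofReal
  rw [show (fun T => {ω | D ω < ofReal T}.indicator g ω) =
      {T | D ω < ofReal T}.indicator fun _ => g ω from rfl,
    lintegral_indicator hs, setLIntegral_const, clock_lt hα, mul_comm]

lemma lintegral_clock_mem_period [SFinite P] (hα : 0 < α) (hD : Measurable D) (hG : Measurable G)
    (hf : Measurable (Function.uncurry f)) :
    ∫⁻ T, ∫⁻ ω, {ω | T ∈ period (D ω) (G ω)}.indicator (f T) ω ∂P ∂clock α =
      ofReal α * discInt α P D G f := by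
  have hm : Measurable fun z : ℝ × Ω => {ω | z.1 ∈ period (D ω) (G ω)}.indicator (f z.1) z.2 :=
    measurable_period_indicator hD hG hf
  rw [lintegral_lintegral_swap hm.aemeasurable, discInt,
    ← lintegral_const_mul' _ _ ENNReal.ofReal_ne_top]
  refine lintegral_congr fun ω => ?_
  have hmω : Measurable fun T => {ω | T ∈ period (D ω) (G ω)}.indicator (f T) ω :=
    hm.comp (f := fun T : ℝ => (T, ω)) (by fun_prop)
  rw [lintegral_clock hmω,
    ← lintegral_const_mul' _ _ ENNReal.ofReal_ne_top,
    ← lintegral_indicator (measurableSet_period _ _), ← lintegral_indicator measurableSet_Ioi]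
  refine lintegral_congr fun r => ?_
  by_cases h1 : r ∈ period (D ω) (G ω)
  · simp only [Set.indicator, period_subset_Ioi _ _ h1, h1, if_true, Set.mem_ofPred_eq]
    rw [ENNReal.ofReal_mul hα.le, mul_assoc]
  · simp [Set.indicator, h1]

namespace IsBrownianWith

lemma measurable_sqError (h : IsBrownianWith 𝒴 P W) {S : Ω → ℝ≥0∞} (hS : Measurable S) :
    Measurable (Function.uncurry (sqError W S)) :=
  ENNReal.measurable_ofReal.comp ((h.measurable_uncurry_real.sub
    ((h.measurable_eval hS.ennreal_toNNReal).comp measurable_snd)).pow_const 2)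

lemma measurable_sqError_at (h : IsBrownianWith 𝒴 P W) {S τ : Ω → ℝ≥0∞} (hS : Measurable S)
    (hτ : Measurable τ) : Measurable fun ω => sqError W S (τ ω).toReal ω :=
  (h.measurable_sqError hS).comp (hτ.ennreal_toReal.prodMk measurable_id)

lemma measurable_corrector_at (h : IsBrownianWith 𝒴 P W) (β : ℝ) {S D : Ω → ℝ≥0∞}
    (hS : Measurable S) (hD : Measurable D) : Measurable fun ω =>
      ofReal (corrector β (W (D ω).toNNReal ω - W (S ω).toNNReal ω)) :=
  ENNReal.measurable_ofReal.comp ((continuous_corrector β).measurable.comp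
    ((h.measurable_eval hD.ennreal_toNNReal).sub (h.measurable_eval hS.ennreal_toNNReal)))

/-- The discounted cost of waiting from `D` to `G` is at least `β / 3` per unit of discounted time,
up to the correction at the time `D`. -/
lemma disc_waiting_le (h : IsBrownianWith 𝒴 P W) (hα : 0 < α) {β : ℝ} (hβ : 0 ≤ β)
    {S D G : Ω → ℝ≥0∞} (hS : IsOptional (pathInfo W 𝒴) S) (hD : IsOptional (pathInfo W 𝒴) D)
    (hG : IsOptional (pathInfo W 𝒴) G) (hSD : ∀ ω, S ω ≤ D ω) (hDG : ∀ ω, D ω ≤ G ω) :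
    ofReal (β / 3) * discInt α P D G (fun _ _ => 1) ≤ discInt α P D G (sqError W S) +
      ∫⁻ ω, disc α (D ω) * ofReal
        (corrector β (W (D ω).toNNReal ω - W (S ω).toNNReal ω)) ∂P := by
  have := h.isProbabilityMeasure
  have hSm := h.measurable_of_isOptional hS
  have hDm := h.measurable_of_isOptional hD
  have hGm := h.measurable_of_isOptional hG
  have hc := h.measurable_corrector_at β hSm hDm
  rw [← lintegral_clock_period hα hDm hGm (f := fun _ _ => 1) measurable_const,
    ← lintegral_clock_period hα hDm hGm (h.measurable_sqError hSm),
    ← lintegral_clock_lt hα hDm hc,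
    ← lintegral_add_right _ (measurable_lt_indicator hDm hc).lintegral_prod_right,
    ← lintegral_const_mul' _ _ ENNReal.ofReal_ne_top]
  refine lintegral_mono_ae (ae_clock_pos.mono fun T hT => ?_)
  have := h.waiting_le hβ hS hD hG hSD hDG T.toNNReal
  simp only [Real.coe_toNNReal T hT.le] at this
  simp only [setLIntegral_const, one_mul]
  exact this

/-- The discounted balance of the squared error over a period: the squared error has drift one. -/
lemma disc_sqError_balance (h : IsBrownianWith 𝒴 P W) (hα : 0 < α) {S D G : Ω → ℝ≥0∞}
    (hS : IsOptional (pathInfo W 𝒴) S) (hD : IsOptional (pathInfo W 𝒴) D)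
    (hG : IsOptional (pathInfo W 𝒴) G) (hSD : ∀ ω, S ω ≤ D ω) (hDG : ∀ ω, D ω ≤ G ω) :
    ∫⁻ ω, disc α (G ω) * sqError W S (G ω).toReal ω ∂P +
      ofReal α * discInt α P D G (sqError W S) =
    ∫⁻ ω, disc α (D ω) * sqError W S (D ω).toReal ω ∂P + discInt α P D G (fun _ _ => 1) := by
  have := h.isProbabilityMeasure
  have hSm := h.measurable_of_isOptional hS
  have hDm := h.measurable_of_isOptional hD
  have hGm := h.measurable_of_isOptional hG
  have hm : ∀ {τ : Ω → ℝ≥0∞}, Measurable τ → Measurable fun T : ℝ => ∫⁻ ω,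
      {ω | τ ω < ofReal T}.indicator (fun ω => sqError W S (τ ω).toReal ω) ω ∂P := fun hτ =>
    (measurable_lt_indicator hτ (h.measurable_sqError_at hSm hτ)).lintegral_prod_right
  rw [← lintegral_clock_period hα hDm hGm (f := fun _ _ => 1) measurable_const,
    ← lintegral_clock_mem_period hα hDm hGm (h.measurable_sqError hSm),
    ← lintegral_clock_lt hα hDm (h.measurable_sqError_at hSm hDm),
    ← lintegral_clock_lt hα hGm (h.measurable_sqError_at hSm hGm),
    ← lintegral_add_left (hm hDm), ← lintegral_add_left (hm hGm)]
  refine lintegral_congr_ae (ae_clock_pos.mono fun T hT => ?_)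
  have := h.sqError_balance hS hD hG hSD hDG T.toNNReal
  simp only [Real.coe_toNNReal T hT.le] at this
  simp only [setLIntegral_const, one_mul]
  exact this

end IsBrownianWith

/-- The discounted length of a period. -/
lemma disc_eq_add_discInt [IsProbabilityMeasure P] (hα : 0 < α) (hD : Measurable D)
    (hG : Measurable G) (hDG : ∀ ω, D ω ≤ G ω) :
    ofReal α * discInt α P D G (fun _ _ => 1) + ∫⁻ ω, disc α (G ω) ∂P =
      ∫⁻ ω, disc α (D ω) ∂P := by
  have h1 := lintegral_clock_lt (P := P) hα hD (g := fun _ => 1) measurable_const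
  have h2 := lintegral_clock_lt (P := P) hα hG (g := fun _ => 1) measurable_const
  simp only [mul_one] at h1 h2
  rw [← lintegral_clock_mem_period hα hD hG measurable_const, ← h1, ← h2,
    ← lintegral_add_right _ (measurable_lt_indicator hG measurable_const).lintegral_prod_right]
  refine lintegral_congr fun T => ?_
  rw [← lintegral_add_right _ (measurable_const.indicator (measurableSet_lt hG measurable_const))]
  refine lintegral_congr fun ω => ?_
  simp only [Set.indicator, Set.mem_ofPred_eq, period]
  by_cases hg : G ω < ofReal T
  · simp [hg, (hDG ω).trans_lt hg, not_le.2 hg]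
  · simp [hg, not_lt.1 hg]

end Discount

/-! ### Service periods -/

section Service

variable {Ω : Type*} {𝒴 : MeasurableSpace Ω} [mΩ : MeasurableSpace Ω] {P : Measure Ω}
  {W : ℝ≥0 → Ω → ℝ} {α : ℝ}

/-- Fubini's theorem for independent random variables, with the σ-algebras as explicit arguments: it
is used for `V = id` and a sub-σ-algebra of the ambient one. -/
lemma lintegral_indep_pair [IsProbabilityMeasure P] {E F : Type*} {mE : MeasurableSpace E}
    {mF : MeasurableSpace F} {V : Ω → E} {D : Ω → F} (hV : Measurable V) (hD : Measurable D)
    (hind : Indep (mE.comap V) (mF.comap D) P) {f : E → F → ℝ≥0∞}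
    (hf : Measurable (Function.uncurry f)) :
    ∫⁻ ω, f (V ω) (D ω) ∂P = ∫⁻ ω', ∫⁻ ω, f (V ω) (D ω') ∂P ∂P := by
  have : IsProbabilityMeasure (P.map V) := Measure.isProbabilityMeasure_map hV.aemeasurable
  have : IsProbabilityMeasure (P.map D) := Measure.isProbabilityMeasure_map hD.aemeasurable
  have e := (indepFun_iff_map_prod_eq_prod_map_map hV.aemeasurable hD.aemeasurable).1
    ((IndepFun_iff_Indep _ _ _).2 hind)
  have hm : Measurable fun y => ∫⁻ x, f x y ∂P.map V := hf.lintegral_prod_left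
  calc ∫⁻ ω, f (V ω) (D ω) ∂P = ∫⁻ z, Function.uncurry f z ∂P.map (fun ω => (V ω, D ω)) := by
        rw [lintegral_map hf (hV.prodMk hD)]; rfl
    _ = ∫⁻ y, ∫⁻ x, f x y ∂P.map V ∂P.map D := by
        rw [e, lintegral_prod_symm' _ hf]; rfl
    _ = ∫⁻ ω', ∫⁻ x, f x (D ω') ∂P.map V ∂P := by rw [lintegral_map hm hD]
    _ = _ := by
        refine lintegral_congr fun ω' => ?_
        have hf' : Measurable fun x => f x (D ω') :=
          hf.comp (measurable_id.prodMk measurable_const)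
        rw [lintegral_map hf' hV]

lemma lintegral_indepFun_pair [IsProbabilityMeasure P] {E F : Type*} [MeasurableSpace E]
    [MeasurableSpace F] {V : Ω → E} {D : Ω → F} (hV : Measurable V) (hD : Measurable D)
    (hind : IndepFun V D P) {f : E → F → ℝ≥0∞} (hf : Measurable (Function.uncurry f)) :
    ∫⁻ ω, f (V ω) (D ω) ∂P = ∫⁻ ω', ∫⁻ ω, f (V ω) (D ω') ∂P ∂P :=
  lintegral_indep_pair hV hD ((IndepFun_iff_Indep _ _ _).1 hind) hf

/-- All information on the path of `W`, enlarged by the events of `𝒴`. -/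
@[reducible] def allInfo (W : ℝ≥0 → Ω → ℝ) (𝒴 : MeasurableSpace Ω) : MeasurableSpace Ω :=
  MeasurableSpace.comap (fun ω t => W t ω) inferInstance ⊔ 𝒴

omit mΩ in
lemma measurable_allInfo (s : ℝ≥0) : Measurable[allInfo W 𝒴] (W s) :=
  Measurable.of_comap_le <| le_sup_of_le_left <|
    ((measurable_pi_apply s).comp (comap_measurable fun ω t => W t ω)).comap_le

omit mΩ in
lemma pathInfo_le_allInfo (t : ℝ≥0) : pathInfo W 𝒴 t ≤ allInfo W 𝒴 :=
  sup_le (iSup₂_le fun s _ => (measurable_allInfo s).comap_le) le_sup_right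

omit mΩ in
lemma measurable_allInfo_uncurry (hW : ∀ ω, Continuous fun t => W t ω) :
    @Measurable _ _ (@Prod.instMeasurableSpace _ _ inferInstance (allInfo W 𝒴)) _
      (Function.uncurry W) :=
  measurable_uncurry_of_continuous_of_measurable (m := allInfo W 𝒴) hW measurable_allInfo

omit mΩ in
lemma measurable_allInfo_eval (hW : ∀ ω, Continuous fun t => W t ω) {τ : Ω → ℝ≥0}
    (hτ : Measurable[allInfo W 𝒴] τ) : Measurable[allInfo W 𝒴] fun ω => W (τ ω) ω :=
  (measurable_allInfo_uncurry hW).comp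
    (@Measurable.prodMk _ _ _ _ _ (allInfo W 𝒴) _ _ hτ (@measurable_id _ (allInfo W 𝒴)))

omit mΩ in
lemma IsOptional.measurable_allInfo {τ : Ω → ℝ≥0∞} (hτ : IsOptional (pathInfo W 𝒴) τ) :
    Measurable[allInfo W 𝒴] τ :=
  IsOptional.measurable (mΩ := allInfo W 𝒴) pathInfo_mono pathInfo_le_allInfo hτ

omit mΩ in
lemma measurable_service_integrand {m : MeasurableSpace Ω} (hW : Measurable (Function.uncurry W))
    {G : Ω → ℝ≥0∞} (hG : Measurable G) {H : Ω → ℝ} (hH : Measurable H)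
    {θ : ℝ≥0 → ℝ≥0} (hθ : Measurable θ) {K : ℝ≥0∞ → ℝ → ℝ → ℝ≥0 → ℝ≥0∞}
    (hK : Measurable fun z : (ℝ≥0∞ × ℝ × ℝ) × ℝ≥0 => K z.1.1 z.1.2.1 z.1.2.2 z.2) :
    Measurable (Function.uncurry fun (ω : Ω) (y : ℝ≥0) =>
      K (G ω) (H ω) (shiftPath W G ω (θ y)) y) := by
  have g1 : Measurable fun z : Ω × ℝ≥0 => (G z.1).toNNReal :=
    (hG.comp measurable_fst).ennreal_toNNReal
  have w1 : Measurable fun z : Ω × ℝ≥0 => shiftPath W G z.1 (θ z.2) :=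
    (hW.comp ((g1.add (hθ.comp measurable_snd)).prodMk measurable_fst)).sub
      (hW.comp (g1.prodMk measurable_fst))
  exact hK.comp (((hG.comp measurable_fst).prodMk
    ((hH.comp measurable_fst).prodMk w1)).prodMk measurable_snd)

-- The next two lemmas restate library facts for a σ-algebra `m` that is not an instance.
omit mΩ in
lemma measurable_sub_of {m : MeasurableSpace Ω} {f g : Ω → ℝ} (hf : Measurable[m] f)
    (hg : Measurable[m] g) : Measurable[m] fun ω => f ω - g ω := hf.sub hg

omit mΩ in
lemma measurable_prodMk_of {m : MeasurableSpace Ω} {E F : Type*} [MeasurableSpace E]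
    [MeasurableSpace F] {f : Ω → E} {g : Ω → F} (hf : Measurable[m] f)
    (hg : Measurable[m] g) : Measurable[m] fun ω => (f ω, g ω) := hf.prodMk hg

lemma disc_ne_top (α : ℝ) (t : ℝ≥0∞) : disc α t ≠ ∞ := by
  unfold disc; split_ifs <;> simp

omit mΩ in
lemma measurable_disc_comp {m : MeasurableSpace Ω} (α : ℝ) {G : Ω → ℝ≥0∞} (hG : Measurable G) :
    Measurable fun ω => disc α (G ω) := (measurable_disc α).comp hG

lemma lintegral_disc_ne_top [IsProbabilityMeasure P] (hα : 0 ≤ α) (G : Ω → ℝ≥0∞) :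
    ∫⁻ ω, disc α (G ω) ∂P ≠ ∞ :=
  ne_top_of_le_ne_top ENNReal.one_ne_top
    ((lintegral_mono fun ω => disc_le_one hα (G ω)).trans (by simp))

namespace IsBrownianWith

lemma allInfo_le (h : IsBrownianWith 𝒴 P W) : allInfo W 𝒴 ≤ mΩ :=
  sup_le (measurable_pi_lambda _ h.meas).comap_le h.le

lemma map_shiftPath_apply (h : IsBrownianWith 𝒴 P W) {τ : Ω → ℝ≥0∞}
    (hτ : IsOptional (pathInfo W 𝒴) τ) (hfin : ∀ᵐ ω ∂P, τ ω ≠ ∞) (s : ℝ≥0) :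
    P.map (fun ω => shiftPath W τ ω s) = gaussianReal 0 s := by
  have h1 := ((h.identDistrib_shiftPath hτ hfin).comp (measurable_pi_apply s)).map_eq
  exact h1.trans (h.brownian.hasLaw_eval s).map_eq

lemma indepFun_shiftPath (h : IsBrownianWith 𝒴 P W) {τ : Ω → ℝ≥0∞}
    (hτ : IsOptional (pathInfo W 𝒴) τ) (hfin : ∀ᵐ ω ∂P, τ ω ≠ ∞) {E : Type*}
    {mE : MeasurableSpace E} {H : Ω → E} (hH : Measurable[pastOf (mΩ := mΩ) hτ] H) :
    IndepFun H (shiftPath W τ) P := by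
  rw [IndepFun_iff_Indep]
  exact indep_of_indep_of_le_left (h.indep_shiftPath hτ hfin) hH.comap_le

/-- Averaging over the service time and over the increment of the Brownian motion, at a time that
depends on the service time only. -/
theorem lintegral_service (h : IsBrownianWith 𝒴 P W) {G : Ω → ℝ≥0∞}
    (hG : IsOptional (pathInfo W 𝒴) G) (hfin : ∀ᵐ ω ∂P, G ω ≠ ∞) {H : Ω → ℝ}
    (hH : Measurable[pastOf (mΩ := mΩ) hG] H) (hH' : Measurable[allInfo W 𝒴] H) {Y : Ω → ℝ≥0}
    (hY : Measurable Y)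
    (hind : Indep (allInfo W 𝒴) (MeasurableSpace.comap Y inferInstance) P)
    {θ : ℝ≥0 → ℝ≥0} (hθ : Measurable θ) {K : ℝ≥0∞ → ℝ → ℝ → ℝ≥0 → ℝ≥0∞}
    (hK : Measurable fun z : (ℝ≥0∞ × ℝ × ℝ) × ℝ≥0 => K z.1.1 z.1.2.1 z.1.2.2 z.2) :
    ∫⁻ ω, K (G ω) (H ω) (shiftPath W G ω (θ (Y ω))) (Y ω) ∂P =
      ∫⁻ ω', ∫⁻ ω, ∫⁻ z, K (G ω) (H ω) z (Y ω') ∂gaussianReal 0 (θ (Y ω')) ∂P ∂P := by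
  have := h.isProbabilityMeasure
  have hGall := hG.measurable_allInfo
  have hid : Indep (MeasurableSpace.comap id (allInfo W 𝒴))
      (MeasurableSpace.comap Y inferInstance) P := by
    rw [MeasurableSpace.comap_id]; exact hind
  have hf : @Measurable _ _ (@Prod.instMeasurableSpace _ _ (allInfo W 𝒴) inferInstance) _
      (Function.uncurry fun (ω : Ω) (y : ℝ≥0) => K (G ω) (H ω) (shiftPath W G ω (θ y)) y) :=
    measurable_service_integrand (m := allInfo W 𝒴) (measurable_allInfo_uncurry h.cont) hGall hH'
      hθ hK
  have e1 := lintegral_indep_pair (mE := allInfo W 𝒴) (V := id) (fun s hs => h.allInfo_le s hs) hY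
    hid hf
  simp only [id] at e1
  rw [e1]
  refine lintegral_congr fun ω' => ?_
  have hGp := hG.measurable_pastOf (mΩ := mΩ) pathInfo_mono h.pathInfo_le
  have hpair : Measurable[pastOf (mΩ := mΩ) hG] fun ω => (G ω, H ω) :=
    measurable_prodMk_of hGp hH
  have hi : IndepFun (fun ω => shiftPath W G ω (θ (Y ω'))) (fun ω => (G ω, H ω)) P :=
    ((h.indepFun_shiftPath hG hfin hpair).comp measurable_id
      (measurable_pi_apply (θ (Y ω')))).symm
  have hZm : Measurable fun ω => shiftPath W G ω (θ (Y ω')) :=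
    (measurable_pi_apply _).comp (h.measurable_shiftPath (h.measurable_of_isOptional hG))
  have e2 := lintegral_indepFun_pair hZm (hpair.mono (pastOf_le hG) le_rfl) hi
    (f := fun z p => K p.1 p.2 z (Y ω')) (by
      exact hK.comp (f := fun z : ℝ × ℝ≥0∞ × ℝ => ((z.2.1, z.2.2, z.1), Y ω')) (by fun_prop))
  refine e2.trans (lintegral_congr fun ω => ?_)
  rw [← h.map_shiftPath_apply hG hfin, lintegral_map _ hZm]
  exact hK.comp (f := fun z : ℝ => ((G ω, H ω, z), Y ω')) (by fun_prop)

end IsBrownianWith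

lemma lintegral_sq_gaussian (c : ℝ) (v : ℝ≥0) :
    ∫⁻ z, ofReal ((c + z) ^ 2) ∂gaussianReal 0 v = ofReal (c ^ 2) + v := by
  have hi : Integrable (fun z : ℝ => (c + z) ^ 2) (gaussianReal 0 v) := by
    have i1 := ((integrable_const (c ^ 2)).add
      ((integrable_pow_gaussian v 1).const_mul (2 * c))).add (integrable_pow_gaussian v 2)
    refine i1.congr (ae_of_all _ fun z => ?_)
    simp only [Pi.add_apply]; ring
  have e := IsBrownianWith.gaussian_quadratic 1 0 c v
  simp only [one_mul, add_zero] at e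
  rw [← ofReal_integral_eq_lintegral_ofReal hi (ae_of_all _ fun z => sq_nonneg _), e,
    ENNReal.ofReal_add (sq_nonneg _) (NNReal.coe_nonneg v), ENNReal.ofReal_coe_nnreal]

/-- The expected correction at the end of a service period that starts with error zero. -/
def serviceCorrection (P : Measure Ω) (β : ℝ) (Y : Ω → ℝ≥0) : ℝ≥0∞ :=
  ∫⁻ ω, ∫⁻ z, ofReal (corrector β z) ∂gaussianReal 0 (Y ω) ∂P

lemma lintegral_corrector_shift_le (β c : ℝ) (v : ℝ≥0) :
    ∫⁻ z, ofReal (corrector β (c + z)) ∂gaussianReal 0 v ≤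
      ∫⁻ z, ofReal (corrector β z) ∂gaussianReal 0 v := by
  have h0 := integrable_corrector_gaussian β 0 v
  simp only [zero_add] at h0
  rw [← ofReal_integral_eq_lintegral_ofReal (integrable_corrector_gaussian β c v)
    (ae_of_all _ fun _ => corrector_nonneg _ _), ← ofReal_integral_eq_lintegral_ofReal h0
    (ae_of_all _ fun _ => corrector_nonneg _ _)]
  exact ENNReal.ofReal_le_ofReal (integral_corrector_shift_le β c v)

/-- The discounted length of a service period. -/
def serviceLength (α : ℝ) (P : Measure Ω) (Y : Ω → ℝ≥0) : ℝ≥0∞ :=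
  ∫⁻ ω, (∫⁻ u in Set.Ioc (0 : ℝ) (Y ω), ofReal (Real.exp (-α * u))) ∂P

/-- The discounted cost of a service period that starts with error zero. -/
def serviceCost (α : ℝ) (P : Measure Ω) (Y : Ω → ℝ≥0) : ℝ≥0∞ :=
  ∫⁻ ω, (∫⁻ u in Set.Ioc (0 : ℝ) (Y ω),
    ofReal (Real.exp (-α * u)) * ofReal u) ∂P

namespace IsBrownianWith

variable {ρ G : Ω → ℝ≥0∞} {Y : Ω → ℝ≥0}

lemma measurable_pastOf_error (h : IsBrownianWith 𝒴 P W) (hρ : IsOptional (pathInfo W 𝒴) ρ)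
    (hG : IsOptional (pathInfo W 𝒴) G) (hρG : ∀ ω, ρ ω ≤ G ω) :
    Measurable[pastOf (mΩ := mΩ) hG] fun ω => W (G ω).toNNReal ω - W (ρ ω).toNNReal ω := by
  have h1 := measurable_pastOf_eval (mΩ := mΩ) pathInfo_mono h.pathInfo_le h.cont
    measurable_pathInfo hG
  have h2 := (measurable_pastOf_eval (mΩ := mΩ) pathInfo_mono h.pathInfo_le h.cont
    measurable_pathInfo hρ).mono (pastOf_mono hρ hG hρG) le_rfl
  exact measurable_sub_of h1 h2

lemma measurable_allInfo_error (h : IsBrownianWith 𝒴 P W) (hρ : IsOptional (pathInfo W 𝒴) ρ)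
    (hG : IsOptional (pathInfo W 𝒴) G) :
    Measurable[allInfo W 𝒴] fun ω => W (G ω).toNNReal ω - W (ρ ω).toNNReal ω :=
  measurable_sub_of
    (measurable_allInfo_eval h.cont (ENNReal.measurable_toNNReal.comp hG.measurable_allInfo))
    (measurable_allInfo_eval h.cont (ENNReal.measurable_toNNReal.comp hρ.measurable_allInfo))

/-- The discount factor at the end of a service period. -/
lemma disc_service (h : IsBrownianWith 𝒴 P W) (hα : 0 ≤ α) (hG : IsOptional (pathInfo W 𝒴) G)
    (hY : Measurable Y) (hind : Indep (allInfo W 𝒴) (MeasurableSpace.comap Y inferInstance) P) :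
    ∫⁻ ω, disc α (G ω + Y ω) ∂P = (∫⁻ ω, disc α (Y ω) ∂P) * ∫⁻ ω, disc α (G ω) ∂P := by
  have := h.isProbabilityMeasure
  have hi : IndepFun G Y P := by
    rw [IndepFun_iff_Indep]
    exact indep_of_indep_of_le_left hind hG.measurable_allInfo.comap_le
  simp_rw [disc_add]
  have := lintegral_indepFun_pair (h.measurable_of_isOptional hG) hY hi
    (f := fun g y => disc α g * disc α y) (((measurable_disc α).comp measurable_fst).mul
      ((measurable_disc α).comp (measurable_coe_nnreal_ennreal.comp measurable_snd)))
  rw [this]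
  have hx := lintegral_disc_ne_top (P := P) hα G
  rw [← lintegral_mul_const' _ _ hx]
  refine lintegral_congr fun ω' => ?_
  rw [lintegral_mul_const _ (measurable_disc_comp α (h.measurable_of_isOptional hG)), mul_comm]

/-- The discounted correction at the end of a service period. -/
lemma disc_corrector_service_le (h : IsBrownianWith 𝒴 P W) (hα : 0 ≤ α) (β : ℝ)
    (hρ : IsOptional (pathInfo W 𝒴) ρ)
    (hG : IsOptional (pathInfo W 𝒴) G) (hρG : ∀ ω, ρ ω ≤ G ω) (hfin : ∀ᵐ ω ∂P, G ω ≠ ∞)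
    (hY : Measurable Y) (hind : Indep (allInfo W 𝒴) (MeasurableSpace.comap Y inferInstance) P) :
    ∫⁻ ω, disc α (G ω + Y ω) * ofReal
        (corrector β (W (G ω + Y ω).toNNReal ω - W (ρ ω).toNNReal ω)) ∂P ≤
      serviceCorrection P β Y * ∫⁻ ω, disc α (G ω) ∂P := by
  have := h.isProbabilityMeasure
  have e := h.lintegral_service hG hfin (h.measurable_pastOf_error hρ hG hρG)
    (h.measurable_allInfo_error hρ hG) hY hind measurable_id
    (K := fun g c z y => disc α (g + y) * ofReal (corrector β (c + z)))
    (((measurable_disc α).comp ((measurable_fst.comp measurable_fst).add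
      (measurable_coe_nnreal_ennreal.comp measurable_snd))).mul
      (ENNReal.measurable_ofReal.comp ((continuous_corrector β).measurable.comp (by fun_prop))))
  have hx := lintegral_disc_ne_top (P := P) hα G
  calc _ = ∫⁻ ω, disc α (G ω + Y ω) * ofReal (corrector β
        (W (G ω).toNNReal ω - W (ρ ω).toNNReal ω + shiftPath W G ω (id (Y ω)))) ∂P := by
        refine lintegral_congr_ae (hfin.mono fun ω hω => ?_)
        simp only [shiftPath, id]
        rw [ENNReal.toNNReal_add hω ENNReal.coe_ne_top, ENNReal.toNNReal_coe]
        congr 4; ring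
    _ = _ := e
    _ ≤ ∫⁻ ω', ∫⁻ ω, disc α (G ω) * ∫⁻ z, ofReal (corrector β z) ∂gaussianReal 0 (Y ω')
          ∂P ∂P := by
        refine lintegral_mono fun ω' => lintegral_mono fun ω => ?_
        rw [lintegral_const_mul' _ _ (disc_ne_top _ _)]
        exact mul_le_mul' (disc_antitone hα le_self_add) (lintegral_corrector_shift_le _ _ _)
    _ = _ := by
        rw [serviceCorrection, ← lintegral_mul_const' _ _ hx]
        refine lintegral_congr fun ω' => ?_
        rw [lintegral_mul_const _ (measurable_disc_comp α (h.measurable_of_isOptional hG)),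
          mul_comm]

/-- The discounted squared error at the end of a service period. -/
lemma le_disc_sqError_service (h : IsBrownianWith 𝒴 P W) (hα : 0 ≤ α)
    (hρ : IsOptional (pathInfo W 𝒴) ρ)
    (hG : IsOptional (pathInfo W 𝒴) G) (hρG : ∀ ω, ρ ω ≤ G ω) (hfin : ∀ᵐ ω ∂P, G ω ≠ ∞)
    (hY : Measurable Y) (hind : Indep (allInfo W 𝒴) (MeasurableSpace.comap Y inferInstance) P) :
    (∫⁻ ω, disc α (Y ω) * Y ω ∂P) * ∫⁻ ω, disc α (G ω) ∂P ≤
      ∫⁻ ω, disc α (G ω + Y ω) * sqError W ρ (G ω + Y ω).toReal ω ∂P := by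
  have := h.isProbabilityMeasure
  have e := h.lintegral_service hG hfin (h.measurable_pastOf_error hρ hG hρG)
    (h.measurable_allInfo_error hρ hG) hY hind measurable_id
    (K := fun g c z y => disc α (g + y) * ofReal ((c + z) ^ 2))
    (((measurable_disc α).comp ((measurable_fst.comp measurable_fst).add
      (measurable_coe_nnreal_ennreal.comp measurable_snd))).mul
      (ENNReal.measurable_ofReal.comp (by fun_prop)))
  have hx := lintegral_disc_ne_top (P := P) hα G
  calc _ = ∫⁻ ω', ∫⁻ ω, disc α (G ω) * (disc α (Y ω') * Y ω') ∂P ∂P := by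
        rw [← lintegral_mul_const' _ _ hx]
        refine lintegral_congr fun ω' => ?_
        rw [lintegral_mul_const _ (measurable_disc_comp α (h.measurable_of_isOptional hG)),
          mul_comm]
    _ ≤ _ := by
        refine lintegral_mono fun ω' => lintegral_mono fun ω => ?_
        rw [lintegral_const_mul' _ _ (disc_ne_top _ _),
          lintegral_sq_gaussian, disc_add, mul_assoc]
        gcongr
        exact le_add_self
    _ = _ := e.symm
    _ = _ := by
        refine lintegral_congr_ae (hfin.mono fun ω hω => ?_)
        simp only [shiftPath, id, sqError, ENNReal.toReal, Real.toNNReal_coe]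
        rw [ENNReal.toNNReal_add hω ENNReal.coe_ne_top, ENNReal.toNNReal_coe]
        congr 3; ring

/-- The discounted cost of a service period. -/
lemma discInt_service (h : IsBrownianWith 𝒴 P W) (hρ : IsOptional (pathInfo W 𝒴) ρ)
    (hG : IsOptional (pathInfo W 𝒴) G) (hρG : ∀ ω, ρ ω ≤ G ω) (hfin : ∀ᵐ ω ∂P, G ω ≠ ∞)
    (hY : Measurable Y) (hind : Indep (allInfo W 𝒴) (MeasurableSpace.comap Y inferInstance) P) :
    discInt α P G (fun ω => G ω + Y ω) (sqError W ρ) =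
      serviceLength α P Y * ∫⁻ ω, disc α (G ω) * sqError W ρ (G ω).toReal ω ∂P +
      serviceCost α P Y * ∫⁻ ω, disc α (G ω) ∂P := by
  have := h.isProbabilityMeasure
  have hGm := h.measurable_of_isOptional hG
  have hρm := h.measurable_of_isOptional hρ
  set x := ∫⁻ ω, disc α (G ω) ∂P
  set q := ∫⁻ ω, disc α (G ω) * sqError W ρ (G ω).toReal ω ∂P
  set f : ℝ → Ω → ℝ≥0∞ := fun u ω => (Set.Ioc (0 : ℝ) (Y ω)).indicator (fun u =>
    disc α (G ω + ofReal u) * ofReal ((W (G ω).toNNReal ω - W (ρ ω).toNNReal ω +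
      shiftPath W G ω u.toNNReal) ^ 2)) u
  have hset : MeasurableSet {z : ℝ × Ω | z.1 ∈ Set.Ioc (0 : ℝ) (Y z.2)} :=
    (measurableSet_lt measurable_const measurable_fst).inter
      (measurableSet_le measurable_fst (hY.coe_nnreal_real.comp measurable_snd))
  have hfm : Measurable (Function.uncurry f) := by
    have hsh : Measurable fun z : ℝ × Ω => shiftPath W G z.2 z.1.toNNReal :=
      (h.measurable_uncurry.comp (((hGm.ennreal_toNNReal.comp measurable_snd).add
        (measurable_real_toNNReal.comp measurable_fst)).prodMk measurable_snd)).sub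
        ((h.measurable_eval hGm.ennreal_toNNReal).comp measurable_snd)
    have herr : Measurable fun z : ℝ × Ω =>
        W (G z.2).toNNReal z.2 - W (ρ z.2).toNNReal z.2 :=
      ((h.measurable_eval hGm.ennreal_toNNReal).sub
        (h.measurable_eval hρm.ennreal_toNNReal)).comp measurable_snd
    have hd : Measurable fun z : ℝ × Ω => disc α (G z.2 + ofReal z.1) :=
      (measurable_disc α).comp ((hGm.comp measurable_snd).add
        (ENNReal.measurable_ofReal.comp measurable_fst))
    exact (hd.mul (ENNReal.measurable_ofReal.comp ((herr.add hsh).pow_const 2))).indicator hset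
  -- the service period, seen from its beginning
  have e1 : discInt α P G (fun ω => G ω + Y ω) (sqError W ρ) = ∫⁻ ω, (∫⁻ u, f u ω) ∂P := by
    refine lintegral_congr_ae (hfin.mono fun ω hω => ?_)
    obtain ⟨g, hg⟩ : ∃ g : ℝ≥0, G ω = g := ⟨_, (ENNReal.coe_toNNReal hω).symm⟩
    simp only
    rw [← lintegral_indicator (measurableSet_period _ _),
      ← lintegral_add_right_eq_self (μ := (volume : Measure ℝ)) _ (g : ℝ)]
    refine lintegral_congr fun u => ?_
    have hiff : u + g ∈ period (G ω) (G ω + Y ω) ↔ u ∈ Set.Ioc (0 : ℝ) (Y ω) := by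
      rw [hg, ← ENNReal.coe_add]
      simp only [period, Set.mem_ofPred_eq, Set.mem_Ioc]
      rw [ENNReal.lt_ofReal_iff_toReal_lt ENNReal.coe_ne_top,
        ENNReal.ofReal_le_iff_le_toReal ENNReal.coe_ne_top]
      simp only [ENNReal.coe_toReal, NNReal.coe_add]
      constructor
      · rintro ⟨h1, h2⟩; exact ⟨by linarith, by linarith⟩
      · rintro ⟨h1, h2⟩; exact ⟨by linarith, by linarith⟩
    by_cases hu : u ∈ Set.Ioc (0 : ℝ) (Y ω)
    · simp only [f, Set.indicator_of_mem hu, Set.indicator_of_mem (hiff.2 hu), sqError, shiftPath]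
      have h1 : ofReal (Real.exp (-α * (u + g))) = disc α (G ω + ofReal u) := by
        rw [← disc_ofReal (add_nonneg hu.1.le g.coe_nonneg), add_comm u,
          ENNReal.ofReal_add g.coe_nonneg hu.1.le, hg,
          ENNReal.ofReal_coe_nnreal]
      have h2 : (u + g).toNNReal = (G ω).toNNReal + u.toNNReal := by
        rw [Real.toNNReal_add hu.1.le g.coe_nonneg, Real.toNNReal_coe, hg,
          ENNReal.toNNReal_coe, add_comm]
      rw [h1, h2]
      congr 3; ring
    · simp only [f, Set.indicator_of_notMem hu, Set.indicator_of_notMem (fun hh => hu (hiff.1 hh))]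
  -- the average at a fixed time after the beginning
  have e2 : ∀ u : ℝ, ∫⁻ ω, f u ω ∂P = ∫⁻ ω, (Set.Ioc (0 : ℝ) (Y ω)).indicator
      (fun u => ofReal (Real.exp (-α * u)) * (q + ofReal u * x)) u ∂P := by
    intro u
    have e := h.lintegral_service hG hfin (h.measurable_pastOf_error hρ hG hρG)
      (h.measurable_allInfo_error hρ hG) hY hind (measurable_const (a := u.toNNReal))
      (K := fun g c z y => {y : ℝ≥0 | u ∈ Set.Ioc (0 : ℝ) y}.indicator (fun _ =>
        disc α (g + ofReal u) * ofReal ((c + z) ^ 2)) y) (by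
        refine Measurable.indicator (f := fun z : (ℝ≥0∞ × ℝ × ℝ) × ℝ≥0 =>
          disc α (z.1.1 + ofReal u) * ofReal ((z.1.2.1 + z.1.2.2) ^ 2))
          (s := {z | u ∈ Set.Ioc (0 : ℝ) z.2}) ?_ ?_
        · exact ((measurable_disc α).comp (by fun_prop)).mul
            (ENNReal.measurable_ofReal.comp (by fun_prop))
        · exact (MeasurableSet.const _).inter (measurableSet_le measurable_const
            measurable_snd.coe_nnreal_real))
    refine Eq.trans ?_ (e.trans ?_)
    · rfl
    · refine lintegral_congr fun ω' => ?_
      by_cases hu : u ∈ Set.Ioc (0 : ℝ) (Y ω')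
      · simp only [Set.mem_ofPred_eq, Set.indicator, hu, if_true]
        have : ∀ ω, ∫⁻ z, disc α (G ω + ofReal u) *
            ofReal ((W (G ω).toNNReal ω - W (ρ ω).toNNReal ω + z) ^ 2)
              ∂gaussianReal 0 u.toNNReal =
            ofReal (Real.exp (-α * u)) *
              (disc α (G ω) * sqError W ρ (G ω).toReal ω + disc α (G ω) * ofReal u) := by
          intro ω
          rw [lintegral_const_mul' _ _ (disc_ne_top _ _),
            lintegral_sq_gaussian, disc_add, disc_ofReal hu.1.le, sqError, ENNReal.toReal,
            Real.toNNReal_coe]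
          rw [show ((u.toNNReal : ℝ≥0) : ℝ≥0∞) = ofReal u from rfl]
          ring
        simp_rw [this]
        have hdm := measurable_disc_comp α hGm
        rw [lintegral_const_mul' _ _ ENNReal.ofReal_ne_top, lintegral_add_right _
          (hdm.mul_const _), lintegral_mul_const _ hdm, mul_comm x]
      · have : ¬ (u ∈ Set.Ioc (0 : ℝ) (Y ω')) := hu
        simp only [Set.indicator, Set.mem_ofPred_eq, this, if_false,
          lintegral_zero]
  have hY' : ∀ k : ℝ → ℝ≥0∞, Measurable k →
      Measurable fun z : ℝ × Ω => (Set.Ioc (0 : ℝ) (Y z.2)).indicator k z.1 :=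
    fun k hk => (hk.comp measurable_fst).indicator hset
  have hm1 : Measurable fun u : ℝ => ofReal (Real.exp (-α * u)) := by fun_prop
  have hm2 : Measurable fun u : ℝ =>
      ofReal (Real.exp (-α * u)) * (q + ofReal u * x) := by fun_prop
  rw [e1, ← lintegral_lintegral_swap hfm.aemeasurable]
  simp_rw [e2]
  rw [lintegral_lintegral_swap (hY' _ hm2).aemeasurable]
  have e3 : ∀ ω, ∫⁻ u, (Set.Ioc (0 : ℝ) (Y ω)).indicator
      (fun u => ofReal (Real.exp (-α * u)) * (q + ofReal u * x)) u =
      (∫⁻ u in Set.Ioc (0 : ℝ) (Y ω), ofReal (Real.exp (-α * u))) * q +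
      (∫⁻ u in Set.Ioc (0 : ℝ) (Y ω), ofReal (Real.exp (-α * u)) * ofReal u) * x :=
    fun ω => by
      rw [lintegral_indicator measurableSet_Ioc, ← lintegral_mul_const _ hm1,
        ← lintegral_mul_const _ (by fun_prop), ← lintegral_add_left (by fun_prop)]
      refine lintegral_congr fun u => ?_
      ring
  simp_rw [e3]
  have hint : ∀ k : ℝ → ℝ≥0∞, Measurable k →
      Measurable fun ω => ∫⁻ u in Set.Ioc (0 : ℝ) (Y ω), k u := fun k hk => by
    simp_rw [← lintegral_indicator measurableSet_Ioc]
    exact Measurable.lintegral_prod_left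
      (f := fun (u : ℝ) (ω : Ω) => (Set.Ioc (0 : ℝ) (Y ω)).indicator k u) (hY' k hk)
  rw [lintegral_add_left ((hint _ hm1).mul_const _), lintegral_mul_const _ (hint _ hm1),
    lintegral_mul_const _ (hint _ (by fun_prop))]
  rfl

end IsBrownianWith

end Service

/-! ### Causal policies -/

section Causal

variable {Ω : Type*}

/-- The signal and the service times of the sampling problem: a continuous Brownian motion and an
independent sequence of independent, identically distributed, square-integrable service times. -/
structure IsModel [MeasurableSpace Ω] (P : Measure Ω) (W : ℝ≥0 → Ω → ℝ) (Y : ℕ → Ω → ℝ≥0) :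
    Prop where
  brownian : IsBrownianReal W P
  meas : ∀ t, Measurable (W t)
  cont : ∀ ω, Continuous fun t => W t ω
  measY : ∀ i, Measurable (Y i)
  indepY : iIndepFun Y P
  identY : ∀ i, IdentDistrib (Y i) (Y 0) P P
  sqY : MemLp (fun ω => (Y 0 ω : ℝ)) 2 P
  indep : IndepFun (fun ω t => W t ω) (fun ω i => Y i ω) P

/-- The events that are determined by the first `m` service times. -/
@[reducible] def serviceInfo (Y : ℕ → Ω → ℝ≥0) (m : ℕ) : MeasurableSpace Ω :=
  ⨆ j ∈ {j : ℕ | j < m}, MeasurableSpace.comap (Y j) inferInstance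

variable {W : ℝ≥0 → Ω → ℝ} {Y : ℕ → Ω → ℝ≥0} {S : ℕ → Ω → ℝ≥0∞}

lemma serviceInfo_mono : Monotone (serviceInfo Y) := fun _ _ h =>
  biSup_mono fun _ hj => lt_of_lt_of_le hj h

lemma measurable_serviceInfo {j m : ℕ} (h : j < m) : Measurable[serviceInfo Y m] (Y j) :=
  Measurable.of_comap_le (le_iSup₂_of_le j h le_rfl)

lemma pathInfo_mono_right {𝒴 𝒴' : MeasurableSpace Ω} (h : 𝒴 ≤ 𝒴') (t : ℝ≥0) :
    pathInfo W 𝒴 t ≤ pathInfo W 𝒴' t := sup_le_sup_left h _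

variable [mΩ : MeasurableSpace Ω] {P : Measure Ω}

namespace IsModel

lemma isProbabilityMeasure (h : IsModel P W Y) : IsProbabilityMeasure P :=
  have hb := h.brownian
  hb.isGaussianProcess.isProbabilityMeasure

lemma serviceInfo_le (h : IsModel P W Y) (m : ℕ) : serviceInfo Y m ≤ mΩ :=
  iSup₂_le fun j _ => (h.measY j).comap_le

omit mΩ in
lemma comap_le_comap_seq (j : ℕ) : MeasurableSpace.comap (Y j) inferInstance ≤
    MeasurableSpace.comap (fun ω i => Y i ω) inferInstance :=
  ((measurable_pi_apply j).comp (comap_measurable fun ω i => Y i ω)).comap_le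

/-- The signal is a Brownian motion relative to its own history enlarged by the first `m` service
times. -/
lemma isBrownianWith (h : IsModel P W Y) (m : ℕ) : IsBrownianWith (serviceInfo Y m) P W where
  brownian := h.brownian
  meas := h.meas
  cont := h.cont
  le := h.serviceInfo_le m
  indep := indep_of_indep_of_le_right ((IndepFun_iff_Indep _ _ _).1 h.indep)
    (iSup₂_le fun j _ => comap_le_comap_seq j)

/-- A service time is independent of the signal and of the previous service times. -/
lemma indep_allInfo (h : IsModel P W Y) (m : ℕ) :
    Indep (allInfo W (serviceInfo Y m)) (MeasurableSpace.comap (Y m) inferInstance) P := by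
  have := h.isProbabilityMeasure
  have hW : MeasurableSpace.comap (fun ω t => W t ω) inferInstance ≤ mΩ :=
    (measurable_pi_lambda _ h.meas).comap_le
  have h1 : Indep (MeasurableSpace.comap (Y m) inferInstance) (serviceInfo Y m) P := by
    have := indep_iSup_of_disjoint (fun i => (h.measY i).comap_le) h.indepY.iIndep
      (S := {m}) (T := {j | j < m}) (by simp)
    simpa only [Set.mem_singleton_iff, iSup_iSup_eq_left] using this
  have h2 : Indep (MeasurableSpace.comap (Y m) inferInstance ⊔ serviceInfo Y m)
      (MeasurableSpace.comap (fun ω t => W t ω) inferInstance) P :=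
    indep_of_indep_of_le_left ((IndepFun_iff_Indep _ _ _).1 h.indep).symm
      (sup_le (comap_le_comap_seq m) (iSup₂_le fun j _ => comap_le_comap_seq j))
  have h3 := indep_sup_right (h.measY m).comap_le (h.serviceInfo_le m) hW h1 h2
  rw [sup_comm] at h3
  exact h3.symm

omit mΩ in
lemma isOptional_mono {τ : Ω → ℝ≥0∞} {l m : ℕ} (hlm : l ≤ m)
    (hτ : IsOptional (pathInfo W (serviceInfo Y l)) τ) :
    IsOptional (pathInfo W (serviceInfo Y m)) τ :=
  hτ.mono fun u => pathInfo_mono_right (serviceInfo_mono hlm) u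

end IsModel

omit mΩ in
/-- The information of the sampler consists of the signal and of the service times of the
delivered samples. -/
lemma samplerInfo_le {m : ℕ}
    (hG : ∀ i < m, IsOptional (pathInfo W (serviceInfo Y m)) (serviceStart Y S i))
    (hD : ∀ i < m, IsOptional (pathInfo W (serviceInfo Y m)) (deliveryTime Y S (i + 1)))
    {t u : ℝ≥0} (htu : t < u) : samplerInfo W Y S m t ≤ pathInfo W (serviceInfo Y m) u := by
  refine iSup₂_le fun s hs => sup_le (sup_le ?_ ?_) ?_
  · exact (measurable_pathInfo s).comap_le.trans (pathInfo_mono (hs.trans htu.le))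
  · refine Measurable.comap_le ?_
    refine Measurable.ite ?_ measurable_const measurable_const
    have : {ω | ∃ i < m, serviceStart Y S i ω ≤ s ∧ (s : ℝ≥0∞) < deliveryTime Y S (i + 1) ω} =
        ⋃ i, ⋃ (_ : i < m), {ω | serviceStart Y S i ω ≤ s} ∩
          {ω | deliveryTime Y S (i + 1) ω ≤ s}ᶜ := by
      ext ω; simp only [Set.mem_ofPred_eq, Set.mem_iUnion, Set.mem_inter_iff, Set.mem_compl_iff,
        not_le, exists_prop]
    rw [this]
    exact .iUnion fun i => .iUnion fun hi =>
      ((hG i hi).measurableSet_le pathInfo_mono (hs.trans_lt htu)).inter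
        ((hD i hi).measurableSet_le pathInfo_mono (hs.trans_lt htu)).compl
  · refine Measurable.comap_le ?_
    have : ackCount Y S m s = fun ω => ∑ i ∈ Finset.range m,
        {ω | deliveryTime Y S (i + 1) ω ≤ s}.indicator (fun _ => 1) ω := by
      ext ω
      rw [ackCount, Finset.card_filter]
      refine Finset.sum_congr rfl fun i _ => ?_
      simp [Set.indicator]
    rw [this]
    refine Finset.measurable_fun_sum _ fun i hi => measurable_const.indicator ?_
    exact (hD i (Finset.mem_range.1 hi)).measurableSet_le pathInfo_mono (hs.trans_lt htu)

variable {W : ℝ≥0 → Ω → ℝ} {Y : ℕ → Ω → ℝ≥0} {S : ℕ → Ω → ℝ≥0∞}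

/-- Causality makes the sampling and delivery times optional times. -/
lemma isOptional_sampling_and_delivery (h : IsModel P W Y)
    (hc : ∀ (m : ℕ) (t : ℝ≥0), MeasurableSet[samplerInfoPlus W Y S m t] {ω | S (m + 1) ω ≤ t})
    (m : ℕ) :
    IsOptional (pathInfo W (serviceInfo Y m)) (S (m + 1)) ∧
      IsOptional (pathInfo W (serviceInfo Y m)) (deliveryTime Y S m) := by
  induction m using Nat.strong_induction_on with
  | _ m ih =>
    have hG : ∀ i < m, IsOptional (pathInfo W (serviceInfo Y i)) (serviceStart Y S i) :=
      fun i hi => (ih i hi).1.max (ih i hi).2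
    have hD : ∀ i < m, IsOptional (pathInfo W (serviceInfo Y (i + 1)))
        (deliveryTime Y S (i + 1)) := fun i hi => by
      have hB := h.isBrownianWith (i + 1)
      have hG' := IsModel.isOptional_mono (Nat.le_succ i) (hG i hi)
      refine IsOptional.add (mΩ := mΩ) pathInfo_mono hG'
        (η := fun ω => (Y i ω : ℝ≥0∞)) ?_
      refine measurable_pastOf_of_zero (mΩ := mΩ) pathInfo_mono hB.pathInfo_le hG' ?_
      exact measurable_coe_nnreal_ennreal.comp
        ((measurable_serviceInfo (Nat.lt_succ_self i)).mono (le_pathInfo 0) le_rfl)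
    constructor
    · refine isOptional_of_le fun t u htu => ?_
      obtain ⟨v, htv, hvu⟩ := exists_between htu
      have h1 : samplerInfoPlus W Y S m t ≤ samplerInfo W Y S m v := iInf₂_le v htv
      exact samplerInfo_le (fun i hi => IsModel.isOptional_mono hi.le (hG i hi))
        (fun i hi => IsModel.isOptional_mono hi (hD i hi)) hvu _ (h1 _ (hc m t))
    · cases m with
      | zero => exact isOptional_const 0
      | succ i => exact hD i (Nat.lt_succ_self i)

omit mΩ in
lemma le_deliveryTime (h0 : ∀ ω, S 0 ω = 0) (i : ℕ) (ω : Ω) : S i ω ≤ deliveryTime Y S i ω := by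
  cases i with
  | zero => rw [h0]; exact zero_le
  | succ i => exact (le_max_left _ _).trans le_self_add

omit mΩ in
lemma deliveryTime_le_serviceStart (i : ℕ) (ω : Ω) :
    deliveryTime Y S i ω ≤ serviceStart Y S i ω := le_max_right _ _

omit mΩ in
lemma serviceStart_le_deliveryTime (i : ℕ) (ω : Ω) :
    serviceStart Y S i ω ≤ deliveryTime Y S (i + 1) ω := le_self_add

omit mΩ in
lemma deliveryTime_mono (ω : Ω) : Monotone fun i => deliveryTime Y S i ω :=
  monotone_nat_of_le_succ fun i =>
    (deliveryTime_le_serviceStart i ω).trans (serviceStart_le_deliveryTime i ω)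

lemma measurable_sample {k : Ω → ℕ} (hk : Measurable k) (hS : ∀ i, Measurable (S i)) :
    Measurable fun ω => S (k ω) ω :=
  (measurable_from_prod_countable_left (f := fun z : Ω × ℕ => S z.2 z.1) hS).comp
    (measurable_id.prodMk hk)

namespace IsOnlinePolicy

lemma isOptional_sampling (h : IsModel P W Y) (hS : IsOnlinePolicy P W Y S) (m : ℕ) :
    IsOptional (pathInfo W (serviceInfo Y m)) (S (m + 1)) :=
  (isOptional_sampling_and_delivery h hS.causal m).1

lemma isOptional_delivery (h : IsModel P W Y) (hS : IsOnlinePolicy P W Y S) (m : ℕ) :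
    IsOptional (pathInfo W (serviceInfo Y m)) (deliveryTime Y S m) :=
  (isOptional_sampling_and_delivery h hS.causal m).2

lemma isOptional_start (h : IsModel P W Y) (hS : IsOnlinePolicy P W Y S) (m : ℕ) :
    IsOptional (pathInfo W (serviceInfo Y m)) (serviceStart Y S m) :=
  (hS.isOptional_sampling h m).max (hS.isOptional_delivery h m)

lemma isOptional_sampling_self (h : IsModel P W Y) (hS : IsOnlinePolicy P W Y S) (m : ℕ) :
    IsOptional (pathInfo W (serviceInfo Y m)) (S m) := by
  cases m with
  | zero => rw [funext hS.zero]; exact isOptional_const 0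
  | succ m => exact IsModel.isOptional_mono (Nat.le_succ m) (hS.isOptional_sampling h m)

lemma measurable_sampling (h : IsModel P W Y) (hS : IsOnlinePolicy P W Y S) (m : ℕ) :
    Measurable (S m) :=
  (h.isBrownianWith m).measurable_of_isOptional (hS.isOptional_sampling_self h m)

lemma sampling_mono (hS : IsOnlinePolicy P W Y S) (ω : Ω) : Monotone fun i => S i ω :=
  monotone_nat_of_le_succ fun i => hS.mono i ω

/-- The moment conditions make the sampling times almost surely finite. -/
lemma ae_sampling_ne_top (h : IsModel P W Y) (hS : IsOnlinePolicy P W Y S) :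
    ∀ᵐ ω ∂P, ∀ i, S i ω ≠ ∞ := by
  obtain ⟨k, hk, hlt, -, -, -, hk0, hkj⟩ := hS.regenerative
  have hm : ∀ j, Measurable fun ω => S (k j ω) ω := fun j =>
    measurable_sample (hk j) (hS.measurable_sampling h)
  have h0 : ∀ᵐ ω ∂P, (S (k 0 ω) ω) ^ 2 < ∞ := ae_lt_top ((hm 0).pow_const 2) hk0.ne
  have h1 : ∀ᵐ ω ∂P, ∀ j, (S (k (j + 1) ω) ω - S (k j ω) ω) ^ 2 < ∞ := ae_all_iff.2 fun j =>
    ae_lt_top (((hm (j + 1)).sub (hm j)).pow_const 2) (hkj j).2.ne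
  filter_upwards [h0, h1] with ω h0 h1 i
  have hfin : ∀ j, S (k j ω) ω ≠ ∞ := by
    intro j
    induction j with
    | zero => intro hh; rw [hh] at h0; simp at h0
    | succ j ih =>
      intro hh
      have := h1 j
      rw [hh, ENNReal.top_sub ih] at this
      simp at this
  have hki : ∀ j, j ≤ k j ω := fun j => by
    induction j with
    | zero => exact Nat.zero_le _
    | succ j ih => exact Nat.succ_le_of_lt (ih.trans_lt (hlt j ω))
  exact ne_top_of_le_ne_top (hfin i) (hS.sampling_mono ω (hki i))

omit mΩ in
lemma deliveryTime_ne_top {ω : Ω} (hω : ∀ i, S i ω ≠ ∞) (i : ℕ) : deliveryTime Y S i ω ≠ ∞ := by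
  induction i with
  | zero => exact ENNReal.zero_ne_top
  | succ i ih =>
    exact ENNReal.add_ne_top.2 ⟨by simp [hω (i + 1), ih], ENNReal.coe_ne_top⟩

lemma ae_serviceStart_ne_top (h : IsModel P W Y) (hS : IsOnlinePolicy P W Y S) (i : ℕ) :
    ∀ᵐ ω ∂P, serviceStart Y S i ω ≠ ∞ := by
  filter_upwards [hS.ae_sampling_ne_top h] with ω hω
  simp [serviceStart, hω (i + 1), deliveryTime_ne_top hω i]

end IsOnlinePolicy

end Causal

/-! ### The discounted cost of a causal policy -/

section DiscountedCost

variable {Ω : Type*} [mΩ : MeasurableSpace Ω] {P : Measure Ω}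
  {W : ℝ≥0 → Ω → ℝ} {Y : ℕ → Ω → ℝ≥0} {S : ℕ → Ω → ℝ≥0∞} {α : ℝ}

lemma discInt_split {D G D' : Ω → ℝ≥0∞} {f : ℝ → Ω → ℝ≥0∞} (hD : Measurable D)
    (hG : Measurable G) (hDG : ∀ ω, D ω ≤ G ω)
    (hGD : ∀ ω, G ω ≤ D' ω) (hf : Measurable (Function.uncurry f)) :
    discInt α P D D' f = discInt α P D G f + discInt α P G D' f := by
  have hm : Measurable fun ω => ∫⁻ r in period (D ω) (G ω),
      ofReal (Real.exp (-α * r)) * f r ω := by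
    simp_rw [← lintegral_indicator (measurableSet_period _ _)]
    exact Measurable.lintegral_prod_left (f := fun (r : ℝ) (ω : Ω) =>
      (period (D ω) (G ω)).indicator (fun r => ofReal (Real.exp (-α * r)) * f r ω) r)
      (measurable_period_indicator hD hG
        (f := fun r ω => ofReal (Real.exp (-α * r)) * f r ω)
        ((by fun_prop : Measurable fun z : ℝ × Ω =>
          ofReal (Real.exp (-α * z.1))).mul hf))
  rw [discInt, discInt, discInt, ← lintegral_add_left hm]
  refine lintegral_congr fun ω => ?_
  rw [← lintegral_union (measurableSet_period _ _)]
  · congr 2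
    ext r
    simp only [period, Set.mem_union, Set.mem_ofPred_eq]
    constructor
    · rintro ⟨h1, h2⟩
      rcases le_or_gt (ofReal r) (G ω) with h3 | h3
      · exact Or.inl ⟨h1, h3⟩
      · exact Or.inr ⟨h3, h2⟩
    · rintro (⟨h1, h2⟩ | ⟨h1, h2⟩)
      · exact ⟨h1, h2.trans (hGD ω)⟩
      · exact ⟨(hDG ω).trans_lt h1, h2⟩
  · rw [Set.disjoint_left]
    rintro r ⟨-, h1⟩ ⟨h2, -⟩
    exact absurd h1 (not_le.2 h2)

lemma measurable_lintegral_Ioc {k : ℝ → ℝ≥0∞} (hk : Measurable k) :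
    Measurable fun y : ℝ≥0 => ∫⁻ u in Set.Ioc (0 : ℝ) y, k u := by
  simp_rw [← lintegral_indicator measurableSet_Ioc]
  refine Measurable.lintegral_prod_left
    (f := fun (u : ℝ) (y : ℝ≥0) => (Set.Ioc (0 : ℝ) y).indicator k u) ?_
  exact (hk.comp measurable_fst).indicator (s := {z : ℝ × ℝ≥0 | z.1 ∈ Set.Ioc (0 : ℝ) z.2})
    ((measurableSet_lt measurable_const measurable_fst).inter
      (measurableSet_le measurable_fst measurable_snd.coe_nnreal_real))

lemma period_zero_coe (y : ℝ≥0) : period 0 y = Set.Ioc (0 : ℝ) y := by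
  ext r
  simp only [period, Set.mem_ofPred_eq, Set.mem_Ioc, ENNReal.ofReal_pos]
  rw [ENNReal.ofReal_le_iff_le_toReal ENNReal.coe_ne_top, ENNReal.coe_toReal]

lemma disc_add_serviceLength [IsProbabilityMeasure P] (hα : 0 < α) {Y : Ω → ℝ≥0}
    (hY : Measurable Y) :
    ∫⁻ ω, disc α (Y ω) ∂P + ofReal α * serviceLength α P Y = 1 := by
  have := disc_eq_add_discInt (P := P) hα (D := fun _ => 0) (G := fun ω => (Y ω : ℝ≥0∞))
    measurable_const hY.coe_nnreal_ennreal fun _ => zero_le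
  simp only [disc_zero, lintegral_const, measure_univ, mul_one, discInt, period_zero_coe] at this
  rw [serviceLength, add_comm]
  exact this

-- The Gaussian law of variance `y` is a dilation of the standard one, which makes the dependence on
-- `y` measurable.
lemma measurable_lintegral_gaussian {k : ℝ → ℝ≥0∞} (hk : Measurable k) :
    Measurable fun y : ℝ≥0 => ∫⁻ z, k z ∂gaussianReal 0 y := by
  have e : ∀ y : ℝ≥0, ∫⁻ z, k z ∂gaussianReal 0 y =
      ∫⁻ z, k (Real.sqrt y * z) ∂gaussianReal 0 1 := fun y => by
    have h1 := gaussianReal_map_const_mul (μ := 0) (v := 1) (Real.sqrt y)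
    have h2 : (NNReal.mk (Real.sqrt y ^ 2) (sq_nonneg _) * 1 : ℝ≥0) = y := by
      ext; simp
    rw [mul_zero, h2] at h1
    rw [← h1, lintegral_map hk (by fun_prop)]
  simp_rw [e]
  exact Measurable.lintegral_prod_right
    (f := fun (y : ℝ≥0) (z : ℝ) => k (Real.sqrt y * z)) (hk.comp (by fun_prop))

section Laws

variable {Y Y' : Ω → ℝ≥0} (hY : IdentDistrib Y Y' P P)

include hY

lemma lintegral_disc_congr : ∫⁻ ω, disc α (Y ω) ∂P = ∫⁻ ω, disc α (Y' ω) ∂P :=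
  (hY.comp ((measurable_disc α).comp measurable_coe_nnreal_ennreal)).lintegral_eq

lemma lintegral_disc_mul_congr :
    ∫⁻ ω, disc α (Y ω) * Y ω ∂P = ∫⁻ ω, disc α (Y' ω) * Y' ω ∂P :=
  (hY.comp (u := fun y : ℝ≥0 => disc α y * y) (((measurable_disc α).comp
    measurable_coe_nnreal_ennreal).mul measurable_coe_nnreal_ennreal)).lintegral_eq

lemma serviceLength_congr : serviceLength α P Y = serviceLength α P Y' :=
  (hY.comp (measurable_lintegral_Ioc (k := fun u => ofReal (Real.exp (-α * u)))
    (by fun_prop))).lintegral_eq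

lemma serviceCost_congr : serviceCost α P Y = serviceCost α P Y' :=
  (hY.comp (measurable_lintegral_Ioc
    (k := fun u => ofReal (Real.exp (-α * u)) * ofReal u)
    (by fun_prop))).lintegral_eq

lemma serviceCorrection_congr (β : ℝ) :
    serviceCorrection P β Y = serviceCorrection P β Y' :=
  (hY.comp (measurable_lintegral_gaussian (k := fun z => ofReal (corrector β z))
    (ENNReal.measurable_ofReal.comp (continuous_corrector β).measurable))).lintegral_eq

end Laws

/-- The discounted expected cost between the deliveries `D i` and `D (i + 1)`. -/
def stageCost (α : ℝ) (P : Measure Ω) (W : ℝ≥0 → Ω → ℝ) (Y : ℕ → Ω → ℝ≥0) (S : ℕ → Ω → ℝ≥0∞)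
    (i : ℕ) : ℝ≥0∞ :=
  discInt α P (deliveryTime Y S i) (deliveryTime Y S (i + 1)) (sqError W (S i))

/-- The discounted expected idle time after the delivery `D i`. -/
def stageIdle (α : ℝ) (P : Measure Ω) (Y : ℕ → Ω → ℝ≥0) (S : ℕ → Ω → ℝ≥0∞) (i : ℕ) : ℝ≥0∞ :=
  discInt α P (deliveryTime Y S i) (serviceStart Y S i) fun _ _ => 1

/-- The expected discount factor at the start of the service of sample `i + 1`. -/
def stageDisc (α : ℝ) (P : Measure Ω) (Y : ℕ → Ω → ℝ≥0) (S : ℕ → Ω → ℝ≥0∞) (i : ℕ) : ℝ≥0∞ :=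
  ∫⁻ ω, disc α (serviceStart Y S i ω) ∂P

namespace IsOnlinePolicy

lemma measurable_delivery (h : IsModel P W Y) (hS : IsOnlinePolicy P W Y S) (i : ℕ) :
    Measurable (deliveryTime Y S i) :=
  (h.isBrownianWith i).measurable_of_isOptional (hS.isOptional_delivery h i)

lemma measurable_start (h : IsModel P W Y) (hS : IsOnlinePolicy P W Y S) (i : ℕ) :
    Measurable (serviceStart Y S i) :=
  (h.isBrownianWith i).measurable_of_isOptional (hS.isOptional_start h i)

lemma lintegral_disc_delivery (h : IsModel P W Y) (hS : IsOnlinePolicy P W Y S) (hα : 0 < α)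
    (i : ℕ) : ∫⁻ ω, disc α (deliveryTime Y S (i + 1) ω) ∂P =
      (∫⁻ ω, disc α (Y 0 ω) ∂P) * stageDisc α P Y S i := by
  have e := (h.isBrownianWith i).disc_service hα.le (hS.isOptional_start h i) (h.measY i)
    (h.indep_allInfo i)
  rw [lintegral_disc_congr (h.identY i)] at e
  exact e

/-- The recursion for the discount factors at the starts of the service periods: the service and the
subsequent idle time both discount. -/
lemma stageIdle_add_stageDisc (h : IsModel P W Y) (hS : IsOnlinePolicy P W Y S) (hα : 0 < α)
    (i : ℕ) : ofReal α * stageIdle α P Y S (i + 1) + stageDisc α P Y S (i + 1) =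
      (∫⁻ ω, disc α (Y 0 ω) ∂P) * stageDisc α P Y S i := by
  have := h.isProbabilityMeasure
  rw [← hS.lintegral_disc_delivery h hα]
  exact disc_eq_add_discInt hα (hS.measurable_delivery h _) (hS.measurable_start h _)
    fun ω => deliveryTime_le_serviceStart _ ω

lemma stageDisc_le_one (h : IsModel P W Y) (hα : 0 < α) (i : ℕ) :
    stageDisc α P Y S i ≤ 1 := by
  have := h.isProbabilityMeasure
  exact (lintegral_mono fun ω => disc_le_one hα.le _).trans (by simp)

lemma stageDisc_le_pow (h : IsModel P W Y) (hS : IsOnlinePolicy P W Y S) (hα : 0 < α)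
    (i : ℕ) : stageDisc α P Y S i ≤ (∫⁻ ω, disc α (Y 0 ω) ∂P) ^ i := by
  induction i with
  | zero => simpa using stageDisc_le_one h hα 0
  | succ i ih =>
    calc _ ≤ _ := le_add_self
      _ = _ := hS.stageIdle_add_stageDisc h hα i
      _ ≤ _ := by rw [pow_succ']; gcongr

/-- The cost between two deliveries, in terms of the idle time and of the discount factors at the
starts of the two service periods. -/
lemma le_stageCost (h : IsModel P W Y) (hS : IsOnlinePolicy P W Y S) (hα : 0 < α) {β : ℝ}
    (hβ : 0 ≤ β) (i : ℕ) :
    (∫⁻ ω, disc α (Y 0 ω) ∂P) * (ofReal (β / 3) * stageIdle α P Y S (i + 1)) +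
      serviceLength α P (Y 0) * ((∫⁻ ω, disc α (Y 0 ω) * Y 0 ω ∂P) * stageDisc α P Y S i +
        stageIdle α P Y S (i + 1)) + serviceCost α P (Y 0) * stageDisc α P Y S (i + 1) ≤
    stageCost α P W Y S (i + 1) + (∫⁻ ω, disc α (Y 0 ω) ∂P) *
      (serviceCorrection P β (Y 0) * stageDisc α P Y S i) := by
  have := h.isProbabilityMeasure
  have hB := h.isBrownianWith i
  have hB' := h.isBrownianWith (i + 1)
  have hSo := hS.isOptional_sampling h i
  have hSo' := hS.isOptional_sampling_self h (i + 1)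
  have hGo := hS.isOptional_start h i
  have hGo' := hS.isOptional_start h (i + 1)
  have hDo' := hS.isOptional_delivery h (i + 1)
  have hSG : ∀ ω, S (i + 1) ω ≤ serviceStart Y S i ω := fun ω => le_max_left _ _
  have hSD : ∀ ω, S (i + 1) ω ≤ deliveryTime Y S (i + 1) ω := le_deliveryTime hS.zero (i + 1)
  have hDG : ∀ ω, deliveryTime Y S (i + 1) ω ≤ serviceStart Y S (i + 1) ω :=
    deliveryTime_le_serviceStart (i + 1)
  have hSG' : ∀ ω, S (i + 1) ω ≤ serviceStart Y S (i + 1) ω := fun ω => (hSD ω).trans (hDG ω)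
  have e1 : stageCost α P W Y S (i + 1) =
      discInt α P (deliveryTime Y S (i + 1)) (serviceStart Y S (i + 1)) (sqError W (S (i + 1))) +
      discInt α P (serviceStart Y S (i + 1)) (deliveryTime Y S (i + 2)) (sqError W (S (i + 1))) :=
    discInt_split (hS.measurable_delivery h _) (hS.measurable_start h _) hDG
      (serviceStart_le_deliveryTime (i + 1)) (hB'.measurable_sqError (hS.measurable_sampling h _))
  have e2 := hB'.discInt_service (α := α) hSo' hGo' hSG' (hS.ae_serviceStart_ne_top h (i + 1))
    (h.measY (i + 1)) (h.indep_allInfo (i + 1))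
  rw [serviceLength_congr (h.identY (i + 1)), serviceCost_congr (h.identY (i + 1))] at e2
  have e3 := hB'.disc_sqError_balance hα hSo' hDo' hGo' hSD hDG
  have e4 := hB'.disc_waiting_le hα hβ hSo' hDo' hGo' hSD hDG
  have e5 := hB.le_disc_sqError_service hα.le hSo hGo hSG (hS.ae_serviceStart_ne_top h i)
    (h.measY i) (h.indep_allInfo i)
  rw [lintegral_disc_mul_congr (h.identY i)] at e5
  have e6 := hB.disc_corrector_service_le hα.le β hSo hGo hSG (hS.ae_serviceStart_ne_top h i)
    (h.measY i) (h.indep_allInfo i)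
  have hsc : serviceCorrection P β (Y i) = serviceCorrection P β (Y 0) :=
    serviceCorrection_congr (h.identY i) β
  rw [hsc] at e6
  have e7 := disc_add_serviceLength (P := P) hα (h.measY 0)
  set w := discInt α P (deliveryTime Y S (i + 1)) (serviceStart Y S (i + 1)) (sqError W (S (i + 1)))
  set φ := ∫⁻ ω, disc α (Y 0 ω) ∂P
  set a := serviceLength α P (Y 0)
  set b := serviceCost α P (Y 0)
  set x := stageDisc α P Y S i
  set x' := stageDisc α P Y S (i + 1)
  set l := stageIdle α P Y S (i + 1)
  set a' := ∫⁻ ω, disc α (Y 0 ω) * Y 0 ω ∂P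
  set c := serviceCorrection P β (Y 0)
  set q := ∫⁻ ω, disc α (serviceStart Y S (i + 1) ω) *
    sqError W (S (i + 1)) (serviceStart Y S (i + 1) ω).toReal ω ∂P
  set p := ∫⁻ ω, disc α (deliveryTime Y S (i + 1) ω) *
    sqError W (S (i + 1)) (deliveryTime Y S (i + 1) ω).toReal ω ∂P
  have e2' : discInt α P (serviceStart Y S (i + 1)) (deliveryTime Y S (i + 2))
      (sqError W (S (i + 1))) = a * q + b * x' := e2
  have e3' : q + ofReal α * w = p + l := e3
  have e4' : ofReal (β / 3) * l ≤ w + c * x := e4.trans (by gcongr; exact e6)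
  have e5' : a' * x ≤ p := e5
  calc φ * (ofReal (β / 3) * l) + a * (a' * x + l) + b * x'
      ≤ φ * (w + c * x) + a * (p + l) + b * x' := by gcongr
    _ = φ * (w + c * x) + a * (q + ofReal α * w) + b * x' := by rw [e3']
    _ = (φ + ofReal α * a) * w + (a * q + b * x') + φ * (c * x) := by ring
    _ = stageCost α P W Y S (i + 1) + φ * (c * x) := by rw [e7, one_mul, e1, e2']

end IsOnlinePolicy

end DiscountedCost

/-! ### The lower bound on the time-average error -/

section LowerBound

variable {Ω : Type*} [mΩ : MeasurableSpace Ω] {P : Measure Ω}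
  {W : ℝ≥0 → Ω → ℝ} {Y : ℕ → Ω → ℝ≥0} {S : ℕ → Ω → ℝ≥0∞} {α : ℝ}

omit mΩ in
lemma estimate_eq {t : ℝ≥0} {ω : Ω} {i : ℕ} (h1 : deliveryTime Y S i ω ≤ t)
    (h2 : (t : ℝ≥0∞) < deliveryTime Y S (i + 1) ω) :
    estimate W Y S t ω = W (S i ω).toNNReal ω := by
  have : {j : ℕ | deliveryTime Y S j ω ≤ t} = Set.Iic i := by
    ext j
    simp only [Set.mem_ofPred_eq, Set.mem_Iic]
    constructor
    · intro hj
      by_contra hij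
      exact absurd (hj.trans_lt h2)
        (not_lt.2 (deliveryTime_mono ω (Nat.succ_le_of_lt (not_le.1 hij))))
    · exact fun hj => (deliveryTime_mono ω hj).trans h1
  rw [estimate, this, csSup_Iic]

/-- The squared error of the estimator at time `t`. -/
def estError (W : ℝ≥0 → Ω → ℝ) (Y : ℕ → Ω → ℝ≥0) (S : ℕ → Ω → ℝ≥0∞) (t : ℝ) (ω : Ω) : ℝ≥0∞ :=
  ofReal ((W t.toNNReal ω - estimate W Y S t.toNNReal ω) ^ 2)

/-- The squared error of the estimator after the first delivery. -/
def lateError (W : ℝ≥0 → Ω → ℝ) (Y : ℕ → Ω → ℝ≥0) (S : ℕ → Ω → ℝ≥0∞) (t : ℝ) (ω : Ω) : ℝ≥0∞ :=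
  ∑' i, (period (deliveryTime Y S (i + 1) ω) (deliveryTime Y S (i + 2) ω)).indicator
    (fun t => sqError W (S (i + 1)) t ω) t

omit mΩ in
lemma eq_of_mem_period {t : ℝ} {ω : Ω} {i j : ℕ}
    (hi : t ∈ period (deliveryTime Y S i ω) (deliveryTime Y S (i + 1) ω))
    (hj : t ∈ period (deliveryTime Y S j ω) (deliveryTime Y S (j + 1) ω)) : i = j := by
  by_contra hij
  rcases Nat.lt_or_gt_of_ne hij with h | h
  · exact absurd (hi.2.trans (deliveryTime_mono ω (Nat.succ_le_of_lt h))) (not_le.2 hj.1)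
  · exact absurd (hj.2.trans (deliveryTime_mono ω (Nat.succ_le_of_lt h))) (not_le.2 hi.1)

omit mΩ in
/-- After the first delivery the two errors agree, up to the countably many delivery times. -/
lemma lateError_le (ω : Ω) : ∀ᵐ t : ℝ, lateError W Y S t ω ≤ estError W Y S t ω := by
  have hc : (Set.range fun i => (deliveryTime Y S i ω).toReal).Countable := Set.countable_range _
  filter_upwards [hc.ae_notMem volume] with t ht
  by_cases hex : ∃ i, t ∈ period (deliveryTime Y S (i + 1) ω) (deliveryTime Y S (i + 2) ω)
  · obtain ⟨i, hi⟩ := hex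
    rw [lateError, tsum_eq_single i, Set.indicator_of_mem hi, sqError, estError,
      estimate_eq (i := i + 1)]
    · exact hi.1.le
    · refine lt_of_le_of_ne hi.2 fun hh => ht ⟨i + 2, ?_⟩
      simp only
      rw [← hh, ENNReal.coe_toReal, Real.coe_toNNReal]
      exact (period_subset_Ioi _ _ hi).le
    · intro j hj
      refine Set.indicator_of_notMem (fun hh => hj ?_) _
      exact Nat.succ_injective (eq_of_mem_period hh hi)
  · push Not at hex
    rw [lateError, ENNReal.tsum_eq_zero.2 fun i => Set.indicator_of_notMem (hex i) _]
    exact zero_le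

lemma period_zero_top : period 0 ∞ = Set.Ioi (0 : ℝ) := by
  ext r; simp [period]

namespace IsOnlinePolicy

lemma measurable_lateError (h : IsModel P W Y) (hS : IsOnlinePolicy P W Y S) :
    Measurable (Function.uncurry (lateError W Y S)) :=
  Measurable.tsum fun i => measurable_period_indicator
    (hS.measurable_delivery h (i + 1)) (hS.measurable_delivery h (i + 2))
    ((h.isBrownianWith 0).measurable_sqError (hS.measurable_sampling h (i + 1)))

lemma discInt_lateError (h : IsModel P W Y) (hS : IsOnlinePolicy P W Y S) :
    discInt α P (fun _ => 0) (fun _ => ∞) (lateError W Y S) =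
      ∑' i, stageCost α P W Y S (i + 1) := by
  have hm : ∀ i, Measurable fun z : ℝ × Ω =>
      (period (deliveryTime Y S (i + 1) z.2) (deliveryTime Y S (i + 2) z.2)).indicator
        (fun t => ofReal (Real.exp (-α * t)) * sqError W (S (i + 1)) t z.2) z.1 := fun i =>
    measurable_period_indicator (f := fun t ω => ofReal (Real.exp (-α * t)) *
        sqError W (S (i + 1)) t ω)
      (hS.measurable_delivery h (i + 1)) (hS.measurable_delivery h (i + 2))
      ((by fun_prop : Measurable fun z : ℝ × Ω => ofReal (Real.exp (-α * z.1))).mul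
        ((h.isBrownianWith 0).measurable_sqError (hS.measurable_sampling h (i + 1))))
  have e : ∀ i ω, ∫⁻ r in period (deliveryTime Y S (i + 1) ω) (deliveryTime Y S (i + 2) ω),
      ofReal (Real.exp (-α * r)) * sqError W (S (i + 1)) r ω =
      ∫⁻ r, (period (deliveryTime Y S (i + 1) ω) (deliveryTime Y S (i + 2) ω)).indicator
        (fun t => ofReal (Real.exp (-α * t)) * sqError W (S (i + 1)) t ω) r :=
    fun i ω => (lintegral_indicator (measurableSet_period _ _) _).symm
  simp only [stageCost, discInt, e]
  rw [← lintegral_tsum fun i => (Measurable.lintegral_prod_left (hm i)).aemeasurable]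
  refine lintegral_congr fun ω => ?_
  have hmω : ∀ i, Measurable fun r : ℝ =>
      (period (deliveryTime Y S (i + 1) ω) (deliveryTime Y S (i + 2) ω)).indicator
        (fun t => ofReal (Real.exp (-α * t)) * sqError W (S (i + 1)) t ω) r := fun i =>
    (hm i).comp (f := fun r : ℝ => (r, ω)) (by fun_prop)
  rw [← lintegral_tsum fun i => (hmω i).aemeasurable,
    ← lintegral_indicator (measurableSet_period _ _)]
  refine lintegral_congr fun r => ?_
  by_cases hr : r ∈ period 0 ∞
  · rw [Set.indicator_of_mem hr, lateError, ← ENNReal.tsum_mul_left]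
    refine tsum_congr fun i => ?_
    by_cases h1 : r ∈ period (deliveryTime Y S (i + 1) ω) (deliveryTime Y S (i + 2) ω) <;>
      simp [h1]
  · rw [Set.indicator_of_notMem hr, ENNReal.tsum_eq_zero.2]
    refine fun i => Set.indicator_of_notMem (fun h1 => hr ?_) _
    rw [period_zero_top]
    exact period_subset_Ioi _ _ h1

/-- The discounted cost is asymptotically at most the time-average cost. -/
lemma exists_discounted_le (h : IsModel P W Y) (hS : IsOnlinePolicy P W Y S) {c : ℝ≥0∞}
    (hc : mse P W Y S < c) : ∃ T₀ : ℝ, 0 ≤ T₀ ∧ ∀ α : ℝ, 0 < α →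
      ofReal α * ∑' i, stageCost α P W Y S (i + 1) ≤ c * (1 + ofReal (α * T₀)) := by
  have := h.isProbabilityMeasure
  have h1 := eventually_lt_of_limsup_lt hc
  obtain ⟨T₁, hT₁⟩ := eventually_atTop.1 h1
  set T₀ := max T₁ 1
  have hT0 : 0 < T₀ := lt_max_of_lt_right one_pos
  refine ⟨T₀, hT0.le, fun α hα => ?_⟩
  set M : ℝ → ℝ≥0∞ := fun T => ∫⁻ ω, (∫⁻ r in period 0 ∞ ∩ Set.Iic T, lateError W Y S r ω) ∂P
  have hM1 : ∀ T, T₀ ≤ T → M T ≤ c * ofReal T := fun T hT => by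
    have h2 := (hT₁ T ((le_max_left _ _).trans hT)).le
    have hTpos : 0 < T := hT0.trans_le hT
    refine le_trans (lintegral_mono fun ω => ?_) ((ENNReal.div_le_iff
      (ENNReal.ofReal_pos.2 hTpos).ne' ENNReal.ofReal_ne_top).1 h2)
    rw [period_zero_top]
    calc ∫⁻ r in Set.Ioi 0 ∩ Set.Iic T, lateError W Y S r ω
        ≤ ∫⁻ r in Set.Icc 0 T, lateError W Y S r ω :=
          lintegral_mono_set fun r hr => ⟨hr.1.le, hr.2⟩
      _ ≤ _ := lintegral_mono_ae (ae_restrict_of_ae (lateError_le ω))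
  have hMmono : Monotone M := fun s t hst => lintegral_mono fun ω =>
    lintegral_mono_set (Set.inter_subset_inter_right _ (Set.Iic_subset_Iic.2 hst))
  have hM2 : ∀ T, 0 < T → M T ≤ c * (ofReal T + ofReal T₀) := fun T hT => by
    rcases le_total T₀ T with h3 | h3
    · exact (hM1 T h3).trans (by gcongr; exact le_self_add)
    · exact (hMmono h3).trans ((hM1 T₀ le_rfl).trans (by gcongr; exact le_add_self))
  have e1 := lintegral_clock_period (P := P) hα (D := fun _ => 0) (G := fun _ => ∞)
    measurable_const measurable_const (hS.measurable_lateError h)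
  rw [hS.discInt_lateError h] at e1
  have hlen : ofReal α * ∫⁻ T, ofReal T ∂clock α = 1 := by
    have e2 := lintegral_clock_period (P := P) hα (D := fun _ => 0) (G := fun _ => ∞)
      measurable_const measurable_const (f := fun _ _ => 1) measurable_const
    have e3 := disc_eq_add_discInt (P := P) hα (D := fun _ => 0) (G := fun _ => ∞)
      measurable_const measurable_const fun _ => zero_le
    simp only [disc_zero, disc_top, lintegral_const, measure_univ, mul_one, add_zero] at e3
    rw [← e3, ← e2]
    congr 1
    refine lintegral_congr fun T => ?_
    simp only [period_zero_top, one_mul, lintegral_const, measure_univ, mul_one]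
    rw [Measure.restrict_apply_univ, Set.Ioi_inter_Iic, Real.volume_Ioc, sub_zero]
  have hone : clock α Set.univ = 1 := by
    have := clock_Ioi hα le_rfl
    rw [mul_zero, Real.exp_zero, ENNReal.ofReal_one] at this
    rw [← this]
    refine measure_congr ?_
    filter_upwards [ae_clock_pos (α := α)] with T hT
    exact propext ⟨fun _ => hT, fun _ => trivial⟩
  calc ofReal α * ∑' i, stageCost α P W Y S (i + 1)
      = ofReal α * ∫⁻ T, M T ∂clock α := by rw [← e1]
    _ ≤ ofReal α * ∫⁻ T, c * (ofReal T + ofReal T₀) ∂clock α := by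
        refine mul_le_mul' le_rfl ?_
        exact lintegral_mono_ae (ae_clock_pos.mono fun T hT => hM2 T hT)
    _ = c * (ofReal α * ∫⁻ T, ofReal T ∂clock α +
          ofReal α * ofReal T₀) := by
        rw [lintegral_const_mul _ (by fun_prop), lintegral_add_left (by fun_prop),
          lintegral_const, hone, mul_one]
        ring
    _ = _ := by rw [hlen, ENNReal.ofReal_mul hα.le]

end IsOnlinePolicy

/-- The expected discounted number of samples, each discounted from the start of its service. -/
def totalDisc (α : ℝ) (P : Measure Ω) (Y : ℕ → Ω → ℝ≥0) (S : ℕ → Ω → ℝ≥0∞) : ℝ≥0∞ :=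
  ∑' i, stageDisc α P Y S i

lemma serviceLength_le (hα : 0 < α) (Y : Ω → ℝ≥0) :
    serviceLength α P Y ≤ ∫⁻ ω, Y ω ∂P := by
  refine lintegral_mono fun ω => ?_
  calc ∫⁻ u in Set.Ioc (0 : ℝ) (Y ω), ofReal (Real.exp (-α * u))
      ≤ ∫⁻ _ in Set.Ioc (0 : ℝ) (Y ω), 1 := by
        refine setLIntegral_mono measurable_const fun u hu => ?_
        rw [← disc_ofReal hu.1.le]
        exact disc_le_one hα.le _
    _ = Y ω := by simp

lemma serviceCost_le (hα : 0 < α) (Y : Ω → ℝ≥0) :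
    serviceCost α P Y ≤ ∫⁻ ω, (Y ω : ℝ≥0∞) ^ 2 ∂P := by
  refine lintegral_mono fun ω => ?_
  calc ∫⁻ u in Set.Ioc (0 : ℝ) (Y ω), ofReal (Real.exp (-α * u)) * ofReal u
      ≤ ∫⁻ _ in Set.Ioc (0 : ℝ) (Y ω), (Y ω : ℝ≥0∞) := by
        refine setLIntegral_mono measurable_const fun u hu => ?_
        rw [← disc_ofReal hu.1.le]
        calc _ ≤ 1 * ofReal u := by gcongr; exact disc_le_one hα.le _
          _ ≤ _ := by
            rw [one_mul]
            exact ENNReal.ofReal_le_of_le_toReal (by simpa using hu.2)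
    _ = _ := by simp [sq]

lemma serviceCorrection_ne_top [IsProbabilityMeasure P] {β : ℝ} (hβ : 0 ≤ β) (Y : Ω → ℝ≥0) :
    serviceCorrection P β Y ≠ ∞ := by
  refine ne_top_of_le_ne_top (b := ofReal (β ^ 2 / 6)) ENNReal.ofReal_ne_top ?_
  calc serviceCorrection P β Y ≤ ∫⁻ _ : Ω, ofReal (β ^ 2 / 6) ∂P := by
        refine lintegral_mono fun ω => ?_
        calc _ ≤ ∫⁻ _ : ℝ, ofReal (β ^ 2 / 6) ∂gaussianReal 0 (Y ω) :=
              lintegral_mono fun z => ENNReal.ofReal_le_ofReal (corrector_le β z hβ)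
          _ = _ := by simp
    _ = _ := by simp

lemma serviceLength_ne_zero {Z : Ω → ℝ≥0} (hZ : Measurable Z) (hZ0 : ∫⁻ ω, (Z ω : ℝ≥0∞) ∂P ≠ 0)
    (α : ℝ) : serviceLength α P Z ≠ 0 := by
  refine fun h0 => hZ0 ?_
  have hm := (measurable_lintegral_Ioc (k := fun u => ofReal (Real.exp (-α * u)))
    (by fun_prop)).comp hZ
  have h1 := (lintegral_eq_zero_iff hm).1 h0
  refine (lintegral_eq_zero_iff hZ.coe_nnreal_ennreal).2 (h1.mono fun ω hω => ?_)
  have h2 := (setLIntegral_eq_zero_iff measurableSet_Ioc (by fun_prop)).1 hω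
  by_contra hne
  have hpos : (0 : ℝ) < Z ω := by
    have : Z ω ≠ 0 := fun h => hne (by simp [h])
    exact_mod_cast pos_iff_ne_zero.2 this
  have h3 : ∀ᵐ x : ℝ, x ∉ Set.Ioc (0 : ℝ) (Z ω) := h2.mono fun x hx hx' => by
    have := hx hx'
    rw [ENNReal.ofReal_eq_zero] at this
    exact absurd this (not_le.2 (Real.exp_pos _))
  have h4 : volume (Set.Ioc (0 : ℝ) (Z ω)) = 0 := by
    rw [measure_eq_zero_iff_ae_notMem]; exact h3
  rw [Real.volume_Ioc, sub_zero, ENNReal.ofReal_eq_zero] at h4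
  exact absurd h4 (not_le.2 hpos)

namespace IsModel

lemma lintegral_sq_ne_top (h : IsModel P W Y) : ∫⁻ ω, (Y 0 ω : ℝ≥0∞) ^ 2 ∂P ≠ ∞ := by
  have := h.sqY.integrable_sq
  have e := this.lintegral_lt_top
  have e2 : ∀ ω, ofReal ((Y 0 ω : ℝ) ^ 2) = (Y 0 ω : ℝ≥0∞) ^ 2 := fun ω => by
    rw [ENNReal.ofReal_pow (NNReal.coe_nonneg _), ENNReal.ofReal_coe_nnreal]
  simp_rw [e2] at e
  exact e.ne

lemma lintegral_ne_top (h : IsModel P W Y) : ∫⁻ ω, (Y 0 ω : ℝ≥0∞) ∂P ≠ ∞ := by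
  have := h.isProbabilityMeasure
  have h1 := (h.sqY.integrable (by norm_num)).lintegral_lt_top
  simp only [ENNReal.ofReal_coe_nnreal] at h1
  exact h1.ne

lemma lintegral_disc_mul_le (_ : IsModel P W Y) (hα : 0 < α) :
    ∫⁻ ω, disc α (Y 0 ω) * Y 0 ω ∂P ≤ ∫⁻ ω, Y 0 ω ∂P :=
  lintegral_mono fun ω => by
    calc _ ≤ 1 * (Y 0 ω : ℝ≥0∞) := by gcongr; exact disc_le_one hα.le _
      _ = _ := one_mul _

lemma lintegral_disc_le_one (h : IsModel P W Y) (hα : 0 < α) :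
    ∫⁻ ω, disc α (Y 0 ω) ∂P ≤ 1 := by
  have := h.isProbabilityMeasure
  exact (lintegral_mono fun ω => disc_le_one hα.le _).trans (by simp)

lemma lintegral_disc_lt_one (h : IsModel P W Y) (hY : ∫⁻ ω, (Y 0 ω : ℝ≥0∞) ∂P ≠ 0) (hα : 0 < α) :
    ∫⁻ ω, disc α (Y 0 ω) ∂P < 1 := by
  have := h.isProbabilityMeasure
  have e := disc_add_serviceLength (P := P) hα (h.measY 0)
  rw [← e]
  refine ENNReal.lt_add_right (ne_top_of_le_ne_top ENNReal.one_ne_top (h.lintegral_disc_le_one hα))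
    (mul_ne_zero (ENNReal.ofReal_pos.2 hα).ne' (serviceLength_ne_zero (h.measY 0) hY α))

end IsModel

namespace IsOnlinePolicy

lemma totalDisc_ne_top (h : IsModel P W Y) (hS : IsOnlinePolicy P W Y S)
    (hY : ∫⁻ ω, (Y 0 ω : ℝ≥0∞) ∂P ≠ 0) (hα : 0 < α) : totalDisc α P Y S ≠ ∞ := by
  refine ne_top_of_le_ne_top ?_ (ENNReal.tsum_le_tsum fun i => hS.stageDisc_le_pow h hα i)
  rw [ENNReal.tsum_geometric]
  exact ENNReal.inv_ne_top.2 (tsub_pos_of_lt (h.lintegral_disc_lt_one hY hα)).ne'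

/-- The lower bound on the cost before the passage to the limit `α → 0`: the terms are the
discounted cost, the discounted number of samples `ξ`, and moments of the service time. -/
theorem discounted_lower_bound (h : IsModel P W Y) (hS : IsOnlinePolicy P W Y S)
    (hY : ∫⁻ ω, (Y 0 ω : ℝ≥0∞) ∂P ≠ 0) {β : ℝ} (hβ : 0 ≤ β) {c : ℝ≥0∞} (hc : c ≠ ∞)
    (hmse : mse P W Y S < c) : ∃ T₀ : ℝ, ∀ α : ℝ, 0 < α →
      ((∫⁻ ω, disc α (Y 0 ω) ∂P).toReal * (β / 3) + (serviceLength α P (Y 0)).toReal) *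
        ((stageDisc α P Y S 0).toReal -
          (serviceLength α P (Y 0)).toReal * (α * (totalDisc α P Y S).toReal)) +
      (serviceLength α P (Y 0)).toReal * (∫⁻ ω, disc α (Y 0 ω) * Y 0 ω ∂P).toReal *
        (α * (totalDisc α P Y S).toReal) +
      (serviceCost α P (Y 0)).toReal * (α * (totalDisc α P Y S).toReal -
        α * (stageDisc α P Y S 0).toReal) ≤
      c.toReal * (1 + α * T₀) + (∫⁻ ω, disc α (Y 0 ω) ∂P).toReal *
        (serviceCorrection P β (Y 0)).toReal * (α * (totalDisc α P Y S).toReal) ∧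
      (serviceLength α P (Y 0)).toReal * (α * (totalDisc α P Y S).toReal) ≤ 1 := by
  have := h.isProbabilityMeasure
  obtain ⟨T₀, hT₀, hle⟩ := hS.exists_discounted_le h hmse
  refine ⟨T₀, fun α hα => ?_⟩
  have hle := hle α hα
  have hX := hS.totalDisc_ne_top h hY hα
  have hφ1 := h.lintegral_disc_le_one hα
  have hφ := ne_top_of_le_ne_top ENNReal.one_ne_top hφ1
  have ha := ne_top_of_le_ne_top h.lintegral_ne_top (serviceLength_le (P := P) hα (Y 0))
  have hb := ne_top_of_le_ne_top h.lintegral_sq_ne_top (serviceCost_le (P := P) hα (Y 0))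
  have ha' := ne_top_of_le_ne_top h.lintegral_ne_top (h.lintegral_disc_mul_le hα)
  have hk := serviceCorrection_ne_top (P := P) hβ (Y 0)
  have hx0 := stageDisc_le_one (S := S) h hα 0
  have hx0' := ne_top_of_le_ne_top ENNReal.one_ne_top hx0
  have e1 := disc_add_serviceLength (P := P) hα (h.measY 0)
  -- summation over the stages
  have e2 : totalDisc α P Y S = stageDisc α P Y S 0 + ∑' i, stageDisc α P Y S (i + 1) :=
    tsum_eq_zero_add' ENNReal.summable
  have hsum := ENNReal.tsum_le_tsum fun i => hS.le_stageCost h hα hβ i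
  have hidle : ∑' i, (ofReal α * stageIdle α P Y S (i + 1) + stageDisc α P Y S (i + 1)) =
      ∑' i, (∫⁻ ω, disc α (Y 0 ω) ∂P) * stageDisc α P Y S i :=
    tsum_congr fun i => hS.stageIdle_add_stageDisc h hα i
  simp only [ENNReal.tsum_add, ENNReal.tsum_mul_left, mul_add] at hsum hidle
  change _ = _ * totalDisc α P Y S at hidle
  rw [show ∑' i, stageDisc α P Y S i = totalDisc α P Y S from rfl] at hsum
  set φ := ∫⁻ ω, disc α (Y 0 ω) ∂P
  set a := serviceLength α P (Y 0)
  set b := serviceCost α P (Y 0)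
  set a' := ∫⁻ ω, disc α (Y 0 ω) * Y 0 ω ∂P
  set k := serviceCorrection P β (Y 0)
  set X := totalDisc α P Y S
  set x₀ := stageDisc α P Y S 0
  set X' := ∑' i, stageDisc α P Y S (i + 1)
  set L := ∑' i, stageIdle α P Y S (i + 1)
  set C := ∑' i, stageCost α P W Y S (i + 1)
  have hX' : X' ≠ ∞ := ne_top_of_le_ne_top hX (e2 ▸ le_add_self)
  have hα0 := (ENNReal.ofReal_pos.2 hα).ne'
  have hL : L ≠ ∞ := by
    intro hL
    rw [hL, ENNReal.mul_top hα0, top_add] at hidle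
    exact ENNReal.mul_ne_top hφ hX hidle.symm
  have hrhs : c * (1 + ofReal (α * T₀)) ≠ ∞ :=
    ENNReal.mul_ne_top hc (ENNReal.add_ne_top.2 ⟨ENNReal.one_ne_top, ENNReal.ofReal_ne_top⟩)
  have hC : C ≠ ∞ := by
    intro hC
    rw [hC, ENNReal.mul_top hα0] at hle
    exact hrhs (top_le_iff.1 hle)
  clear_value φ a b a' k X x₀ X' L C
  lift φ to ℝ≥0 using hφ
  lift a to ℝ≥0 using ha
  lift b to ℝ≥0 using hb
  lift a' to ℝ≥0 using ha'
  lift k to ℝ≥0 using hk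
  lift X to ℝ≥0 using hX
  lift x₀ to ℝ≥0 using hx0'
  lift X' to ℝ≥0 using hX'
  lift L to ℝ≥0 using hL
  lift C to ℝ≥0 using hC
  lift c to ℝ≥0 using hc
  have r1 : (φ : ℝ) + α * a = 1 := by
    have := congrArg ENNReal.toReal e1
    rw [ENNReal.toReal_add (by finiteness) (by finiteness), ENNReal.toReal_mul,
      ENNReal.toReal_ofReal hα.le] at this
    simpa using this
  have r2 : (X : ℝ) = x₀ + X' := by exact_mod_cast e2
  have r3 : α * L + X' = (φ : ℝ) * X := by
    have := congrArg ENNReal.toReal hidle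
    rw [ENNReal.toReal_add (by finiteness) (by finiteness), ENNReal.toReal_mul,
      ENNReal.toReal_ofReal hα.le] at this
    simpa using this
  have r4 : α * C ≤ (c : ℝ) * (1 + α * T₀) := by
    have := ENNReal.toReal_mono hrhs hle
    rw [ENNReal.toReal_mul, ENNReal.toReal_mul, ENNReal.toReal_add (by finiteness) (by finiteness),
      ENNReal.toReal_ofReal hα.le, ENNReal.toReal_ofReal (by positivity)] at this
    simpa using this
  have r5 : (φ : ℝ) * (β / 3 * L) + (a * (a' * X) + a * L) + b * X' ≤ C + φ * (k * X) := by
    have := ENNReal.toReal_mono (by finiteness) hsum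
    have h3 : (0 : ℝ) ≤ β / 3 := by positivity
    rw [ENNReal.toReal_add (by finiteness) (by finiteness),
      ENNReal.toReal_add (by finiteness) (by finiteness),
      ENNReal.toReal_add (by finiteness) (by finiteness),
      ENNReal.toReal_add (by finiteness) (by finiteness)] at this
    simpa [ENNReal.toReal_mul, ENNReal.toReal_ofReal h3] using this
  have r6 : (x₀ : ℝ) ≤ 1 := by exact_mod_cast hx0
  simp only [ENNReal.coe_toReal]
  have r7 : α * L = x₀ - a * (α * X) := by
    have : (φ : ℝ) = 1 - α * a := by linarith
    rw [this] at r3; linarith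
  have r8 : X' = X - (x₀ : ℝ) := by linarith
  refine ⟨?_, ?_⟩
  · have r9 := mul_le_mul_of_nonneg_left r5 hα.le
    rw [← r7]
    rw [r8] at r9
    nlinarith
  · have : 0 ≤ α * (L : ℝ) := by positivity
    linarith

end IsOnlinePolicy

end LowerBound

/-! ### Vanishing discount -/

section Vanishing

variable {Ω : Type*} [mΩ : MeasurableSpace Ω] {P : Measure Ω}
  {W : ℝ≥0 → Ω → ℝ} {Y : ℕ → Ω → ℝ≥0} {S : ℕ → Ω → ℝ≥0∞}

/-- A sequence of discount rates that tends to zero. -/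
def rate (n : ℕ) : ℝ := 1 / ((n : ℝ) + 1)

lemma rate_pos (n : ℕ) : 0 < rate n := by unfold rate; positivity

lemma tendsto_rate : Tendsto rate atTop (nhds 0) := tendsto_one_div_add_atTop_nhds_zero_nat

lemma tendsto_exp_rate (u : ℝ) : Tendsto (fun n => Real.exp (-rate n * u)) atTop (nhds 1) := by
  have h1 : Tendsto (fun n => Real.exp (-rate n * u)) atTop (nhds (Real.exp (-0 * u))) :=
    (Real.continuous_exp.tendsto _).comp ((tendsto_rate.neg).mul_const u)
  simpa using h1

lemma tendsto_disc_rate {t : ℝ≥0∞} (ht : t ≠ ∞) :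
    Tendsto (fun n => disc (rate n) t) atTop (nhds 1) := by
  simp_rw [disc_of_ne_top ht]
  simpa using ENNReal.tendsto_ofReal (tendsto_exp_rate t.toReal)

lemma tendsto_lintegral_disc_rate [IsProbabilityMeasure P] {τ : Ω → ℝ≥0∞} (hτ : Measurable τ)
    (hfin : ∀ᵐ ω ∂P, τ ω ≠ ∞) :
    Tendsto (fun n => ∫⁻ ω, disc (rate n) (τ ω) ∂P) atTop (nhds 1) := by
  have := tendsto_lintegral_of_dominated_convergence (μ := P) (F := fun n ω => disc (rate n) (τ ω))
    (f := fun _ => 1) (fun _ => 1) (fun n => (measurable_disc _).comp hτ)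
    (fun n => ae_of_all _ fun ω => disc_le_one (rate_pos n).le _) (by simp)
    (hfin.mono fun ω hω => tendsto_disc_rate hω)
  simpa using this

lemma tendsto_lintegral_Ioc_rate {k : ℝ → ℝ≥0∞} (hk : Measurable k) {y : ℝ≥0}
    (hfin : ∫⁻ u in Set.Ioc (0 : ℝ) y, k u ≠ ∞) :
    Tendsto (fun n => ∫⁻ u in Set.Ioc (0 : ℝ) y, ofReal (Real.exp (-rate n * u)) * k u)
      atTop (nhds (∫⁻ u in Set.Ioc (0 : ℝ) y, k u)) := by
  refine tendsto_lintegral_of_dominated_convergence _ (fun n => by fun_prop) (fun n => ?_) hfin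
    (ae_of_all _ fun u => ?_)
  · filter_upwards [ae_restrict_mem measurableSet_Ioc] with u hu
    rw [← disc_ofReal hu.1.le]
    calc _ ≤ 1 * k u := by gcongr; exact disc_le_one (rate_pos n).le _
      _ = _ := one_mul _
  · have h1 := ENNReal.tendsto_ofReal (tendsto_exp_rate u)
    have h2 := ENNReal.Tendsto.mul_const (b := k u) h1 (Or.inl (by simp))
    simpa using h2

lemma lintegral_Ioc_id (y : ℝ≥0) :
    ∫⁻ u in Set.Ioc (0 : ℝ) y, ofReal u = ofReal ((y : ℝ) ^ 2 / 2) := by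
  rw [← ofReal_integral_eq_lintegral_ofReal, ← intervalIntegral.integral_of_le y.coe_nonneg,
    integral_id]
  · congr 1; ring
  · exact (intervalIntegral.intervalIntegrable_id).1
  · filter_upwards [ae_restrict_mem measurableSet_Ioc] with u hu using hu.1.le

lemma tendsto_serviceLength {Z : Ω → ℝ≥0} (hZ : Measurable Z) (hfin : ∫⁻ ω, Z ω ∂P ≠ ∞) :
    Tendsto (fun n => serviceLength (rate n) P Z) atTop (nhds (∫⁻ ω, Z ω ∂P)) := by
  refine tendsto_lintegral_of_dominated_convergence (fun ω => (Z ω : ℝ≥0∞)) (fun n =>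
    (measurable_lintegral_Ioc (k := fun u => ofReal (Real.exp (-rate n * u)))
      (by fun_prop)).comp hZ) (fun n => ae_of_all _ fun ω => ?_) hfin (ae_of_all _ fun ω => ?_)
  · calc ∫⁻ u in Set.Ioc (0 : ℝ) (Z ω), ofReal (Real.exp (-rate n * u))
        ≤ ∫⁻ _ in Set.Ioc (0 : ℝ) (Z ω), 1 := by
          refine setLIntegral_mono measurable_const fun u hu => ?_
          rw [← disc_ofReal hu.1.le]
          exact disc_le_one (rate_pos n).le _
      _ = Z ω := by simp
  · have := tendsto_lintegral_Ioc_rate (k := fun _ => 1) measurable_const (y := Z ω) (by simp)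
    simpa using this

namespace IsModel

lemma tendsto_serviceCost (h : IsModel P W Y) :
    Tendsto (fun n => serviceCost (rate n) P (Y 0)) atTop
      (nhds (∫⁻ ω, ofReal ((Y 0 ω : ℝ) ^ 2 / 2) ∂P)) := by
  have hfin : ∫⁻ ω, ofReal ((Y 0 ω : ℝ) ^ 2 / 2) ∂P ≠ ∞ :=
    ((h.sqY.integrable_sq).div_const 2).lintegral_lt_top.ne
  refine tendsto_lintegral_of_dominated_convergence (fun ω => ofReal ((Y 0 ω : ℝ) ^ 2 / 2))
    (fun n => (measurable_lintegral_Ioc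
      (k := fun u => ofReal (Real.exp (-rate n * u)) * ofReal u)
      (by fun_prop)).comp (h.measY 0)) (fun n => ae_of_all _ fun ω => ?_) hfin
    (ae_of_all _ fun ω => ?_)
  · simp only [← lintegral_Ioc_id]
    refine setLIntegral_mono (by fun_prop) fun u hu => ?_
    rw [← disc_ofReal hu.1.le]
    calc _ ≤ 1 * ofReal u := by gcongr; exact disc_le_one (rate_pos n).le _
      _ = _ := one_mul _
  · rw [← lintegral_Ioc_id]
    refine tendsto_lintegral_Ioc_rate (by fun_prop) ?_
    rw [lintegral_Ioc_id]; simp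

lemma tendsto_lintegral_disc_mul (h : IsModel P W Y) :
    Tendsto (fun n => ∫⁻ ω, disc (rate n) (Y 0 ω) * Y 0 ω ∂P) atTop
      (nhds (∫⁻ ω, Y 0 ω ∂P)) := by
  refine tendsto_lintegral_of_dominated_convergence (fun ω => (Y 0 ω : ℝ≥0∞)) (fun n =>
    ((measurable_disc _).comp (h.measY 0).coe_nnreal_ennreal).mul (h.measY 0).coe_nnreal_ennreal)
    (fun n => ae_of_all _ fun ω => ?_) h.lintegral_ne_top (ae_of_all _ fun ω => ?_)
  · exact (mul_le_mul' (disc_le_one (rate_pos n).le _) le_rfl).trans (one_mul _).le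
  · have := ENNReal.Tendsto.mul_const (b := (Y 0 ω : ℝ≥0∞))
      (tendsto_disc_rate (t := (Y 0 ω : ℝ≥0∞)) (by simp)) (Or.inl (by simp))
    simpa using this

end IsModel

/-- Passage to the limit in an inequality that is affine in a bounded sequence `ξ`. -/
lemma le_of_tendsto_affine {A B a ξ : ℕ → ℝ} {μ V a₀ c κ : ℝ} (hA : Tendsto A atTop (nhds μ))
    (hB : Tendsto B atTop (nhds V)) (ha : Tendsto a atTop (nhds a₀)) (ha₀ : 0 < a₀)
    (hξ : ∀ n, 0 ≤ ξ n) (haξ : ∀ n, a n * ξ n ≤ 1) (hle : ∀ n, A n + ξ n * B n ≤ c) (hV : V ≤ 0)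
    (hκ : V ≠ 0 → ∀ ε > 0, ∀ᶠ n in atTop, ξ n ≤ κ + ε) : μ + V * κ ≤ c := by
  rcases hV.eq_or_lt with rfl | hV
  · have hlim : Tendsto (fun n => A n - |B n| / a n) atTop (nhds (μ - |0| / a₀)) :=
      hA.sub (hB.abs.div ha ha₀.ne')
    have : μ - |0| / a₀ ≤ c := by
      refine le_of_tendsto hlim ?_
      filter_upwards [ha.eventually (lt_mem_nhds ha₀)] with n hn
      have h1 : ξ n ≤ 1 / a n := by rw [le_div_iff₀ hn, mul_comm]; exact haξ n
      have h2 : -(|B n| / a n) ≤ ξ n * B n := by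
        have h3 := neg_abs_le (B n)
        have h4 : ξ n * |B n| ≤ 1 / a n * |B n| := by gcongr
        have h5 : 1 / a n * |B n| = |B n| / a n := by ring
        nlinarith [hξ n, abs_nonneg (B n)]
      linarith [hle n]
    simpa using this
  · have key : ∀ ε > 0, μ + (κ + ε) * V ≤ c := fun ε hε => by
      refine le_of_tendsto (hA.add (hB.const_mul (κ + ε))) ?_
      filter_upwards [hκ hV.ne ε hε, hB.eventually (gt_mem_nhds hV)] with n h1 h2
      have := hle n
      nlinarith
    refine le_of_forall_pos_le_add fun δ hδ => ?_
    have := key (δ / (-V)) (div_pos hδ (by linarith))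
    have e : δ / (-V) * V = -δ := by rw [div_neg, neg_mul, div_mul_cancel₀ _ hV.ne]
    nlinarith

/-- The expected correction at the end of a service period, as a real number. -/
def meanCorrection (P : Measure Ω) (β : ℝ) (Y : Ω → ℝ≥0) : ℝ := (serviceCorrection P β Y).toReal

/-- The excess of the expected cost of a cycle, under the threshold policy with squared threshold
`β`, over `E Y + β / 3` times the expected length of the cycle. -/
def cycleExcess (P : Measure Ω) (β : ℝ) (Y : Ω → ℝ≥0) : ℝ :=
  -meanCorrection P β Y + (∫ ω, (Y ω : ℝ) ^ 2 ∂P) / 2 - (∫ ω, (Y ω : ℝ) ∂P) * β / 3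

lemma toReal_lintegral_coe {Z : Ω → ℝ≥0} (hZ : Measurable Z) :
    (∫⁻ ω, (Z ω : ℝ≥0∞) ∂P).toReal = ∫ ω, (Z ω : ℝ) ∂P := by
  rw [integral_eq_lintegral_of_nonneg_ae (ae_of_all _ fun ω => (Z ω).coe_nonneg)
    hZ.coe_nnreal_real.aestronglyMeasurable]
  simp

/-- A lower bound on the mean-square error of a causal policy. The number `κ` bounds the asymptotic
sampling rate; it is irrelevant if the excess cost of a cycle vanishes, which is why no bound on the
rate is required in that case. -/
theorem IsOnlinePolicy.lower_bound (h : IsModel P W Y) (hS : IsOnlinePolicy P W Y S)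
    (hY : ∫⁻ ω, (Y 0 ω : ℝ≥0∞) ∂P ≠ 0) {β κ : ℝ} (hβ : 0 ≤ β) (hV : cycleExcess P β (Y 0) ≤ 0)
    (hκ : cycleExcess P β (Y 0) ≠ 0 → ∀ ε > 0, ∀ᶠ n in atTop,
      rate n * (totalDisc (rate n) P Y S).toReal ≤ κ + ε) :
    ofReal ((∫ ω, (Y 0 ω : ℝ) ∂P) + β / 3 + cycleExcess P β (Y 0) * κ) ≤ mse P W Y S := by
  have := h.isProbabilityMeasure
  refine le_of_forall_gt fun c₀ hc₀ => ?_
  obtain ⟨c, h1, h2⟩ := exists_between hc₀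
  have hc : c ≠ ∞ := (h2.trans_le le_top).ne
  refine lt_of_le_of_lt ?_ h2
  obtain ⟨T₀, hT⟩ := hS.discounted_lower_bound h hY hβ hc h1
  rw [← ENNReal.ofReal_toReal hc]
  refine ENNReal.ofReal_le_ofReal ?_
  have lφ : Tendsto (fun n => (∫⁻ ω, disc (rate n) (Y 0 ω) ∂P).toReal) atTop (nhds 1) := by
    have := (ENNReal.tendsto_toReal ENNReal.one_ne_top).comp (tendsto_lintegral_disc_rate (P := P)
      (h.measY 0).coe_nnreal_ennreal (ae_of_all _ fun ω => ENNReal.coe_ne_top))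
    rw [ENNReal.toReal_one] at this
    exact this
  have lx : Tendsto (fun n => (stageDisc (rate n) P Y S 0).toReal) atTop (nhds 1) := by
    have := (ENNReal.tendsto_toReal ENNReal.one_ne_top).comp (tendsto_lintegral_disc_rate (P := P)
      (hS.measurable_start h 0) (hS.ae_serviceStart_ne_top h 0))
    rw [ENNReal.toReal_one] at this
    exact this
  set a₀ := ∫ ω, (Y 0 ω : ℝ) ∂P
  have ea₀ : (∫⁻ ω, (Y 0 ω : ℝ≥0∞) ∂P).toReal = a₀ := toReal_lintegral_coe (h.measY 0)
  have ha₀ : 0 < a₀ := ea₀ ▸ ENNReal.toReal_pos hY h.lintegral_ne_top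
  have la : Tendsto (fun n => (serviceLength (rate n) P (Y 0)).toReal) atTop (nhds a₀) :=
    ea₀ ▸ (ENNReal.tendsto_toReal h.lintegral_ne_top).comp
      (tendsto_serviceLength (h.measY 0) h.lintegral_ne_top)
  have la' : Tendsto (fun n => (∫⁻ ω, disc (rate n) (Y 0 ω) * Y 0 ω ∂P).toReal) atTop (nhds a₀) :=
    ea₀ ▸ (ENNReal.tendsto_toReal h.lintegral_ne_top).comp h.tendsto_lintegral_disc_mul
  have hint := (h.sqY.integrable_sq).div_const 2
  have eb : (∫⁻ ω, ofReal ((Y 0 ω : ℝ) ^ 2 / 2) ∂P).toReal =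
      (∫ ω, (Y 0 ω : ℝ) ^ 2 ∂P) / 2 := by
    rw [← integral_div, ← ofReal_integral_eq_lintegral_ofReal hint
      (ae_of_all _ fun ω => by positivity), ENNReal.toReal_ofReal]
    exact integral_nonneg fun ω => by positivity
  have lb : Tendsto (fun n => (serviceCost (rate n) P (Y 0)).toReal) atTop
      (nhds ((∫ ω, (Y 0 ω : ℝ) ^ 2 ∂P) / 2)) :=
    eb ▸ (ENNReal.tendsto_toReal hint.lintegral_lt_top.ne).comp h.tendsto_serviceCost
  set φ := fun n => (∫⁻ ω, disc (rate n) (Y 0 ω) ∂P).toReal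
  set x := fun n => (stageDisc (rate n) P Y S 0).toReal
  set a := fun n => (serviceLength (rate n) P (Y 0)).toReal
  set a' := fun n => (∫⁻ ω, disc (rate n) (Y 0 ω) * Y 0 ω ∂P).toReal
  set b := fun n => (serviceCost (rate n) P (Y 0)).toReal
  set ξ := fun n => rate n * (totalDisc (rate n) P Y S).toReal
  set k := meanCorrection P β (Y 0)
  refine le_of_tendsto_affine (A := fun n => (φ n * (β / 3) + a n) * x n - b n * (rate n * x n) -
      c.toReal * (rate n * T₀)) (B := fun n => -((φ n * (β / 3) + a n) * a n) + a n * a' n + b n -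
      φ n * k) (a := a) (ξ := ξ) ?_ ?_ la ha₀
    (fun n => mul_nonneg (rate_pos n).le ENNReal.toReal_nonneg)
    (fun n => (hT (rate n) (rate_pos n)).2) (fun n => ?_) hV hκ
  · have := ((((lφ.mul_const (β / 3)).add la).mul lx).sub (lb.mul (tendsto_rate.mul lx))).sub
      ((tendsto_rate.mul_const T₀).const_mul c.toReal)
    convert this using 2
    ring
  · have := ((((((lφ.mul_const (β / 3)).add la).mul la).neg).add (la.mul la')).add lb).sub
      (lφ.mul_const k)
    convert this using 2
    rw [cycleExcess]; ring
  · have := (hT (rate n) (rate_pos n)).1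
    simp only [φ, x, a, a', b, ξ, k, meanCorrection]
    linarith

end Vanishing

/-! ### Regenerative sampling times -/

section Renewal

variable {Ω : Type*} [mΩ : MeasurableSpace Ω] {P : Measure Ω}
  {S : ℕ → Ω → ℝ≥0∞} {k : ℕ → Ω → ℕ}

/-- Nondecreasing sampling times with regeneration indices `k`; only the properties of the first
cycle are recorded of the moment conditions. -/
structure IsRegenerationIndex (P : Measure Ω) (S : ℕ → Ω → ℝ≥0∞) (k : ℕ → Ω → ℕ) : Prop where
  measS : ∀ i, Measurable (S i)
  zero : ∀ ω, S 0 ω = 0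
  mono : ∀ ω, Monotone fun i => S i ω
  fin : ∀ᵐ ω ∂P, ∀ i, S i ω ≠ ∞
  meas : ∀ j, Measurable (k j)
  lt : ∀ j ω, k j ω < k (j + 1) ω
  ident : ∀ j, IdentDistrib (postProcess (interSampling S) k j)
    (postProcess (interSampling S) k 0) P P
  indep : ∀ j, IndepFun (preProcess (interSampling S) k j) (postProcess (interSampling S) k j) P
  length_fin : ∫⁻ ω, ((k 1 ω - k 0 ω : ℕ) : ℝ≥0∞) ∂P < ∞
  start_fin : ∫⁻ ω, (S (k 0 ω) ω) ^ 2 ∂P < ∞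
  cycle_pos : 0 < ∫⁻ ω, (S (k 1 ω) ω - S (k 0 ω) ω) ^ 2 ∂P
  cycle_fin : ∫⁻ ω, (S (k 1 ω) ω - S (k 0 ω) ω) ^ 2 ∂P < ∞

lemma IsOnlinePolicy.exists_regenerationIndex {W : ℝ≥0 → Ω → ℝ} {Y : ℕ → Ω → ℝ≥0}
    (h : IsModel P W Y) (hS : IsOnlinePolicy P W Y S) : ∃ k, IsRegenerationIndex P S k := by
  obtain ⟨k, h1, h2, h3, h4, h5, h6, h7⟩ := hS.regenerative
  exact ⟨k, hS.measurable_sampling h, hS.zero, hS.sampling_mono, hS.ae_sampling_ne_top h, h1, h2,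
    h3, h4, h5 0, h6, (h7 0).1, (h7 0).2⟩

/-- The length of the cycle that begins at the regeneration index `k j`. -/
def cycleLength (S : ℕ → Ω → ℝ≥0∞) (k : ℕ → Ω → ℕ) (j : ℕ) (ω : Ω) : ℝ≥0∞ :=
  ∑ i ∈ Finset.range (k (j + 1) ω - k j ω), interSampling S (k j ω + i) ω

/-- The number of samples in the cycle that begins at the regeneration index `k j`. -/
def cycleCount (k : ℕ → Ω → ℕ) (j : ℕ) (ω : Ω) : ℝ≥0∞ := ((k (j + 1) ω - k j ω : ℕ) : ℝ≥0∞)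

namespace IsRegenerationIndex

omit mΩ in
lemma tsum_ite_lt (f : ℕ → ℝ≥0∞) (n : ℕ) :
    ∑' i, (if i < n then f i else 0) = ∑ i ∈ Finset.range n, f i := by
  rw [tsum_eq_sum (s := Finset.range n) fun i hi => if_neg (by simpa using hi)]
  exact Finset.sum_congr rfl fun i hi => if_pos (Finset.mem_range.1 hi)

lemma sampling_add (h : IsRegenerationIndex P S k) (m n : ℕ) (ω : Ω) :
    S (m + n) ω = S m ω + ∑ i ∈ Finset.range n, interSampling S (m + i) ω := by
  induction n with
  | zero => simp
  | succ n ih =>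
    rw [Finset.sum_range_succ, ← add_assoc (S m ω), ← ih]
    exact (add_tsub_cancel_of_le (h.mono ω (Nat.le_succ (m + n)))).symm

lemma sampling_succ (h : IsRegenerationIndex P S k) (j : ℕ) (ω : Ω) :
    S (k (j + 1) ω) ω = S (k j ω) ω + cycleLength S k j ω := by
  rw [cycleLength, ← h.sampling_add, Nat.add_sub_cancel' (h.lt j ω).le]

lemma le_index (h : IsRegenerationIndex P S k) (j : ℕ) (ω : Ω) : j ≤ k j ω := by
  induction j with
  | zero => exact Nat.zero_le _
  | succ j ih => exact Nat.succ_le_of_lt (ih.trans_lt (h.lt j ω))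

lemma measurable_interSampling (h : IsRegenerationIndex P S k) (i : ℕ) :
    Measurable (interSampling S i) := (h.measS (i + 1)).sub (h.measS i)

lemma measurable_preProcess (h : IsRegenerationIndex P S k) (j : ℕ) :
    Measurable (preProcess (interSampling S) k j) := by
  have h1 : Measurable fun (ω : Ω) (i : Fin (j + 1)) => k i ω :=
    measurable_pi_lambda _ fun i => h.meas i
  have h2 : Measurable fun (ω : Ω) (i : ℕ) => if i < k j ω then interSampling S i ω else 0 :=
    measurable_pi_lambda _ fun i => Measurable.ite (measurableSet_lt measurable_const (h.meas j))
      (h.measurable_interSampling i) measurable_const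
  exact h1.prodMk h2

/-- A regeneration epoch is a function of the pre-process. -/
lemma tsum_pre_interSampling (h : IsRegenerationIndex P S k) (j : ℕ) (ω : Ω) :
    ∑' i, (preProcess (interSampling S) k j ω).2 i = S (k j ω) ω := by
  have := h.sampling_add 0 (k j ω) ω
  simp only [zero_add, h.zero] at this
  rw [this]
  exact tsum_ite_lt _ _

/-- A quantity that is determined before a regeneration index is independent of a quantity that is
determined afterwards. -/
lemma lintegral_pre_mul_post (h : IsRegenerationIndex P S k) (j : ℕ)
    {F : (Fin (j + 1) → ℕ) × (ℕ → ℝ≥0∞) → ℝ≥0∞} (hF : Measurable F)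
    {H : (ℕ → ℝ≥0∞) × (ℕ → ℕ) → ℝ≥0∞} (hH : Measurable H) :
    ∫⁻ ω, F (preProcess (interSampling S) k j ω) * H (postProcess (interSampling S) k j ω) ∂P =
      (∫⁻ ω, F (preProcess (interSampling S) k j ω) ∂P) *
        ∫⁻ ω, H (postProcess (interSampling S) k 0 ω) ∂P := by
  have e := lintegral_mul_eq_lintegral_mul_lintegral_of_indepFun''
    (hF.comp (measurable_preProcess h j)).aemeasurable
    (hH.comp_aemeasurable (h.ident j).aemeasurable_fst) ((h.indep j).comp hF hH)
  exact e.trans (congrArg _ ((h.ident j).comp hH).lintegral_eq)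

/-- The length of the first cycle, as a function of the post-process. -/
def lengthOf (p : (ℕ → ℝ≥0∞) × (ℕ → ℕ)) : ℝ≥0∞ := ∑' i, if i < p.2 0 then p.1 i else 0

lemma measurable_lengthOf : Measurable lengthOf := by
  refine Measurable.tsum fun i => Measurable.ite ?_ (by fun_prop) measurable_const
  exact measurableSet_lt measurable_const ((measurable_pi_apply 0).comp measurable_snd)

omit mΩ in
lemma lengthOf_postProcess (j : ℕ) (ω : Ω) :
    lengthOf (postProcess (interSampling S) k j ω) = cycleLength S k j ω := tsum_ite_lt _ _

lemma measurable_countOf (b : ℕ) :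
    Measurable fun p : (ℕ → ℝ≥0∞) × (ℕ → ℕ) => ((min (p.2 0) b : ℕ) : ℝ≥0∞) :=
  (measurable_from_nat (f := fun n => ((min n b : ℕ) : ℝ≥0∞))).comp
    ((measurable_pi_apply 0).comp measurable_snd)

lemma measurable_index_lt (j n : ℕ) : Measurable
    fun p : (Fin (j + 1) → ℕ) × (ℕ → ℝ≥0∞) => if p.1 (Fin.last j) < n then (1 : ℝ≥0∞) else 0 :=
  Measurable.ite (measurableSet_lt ((measurable_pi_apply _).comp measurable_fst) measurable_const)
    measurable_const measurable_const

lemma measurable_cycleLength (h : IsRegenerationIndex P S k) (j : ℕ) :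
    Measurable (cycleLength S k j) := by
  have e : cycleLength S k j = fun ω => ∑' i,
      if i < k (j + 1) ω - k j ω then interSampling S (k j ω + i) ω else 0 := by
    ext ω; rw [tsum_ite_lt]; rfl
  rw [e]
  refine Measurable.tsum fun i => Measurable.ite ?_ ?_ measurable_const
  · exact measurableSet_lt measurable_const ((measurable_from_nat (f := id)).comp
      ((h.meas (j + 1)).sub (h.meas j)))
  · exact measurable_sample (S := fun n ω => interSampling S (n + i) ω) (h.meas j)
      fun n => h.measurable_interSampling (n + i)

lemma ae_cycleLength_eq (h : IsRegenerationIndex P S k) :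
    ∀ᵐ ω ∂P, cycleLength S k 0 ω = S (k 1 ω) ω - S (k 0 ω) ω := by
  filter_upwards [h.fin] with ω hω
  rw [h.sampling_succ 0, ENNReal.add_sub_cancel_left (hω _)]

lemma ne_top_of_sq [IsProbabilityMeasure P] {f : Ω → ℝ≥0∞} (hf : ∫⁻ ω, f ω ^ 2 ∂P < ∞) :
    ∫⁻ ω, f ω ∂P ≠ ∞ := by
  refine ne_top_of_le_ne_top (ENNReal.add_ne_top.2 ⟨ENNReal.one_ne_top, hf.ne⟩)
    (b := 1 + ∫⁻ ω, f ω ^ 2 ∂P) ?_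
  calc ∫⁻ ω, f ω ∂P ≤ ∫⁻ ω, (1 + f ω ^ 2) ∂P := by
        refine lintegral_mono fun ω => ?_
        rcases le_total (f ω) 1 with h1 | h1
        · exact h1.trans le_self_add
        · calc f ω = f ω * 1 := (mul_one _).symm
            _ ≤ f ω * f ω := by gcongr
            _ = f ω ^ 2 := (sq _).symm
            _ ≤ _ := le_add_self
    _ = _ := by rw [lintegral_add_left measurable_const]; simp

lemma meanCycle_ne_top [IsProbabilityMeasure P] (h : IsRegenerationIndex P S k) :
    ∫⁻ ω, cycleLength S k 0 ω ∂P ≠ ∞ := by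
  rw [lintegral_congr_ae h.ae_cycleLength_eq]; exact ne_top_of_sq h.cycle_fin

lemma meanCycle_ne_zero (h : IsRegenerationIndex P S k) :
    ∫⁻ ω, cycleLength S k 0 ω ∂P ≠ 0 := by
  intro h0
  have h1 := (lintegral_eq_zero_iff (h.measurable_cycleLength 0)).1 h0
  refine h.cycle_pos.ne' ((lintegral_congr_ae ?_).trans lintegral_zero)
  filter_upwards [h1, h.ae_cycleLength_eq] with ω h2 h3
  rw [← h3, h2]; simp

lemma one_le_meanCount [IsProbabilityMeasure P] (h : IsRegenerationIndex P S k) {b : ℕ}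
    (hb : 1 ≤ b) :
    1 ≤ ∫⁻ ω, ((min (k 1 ω - k 0 ω) b : ℕ) : ℝ≥0∞) ∂P := by
  calc (1 : ℝ≥0∞) = ∫⁻ _, 1 ∂P := by simp
    _ ≤ _ := lintegral_mono fun ω => by
      have : k 0 ω < k 1 ω := h.lt 0 ω
      have h1 : 1 ≤ min (k 1 ω - k 0 ω) b := by omega
      show (1 : ℝ≥0∞) ≤ _
      exact_mod_cast h1

/-- A bound on the expected number of cycles that begin before the sample `n`. The number of samples
in a cycle is truncated at `b`, which bounds the overshoot of the last cycle. -/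
lemma tsum_prob_mul_le (h : IsRegenerationIndex P S k) [IsProbabilityMeasure P] (n b : ℕ) :
    (∑' j, ∫⁻ ω, (if k j ω < n then 1 else 0) ∂P) *
      ∫⁻ ω, ((min (k 1 ω - k 0 ω) b : ℕ) : ℝ≥0∞) ∂P ≤ n + b := by
  have e : ∀ j, ∫⁻ ω, (if k j ω < n then 1 else 0) * ((min (k (j + 1) ω - k j ω) b : ℕ) : ℝ≥0∞) ∂P =
      (∫⁻ ω, (if k j ω < n then 1 else 0) ∂P) *
        ∫⁻ ω, ((min (k 1 ω - k 0 ω) b : ℕ) : ℝ≥0∞) ∂P :=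
    fun j => h.lintegral_pre_mul_post j (measurable_index_lt j n) (measurable_countOf b)
  rw [← ENNReal.tsum_mul_right]
  simp_rw [← e]
  have hm : ∀ j, Measurable fun ω =>
      (if k j ω < n then 1 else 0) * ((min (k (j + 1) ω - k j ω) b : ℕ) : ℝ≥0∞) := fun j =>
    (Measurable.ite (measurableSet_lt (h.meas j) measurable_const) measurable_const
      measurable_const).mul ((measurable_from_nat (f := fun i => ((min i b : ℕ) : ℝ≥0∞))).comp
        ((h.meas (j + 1)).sub (h.meas j)))
  rw [← lintegral_tsum fun j => (hm j).aemeasurable]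
  calc _ ≤ ∫⁻ _, ((n : ℝ≥0∞) + b) ∂P := by
        refine lintegral_mono fun ω => ENNReal.tsum_le_of_sum_range_le fun J => ?_
        have key : ∀ J, ∑ j ∈ Finset.range J,
            (if k j ω < n then min (k (j + 1) ω - k j ω) b else 0) ≤
            (if k J ω < n then k J ω else n + b) := by
          intro J
          induction J with
          | zero => simp
          | succ J ih =>
            rw [Finset.sum_range_succ]
            have h1 := h.lt J ω
            split_ifs at ih ⊢ <;> omega
        have h2 : ∑ j ∈ Finset.range J,
            (if k j ω < n then min (k (j + 1) ω - k j ω) b else 0) ≤ n + b :=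
          (key J).trans (by split_ifs <;> omega)
        calc _ = ((∑ j ∈ Finset.range J,
              (if k j ω < n then min (k (j + 1) ω - k j ω) b else 0) : ℕ) : ℝ≥0∞) := by
              push_cast
              refine Finset.sum_congr rfl fun j _ => ?_
              split_ifs <;> simp
          _ ≤ ((n + b : ℕ) : ℝ≥0∞) := by exact_mod_cast h2
          _ = _ := by push_cast; rfl
    _ = _ := by simp

/-- A sample is taken at the latest at the end of the last cycle that begins before it. -/
lemma lintegral_sampling_le (h : IsRegenerationIndex P S k) (n : ℕ) :
    ∫⁻ ω, S n ω ∂P ≤ ∫⁻ ω, S (k 0 ω) ω ∂P +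
      (∑' j, ∫⁻ ω, (if k j ω < n then 1 else 0) ∂P) * ∫⁻ ω, cycleLength S k 0 ω ∂P := by
  have e : ∀ j, ∫⁻ ω, (if k j ω < n then 1 else 0) * cycleLength S k j ω ∂P =
      (∫⁻ ω, (if k j ω < n then 1 else 0) ∂P) * ∫⁻ ω, cycleLength S k 0 ω ∂P := fun j => by
    have := h.lintegral_pre_mul_post j (measurable_index_lt j n) measurable_lengthOf
    simp only [lengthOf_postProcess] at this
    exact this
  have hm : ∀ j, Measurable fun ω => (if k j ω < n then 1 else 0) * cycleLength S k j ω := fun j =>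
    (Measurable.ite (measurableSet_lt (h.meas j) measurable_const) measurable_const
      measurable_const).mul (h.measurable_cycleLength j)
  rw [← ENNReal.tsum_mul_right]
  simp_rw [← e]
  rw [← lintegral_tsum fun j => (hm j).aemeasurable,
    ← lintegral_add_left (measurable_sample (h.meas 0) h.measS)]
  refine lintegral_mono fun ω => ?_
  have key : ∀ J, min (S n ω) (S (k J ω) ω) ≤ S (k 0 ω) ω +
      ∑ j ∈ Finset.range J, (if k j ω < n then 1 else 0) * cycleLength S k j ω := by
    intro J
    induction J with
    | zero => simp
    | succ J ih =>
      rw [Finset.sum_range_succ, ← add_assoc]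
      by_cases hJ : k J ω < n
      · rw [if_pos hJ, one_mul]
        rw [min_eq_right (h.mono ω hJ.le)] at ih
        calc _ ≤ S (k (J + 1) ω) ω := min_le_right _ _
          _ = _ := h.sampling_succ J ω
          _ ≤ _ := by gcongr
      · rw [if_neg hJ, zero_mul, add_zero]
        rw [min_eq_left (h.mono ω (not_lt.1 hJ))] at ih
        exact (min_le_left _ _).trans ih
  have h1 := key n
  rw [min_eq_left (h.mono ω (h.le_index n ω))] at h1
  refine h1.trans ?_
  gcongr
  exact ENNReal.sum_le_tsum _

/-- The asymptotic mean inter-sampling time is at most the mean length of a cycle, divided by its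
mean number of samples. -/
theorem liminf_le (h : IsRegenerationIndex P S k) [IsProbabilityMeasure P] :
    liminf (fun n : ℕ => (∫⁻ ω, S n ω ∂P) / (n : ℝ≥0∞)) atTop ≤
      (∫⁻ ω, cycleLength S k 0 ω ∂P) / ∫⁻ ω, cycleCount k 0 ω ∂P := by
  set C := ∫⁻ ω, cycleLength S k 0 ω ∂P
  set A := ∫⁻ ω, S (k 0 ω) ω ∂P
  have hC : C ≠ ∞ := h.meanCycle_ne_top
  have hA : A ≠ ∞ := ne_top_of_sq h.start_fin
  set K : ℕ → ℝ≥0∞ := fun b => ∫⁻ ω, ((min (k 1 ω - k 0 ω) b : ℕ) : ℝ≥0∞) ∂P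
  have hK1 : ∀ b, 1 ≤ b → 1 ≤ K b := fun b hb => h.one_le_meanCount hb
  have hKfin : ∀ b, K b ≠ ∞ := fun b => ne_top_of_le_ne_top h.length_fin.ne
    (lintegral_mono fun ω => Nat.cast_le.2 (min_le_left _ _))
  have hb : ∀ b, 1 ≤ b →
      liminf (fun n : ℕ => (∫⁻ ω, S n ω ∂P) / (n : ℝ≥0∞)) atTop ≤ C / K b := by
    intro b hb
    have hK0 : K b ≠ 0 := (zero_lt_one.trans_le (hK1 b hb)).ne'
    have hbd : ∀ n : ℕ, 1 ≤ n → (∫⁻ ω, S n ω ∂P) / (n : ℝ≥0∞) ≤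
        (A + b * (C / K b)) * (n : ℝ≥0∞)⁻¹ + C / K b := by
      intro n hn
      have h1 := h.lintegral_sampling_le n
      have h2 : ∑' j, ∫⁻ ω, (if k j ω < n then 1 else 0) ∂P ≤ ((n : ℝ≥0∞) + b) / K b :=
        (ENNReal.le_div_iff_mul_le (Or.inl hK0) (Or.inl (hKfin b))).2 (h.tsum_prob_mul_le n b)
      have hn0 : (n : ℝ≥0∞) ≠ 0 := by exact_mod_cast (Nat.one_le_iff_ne_zero.1 hn)
      calc _ ≤ (A + ((n : ℝ≥0∞) + b) / K b * C) / n := by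
            gcongr; exact h1.trans (by gcongr)
        _ = (A + b * (C / K b)) * (n : ℝ≥0∞)⁻¹ + C / K b * ((n : ℝ≥0∞) * (n : ℝ≥0∞)⁻¹) := by
            simp only [ENNReal.div_eq_inv_mul]; ring
        _ = _ := by rw [ENNReal.mul_inv_cancel hn0 (ENNReal.natCast_ne_top n), mul_one]
    have hlim : Tendsto (fun n : ℕ => (A + b * (C / K b)) * (n : ℝ≥0∞)⁻¹ + C / K b) atTop
        (nhds ((A + b * (C / K b)) * 0 + C / K b)) :=
      (ENNReal.Tendsto.const_mul ENNReal.tendsto_inv_nat_nhds_zero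
        (Or.inr (by finiteness))).add_const _
    rw [mul_zero, zero_add] at hlim
    rw [← hlim.liminf_eq]
    exact liminf_le_liminf ((eventually_ge_atTop 1).mono fun n hn => hbd n hn)
  have hKlim : Tendsto K atTop (nhds (∫⁻ ω, cycleCount k 0 ω ∂P)) := by
    refine lintegral_tendsto_of_tendsto_of_monotone (fun b => ?_) (ae_of_all _ fun ω b b' hbb => ?_)
      (ae_of_all _ fun ω => ?_)
    · exact ((measurable_from_nat (f := fun i => ((min i b : ℕ) : ℝ≥0∞))).comp
        ((h.meas 1).sub (h.meas 0))).aemeasurable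
    · exact Nat.cast_le.2 (min_le_min_left _ hbb)
    · refine tendsto_const_nhds.congr' ?_
      filter_upwards [eventually_ge_atTop (k 1 ω - k 0 ω)] with b hb
      rw [min_eq_left hb]; rfl
  refine ge_of_tendsto (ENNReal.Tendsto.div tendsto_const_nhds (Or.inl h.meanCycle_ne_zero) hKlim
    (Or.inr hC)) ((eventually_ge_atTop 1).mono fun b hb' => hb b hb')

/-- The cycles being independent, the discount factor of a regeneration epoch is at most a power of
the discount factor of one cycle. -/
lemma lintegral_disc_index_le (h : IsRegenerationIndex P S k) [IsProbabilityMeasure P] {α : ℝ}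
    (hα : 0 < α) (j : ℕ) : ∫⁻ ω, disc α (S (k j ω) ω) ∂P ≤
      (∫⁻ ω, disc α (cycleLength S k 0 ω) ∂P) ^ j := by
  induction j with
  | zero => exact (lintegral_mono fun ω => disc_le_one hα.le _).trans (by simp)
  | succ j ih =>
    have e := h.lintegral_pre_mul_post j
      (F := fun p => disc α (∑' i, p.2 i)) (H := fun p => disc α (lengthOf p))
      ((measurable_disc α).comp (Measurable.tsum fun i => by fun_prop))
      ((measurable_disc α).comp measurable_lengthOf)
    simp only [h.tsum_pre_interSampling, lengthOf_postProcess] at e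
    simp_rw [h.sampling_succ j, disc_add]
    rw [e, pow_succ]
    gcongr

/-- The expected discounted number of samples after the first regeneration: all samples of a cycle
are discounted from its beginning, and the discount factors of the cycles form a geometric
series. -/
lemma tail_le (h : IsRegenerationIndex P S k) [IsProbabilityMeasure P] {α : ℝ} (hα : 0 < α) :
    ∑' i, ∫⁻ ω, (if k 0 ω ≤ i then disc α (S i ω) else 0) ∂P ≤
      (∫⁻ ω, cycleCount k 0 ω ∂P) * (1 - ∫⁻ ω, disc α (cycleLength S k 0 ω) ∂P)⁻¹ := by
  have hm : ∀ i, Measurable fun ω => if k 0 ω ≤ i then disc α (S i ω) else 0 := fun i =>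
    Measurable.ite (measurableSet_le (h.meas 0) measurable_const)
      ((measurable_disc α).comp (h.measS i)) measurable_const
  have hmc : ∀ j, Measurable (cycleCount k j) := fun j =>
    (measurable_from_nat (f := fun i => ((i : ℕ) : ℝ≥0∞))).comp ((h.meas (j + 1)).sub (h.meas j))
  have hmd : ∀ j, Measurable fun ω => disc α (S (k j ω) ω) := fun j =>
    (measurable_disc α).comp (measurable_sample (h.meas j) h.measS)
  rw [← lintegral_tsum fun i => (hm i).aemeasurable]
  have e : ∀ j, ∫⁻ ω, disc α (S (k j ω) ω) * cycleCount k j ω ∂P =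
      (∫⁻ ω, disc α (S (k j ω) ω) ∂P) * ∫⁻ ω, cycleCount k 0 ω ∂P := fun j => by
    have e1 := h.lintegral_pre_mul_post j
      (F := fun p => disc α (∑' i, p.2 i)) (H := fun p => ((p.2 0 : ℕ) : ℝ≥0∞))
      ((measurable_disc α).comp (Measurable.tsum fun i => by fun_prop))
      ((measurable_from_nat (f := fun i => ((i : ℕ) : ℝ≥0∞))).comp
        ((measurable_pi_apply 0).comp measurable_snd))
    simp only [h.tsum_pre_interSampling] at e1
    exact e1
  calc _ ≤ ∫⁻ ω, ∑' j, disc α (S (k j ω) ω) * cycleCount k j ω ∂P := by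
        refine lintegral_mono fun ω => ENNReal.tsum_le_of_sum_range_le fun N => ?_
        have key : ∀ J, ∑ i ∈ Finset.range (k J ω), (if k 0 ω ≤ i then disc α (S i ω) else 0) ≤
            ∑ j ∈ Finset.range J, disc α (S (k j ω) ω) * cycleCount k j ω := by
          intro J
          induction J with
          | zero =>
            refine (Finset.sum_eq_zero fun i hi => if_neg ?_).le
            have := Finset.mem_range.1 hi; omega
          | succ J ih =>
            rw [Finset.sum_range_succ, ← Finset.sum_range_add_sum_Ico _ (h.lt J ω).le]
            gcongr
            calc _ ≤ ∑ i ∈ Finset.Ico (k J ω) (k (J + 1) ω), disc α (S (k J ω) ω) := by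
                  refine Finset.sum_le_sum fun i hi => ?_
                  split_ifs
                  · exact disc_antitone hα.le (h.mono ω (Finset.mem_Ico.1 hi).1)
                  · exact zero_le
              _ = _ := by
                rw [Finset.sum_const, Nat.card_Ico, nsmul_eq_mul, mul_comm]; rfl
        calc _ ≤ ∑ i ∈ Finset.range (k N ω), (if k 0 ω ≤ i then disc α (S i ω) else 0) :=
              Finset.sum_le_sum_of_subset (Finset.range_subset_range.2 (h.le_index N ω))
          _ ≤ _ := key N
          _ ≤ _ := ENNReal.sum_le_tsum _
    _ = ∑' j, ∫⁻ ω, disc α (S (k j ω) ω) * cycleCount k j ω ∂P :=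
        lintegral_tsum fun j => ((hmd j).mul (hmc j)).aemeasurable
    _ ≤ ∑' j, (∫⁻ ω, disc α (cycleLength S k 0 ω) ∂P) ^ j * ∫⁻ ω, cycleCount k 0 ω ∂P := by
        refine ENNReal.tsum_le_tsum fun j => ?_
        rw [e]
        gcongr
        exact h.lintegral_disc_index_le hα j
    _ = _ := by rw [ENNReal.tsum_mul_right, ENNReal.tsum_geometric, mul_comm]

end IsRegenerationIndex

end Renewal

/-! ### The discounted number of samples of a regenerative policy -/

section DiscountedNumber

variable {Ω : Type*} [mΩ : MeasurableSpace Ω] {P : Measure Ω}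
  {W : ℝ≥0 → Ω → ℝ} {Y : ℕ → Ω → ℝ≥0} {S : ℕ → Ω → ℝ≥0∞} {k : ℕ → Ω → ℕ}

/-- A sequence that is dominated by `φ ^ i` and by a null sequence has a sum of order
`o(1 / (1 - φ))`: the two bounds are combined by their geometric mean. -/
lemma tsum_le_of_le_pow {y : ℕ → ℝ≥0∞} {φ δ : ℝ} (hφ0 : 0 ≤ φ) (hφ1 : φ < 1) (hδ : 0 ≤ δ) {i₀ : ℕ}
    (h1 : ∀ i, y i ≤ ofReal (φ ^ i)) (h2 : ∀ i, i₀ ≤ i → y i ≤ ofReal (δ ^ 2)) :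
    ∑' i, y i ≤ ofReal (i₀ + 2 * δ / (1 - φ)) := by
  have hs0 := Real.sqrt_nonneg φ
  have hs1 : Real.sqrt φ < 1 := by rw [Real.sqrt_lt' one_pos]; simpa using hφ1
  have hsq := Real.sq_sqrt hφ0
  have hb : ∀ i, y i ≤ (if i < i₀ then 1 else 0) + ofReal (δ * Real.sqrt φ ^ i) := by
    intro i
    by_cases hi : i < i₀
    · rw [if_pos hi]
      refine (h1 i).trans (le_add_right ?_)
      rw [← ENNReal.ofReal_one]
      exact ENNReal.ofReal_le_ofReal (pow_le_one₀ hφ0 hφ1.le)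
    · rw [if_neg hi, zero_add]
      have hfin : y i ≠ ∞ := ne_top_of_le_ne_top ENNReal.ofReal_ne_top (h1 i)
      rw [← ENNReal.ofReal_toReal hfin]
      refine ENNReal.ofReal_le_ofReal (abs_le_of_sq_le_sq' ?_ (by positivity)).2
      have e1 : (y i).toReal ≤ φ ^ i := ENNReal.toReal_le_of_le_ofReal (by positivity) (h1 i)
      have e2 : (y i).toReal ≤ δ ^ 2 :=
        ENNReal.toReal_le_of_le_ofReal (by positivity) (h2 i (not_lt.1 hi))
      calc (y i).toReal ^ 2 = (y i).toReal * (y i).toReal := sq _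
        _ ≤ δ ^ 2 * φ ^ i := by gcongr
        _ = (δ * Real.sqrt φ ^ i) ^ 2 := by
          rw [mul_pow, ← pow_mul, mul_comm i 2, pow_mul, hsq]
  calc ∑' i, y i ≤ ∑' i, ((if i < i₀ then 1 else 0) + ofReal (δ * Real.sqrt φ ^ i)) :=
        ENNReal.tsum_le_tsum hb
    _ = i₀ + ofReal (δ * (1 - Real.sqrt φ)⁻¹) := by
        rw [ENNReal.tsum_add, IsRegenerationIndex.tsum_ite_lt (fun _ => 1),
          ← ENNReal.ofReal_tsum_of_nonneg (fun i => by positivity)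
            ((summable_geometric_of_lt_one hs0 hs1).mul_left δ), tsum_mul_left,
          tsum_geometric_of_lt_one hs0 hs1]
        simp
    _ ≤ _ := by
        rw [ENNReal.ofReal_add (Nat.cast_nonneg _)
          (div_nonneg (by positivity) (by linarith)), ENNReal.ofReal_natCast]
        gcongr
        rw [← div_eq_mul_inv, div_le_div_iff₀ (by linarith) (by linarith)]
        nlinarith [mul_nonneg hδ (mul_nonneg (sub_nonneg.2 hs1.le) (sub_nonneg.2 hs1.le))]

lemma lintegral_toNNReal_cycleLength [IsProbabilityMeasure P] (hk : IsRegenerationIndex P S k)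
    (f : ℝ≥0∞ → ℝ≥0∞) :
    ∫⁻ ω, f (cycleLength S k 0 ω) ∂P = ∫⁻ ω, f ((cycleLength S k 0 ω).toNNReal : ℝ≥0∞) ∂P := by
  refine lintegral_congr_ae ?_
  filter_upwards [ae_lt_top (hk.measurable_cycleLength 0) hk.meanCycle_ne_top] with ω hω
  rw [ENNReal.coe_toNNReal hω.ne]

/-- The discounted number of samples is asymptotically at most the mean number of samples in a
cycle, divided by the mean length of a cycle. -/
theorem IsOnlinePolicy.eventually_totalDisc_le (h : IsModel P W Y) (hS : IsOnlinePolicy P W Y S)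
    (hY : ∫⁻ ω, (Y 0 ω : ℝ≥0∞) ∂P ≠ 0) (hk : IsRegenerationIndex P S k) {ε : ℝ} (hε : 0 < ε) :
    ∀ᶠ n in atTop, rate n * (totalDisc (rate n) P Y S).toReal ≤
      (∫⁻ ω, cycleCount k 0 ω ∂P).toReal / (∫⁻ ω, cycleLength S k 0 ω ∂P).toReal + ε := by
  have := h.isProbabilityMeasure
  set K := ∫⁻ ω, cycleCount k 0 ω ∂P
  set C := ∫⁻ ω, cycleLength S k 0 ω ∂P
  set a := (∫⁻ ω, (Y 0 ω : ℝ≥0∞) ∂P).toReal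
  have ha0 : 0 < a := ENNReal.toReal_pos hY h.lintegral_ne_top
  have hK : K ≠ ∞ := hk.length_fin.ne
  set Z : Ω → ℝ≥0 := fun ω => (cycleLength S k 0 ω).toNNReal
  have hZ : Measurable Z := (hk.measurable_cycleLength 0).ennreal_toNNReal
  have hCZ : C = ∫⁻ ω, (Z ω : ℝ≥0∞) ∂P := lintegral_toNNReal_cycleLength hk id
  have hCfin : C ≠ ∞ := hk.meanCycle_ne_top
  have hC0 : 0 < C.toReal := ENNReal.toReal_pos hk.meanCycle_ne_zero hCfin
  set δ := ε * a / 4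
  have hδ : 0 < δ := by positivity
  -- the first regeneration occurs late with small probability
  have hp : Tendsto (fun i : ℕ => P {ω | i < k 0 ω}) atTop (nhds 0) := by
    have h1 := tendsto_measure_iInter_atTop (μ := P) (s := fun i : ℕ => {ω | i < k 0 ω})
      (fun i => (measurableSet_lt measurable_const (hk.meas 0)).nullMeasurableSet)
      (fun i j hij ω hω => lt_of_le_of_lt hij hω) ⟨0, measure_ne_top _ _⟩
    have e : ⋂ i : ℕ, {ω | i < k 0 ω} = ∅ := by
      refine Set.eq_empty_of_forall_notMem fun ω hω => ?_
      have h2 : k 0 ω < k 0 ω := Set.mem_iInter.1 hω (k 0 ω)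
      exact lt_irrefl _ h2
    rw [e, measure_empty] at h1
    exact h1
  obtain ⟨i₀, hi₀⟩ := ((hp.eventually_le_const (ENNReal.ofReal_pos.2
    (by positivity : 0 < δ ^ 2))).exists_forall_of_atTop)
  have hstage : ∀ n : ℕ, rate n * (totalDisc (rate n) P Y S).toReal ≤
      rate n * i₀ + 2 * δ / (serviceLength (rate n) P (Y 0)).toReal +
        K.toReal / (serviceLength (rate n) P Z).toReal := by
    intro n
    set α := rate n
    have hα : 0 < α := rate_pos n
    set φ := ∫⁻ ω, disc α (Y 0 ω) ∂P
    set ψ := ∫⁻ ω, disc α (cycleLength S k 0 ω) ∂P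
    have hφ1 : φ < 1 := h.lintegral_disc_lt_one hY hα
    have hφ := (hφ1.trans_le le_top).ne
    have e1 : φ + ofReal α * serviceLength α P (Y 0) = 1 :=
      disc_add_serviceLength hα (h.measY 0)
    have e2 : ψ + ofReal α * serviceLength α P Z = 1 := by
      have := disc_add_serviceLength (P := P) hα hZ
      rw [← lintegral_toNNReal_cycleLength hk (disc α)] at this
      exact this
    have hla : serviceLength α P (Y 0) ≠ ∞ :=
      ne_top_of_le_ne_top h.lintegral_ne_top (serviceLength_le hα _)
    have hlz : serviceLength α P Z ≠ ∞ :=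
      ne_top_of_le_ne_top (hCZ ▸ hCfin) (serviceLength_le hα _)
    have hψ : ψ ≠ ∞ := ne_top_of_le_ne_top ENNReal.one_ne_top (e2 ▸ le_self_add)
    have hlz0 : serviceLength α P Z ≠ 0 :=
      serviceLength_ne_zero hZ (hCZ ▸ hk.meanCycle_ne_zero) α
    have e1r : φ.toReal + α * (serviceLength α P (Y 0)).toReal = 1 := by
      have := congrArg ENNReal.toReal e1
      rwa [ENNReal.toReal_add hφ (ENNReal.mul_ne_top ENNReal.ofReal_ne_top hla),
        ENNReal.toReal_mul, ENNReal.toReal_ofReal hα.le, ENNReal.toReal_one] at this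
    have hφr : φ.toReal < 1 := by
      have := (ENNReal.toReal_lt_toReal hφ ENNReal.one_ne_top).2 hφ1
      rwa [ENNReal.toReal_one] at this
    set y : ℕ → ℝ≥0∞ := fun i => ∫⁻ ω, (if i < k 0 ω then disc α (serviceStart Y S i ω) else 0) ∂P
    have hy1 : ∀ i, y i ≤ ofReal (φ.toReal ^ i) := fun i => by
      rw [ENNReal.ofReal_pow ENNReal.toReal_nonneg, ENNReal.ofReal_toReal hφ]
      refine le_trans (lintegral_mono fun ω => ?_) (hS.stageDisc_le_pow h hα i)
      split_ifs
      · exact le_rfl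
      · exact zero_le
    have hy2 : ∀ i, i₀ ≤ i → y i ≤ ofReal (δ ^ 2) := fun i hi => by
      refine le_trans ?_ (hi₀ i hi)
      rw [← lintegral_indicator_one (measurableSet_lt measurable_const (hk.meas 0))]
      refine lintegral_mono fun ω => ?_
      by_cases hω : i < k 0 ω
      · rw [if_pos hω, Set.indicator_of_mem (show ω ∈ {ω | i < k 0 ω} from hω)]
        exact disc_le_one hα.le _
      · rw [if_neg hω]; exact zero_le
    have hhead := tsum_le_of_le_pow ENNReal.toReal_nonneg hφr hδ.le hy1 hy2
    have htail := hk.tail_le hα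
    have hsplit : totalDisc α P Y S ≤ ∑' i, y i +
        ∑' i, ∫⁻ ω, (if k 0 ω ≤ i then disc α (S i ω) else 0) ∂P := by
      rw [← ENNReal.tsum_add]
      refine ENNReal.tsum_le_tsum fun i => ?_
      have hm : Measurable fun ω => if k 0 ω ≤ i then disc α (S i ω) else 0 :=
        Measurable.ite (measurableSet_le (hk.meas 0) measurable_const)
          ((measurable_disc α).comp (hk.measS i)) measurable_const
      rw [← lintegral_add_right _ hm]
      refine lintegral_mono fun ω => ?_
      by_cases hω : i < k 0 ω
      · rw [if_pos hω]; exact le_self_add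
      · rw [if_neg hω, if_pos (not_lt.1 hω), zero_add]
        exact disc_antitone hα.le ((hk.mono ω (Nat.le_succ i)).trans (le_max_left _ _))
    have htot : totalDisc α P Y S ≤ ofReal (i₀ + 2 * δ / (1 - φ.toReal)) +
        K * (ofReal α * serviceLength α P Z)⁻¹ := by
      refine (hsplit.trans (add_le_add hhead htail)).trans_eq ?_
      rw [← e2, ENNReal.add_sub_cancel_left hψ]
    have hα0 := (ENNReal.ofReal_pos.2 hα).ne'
    have hfin2 : K * (ofReal α * serviceLength α P Z)⁻¹ ≠ ∞ :=
      ENNReal.mul_ne_top hK (ENNReal.inv_ne_top.2 (mul_ne_zero hα0 hlz0))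
    have := ENNReal.toReal_mono (ENNReal.add_ne_top.2 ⟨ENNReal.ofReal_ne_top, hfin2⟩) htot
    rw [ENNReal.toReal_add ENNReal.ofReal_ne_top hfin2, ENNReal.toReal_ofReal
      (add_nonneg (Nat.cast_nonneg _) (div_nonneg (by positivity) (by linarith))),
      ENNReal.toReal_mul, ENNReal.toReal_inv, ENNReal.toReal_mul, ENNReal.toReal_ofReal hα.le,
      show 1 - φ.toReal = α * (serviceLength α P (Y 0)).toReal by linarith] at this
    calc _ ≤ α * (↑i₀ + 2 * δ / (α * (serviceLength α P (Y 0)).toReal) +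
          K.toReal * (α * (serviceLength α P Z).toReal)⁻¹) := by gcongr
      _ = _ := by
        have : (serviceLength α P (Y 0)).toReal ≠ 0 := by
          intro h0; rw [h0] at e1r; linarith
        have : (serviceLength α P Z).toReal ≠ 0 := ENNReal.toReal_ne_zero.2 ⟨hlz0, hlz⟩
        field_simp
  have l1 : Tendsto (fun n => (serviceLength (rate n) P (Y 0)).toReal) atTop (nhds a) :=
    (ENNReal.tendsto_toReal h.lintegral_ne_top).comp
      (tendsto_serviceLength (h.measY 0) h.lintegral_ne_top)
  have l2 : Tendsto (fun n => (serviceLength (rate n) P Z).toReal) atTop (nhds C.toReal) := by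
    rw [hCZ]
    exact (ENNReal.tendsto_toReal (hCZ ▸ hCfin)).comp (tendsto_serviceLength hZ (hCZ ▸ hCfin))
  have l3 : Tendsto (fun n => rate n * i₀ + 2 * δ / (serviceLength (rate n) P (Y 0)).toReal +
        K.toReal / (serviceLength (rate n) P Z).toReal) atTop
      (nhds (0 * i₀ + 2 * δ / a + K.toReal / C.toReal)) :=
    ((tendsto_rate.mul_const _).add (tendsto_const_nhds.div l1 ha0.ne')).add
      (tendsto_const_nhds.div l2 hC0.ne')
  have hlt : 0 * (i₀ : ℝ) + 2 * δ / a + K.toReal / C.toReal < K.toReal / C.toReal + ε := by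
    have : 2 * δ / a = ε / 2 := by simp only [δ]; field_simp; norm_num
    rw [this]; linarith
  filter_upwards [l3.eventually_lt_const hlt] with n hn
  exact (hstage n).trans hn.le

end DiscountedNumber

/-! ### The first exit of a path from an interval -/

section Exit

/-- The first time from `y` on at which the square of the path `x` exceeds `β`. For continuous
paths the restriction to rational times is immaterial, but it makes the exit time a measurable
function of the path. -/
def exitTime (β : ℝ) (x : ℝ≥0 → ℝ) (y : ℝ≥0) : ℝ≥0∞ :=
  ⨅ q : ℚ, ⨅ (_ : y ≤ Real.toNNReal q ∧ β < x (Real.toNNReal q) ^ 2), (Real.toNNReal q : ℝ≥0∞)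

variable {β : ℝ} {x : ℝ≥0 → ℝ} {y r : ℝ≥0}

lemma exitTime_lt_iff {u : ℝ≥0∞} : exitTime β x y < u ↔
    ∃ q : ℚ, (y ≤ Real.toNNReal q ∧ β < x (Real.toNNReal q) ^ 2) ∧
      (Real.toNNReal q : ℝ≥0∞) < u := by
  simp only [exitTime, iInf_lt_iff, exists_prop]

lemma le_exitTime : y ≤ exitTime β x y :=
  le_iInf₂ fun _ hq => ENNReal.coe_le_coe.2 hq.1

lemma measurable_exitTime : Measurable fun z : (ℝ≥0 → ℝ) × ℝ≥0 => exitTime β z.1 z.2 := by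
  refine measurable_of_Iio fun u => ?_
  have : (fun z : (ℝ≥0 → ℝ) × ℝ≥0 => exitTime β z.1 z.2) ⁻¹' Set.Iio u =
      ⋃ q : ℚ, ⋃ (_ : (Real.toNNReal q : ℝ≥0∞) < u),
        {z | z.2 ≤ Real.toNNReal q} ∩ {z | β < z.1 (Real.toNNReal q) ^ 2} := by
    ext z
    simp only [Set.mem_preimage, Set.mem_Iio, exitTime_lt_iff, Set.mem_iUnion, Set.mem_inter_iff,
      Set.mem_ofPred_eq, exists_prop]
    exact exists_congr fun q => and_comm
  rw [this]
  refine .iUnion fun q => .iUnion fun _ => ?_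
  exact (measurableSet_le measurable_snd measurable_const).inter (measurableSet_lt measurable_const
    (((measurable_pi_apply _).comp measurable_fst).pow_const 2))

/-- A strict inequality that holds at some time holds at a slightly later rational time. -/
lemma exists_rat_of_continuous (hx : Continuous x) (h : β < x r ^ 2) {u : ℝ≥0∞} (hu : r < u) :
    ∃ q : ℚ, r < Real.toNNReal q ∧ (Real.toNNReal q : ℝ≥0∞) < u ∧
      β < x (Real.toNNReal q) ^ 2 := by
  have h1 : ∀ᶠ s in nhds r, β < x s ^ 2 :=
    ((hx.pow 2).tendsto r).eventually_const_lt h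
  obtain ⟨b, hb, hs⟩ := (mem_nhdsGE_iff_exists_Ico_subset' (lt_add_one r)).1
    (mem_nhdsWithin_of_mem_nhds h1)
  obtain ⟨q, hq1, hq2⟩ := lt_iff_exists_rat_nnreal.1
    (lt_min (ENNReal.coe_lt_coe.2 hb) hu : (r : ℝ≥0∞) < min (b : ℝ≥0∞) u)
  have hq1' : r < Real.toNNReal q := ENNReal.coe_lt_coe.1 hq1
  exact ⟨q, hq1', hq2.trans_le (min_le_right _ _),
    hs ⟨hq1'.le, ENNReal.coe_lt_coe.1 (hq2.trans_le (min_le_left _ _))⟩⟩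

lemma exitTime_le (hx : Continuous x) (hy : y ≤ r) (h : β < x r ^ 2) : exitTime β x y ≤ r := by
  refine le_of_forall_gt fun u hu => ?_
  obtain ⟨q, h1, h2, h3⟩ := exists_rat_of_continuous hx h hu
  exact exitTime_lt_iff.2 ⟨q, ⟨hy.trans h1.le, h3⟩, h2⟩

lemma sq_le_of_lt_exitTime (hx : Continuous x) (hy : y ≤ r) (h : r < exitTime β x y) :
    x r ^ 2 ≤ β := by
  by_contra! hlt
  exact absurd (exitTime_le hx hy hlt) (not_le.2 h)

lemma le_sq_exitTime (hx : Continuous x) (h : exitTime β x y = r) : β ≤ x r ^ 2 := by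
  by_contra! hlt
  have h1 : ∀ᶠ s in nhds r, x s ^ 2 < β := ((hx.pow 2).tendsto r).eventually_lt_const hlt
  obtain ⟨b, hb, hs⟩ := (mem_nhdsGE_iff_exists_Ico_subset' (lt_add_one r)).1
    (mem_nhdsWithin_of_mem_nhds h1)
  have h2 : exitTime β x y < b := by rw [h]; exact_mod_cast hb
  obtain ⟨q, ⟨h3, h4⟩, h5⟩ := exitTime_lt_iff.1 h2
  have h6 : r ≤ Real.toNNReal q := by
    have : exitTime β x y ≤ (Real.toNNReal q : ℝ≥0∞) := iInf₂_le q ⟨h3, h4⟩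
    rw [h] at this
    exact_mod_cast this
  have h7 : x (Real.toNNReal q) ^ 2 < β := hs ⟨h6, by exact_mod_cast h5⟩
  exact lt_asymm h4 h7

lemma sq_le_of_le_exitTime (hx : Continuous x) (hy : y ≤ r) (h : r ≤ exitTime β x y) :
    x r ^ 2 ≤ max β (x y ^ 2) := by
  rcases hy.eq_or_lt with rfl | hyr
  · exact le_max_right _ _
  refine le_trans ?_ (le_max_left _ _)
  have : Set.Ioo y r ∈ nhdsWithin r (Set.Iio r) := Ioo_mem_nhdsLT hyr
  have hne : (nhdsWithin r (Set.Iio r)).NeBot := by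
    exact nhdsLT_neBot_of_exists_lt ⟨y, hyr⟩
  refine le_of_tendsto (((hx.pow 2).tendsto r).mono_left nhdsWithin_le_nhds)
    (mem_of_superset this fun s hs => ?_)
  exact sq_le_of_lt_exitTime hx hs.1.le ((ENNReal.coe_lt_coe.2 hs.2).trans_le h)

/-- The value of the squared path at the exit time. -/
lemma sq_exitTime (hx : Continuous x) (h : exitTime β x y = r) :
    x r ^ 2 = max β (x y ^ 2) := by
  have hyr : y ≤ r := by
    have : (y : ℝ≥0∞) ≤ exitTime β x y := le_exitTime
    rw [h] at this; exact_mod_cast this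
  refine le_antisymm (sq_le_of_le_exitTime hx hyr h.ge) (max_le (le_sq_exitTime hx h) ?_)
  rcases le_or_gt (x y ^ 2) β with h1 | h1
  · exact h1.trans (le_sq_exitTime hx h)
  · have := exitTime_le hx le_rfl h1
    rw [h] at this
    rw [le_antisymm hyr (by exact_mod_cast this)]

end Exit

/-! ### Moments at the exit time -/

section ExitMoments

variable {Ω : Type*} {𝒴 : MeasurableSpace Ω} [mΩ : MeasurableSpace Ω] {P : Measure Ω}
  {W : ℝ≥0 → Ω → ℝ} {β : ℝ} {y : ℝ≥0}

omit mΩ in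
lemma isOptional_exitTime : IsOptional (pathInfo W 𝒴) fun ω => exitTime β (fun s => W s ω) y := by
  intro u
  have : {ω | exitTime β (fun s => W s ω) y < u} =
      ⋃ q : ℚ, ⋃ (_ : y ≤ Real.toNNReal q ∧ Real.toNNReal q < u),
        {ω | β < W (Real.toNNReal q) ω ^ 2} := by
    ext ω
    simp only [exitTime_lt_iff, Set.mem_iUnion, Set.mem_ofPred_eq, exists_prop, ENNReal.coe_lt_coe]
    exact exists_congr fun q => by tauto
  rw [this]
  refine .iUnion fun q => .iUnion fun hq => ?_
  have hm : Measurable[pathInfo W 𝒴 u] (W (Real.toNNReal q)) :=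
    (measurable_pathInfo _).mono (pathInfo_mono hq.2.le) le_rfl
  exact measurableSet_lt measurable_const (Measurable.pow_const hm 2)

lemma ofReal_integral_le {f : Ω → ℝ} (hf : Integrable f P) :
    ofReal (∫ ω, f ω ∂P) ≤ ∫⁻ ω, ofReal (f ω) ∂P := by
  refine (ENNReal.ofReal_le_ofReal (integral_mono hf hf.pos_part fun ω => le_max_left _ _)).trans ?_
  rw [ofReal_integral_eq_lintegral_ofReal hf.pos_part (ae_of_all _ fun ω => le_max_right _ _)]
  refine lintegral_mono fun ω => ?_
  rcases le_total (f ω) 0 with h | h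
  · rw [max_eq_right h]; simp
  · rw [max_eq_left h]

/-- The mean of `max β (B y ^ 2)` for a Brownian motion `B`: the mean exit time after `y`. -/
def meanExit (β : ℝ) (y : ℝ≥0) : ℝ≥0∞ :=
  ∫⁻ z, ofReal (max β (z ^ 2)) ∂gaussianReal 0 y

/-- The mean of `(β² - B y ^ 4)⁺ / 6` for a Brownian motion `B`: the mean squared error that is
accumulated from `y` until the exit time. -/
def meanExitCost (β : ℝ) (y : ℝ≥0) : ℝ≥0∞ :=
  ∫⁻ z, ofReal ((max β (z ^ 2) ^ 2 - (z ^ 2) ^ 2) / 6) ∂gaussianReal 0 y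

lemma lintegral_sq_gaussian_zero (y : ℝ≥0) :
    ∫⁻ z, ofReal (z ^ 2) ∂gaussianReal 0 y = y := by
  have := lintegral_sq_gaussian 0 y
  simpa using this

lemma meanExit_le (hβ : 0 ≤ β) (y : ℝ≥0) : meanExit β y ≤ ofReal β + y := by
  calc meanExit β y ≤ ∫⁻ z, (ofReal β + ofReal (z ^ 2)) ∂gaussianReal 0 y := by
        refine lintegral_mono fun z => ?_
        rw [← ENNReal.ofReal_add hβ (sq_nonneg z)]
        exact ENNReal.ofReal_le_ofReal (max_le (by nlinarith [sq_nonneg z]) (by linarith))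
    _ = _ := by
        rw [lintegral_add_left measurable_const, lintegral_sq_gaussian_zero]; simp

lemma measurable_meanExit : Measurable (meanExit β) :=
  measurable_lintegral_gaussian (by fun_prop)

lemma measurable_meanExitCost : Measurable (meanExitCost β) :=
  measurable_lintegral_gaussian (by fun_prop)

namespace IsBrownianWith

lemma lintegral_comp_eval (h : IsBrownianWith 𝒴 P W) (y : ℝ≥0) {f : ℝ → ℝ≥0∞}
    (hf : Measurable f) : ∫⁻ ω, f (W y ω) ∂P = ∫⁻ z, f z ∂gaussianReal 0 y := by
  rw [← (h.brownian.hasLaw_eval y).map_eq, lintegral_map hf (h.meas y)]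

/-- The mean exit time. -/
theorem lintegral_exitTime (h : IsBrownianWith 𝒴 P W) (hβ : 0 ≤ β) (y : ℝ≥0) :
    (∀ᵐ ω ∂P, exitTime β (fun s => W s ω) y ≠ ∞) ∧
      ∫⁻ ω, exitTime β (fun s => W s ω) y ∂P = meanExit β y := by
  have := h.isProbabilityMeasure
  set ρ : Ω → ℝ≥0∞ := fun ω => exitTime β (fun s => W s ω) y
  have hρ : IsOptional (pathInfo W 𝒴) ρ := isOptional_exitTime
  have hρm := h.measurable_of_isOptional hρ
  have hW0 : ∀ᵐ ω ∂P, W 0 ω = 0 := by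
    have h2 : ∫⁻ ω, ofReal (W 0 ω ^ 2) ∂P = 0 := by
      rw [h.lintegral_comp_eval 0 (f := fun z => ofReal (z ^ 2)) (by fun_prop),
        lintegral_sq_gaussian_zero]; rfl
    have h3 := (lintegral_eq_zero_iff
      (ENNReal.measurable_ofReal.comp ((h.meas 0).pow_const 2))).1 h2
    filter_upwards [h3] with ω hω
    have : W 0 ω ^ 2 ≤ 0 := ENNReal.ofReal_eq_zero.1 hω
    nlinarith
  -- the identity for the truncated exit time
  have hT : ∀ T : ℕ, ∫⁻ ω, min (ρ ω) (T : ℝ≥0∞) ∂P =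
      ∫⁻ ω, ofReal (W (trunc T ρ ω) ω ^ 2) ∂P := by
    intro T
    have key := h.integral_sq_sub (isOptional_const (F := pathInfo W 𝒴) ((0 : ℝ≥0) : ℝ≥0∞))
      (hρ.trunc T) (fun ω => zero_le) (T := T) (fun ω => trunc_le T ρ ω)
      (X := fun _ => 0) measurable_const
      (memLp_const 0)
    simp only [sub_zero] at key
    have hI2 := integrable_pow_two (h.memLp_eval_trunc hρ T)
    have hIτ := h.integrable_trunc hρ T
    have e : ∫ ω, W (trunc T ρ ω) ω ^ 2 ∂P = ∫ ω, (trunc T ρ ω : ℝ) ∂P := by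
      have h1 := integral_sub hI2 hIτ
      have h2 : ∫ ω, (W (trunc T ρ ω) ω ^ 2 - (trunc T ρ ω : ℝ)) ∂P = 0 := by
        rw [← key]
        refine integral_congr_ae ?_
        filter_upwards [hW0] with ω hω
        simp [hω]
      linarith
    rw [← ofReal_integral_eq_lintegral_ofReal hI2 (ae_of_all _ fun ω => sq_nonneg _), e,
      ofReal_integral_eq_lintegral_ofReal hIτ (ae_of_all _ fun ω => NNReal.coe_nonneg _)]
    refine lintegral_congr fun ω => ?_
    rw [ENNReal.ofReal_coe_nnreal]
    exact (coe_trunc T ρ ω).symm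
  have hsup : ∀ ω, Tendsto (fun T : ℕ => min (ρ ω) (T : ℝ≥0∞)) atTop (nhds (ρ ω)) := fun ω => by
    have := (tendsto_const_nhds (x := ρ ω)).min ENNReal.tendsto_nat_nhds_top
    rwa [min_eq_left le_top] at this
  have hlim : Tendsto (fun T : ℕ => ∫⁻ ω, min (ρ ω) (T : ℝ≥0∞) ∂P) atTop (nhds (∫⁻ ω, ρ ω ∂P)) :=
    lintegral_tendsto_of_tendsto_of_monotone
      (fun T => (hρm.min measurable_const).aemeasurable)
      (ae_of_all _ fun ω T T' hTT => min_le_min_left _ (Nat.cast_le.2 hTT))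
      (ae_of_all _ hsup)
  -- domination
  have hdom : ∀ᶠ T : ℕ in atTop, ∀ ω, ofReal (W (trunc T ρ ω) ω ^ 2) ≤
      ofReal (max β (W y ω ^ 2)) := by
    filter_upwards [eventually_ge_atTop ⌈y⌉₊] with T hT ω
    refine ENNReal.ofReal_le_ofReal (sq_le_of_le_exitTime (x := fun s => W s ω) (h.cont ω) ?_ ?_)
    · have h1 : (y : ℝ≥0∞) ≤ (trunc T ρ ω : ℝ≥0∞) := by
        rw [coe_trunc]
        refine le_min le_exitTime ?_
        exact_mod_cast Nat.ceil_le.1 hT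
      exact_mod_cast h1
    · rw [coe_trunc]; exact min_le_left _ _
  have hE : ∫⁻ ω, ofReal (max β (W y ω ^ 2)) ∂P = meanExit β y :=
    h.lintegral_comp_eval y (f := fun z => ofReal (max β (z ^ 2))) (by fun_prop)
  have hEfin : ∫⁻ ω, ofReal (max β (W y ω ^ 2)) ∂P ≠ ∞ := by
    rw [hE]; exact ne_top_of_le_ne_top (by finiteness) (meanExit_le hβ y)
  have hfin : ∫⁻ ω, ρ ω ∂P ≠ ∞ := by
    refine ne_top_of_le_ne_top hEfin (le_of_tendsto hlim ?_)
    filter_upwards [hdom] with T h1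
    rw [hT T]
    exact lintegral_mono h1
  have hae : ∀ᵐ ω ∂P, ρ ω ≠ ∞ := (ae_lt_top hρm hfin).mono fun ω hω => hω.ne
  refine ⟨hae, ?_⟩
  have hlim2 : Tendsto (fun T : ℕ => ∫⁻ ω, ofReal (W (trunc T ρ ω) ω ^ 2) ∂P) atTop
      (nhds (∫⁻ ω, ofReal (max β (W y ω ^ 2)) ∂P)) := by
    refine tendsto_lintegral_filter_of_dominated_convergence _ (Eventually.of_forall fun T =>
      ENNReal.measurable_ofReal.comp ((h.measurable_eval_trunc hρ T).pow_const 2))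
      (hdom.mono fun T h1 => ae_of_all _ h1) hEfin ?_
    filter_upwards [hae] with ω hω
    refine tendsto_const_nhds.congr' ?_
    filter_upwards [eventually_ge_atTop ⌈(ρ ω).toNNReal⌉₊] with T hT
    have h1 : ρ ω ≤ (T : ℝ≥0) := by
      rw [← ENNReal.coe_toNNReal hω]
      exact_mod_cast Nat.ceil_le.1 hT
    rw [trunc_of_le h1]
    rw [sq_exitTime (x := fun s => W s ω) (h.cont ω) (ENNReal.coe_toNNReal hω).symm]
  simp_rw [hT] at hlim
  rw [← hE]
  exact tendsto_nhds_unique hlim hlim2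

/-- The squared error that is accumulated until the exit time. -/
theorem lintegral_exitCost_le (h : IsBrownianWith 𝒴 P W) (y : ℝ≥0) :
    ∫⁻ ω, (∫⁻ r in period y (exitTime β (fun s => W s ω) y),
      ofReal (W r.toNNReal ω ^ 2)) ∂P ≤ meanExitCost β y := by
  have := h.isProbabilityMeasure
  set ρ : Ω → ℝ≥0∞ := fun ω => exitTime β (fun s => W s ω) y
  have hρ : IsOptional (pathInfo W 𝒴) ρ := isOptional_exitTime
  have hyo : IsOptional (pathInfo W 𝒴) fun _ => (y : ℝ≥0∞) := isOptional_const _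
  have hmono : ∀ (T : ℕ) ω, trunc T (fun _ => (y : ℝ≥0∞)) ω ≤ trunc T ρ ω := fun T ω =>
    trunc_mono T le_exitTime
  have hcont : ∀ ω, Continuous fun r : ℝ => W r.toNNReal ω ^ 2 := fun ω =>
    ((h.cont ω).comp continuous_real_toNNReal).pow 2
  set I : ℕ → Ω → ℝ := fun T ω =>
    ∫ r in (trunc T (fun _ => (y : ℝ≥0∞)) ω : ℝ)..trunc T ρ ω, W r.toNNReal ω ^ 2
  have hII : ∀ T, Integrable (I T) P := fun T => by
    have := h.integrable_timeIntegral 1 0 (h.measurable_trunc hyo T) (h.measurable_trunc hρ T)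
      (hmono T) (T := T) (fun ω => trunc_le T ρ ω) (X := fun _ => 0) measurable_const
      (memLp_const 0)
    simpa only [one_mul, add_zero, sub_zero] using this
  have hI0 : ∀ T ω, 0 ≤ I T ω := fun T ω => intervalIntegral.integral_nonneg
    (by exact_mod_cast hmono T ω) fun _ _ => sq_nonneg _
  have hIe : ∀ (T : ℕ) ω, ofReal (I T ω) =
      ∫⁻ r in period y (ρ ω) ∩ Set.Iic (T : ℝ), ofReal (W r.toNNReal ω ^ 2) := by
    intro T ω
    have e := period_inter_Iic (y : ℝ≥0∞) (ρ ω) (T : ℝ≥0)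
    rw [NNReal.coe_natCast] at e
    rw [e, ← ofReal_integral_eq_lintegral_ofReal]
    · congr 1
      exact intervalIntegral.integral_of_le (by exact_mod_cast hmono T ω)
    · exact (hcont ω).integrableOn_Ioc
    · exact ae_of_all _ fun _ => sq_nonneg _
  have hE : meanExitCost β y =
      ∫⁻ ω, ofReal ((max β (W y ω ^ 2) ^ 2 - (W y ω ^ 2) ^ 2) / 6) ∂P :=
    (h.lintegral_comp_eval y
      (f := fun z => ofReal ((max β (z ^ 2) ^ 2 - (z ^ 2) ^ 2) / 6)) (by fun_prop)).symm
  have hT : ∀ T : ℕ, y ≤ T → ∫⁻ ω, ofReal (I T ω) ∂P ≤ meanExitCost β y := by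
    intro T hyT
    have hty : ∀ ω, trunc T (fun _ : Ω => (y : ℝ≥0∞)) ω = y := fun ω =>
      trunc_of_le (T := (T : ℝ≥0)) (τ := fun _ : Ω => (y : ℝ≥0∞)) (ω := ω)
        (ENNReal.coe_le_coe.2 hyT)
    have key := h.dynkin_le (ψ := fun x => -x ^ 4) (C := 1) (p := -6) (q := 0) (by fun_prop)
      (fun x => by rw [abs_neg, abs_of_nonneg (by positivity)]; linarith)
      (fun x v => by
        have e := integral_cubic_gaussian v (-x ^ 4) (-4 * x ^ 3) (-6 * x ^ 2) (-4 * x) (-1)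
        refine le_of_eq ?_
        calc _ = _ := by congr 1 with z; ring
          _ = _ := e
          _ = _ := by ring)
      (hyo.trunc T) (hρ.trunc T) (hmono T) (T := T) (fun ω => trunc_le T ρ ω)
      (X := fun _ => 0) measurable_const
      (memLp_const 0)
    simp only [sub_zero, add_zero, intervalIntegral.integral_const_mul] at key
    have i1 := integrable_pow_four (h.memLp_eval_trunc hρ T)
    have i2 := integrable_pow_four (h.memLp_eval_trunc hyo T)
    have e : ∫ ω, I T ω ∂P ≤
        ∫ ω, (W (trunc T ρ ω) ω ^ 4 - W (trunc T (fun _ => (y : ℝ≥0∞)) ω) ω ^ 4) / 6 ∂P := by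
      have h1 := integral_sub (hII T) ((i1.sub i2).div_const 6)
      simp only [Pi.sub_apply] at h1
      have h2 : ∫ ω, (I T ω - (W (trunc T ρ ω) ω ^ 4 -
          W (trunc T (fun _ => (y : ℝ≥0∞)) ω) ω ^ 4) / 6) ∂P ≤ 0 := by
        have h3 : ∀ ω, I T ω - (W (trunc T ρ ω) ω ^ 4 -
            W (trunc T (fun _ => (y : ℝ≥0∞)) ω) ω ^ 4) / 6 =
            (1 / 6) * (-W (trunc T ρ ω) ω ^ 4 - -W (trunc T (fun _ => (y : ℝ≥0∞)) ω) ω ^ 4 -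
              -6 * I T ω) := fun ω => by ring
        simp_rw [h3]
        rw [integral_const_mul]
        exact mul_nonpos_of_nonneg_of_nonpos (by norm_num) key
      linarith
    rw [← ofReal_integral_eq_lintegral_ofReal (hII T) (ae_of_all _ (hI0 T)), hE]
    refine (ENNReal.ofReal_le_ofReal e).trans
      ((ofReal_integral_le ((i1.sub i2).div_const 6)).trans ?_)
    refine lintegral_mono fun ω => ENNReal.ofReal_le_ofReal ?_
    have h1 : W (trunc T ρ ω) ω ^ 2 ≤ max β (W y ω ^ 2) := by
      refine sq_le_of_le_exitTime (x := fun s => W s ω) (h.cont ω) ?_ ?_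
      · rw [← hty ω]; exact hmono T ω
      · rw [coe_trunc]; exact min_le_left _ _
    simp only [Pi.sub_apply]
    rw [hty ω]
    have h2 : W (trunc T ρ ω) ω ^ 4 ≤ max β (W y ω ^ 2) ^ 2 := by
      calc W (trunc T ρ ω) ω ^ 4 = (W (trunc T ρ ω) ω ^ 2) ^ 2 := by ring
        _ ≤ _ := by gcongr
    have h3 : W y ω ^ 4 = (W y ω ^ 2) ^ 2 := by ring
    rw [h3]; gcongr
  have hsup : ∀ ω, ∫⁻ r in period y (ρ ω), ofReal (W r.toNNReal ω ^ 2) =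
      ⨆ T : ℕ, ofReal (I T ω) := fun ω => by
    simp_rw [hIe]
    have hd : Monotone fun T : ℕ => period y (ρ ω) ∩ Set.Iic (T : ℝ) := fun T T' hTT =>
      Set.inter_subset_inter_right _ (Set.Iic_subset_Iic.2 (Nat.cast_le.2 hTT))
    have hU : ⋃ T : ℕ, Set.Iic (T : ℝ) = Set.univ := Set.iUnion_eq_univ_iff.2 fun r =>
      exists_nat_ge r
    rw [← setLIntegral_iUnion_of_directed _ hd.directed_le, ← Set.inter_iUnion, hU, Set.inter_univ]
  show ∫⁻ ω, (∫⁻ r in period y (ρ ω), ofReal (W r.toNNReal ω ^ 2)) ∂P ≤ _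
  simp_rw [hsup]
  have hmonoI : ∀ ω, Monotone fun T => ofReal (I T ω) := fun ω T T' hTT => by
    simp only [hIe]
    exact lintegral_mono_set (Set.inter_subset_inter_right _
      (Set.Iic_subset_Iic.2 (Nat.cast_le.2 hTT)))
  rw [lintegral_iSup' (fun T => (hII T).aemeasurable.ennreal_ofReal) (ae_of_all _ hmonoI)]
  refine iSup_le fun T => ?_
  refine le_trans (lintegral_mono fun ω => hmonoI ω (le_max_left T ⌈y⌉₊)) (hT _ ?_)
  exact (Nat.le_ceil y).trans (by exact_mod_cast le_max_right _ _)

end IsBrownianWith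

lemma lintegral_period_add (c : ℝ≥0) (a b : ℝ≥0∞) (f : ℝ → ℝ≥0∞) :
    ∫⁻ r in period (c + a) (c + b), f r = ∫⁻ s in period a b, f (c + s) := by
  rw [← lintegral_indicator (measurableSet_period _ _),
    ← lintegral_indicator (measurableSet_period _ _),
    ← lintegral_add_left_eq_self _ (c : ℝ)]
  refine lintegral_congr fun s => ?_
  rcases le_or_gt s 0 with hs | hs
  · have h1 : s ∉ period a b := fun h1 => by
      have := h1.1; rw [ENNReal.ofReal_of_nonpos hs] at this; exact not_lt_zero this
    have h2 : (c : ℝ) + s ∉ period (c + a) (c + b) := fun h2 => by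
      have h3 : ofReal ((c : ℝ) + s) ≤ c := by
        rw [← ENNReal.ofReal_coe_nnreal]; exact ENNReal.ofReal_le_ofReal (by linarith)
      exact absurd (h2.1.trans_le h3) (not_lt.2 le_self_add)
    simp only [Set.indicator_of_notMem h1, Set.indicator_of_notMem h2]
  · have h1 : (c : ℝ) + s ∈ period (c + a) (c + b) ↔ s ∈ period a b := by
      simp only [period, Set.mem_ofPred_eq]
      rw [ENNReal.ofReal_add c.coe_nonneg hs.le, ENNReal.ofReal_coe_nnreal,
        ENNReal.add_lt_add_iff_left ENNReal.coe_ne_top,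
        ENNReal.add_le_add_iff_left ENNReal.coe_ne_top]
    by_cases h2 : s ∈ period a b
    · simp only [Set.indicator_of_mem h2, Set.indicator_of_mem (h1.2 h2)]
    · simp only [Set.indicator_of_notMem h2, Set.indicator_of_notMem (mt h1.1 h2)]

namespace IsBrownianWith

/-- The squared error of the threshold rule over one cycle: the previous sample is delivered at
time `y`, the next one is taken at the exit time and its service takes the time `y'`. -/
theorem lintegral_cycleCost_le (h : IsBrownianWith 𝒴 P W) (hβ : 0 ≤ β) (y y' : ℝ≥0) :
    ∫⁻ ω, (∫⁻ r in period y (exitTime β (fun s => W s ω) y + y'),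
      ofReal (W r.toNNReal ω ^ 2)) ∂P ≤
      meanExitCost β y + y' * meanExit β y + (y' : ℝ≥0∞) ^ 2 / 2 := by
  have := h.isProbabilityMeasure
  set ρ : Ω → ℝ≥0∞ := fun ω => exitTime β (fun s => W s ω) y
  have hρ : IsOptional (pathInfo W 𝒴) ρ := isOptional_exitTime
  have hρm := h.measurable_of_isOptional hρ
  obtain ⟨hfin, -⟩ := h.lintegral_exitTime hβ y
  have hsq : ∀ᵐ ω ∂P, W (ρ ω).toNNReal ω ^ 2 = max β (W y ω ^ 2) := by
    filter_upwards [hfin] with ω hω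
    exact sq_exitTime (x := fun s => W s ω) (h.cont ω) (ENNReal.coe_toNNReal hω).symm
  have hE : ∫⁻ ω, ofReal (W (ρ ω).toNNReal ω ^ 2) ∂P = meanExit β y := by
    rw [meanExit, ← h.lintegral_comp_eval y (f := fun z => ofReal (max β (z ^ 2)))
      (by fun_prop)]
    exact lintegral_congr_ae (hsq.mono fun ω hω => by simp only [hω])
  have hm1 : Measurable fun ω => W (ρ ω).toNNReal ω := h.measurable_eval hρm.ennreal_toNNReal
  -- the squared value after a further delay `v`
  have hv : ∀ v : ℝ≥0, ∫⁻ ω, ofReal (W ((ρ ω).toNNReal + v) ω ^ 2) ∂P =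
      meanExit β y + v := fun v => by
    have hind := (h.indepFun_shiftPath hρ hfin (measurable_pastOf_eval (mΩ := mΩ) pathInfo_mono
      h.pathInfo_le h.cont measurable_pathInfo hρ)).comp measurable_id (measurable_pi_apply v)
    have hZ : Measurable fun ω => shiftPath W ρ ω v :=
      (measurable_pi_apply v).comp (h.measurable_shiftPath hρm)
    have e := lintegral_indepFun_pair hZ hm1 hind.symm
      (f := fun z w => ofReal ((w + z) ^ 2)) (by fun_prop)
    have e1 : ∀ w, ∫⁻ ω, ofReal ((w + shiftPath W ρ ω v) ^ 2) ∂P =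
        ofReal (w ^ 2) + v := fun w => by
      rw [← lintegral_sq_gaussian w v, ← h.map_shiftPath_apply hρ hfin v, lintegral_map
        (by fun_prop) hZ]
    simp_rw [e1] at e
    rw [lintegral_add_right _ measurable_const, hE, lintegral_const, measure_univ, mul_one] at e
    rw [← e]
    refine lintegral_congr fun ω => ?_
    simp only [shiftPath, add_sub_cancel]
  have hsplit : ∀ᵐ ω ∂P, ∫⁻ r in period y (ρ ω + y'), ofReal (W r.toNNReal ω ^ 2) ≤
      (∫⁻ r in period y (ρ ω), ofReal (W r.toNNReal ω ^ 2)) +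
        ∫⁻ s in Set.Ioc (0 : ℝ) y',
          ofReal (W ((ρ ω).toNNReal + s.toNNReal) ω ^ 2) := by
    filter_upwards [hfin] with ω hω
    have e := lintegral_period_add (ρ ω).toNNReal 0 y'
      (fun r => ofReal (W r.toNNReal ω ^ 2))
    rw [add_zero, ENNReal.coe_toNNReal hω, period_zero_coe] at e
    have e2 : ∫⁻ s in Set.Ioc (0 : ℝ) y',
        ofReal (W (((ρ ω).toNNReal : ℝ) + s).toNNReal ω ^ 2) = ∫⁻ s in Set.Ioc (0 : ℝ) y',
          ofReal (W ((ρ ω).toNNReal + s.toNNReal) ω ^ 2) := by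
      refine setLIntegral_congr_fun measurableSet_Ioc fun s hs => ?_
      simp only [Real.toNNReal_add (NNReal.coe_nonneg _) hs.1.le, Real.toNNReal_coe]
    rw [← e2, ← e]
    refine (lintegral_mono_set fun r hr => ?_).trans (lintegral_union_le _ _ _)
    rcases le_or_gt (ofReal r) (ρ ω) with h1 | h1
    · exact Or.inl ⟨hr.1, h1⟩
    · exact Or.inr ⟨h1, hr.2⟩
  have hjm : Measurable (Function.uncurry fun (ω : Ω) (s : ℝ) =>
      ofReal (W ((ρ ω).toNNReal + s.toNNReal) ω ^ 2)) := by
    have h1 : Measurable fun z : Ω × ℝ => W ((ρ z.1).toNNReal + z.2.toNNReal) z.1 :=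
      h.measurable_uncurry.comp ((((hρm.comp measurable_fst).ennreal_toNNReal).add
        (measurable_real_toNNReal.comp measurable_snd)).prodMk measurable_fst)
    exact ENNReal.measurable_ofReal.comp (h1.pow_const 2)
  calc _ ≤ ∫⁻ ω, ((∫⁻ r in period y (ρ ω), ofReal (W r.toNNReal ω ^ 2)) +
        ∫⁻ s in Set.Ioc (0 : ℝ) y',
          ofReal (W ((ρ ω).toNNReal + s.toNNReal) ω ^ 2)) ∂P := lintegral_mono_ae hsplit
    _ = ∫⁻ ω, (∫⁻ r in period y (ρ ω), ofReal (W r.toNNReal ω ^ 2)) ∂P +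
        ∫⁻ s in Set.Ioc (0 : ℝ) y', ∫⁻ ω,
          ofReal (W ((ρ ω).toNNReal + s.toNNReal) ω ^ 2) ∂P := by
        rw [lintegral_add_right _ hjm.lintegral_prod_right,
          lintegral_lintegral_swap hjm.aemeasurable]
    _ ≤ meanExitCost β y + ∫⁻ s in Set.Ioc (0 : ℝ) y', (meanExit β y + ofReal s) := by
        simp_rw [hv]
        exact add_le_add (h.lintegral_exitCost_le y) le_rfl
    _ = _ := by
        have e : ofReal ((y' : ℝ) ^ 2 / 2) = (y' : ℝ≥0∞) ^ 2 / 2 := by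
          rw [ENNReal.ofReal_div_of_pos two_pos, ENNReal.ofReal_pow y'.coe_nonneg,
            ENNReal.ofReal_coe_nnreal, ENNReal.ofReal_ofNat]
        rw [lintegral_add_left measurable_const, lintegral_Ioc_id, e, setLIntegral_const,
          Real.volume_Ioc, sub_zero, ENNReal.ofReal_coe_nnreal, mul_comm, add_assoc]

end IsBrownianWith

end ExitMoments

/-! ### The second moment of the exit time -/

section ExitSecondMoment

variable {Ω : Type*} {𝒴 : MeasurableSpace Ω} [mΩ : MeasurableSpace Ω] {P : Measure Ω}
  {W : ℝ≥0 → Ω → ℝ} {β : ℝ} {y : ℝ≥0}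

namespace IsBrownianWith

/-- The mean residual exit time is at most `β` on the event that the exit has not occurred. -/
lemma lintegral_exitTime_sub_le (h : IsBrownianWith 𝒴 P W) {y t : ℝ≥0} (hyt : y ≤ t) :
    ∫⁻ ω, (exitTime β (fun s => W s ω) y - t) ∂P ≤
      ofReal β * P {ω | t < exitTime β (fun s => W s ω) y} := by
  have := h.isProbabilityMeasure
  set ρ : Ω → ℝ≥0∞ := fun ω => exitTime β (fun s => W s ω) y
  show ∫⁻ ω, (ρ ω - t) ∂P ≤ ofReal β * P {ω | t < ρ ω}
  have hρ : IsOptional (pathInfo W 𝒴) ρ := isOptional_exitTime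
  have hρm := h.measurable_of_isOptional hρ
  have hset : MeasurableSet {ω | (t : ℝ≥0∞) < ρ ω} := measurableSet_lt measurable_const hρm
  have hmax : IsOptional (pathInfo W 𝒴) fun ω => max (ρ ω) t := hρ.max (isOptional_const _)
  have hT : ∀ T : ℕ, t ≤ T → ∫⁻ ω, (min (ρ ω) T - t) ∂P ≤
      ofReal β * P {ω | t < ρ ω} := by
    intro T htT
    set τ := trunc T fun ω => max (ρ ω) t
    have hτ : ∀ ω, (τ ω : ℝ≥0∞) = max (min (ρ ω) T) t := fun ω => by
      have h1 : (t : ℝ≥0∞) ≤ ((T : ℝ≥0) : ℝ≥0∞) := ENNReal.coe_le_coe.2 htT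
      rw [coe_trunc, ← ENNReal.coe_natCast, max_min_distrib_right, max_eq_left h1]
    have htτ : ∀ ω, t ≤ τ ω := fun ω => by
      have : (t : ℝ≥0∞) ≤ τ ω := by rw [hτ]; exact le_max_right _ _
      exact_mod_cast this
    have key := h.integral_sq_sub (isOptional_const (F := pathInfo W 𝒴) (t : ℝ≥0∞))
      (hmax.trunc T) htτ (T := T) (fun ω => trunc_le T _ ω)
      (X := fun _ => 0) measurable_const
      (memLp_const 0)
    simp only [sub_zero] at key
    have i1 := integrable_pow_two (h.memLp_eval_trunc hmax T)
    have i2 := integrable_pow_two (h.memLp_eval_of_le (τ := fun _ => t) measurable_const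
      (T := T) fun _ => htT)
    have i3 : Integrable (fun ω => (τ ω : ℝ) - t) P :=
      (integrable_const (T : ℝ)).mono' ((h.measurable_trunc hmax T).coe_nnreal_real.sub_const
        _).aestronglyMeasurable (ae_of_all _ fun ω => by
          rw [Real.norm_of_nonneg (sub_nonneg.2 (by exact_mod_cast htτ ω))]
          have : (τ ω : ℝ) ≤ T := by exact_mod_cast trunc_le T _ ω
          have := t.coe_nonneg
          linarith)
    have i4 : Integrable ({ω | (t : ℝ≥0∞) < ρ ω}.indicator fun _ => β) P :=
      (integrable_const β).indicator hset
    have e1 := integral_sub (i1.sub i2) i3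
    simp only [Pi.sub_apply] at e1
    have e2 : ∫ ω, ((τ ω : ℝ) - t) ∂P ≤
        ∫ ω, {ω | (t : ℝ≥0∞) < ρ ω}.indicator (fun _ => β) ω ∂P := by
      have e3 : ∫ ω, ((τ ω : ℝ) - t) ∂P = ∫ ω, (W (τ ω) ω ^ 2 - W t ω ^ 2) ∂P := by
        linarith
      rw [e3]
      refine integral_mono (i1.sub i2) i4 fun ω => ?_
      show W (τ ω) ω ^ 2 - W t ω ^ 2 ≤ _
      by_cases hω : (t : ℝ≥0∞) < ρ ω
      · rw [Set.indicator_of_mem (show ω ∈ {ω | (t : ℝ≥0∞) < ρ ω} from hω)]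
        have h2 : W (τ ω) ω ^ 2 ≤ max β (W y ω ^ 2) := by
          refine sq_le_of_le_exitTime (x := fun s => W s ω) (h.cont ω) (hyt.trans (htτ ω)) ?_
          rw [hτ]
          exact max_le (min_le_left _ _) hω.le
        have h3 : W y ω ^ 2 ≤ β := sq_le_of_lt_exitTime (x := fun s => W s ω) (h.cont ω) le_rfl
          ((ENNReal.coe_le_coe.2 hyt).trans_lt hω)
        rw [max_eq_left h3] at h2
        nlinarith [sq_nonneg (W t ω)]
      · rw [Set.indicator_of_notMem (show ω ∉ {ω | (t : ℝ≥0∞) < ρ ω} from hω)]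
        have h1 : τ ω = t := by
          have := hτ ω
          rw [max_eq_right ((min_le_left _ _).trans (not_lt.1 hω))] at this
          exact_mod_cast this
        rw [h1, sub_self]
    calc ∫⁻ ω, (min (ρ ω) T - t) ∂P = ∫⁻ ω, ofReal ((τ ω : ℝ) - t) ∂P := by
          refine lintegral_congr fun ω => ?_
          rw [ENNReal.ofReal_sub _ t.coe_nonneg, ENNReal.ofReal_coe_nnreal,
            ENNReal.ofReal_coe_nnreal, hτ]
          rcases le_total (min (ρ ω) T) t with h1 | h1
          · rw [max_eq_right h1, tsub_self, tsub_eq_zero_of_le h1]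
          · rw [max_eq_left h1]
      _ = ofReal (∫ ω, ((τ ω : ℝ) - t) ∂P) :=
          (ofReal_integral_eq_lintegral_ofReal i3 (ae_of_all _ fun ω =>
            sub_nonneg.2 (by exact_mod_cast htτ ω))).symm
      _ ≤ ofReal (∫ ω, {ω | (t : ℝ≥0∞) < ρ ω}.indicator (fun _ => β) ω ∂P) :=
          ENNReal.ofReal_le_ofReal e2
      _ = _ := by
          rw [integral_indicator_const _ hset, smul_eq_mul, ENNReal.ofReal_mul measureReal_nonneg,
            Measure.real, ENNReal.ofReal_toReal (measure_ne_top _ _), mul_comm]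
  have hlim : Tendsto (fun T : ℕ => ∫⁻ ω, (min (ρ ω) (T : ℝ≥0∞) - t) ∂P) atTop
      (nhds (∫⁻ ω, (ρ ω - t) ∂P)) :=
    lintegral_tendsto_of_tendsto_of_monotone
      (fun T => ((hρm.min measurable_const).sub_const _).aemeasurable)
      (ae_of_all _ fun ω T T' hTT => tsub_le_tsub_right
        (min_le_min_left _ (Nat.cast_le.2 hTT)) _)
      (ae_of_all _ fun ω => by
        have := (tendsto_const_nhds (x := ρ ω)).min ENNReal.tendsto_nat_nhds_top
        rw [min_eq_left le_top] at this
        exact ENNReal.Tendsto.sub this tendsto_const_nhds (Or.inr ENNReal.coe_ne_top))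
  refine le_of_tendsto hlim ?_
  filter_upwards [eventually_ge_atTop ⌈t⌉₊] with T h1
  exact hT T (Nat.ceil_le.1 h1)

omit mΩ in
lemma add_sq_le_two_mul (a b : ℝ≥0∞) : (a + b) ^ 2 ≤ 2 * a ^ 2 + 2 * b ^ 2 := by
  rcases eq_or_ne a ∞ with rfl | ha
  · simp
  rcases eq_or_ne b ∞ with rfl | hb
  · simp
  lift a to ℝ≥0 using ha
  lift b to ℝ≥0 using hb
  have h : (a + b) ^ 2 ≤ 2 * a ^ 2 + 2 * b ^ 2 := by
    rw [← NNReal.coe_le_coe]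
    push_cast
    nlinarith [sq_nonneg ((a : ℝ) - b)]
  exact_mod_cast h

/-- The square of a number as the integral of its residuals. -/
lemma sq_le_lintegral_sub (a : ℝ≥0) :
    (a : ℝ≥0∞) ^ 2 ≤ 2 * ∫⁻ t in Set.Ioi (0 : ℝ), ((a : ℝ≥0∞) - ofReal t) := by
  have h1 : ofReal ((a : ℝ) ^ 2 / 2) ≤
      ∫⁻ t in Set.Ioi (0 : ℝ), ((a : ℝ≥0∞) - ofReal t) := by
    calc ofReal ((a : ℝ) ^ 2 / 2) = ∫⁻ t in Set.Ioc (0 : ℝ) a, ofReal (a - t) := by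
          rw [← ofReal_integral_eq_lintegral_ofReal, ← intervalIntegral.integral_of_le a.coe_nonneg]
          · congr 1
            rw [intervalIntegral.integral_sub (by simp) (by simp), integral_id]
            simp; ring
          · exact (continuous_const.sub continuous_id).integrableOn_Ioc
          · refine (ae_restrict_iff' measurableSet_Ioc).2 (ae_of_all _ fun t ht => ?_)
            exact sub_nonneg.2 ht.2
      _ ≤ ∫⁻ t in Set.Ioi (0 : ℝ), ofReal (a - t) :=
          lintegral_mono_set Set.Ioc_subset_Ioi_self
      _ = _ := by
          refine setLIntegral_congr_fun measurableSet_Ioi fun t ht => ?_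
          rw [ENNReal.ofReal_sub _ (le_of_lt ht), ENNReal.ofReal_coe_nnreal]
  calc (a : ℝ≥0∞) ^ 2 = 2 * ofReal ((a : ℝ) ^ 2 / 2) := by
        rw [← ENNReal.ofReal_ofNat, ← ENNReal.ofReal_mul (by norm_num),
          mul_div_cancel₀ _ two_ne_zero,
          ENNReal.ofReal_pow a.coe_nonneg, ENNReal.ofReal_coe_nnreal]
    _ ≤ _ := by gcongr

/-- The second moment of the exit time is finite: the square is the integral of the residuals, and
the mean residual is at most `β` while the exit has not occurred. -/
theorem lintegral_exitTime_sq_le (h : IsBrownianWith 𝒴 P W) (hβ : 0 ≤ β) (y : ℝ≥0) :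
    ∫⁻ ω, exitTime β (fun s => W s ω) y ^ 2 ∂P ≤
      2 * (y : ℝ≥0∞) ^ 2 + 4 * ofReal β * (ofReal β + y) := by
  have := h.isProbabilityMeasure
  set ρ : Ω → ℝ≥0∞ := fun ω => exitTime β (fun s => W s ω) y
  show ∫⁻ ω, ρ ω ^ 2 ∂P ≤ _
  have hρm : Measurable ρ :=
    h.measurable_of_isOptional (isOptional_exitTime : IsOptional (pathInfo W 𝒴) ρ)
  obtain ⟨hfin, hmean⟩ := h.lintegral_exitTime hβ y
  have hjm : Measurable (Function.uncurry fun (ω : Ω) (t : ℝ) =>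
      ρ ω - (y + ofReal t)) :=
    (hρm.comp measurable_fst).sub (measurable_const.add
      (ENNReal.measurable_ofReal.comp measurable_snd))
  have hjm2 : MeasurableSet {z : Ω × ℝ | y + ofReal z.2 < ρ z.1} :=
    measurableSet_lt (measurable_const.add (ENNReal.measurable_ofReal.comp measurable_snd))
      (hρm.comp measurable_fst)
  have hjm3 : Measurable (Function.uncurry fun (ω : Ω) (t : ℝ) =>
      if y + ofReal t < ρ ω then (1 : ℝ≥0∞) else 0) :=
    Measurable.ite hjm2 measurable_const measurable_const
  have h1 : ∫⁻ ω, (ρ ω - y) ^ 2 ∂P ≤ 2 * (ofReal β * meanExit β y) := by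
    calc ∫⁻ ω, (ρ ω - y) ^ 2 ∂P ≤
          ∫⁻ ω, 2 * (∫⁻ t in Set.Ioi (0 : ℝ), (ρ ω - (y + ofReal t))) ∂P := by
          refine lintegral_mono_ae (hfin.mono fun ω hω => ?_)
          have e := sq_le_lintegral_sub (ρ ω - y).toNNReal
          rw [ENNReal.coe_toNNReal (ENNReal.sub_ne_top hω)] at e
          simpa only [tsub_tsub] using e
      _ = 2 * ∫⁻ t in Set.Ioi (0 : ℝ), ∫⁻ ω, (ρ ω - (y + ofReal t)) ∂P := by
          rw [lintegral_const_mul' _ _ (by simp), lintegral_lintegral_swap hjm.aemeasurable]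
      _ ≤ 2 * ∫⁻ t in Set.Ioi (0 : ℝ), ofReal β *
            ∫⁻ ω, (if y + ofReal t < ρ ω then (1 : ℝ≥0∞) else 0) ∂P := by
          refine mul_le_mul_right (lintegral_mono fun t => ?_) _
          have e := h.lintegral_exitTime_sub_le (β := β) (y := y) (t := y + t.toNNReal) le_self_add
          have e1 : ((y + t.toNNReal : ℝ≥0) : ℝ≥0∞) = y + ofReal t := by
            rw [ENNReal.coe_add]; rfl
          rw [e1] at e
          refine e.trans_eq ?_
          rw [← lintegral_indicator_one (measurableSet_lt measurable_const hρm)]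
          simp only [Set.indicator, Set.mem_ofPred_eq, Pi.one_apply]
      _ = 2 * (ofReal β * ∫⁻ ω, (∫⁻ t in Set.Ioi (0 : ℝ),
            (if y + ofReal t < ρ ω then (1 : ℝ≥0∞) else 0)) ∂P) := by
          rw [lintegral_const_mul' _ _ ENNReal.ofReal_ne_top,
            lintegral_lintegral_swap hjm3.aemeasurable]
      _ ≤ 2 * (ofReal β * ∫⁻ ω, ρ ω ∂P) := by
          refine mul_le_mul_right (mul_le_mul_right
            (lintegral_mono_ae (hfin.mono fun ω hω => ?_)) _) _
          calc ∫⁻ t in Set.Ioi (0 : ℝ), (if y + ofReal t < ρ ω then (1 : ℝ≥0∞) else 0)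
              ≤ ∫⁻ t, (Set.Ioc (0 : ℝ) (ρ ω).toReal).indicator 1 t := by
                rw [← lintegral_indicator measurableSet_Ioi]
                refine lintegral_mono fun t => ?_
                by_cases ht : t ∈ Set.Ioi (0 : ℝ)
                · rw [Set.indicator_of_mem ht]
                  split_ifs with h2
                  · have h3 : t ∈ Set.Ioc (0 : ℝ) (ρ ω).toReal :=
                      ⟨ht, (ENNReal.ofReal_le_iff_le_toReal hω).1 (le_add_self.trans h2.le)⟩
                    rw [Set.indicator_of_mem h3]; rfl
                  · exact zero_le
                · rw [Set.indicator_of_notMem ht]; exact zero_le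
            _ = ρ ω := by
                rw [lintegral_indicator_one measurableSet_Ioc, Real.volume_Ioc, sub_zero,
                  ENNReal.ofReal_toReal hω]
      _ = _ := by rw [hmean]
  calc ∫⁻ ω, ρ ω ^ 2 ∂P ≤ ∫⁻ ω, (2 * (y : ℝ≥0∞) ^ 2 + 2 * (ρ ω - y) ^ 2) ∂P := by
        refine lintegral_mono fun ω => ?_
        have e : ρ ω = y + (ρ ω - y) := (add_tsub_cancel_of_le le_exitTime).symm
        have := add_sq_le_two_mul (y : ℝ≥0∞) (ρ ω - y)
        rwa [← e] at this
    _ = 2 * (y : ℝ≥0∞) ^ 2 + 2 * ∫⁻ ω, (ρ ω - y) ^ 2 ∂P := by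
        have e : ∫⁻ ω, 2 * (ρ ω - y) ^ 2 ∂P = 2 * ∫⁻ ω, (ρ ω - y) ^ 2 ∂P :=
          lintegral_const_mul' _ _ (by simp)
        rw [lintegral_add_left measurable_const, e]; simp
    _ ≤ 2 * (y : ℝ≥0∞) ^ 2 + 2 * (2 * (ofReal β * (ofReal β + y))) := by
        have := h1.trans (mul_le_mul_right (mul_le_mul_right (meanExit_le hβ y) _) _)
        gcongr
    _ = _ := by ring

end IsBrownianWith

end ExitSecondMoment

/-! ### The threshold policy -/

section Threshold

variable {Ω : Type*}

/-- The service time of sample `i`, where sample `0` needs no service. -/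
def prevService (Y : ℕ → Ω → ℝ≥0) : ℕ → Ω → ℝ≥0
  | 0, _ => 0
  | i + 1, ω => Y i ω

/-- The sampling times of the threshold policy: after the delivery of a sample, the next sample is
taken as soon as the squared error exceeds `β`. -/
def thresholdPolicy (β : ℝ) (W : ℝ≥0 → Ω → ℝ) (Y : ℕ → Ω → ℝ≥0) : ℕ → Ω → ℝ≥0∞
  | 0 => fun _ => 0
  | n + 1 => fun ω => thresholdPolicy β W Y n ω +
      exitTime β (shiftPath W (thresholdPolicy β W Y n) ω) (prevService Y n ω)

/-- The waiting time of the threshold policy between the samples `n` and `n + 1`. -/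
def waitingTime (β : ℝ) (W : ℝ≥0 → Ω → ℝ) (Y : ℕ → Ω → ℝ≥0) (n : ℕ) (ω : Ω) : ℝ≥0∞ :=
  exitTime β (shiftPath W (thresholdPolicy β W Y n) ω) (prevService Y n ω)

variable {W : ℝ≥0 → Ω → ℝ} {Y : ℕ → Ω → ℝ≥0} {β : ℝ}

lemma thresholdPolicy_succ (n : ℕ) (ω : Ω) :
    thresholdPolicy β W Y (n + 1) ω = thresholdPolicy β W Y n ω + waitingTime β W Y n ω := rfl

lemma deliveryTime_thresholdPolicy (n : ℕ) (ω : Ω) :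
    deliveryTime Y (thresholdPolicy β W Y) n ω =
      thresholdPolicy β W Y n ω + prevService Y n ω := by
  induction n with
  | zero => simp [deliveryTime, thresholdPolicy, prevService]
  | succ n ih =>
    rw [deliveryTime, ih, max_eq_left]
    · rfl
    · rw [thresholdPolicy_succ]
      gcongr
      exact le_exitTime

lemma deliveryTime_le_thresholdPolicy (n : ℕ) (ω : Ω) :
    deliveryTime Y (thresholdPolicy β W Y) n ω ≤ thresholdPolicy β W Y (n + 1) ω := by
  rw [deliveryTime_thresholdPolicy, thresholdPolicy_succ]
  gcongr
  exact le_exitTime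

/-- The sampling time `n + 1` in terms of the signal and of the delivery of sample `n`. -/
lemma thresholdPolicy_succ_lt_iff (hW : ∀ ω, Continuous fun t => W t ω) (n : ℕ) (ω : Ω) (u : ℝ≥0) :
    thresholdPolicy β W Y (n + 1) ω < u ↔ ∃ q : ℚ, Real.toNNReal q < u ∧
      deliveryTime Y (thresholdPolicy β W Y) n ω ≤ Real.toNNReal q ∧
      β < (W (Real.toNNReal q) ω - W (thresholdPolicy β W Y n ω).toNNReal ω) ^ 2 := by
  rw [deliveryTime_thresholdPolicy, thresholdPolicy_succ, waitingTime]
  set s := thresholdPolicy β W Y n ω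
  set y := prevService Y n ω
  constructor
  · intro h
    have hs : s ≠ ∞ := ne_top_of_le_ne_top (h.trans_le le_top).ne le_self_add
    rw [add_comm, ← lt_tsub_iff_right] at h
    obtain ⟨q, ⟨h1, h2⟩, h3⟩ := exitTime_lt_iff.1 h
    rw [lt_tsub_iff_right] at h3
    have h2' : β < (fun r => W r ω - W s.toNNReal ω) (s.toNNReal + Real.toNNReal q) ^ 2 := h2
    obtain ⟨q', h4, h5, h6⟩ := exists_rat_of_continuous (u := u) ((hW ω).sub continuous_const) h2'
      (by rw [ENNReal.coe_add, ENNReal.coe_toNNReal hs, add_comm]; exact h3)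
    refine ⟨q', by exact_mod_cast h5, ?_, h6⟩
    rw [← ENNReal.coe_toNNReal hs]
    exact_mod_cast (add_le_add_right h1 _).trans h4.le
  · rintro ⟨q, h1, h2, h3⟩
    have hs : s ≠ ∞ := ne_top_of_le_ne_top ENNReal.coe_ne_top (le_self_add.trans h2)
    rw [← ENNReal.coe_toNNReal hs] at h2 ⊢
    have h2' : s.toNNReal + y ≤ Real.toNNReal q := by exact_mod_cast h2
    have h4 : s.toNNReal ≤ Real.toNNReal q := le_self_add.trans h2'
    have hle := exitTime_le (x := shiftPath W (thresholdPolicy β W Y n) ω) (y := y)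
      (r := Real.toNNReal q - s.toNNReal) (β := β)
      (((hW ω).comp (continuous_const.add continuous_id)).sub continuous_const)
      (le_tsub_of_add_le_left h2') (by
        show β < (W (s.toNNReal + (Real.toNNReal q - s.toNNReal)) ω - W s.toNNReal ω) ^ 2
        rwa [add_tsub_cancel_of_le h4])
    calc (s.toNNReal : ℝ≥0∞) + _ ≤ s.toNNReal + ((Real.toNNReal q - s.toNNReal : ℝ≥0) : ℝ≥0∞) := by
          gcongr
      _ = Real.toNNReal q := by rw [← ENNReal.coe_add, add_tsub_cancel_of_le h4]
      _ < u := by exact_mod_cast h1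

/-- A filtration to which the signal and the deliveries are adapted determines the next sampling
time of the threshold policy. -/
lemma isOptional_thresholdPolicy_succ {F : ℝ≥0 → MeasurableSpace Ω} (hF : Monotone F)
    (hW : ∀ ω, Continuous fun t => W t ω) (hWF : ∀ s, Measurable[F s] (W s)) {n : ℕ}
    (hS : IsOptional F (thresholdPolicy β W Y n))
    (hD : ∀ q, MeasurableSet[F q] {ω | deliveryTime Y (thresholdPolicy β W Y) n ω ≤ (q : ℝ≥0)}) :
    IsOptional F (thresholdPolicy β W Y (n + 1)) := by
  intro u
  have e : {ω | thresholdPolicy β W Y (n + 1) ω < u} = ⋃ q : ℚ, ⋃ (_ : Real.toNNReal q < u),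
      {ω | deliveryTime Y (thresholdPolicy β W Y) n ω ≤ Real.toNNReal q} ∩
        ⋃ q' : ℚ, ⋃ (_ : Real.toNNReal q' < u), ({ω | β < (W (Real.toNNReal q) ω -
          W (thresholdPolicy β W Y n ω).toNNReal ω) ^ 2} ∩
          {ω | thresholdPolicy β W Y n ω < u}) := by
    ext ω
    simp only [Set.mem_ofPred_eq, thresholdPolicy_succ_lt_iff hW, Set.mem_iUnion, Set.mem_inter_iff,
      exists_prop]
    constructor
    · rintro ⟨q, h1, h2, h3⟩
      refine ⟨q, h1, h2, q, h1, h3, ?_⟩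
      refine lt_of_le_of_lt (le_trans ?_ h2) (ENNReal.coe_lt_coe.2 h1)
      rw [deliveryTime_thresholdPolicy]; exact le_self_add
    · rintro ⟨q, h1, h2, q', -, h3, -⟩
      exact ⟨q, h1, h2, h3⟩
  rw [e]
  have hm := measurable_pastOf_eval (mΩ := ⊤) hF (fun _ => le_top) hW hWF hS
  refine .iUnion fun q => .iUnion fun hq => (hF hq.le _ (hD _)).inter ?_
  refine .iUnion fun _ => .iUnion fun _ => ?_
  have hq' : Measurable[F u] (W (Real.toNNReal q)) := (hWF _).mono (hF hq.le) le_rfl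
  -- on the event that the last sample precedes `u`, its value is information at time `u`
  have e2 : {ω | β < (W (Real.toNNReal q) ω - W (thresholdPolicy β W Y n ω).toNNReal ω) ^ 2} ∩
      {ω | thresholdPolicy β W Y n ω < u} =
      {ω | β < (W (Real.toNNReal q) ω - {ω | thresholdPolicy β W Y n ω < u}.indicator
        (fun ω => W (thresholdPolicy β W Y n ω).toNNReal ω) ω) ^ 2} ∩
      {ω | thresholdPolicy β W Y n ω < u} := by
    ext ω
    simp only [Set.mem_inter_iff, Set.mem_ofPred_eq]
    refine and_congr_left fun h => ?_
    rw [Set.indicator_of_mem (show ω ∈ {ω | thresholdPolicy β W Y n ω < u} from h)]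
  rw [e2]
  have hm' := measurable_indicator_of_pastOf (mΩ := ⊤) hS hm u
  exact (measurableSet_lt measurable_const (Measurable.pow_const (Measurable.sub hq' hm') 2)).inter
    (hS u)

/-- Samples are delivered in order, so the number of acknowledged deliveries tells which ones have
been delivered. -/
lemma ackCount_ge_iff {S : ℕ → Ω → ℝ≥0∞} {i m : ℕ} (him : i ≤ m) (hi : 1 ≤ i) (s : ℝ≥0) (ω : Ω) :
    deliveryTime Y S i ω ≤ s ↔ i ≤ ackCount Y S m s ω := by
  classical
  unfold ackCount
  constructor
  · intro h
    calc i = (Finset.range i).card := (Finset.card_range i).symm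
      _ ≤ _ := by
        refine Finset.card_le_card fun j hj => ?_
        rw [Finset.mem_range] at hj
        refine Finset.mem_filter.2 ⟨Finset.mem_range.2 (hj.trans_le him), ?_⟩
        exact (deliveryTime_mono ω (Nat.succ_le_of_lt hj)).trans h
  · intro h
    by_contra hlt
    have hsub : ((Finset.range m).filter fun j => deliveryTime Y S (j + 1) ω ≤ s) ⊆
        Finset.range (i - 1) := fun j hj => by
      rw [Finset.mem_filter] at hj
      rw [Finset.mem_range]
      by_contra hj'
      exact hlt ((deliveryTime_mono ω (by omega : i ≤ j + 1)).trans hj.2)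
    have := Finset.card_le_card hsub
    rw [Finset.card_range] at this
    have h2 : i ≤ i - 1 := h.trans (by convert! this)
    omega

/-- The sampler observes the deliveries. -/
lemma measurableSet_deliveryTime_le {S : ℕ → Ω → ℝ≥0∞} {i m : ℕ} (hi : i ≤ m) (q : ℝ≥0) :
    MeasurableSet[samplerInfo W Y S m q] {ω | deliveryTime Y S i ω ≤ (q : ℝ≥0)} := by
  rcases Nat.eq_zero_or_pos i with rfl | hi0
  · simp [deliveryTime]
  · have e : {ω | deliveryTime Y S i ω ≤ (q : ℝ≥0)} = ackCount Y S m q ⁻¹' {k | i ≤ k} := by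
      ext ω; exact ackCount_ge_iff hi hi0 q ω
    rw [e]
    have h1 : MeasurableSpace.comap (ackCount Y S m q) ⊤ ≤ samplerInfo W Y S m q :=
      le_iSup₂_of_le (f := fun r (_ : r ≤ q) => MeasurableSpace.comap (W r) inferInstance ⊔
        MeasurableSpace.comap (serverState Y S m r) ⊤ ⊔
        MeasurableSpace.comap (ackCount Y S m r) ⊤) q le_rfl le_sup_right
    exact h1 _ ⟨_, trivial, rfl⟩

/-- The threshold policy can be realized by the sampler. -/
lemma thresholdPolicy_causal (hW : ∀ ω, Continuous fun t => W t ω) (m : ℕ) (t : ℝ≥0) :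
    MeasurableSet[samplerInfoPlus W Y (thresholdPolicy β W Y) m t]
      {ω | thresholdPolicy β W Y (m + 1) ω ≤ t} := by
  set S := thresholdPolicy β W Y
  set F := samplerInfo W Y S m
  have hF : Monotone F := fun _ _ h => biSup_mono fun _ hs => le_trans hs h
  have hWF : ∀ s, Measurable[F s] (W s) := fun s => Measurable.of_comap_le
    (le_iSup₂_of_le (f := fun r (_ : r ≤ s) => MeasurableSpace.comap (W r) inferInstance ⊔
    MeasurableSpace.comap (serverState Y S m r) ⊤ ⊔ MeasurableSpace.comap (ackCount Y S m r) ⊤)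
      s le_rfl (le_sup_of_le_left le_sup_left))
  have hS : ∀ i ≤ m + 1, IsOptional F (S i) := by
    intro i
    induction i with
    | zero => exact fun _ => isOptional_const 0
    | succ i ih =>
      exact fun hi => isOptional_thresholdPolicy_succ hF hW hWF (ih (by omega))
        (measurableSet_deliveryTime_le (by omega))
  refine MeasurableSpace.measurableSet_iInf.2 fun u =>
    MeasurableSpace.measurableSet_iInf.2 fun hu => ?_
  exact (hS (m + 1) le_rfl).measurableSet_le hF hu

end Threshold

/-! ### Independence of the inter-sampling times of the threshold policy -/

section ThresholdRenewal

variable {Ω : Type*} [mΩ : MeasurableSpace Ω] {P : Measure Ω}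
  {W : ℝ≥0 → Ω → ℝ} {Y : ℕ → Ω → ℝ≥0} {β : ℝ}

omit mΩ in
lemma measurable_exitTime_comp {E : Type*} {mE : MeasurableSpace E} {x : E → ℝ≥0 → ℝ} {y : E → ℝ≥0}
    (hx : Measurable x) (hy : Measurable y) : Measurable fun e => exitTime β (x e) (y e) :=
  (measurable_exitTime (β := β)).comp (hx.prodMk hy)

lemma isOptional_thresholdPolicy (h : IsModel P W Y) {i m : ℕ} (him : i ≤ m + 1) :
    IsOptional (pathInfo W (serviceInfo Y m)) (thresholdPolicy β W Y i) := by
  cases i with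
  | zero => exact isOptional_const 0
  | succ i =>
    exact IsModel.isOptional_mono (Nat.le_of_succ_le_succ him)
      (isOptional_sampling_and_delivery h (thresholdPolicy_causal h.cont) i).1

lemma measurable_thresholdPolicy (h : IsModel P W Y) (i : ℕ) :
    Measurable (thresholdPolicy β W Y i) :=
  (h.isBrownianWith i).measurable_of_isOptional (isOptional_thresholdPolicy h (Nat.le_succ i))

omit mΩ in
lemma thresholdPolicy_mono (ω : Ω) : Monotone fun i => thresholdPolicy β W Y i ω :=
  monotone_nat_of_le_succ fun _ => le_self_add

omit mΩ in
lemma measurable_path {m : MeasurableSpace Ω} (hW : ∀ t, Measurable (W t)) :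
    Measurable fun ω s => W s ω := measurable_pi_lambda _ hW

/-- Averaging over a cycle of the threshold policy: the signal after the sampling time and the
service times of the two samples are independent of each other and of the past. -/
lemma lintegral_threshold_cycle (h : IsModel P W Y) (m : ℕ)
    (hfin : ∀ᵐ ω ∂P, thresholdPolicy β W Y (m + 1) ω ≠ ∞) {X : Ω → ℝ≥0∞}
    (hX : Measurable[pastOf (mΩ := mΩ) (isOptional_thresholdPolicy (β := β) h
      (Nat.le_succ_of_le (Nat.le_succ (m + 1))))] X)
    (hX' : Measurable[allInfo W (serviceInfo Y m)] X)
    {f : (ℝ≥0 → ℝ) × ℝ≥0 × ℝ≥0 → ℝ≥0∞} (hf : Measurable f) :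
    ∫⁻ ω, X ω * f (shiftPath W (thresholdPolicy β W Y (m + 1)) ω, Y m ω, Y (m + 1) ω) ∂P =
      (∫⁻ ω, X ω ∂P) *
        ∫⁻ ω₁, ∫⁻ ω₂, ∫⁻ ω, f (fun s => W s ω, Y 0 ω₁, Y 0 ω₂) ∂P ∂P ∂P := by
  have := h.isProbabilityMeasure
  have hB := h.isBrownianWith (m + 2)
  set S := thresholdPolicy β W Y (m + 1)
  have hopt : IsOptional (pathInfo W (serviceInfo Y (m + 2))) S :=
    isOptional_thresholdPolicy h (Nat.le_succ_of_le (Nat.le_succ (m + 1)))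
  set Z := shiftPath W S
  have hZ : Measurable Z := hB.measurable_shiftPath (hB.measurable_of_isOptional hopt)
  have hXm : Measurable X := hX.mono (pastOf_le hopt) le_rfl
  have hWm : Measurable fun ω s => W s ω := measurable_path h.meas
  set Φ : ℝ≥0 × ℝ≥0 → ℝ≥0∞ := fun p => ∫⁻ ω, f (fun s => W s ω, p) ∂P
  have hΦ : Measurable Φ := Measurable.lintegral_prod_left
    (f := fun (ω : Ω) (p : ℝ≥0 × ℝ≥0) => f (fun s => W s ω, p))
    (hf.comp ((hWm.comp measurable_fst).prodMk measurable_snd))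
  set Ψ : ℝ≥0 → ℝ≥0∞ := fun y => ∫⁻ ω, Φ (y, Y 0 ω) ∂P
  have hΨ : Measurable Ψ := Measurable.lintegral_prod_left
    (f := fun (ω : Ω) (y : ℝ≥0) => Φ (y, Y 0 ω))
    (hΦ.comp (measurable_snd.prodMk ((h.measY 0).comp measurable_fst)))
  have hYpast : ∀ j < m + 2, Measurable[pastOf (mΩ := mΩ) hopt] (Y j) := fun j hj =>
    measurable_pastOf_of_zero pathInfo_mono hB.pathInfo_le hopt
      ((measurable_serviceInfo hj).mono (le_pathInfo 0) le_rfl)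
  -- the signal after the sampling time
  have e1 : ∫⁻ ω, X ω * f (Z ω, Y m ω, Y (m + 1) ω) ∂P =
      ∫⁻ ω, X ω * Φ (Y m ω, Y (m + 1) ω) ∂P := by
    have hD : Measurable fun ω => (X ω, Y m ω, Y (m + 1) ω) :=
      hXm.prodMk ((h.measY m).prodMk (h.measY (m + 1)))
    have e := lintegral_indepFun_pair hZ hD (hB.indepFun_shiftPath hopt hfin
      (measurable_prodMk_of hX (measurable_prodMk_of (hYpast m (by omega))
        (hYpast (m + 1) (by omega))))).symm
      (f := fun z d => d.1 * f (z, d.2))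
      ((measurable_fst.comp measurable_snd).mul
        (hf.comp (measurable_fst.prodMk (measurable_snd.comp measurable_snd))))
    rw [e]
    refine lintegral_congr fun ω' => ?_
    have hfd : Measurable fun z => f (z, Y m ω', Y (m + 1) ω') :=
      hf.comp (measurable_id.prodMk measurable_const)
    exact (lintegral_const_mul _ (hfd.comp hZ)).trans
      (congrArg _ ((hB.identDistrib_shiftPath hopt hfin).comp hfd).lintegral_eq)
  -- the second service time
  have e2 : ∫⁻ ω, X ω * Φ (Y m ω, Y (m + 1) ω) ∂P = ∫⁻ ω, X ω * Ψ (Y m ω) ∂P := by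
    have hle : allInfo W (serviceInfo Y m) ≤ allInfo W (serviceInfo Y (m + 1)) :=
      sup_le_sup_left (serviceInfo_mono (Nat.le_succ m)) _
    have hDall : Measurable[allInfo W (serviceInfo Y (m + 1))] fun ω => (X ω, Y m ω) :=
      measurable_prodMk_of (hX'.mono hle le_rfl)
        ((measurable_serviceInfo (Nat.lt_succ_self m)).mono le_sup_right le_rfl)
    have e := lintegral_indep_pair (h.measY (m + 1)) (hXm.prodMk (h.measY m))
      (indep_of_indep_of_le_right (h.indep_allInfo (m + 1)).symm hDall.comap_le)
      (f := fun y' d => d.1 * Φ (d.2, y'))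
      ((measurable_fst.comp measurable_snd).mul
        (hΦ.comp ((measurable_snd.comp measurable_snd).prodMk measurable_fst)))
    rw [e]
    refine lintegral_congr fun ω' => ?_
    have hfd : Measurable fun y' => Φ (Y m ω', y') :=
      hΦ.comp (measurable_const.prodMk measurable_id)
    exact (lintegral_const_mul _ (hfd.comp (h.measY (m + 1)))).trans
      (congrArg _ ((h.identY (m + 1)).comp hfd).lintegral_eq)
  -- the first service time
  have e3 : ∫⁻ ω, X ω * Ψ (Y m ω) ∂P = (∫⁻ ω, X ω ∂P) * ∫⁻ ω, Ψ (Y 0 ω) ∂P := by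
    have e := lintegral_indep_pair (h.measY m) hXm
      (indep_of_indep_of_le_right (h.indep_allInfo m).symm hX'.comap_le)
      (f := fun y x => x * Ψ y) (measurable_snd.mul (hΨ.comp measurable_fst))
    rw [e, ← lintegral_mul_const _ hXm]
    refine lintegral_congr fun ω' => ?_
    exact (lintegral_const_mul _ (hΨ.comp (h.measY m))).trans
      (congrArg _ ((h.identY m).comp hΨ).lintegral_eq)
  rw [e1, e2, e3]

/-- The first cycle of the threshold policy. -/
lemma lintegral_threshold_zero (h : IsModel P W Y) {f : (ℝ≥0 → ℝ) × ℝ≥0 → ℝ≥0∞}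
    (hf : Measurable f) :
    ∫⁻ ω, f (shiftPath W (thresholdPolicy β W Y 0) ω, Y 0 ω) ∂P =
      ∫⁻ ω', ∫⁻ ω, f (fun s => W s ω, Y 0 ω') ∂P ∂P := by
  have := h.isProbabilityMeasure
  have hB := h.isBrownianWith 1
  have hopt : IsOptional (pathInfo W (serviceInfo Y 1)) (thresholdPolicy β W Y 0) :=
    isOptional_thresholdPolicy h (by omega)
  have hfin : ∀ᵐ ω ∂P, thresholdPolicy β W Y 0 ω ≠ ∞ := ae_of_all _ fun ω => by
    simp [thresholdPolicy]
  have hZ := hB.measurable_shiftPath (hB.measurable_of_isOptional hopt)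
  have hY : Measurable[pastOf (mΩ := mΩ) hopt] (Y 0) :=
    measurable_pastOf_of_zero pathInfo_mono hB.pathInfo_le hopt
      ((measurable_serviceInfo one_pos).mono (le_pathInfo 0) le_rfl)
  have e := lintegral_indepFun_pair hZ (h.measY 0) (hB.indepFun_shiftPath hopt hfin hY).symm
    (f := fun z y => f (z, y)) hf
  rw [e]
  refine lintegral_congr fun ω' => ?_
  exact ((hB.identDistrib_shiftPath hopt hfin).comp
    (hf.comp (measurable_id.prodMk measurable_const))).lintegral_eq

lemma measurable_prevService (h : IsModel P W Y) (n : ℕ) : Measurable (prevService Y n) := by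
  cases n with
  | zero => exact measurable_const
  | succ n => exact h.measY n

lemma measurable_waitingTime (h : IsModel P W Y) (n : ℕ) : Measurable (waitingTime β W Y n) := by
  have hZ : Measurable (shiftPath W (thresholdPolicy β W Y n)) :=
    (h.isBrownianWith n).measurable_shiftPath (measurable_thresholdPolicy h n)
  exact measurable_exitTime_comp hZ (measurable_prevService h n)

/-- The law of the waiting times after the first one. -/
lemma lintegral_waitingTime_succ (h : IsModel P W Y) (m : ℕ)
    (hfin : ∀ᵐ ω ∂P, thresholdPolicy β W Y (m + 1) ω ≠ ∞) {X : Ω → ℝ≥0∞}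
    (hX : Measurable[pastOf (mΩ := mΩ) (isOptional_thresholdPolicy (β := β) h
      (Nat.le_succ_of_le (Nat.le_succ (m + 1))))] X)
    (hX' : Measurable[allInfo W (serviceInfo Y m)] X) {g : ℝ≥0∞ → ℝ≥0∞} (hg : Measurable g) :
    ∫⁻ ω, X ω * g (waitingTime β W Y (m + 1) ω) ∂P =
      (∫⁻ ω, X ω ∂P) * ∫⁻ ω', ∫⁻ ω, g (exitTime β (fun s => W s ω) (Y 0 ω')) ∂P ∂P := by
  have := h.isProbabilityMeasure
  have e := lintegral_threshold_cycle h m hfin hX hX' (f := fun z => g (exitTime β z.1 z.2.1))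
    (hg.comp (measurable_exitTime_comp measurable_fst (measurable_fst.comp measurable_snd)))
  simp only [lintegral_const, measure_univ, mul_one] at e
  exact e

/-- The sampling times of the threshold policy are almost surely finite. -/
lemma ae_thresholdPolicy_ne_top (h : IsModel P W Y) (hβ : 0 ≤ β) (n : ℕ) :
    ∀ᵐ ω ∂P, thresholdPolicy β W Y n ω ≠ ∞ := by
  have := h.isProbabilityMeasure
  have hg : Measurable (({∞} : Set ℝ≥0∞).indicator (1 : ℝ≥0∞ → ℝ≥0∞)) :=
    measurable_one.indicator (measurableSet_singleton _)
  have hzero : ∀ y : ℝ≥0, ∫⁻ ω, ({∞} : Set ℝ≥0∞).indicator 1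
      (exitTime β (fun s => W s ω) y) ∂P = 0 := fun y => by
    refine (lintegral_congr_ae (((h.isBrownianWith 0).lintegral_exitTime hβ y).1.mono
      fun ω hω => Set.indicator_of_notMem (s := ({∞} : Set ℝ≥0∞))
        (a := exitTime β (fun s => W s ω) y) hω 1)).trans lintegral_zero
  have hstep : ∀ n, ∫⁻ ω, ({∞} : Set ℝ≥0∞).indicator 1 (waitingTime β W Y n ω) ∂P = 0 →
      ∀ᵐ ω ∂P, waitingTime β W Y n ω ≠ ∞ := fun n hn => by
    have hgn : Measurable fun ω => ({∞} : Set ℝ≥0∞).indicator (1 : ℝ≥0∞ → ℝ≥0∞)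
      (waitingTime β W Y n ω) := hg.comp (measurable_waitingTime h n)
    filter_upwards [(lintegral_eq_zero_iff hgn).1 hn] with ω hω hh
    have h1 : waitingTime β W Y n ω ∈ ({∞} : Set ℝ≥0∞) := hh
    rw [Set.indicator_of_mem h1] at hω
    exact one_ne_zero hω
  induction n with
  | zero => exact ae_of_all _ fun ω => ENNReal.zero_ne_top
  | succ n ih =>
    have hw : ∀ᵐ ω ∂P, waitingTime β W Y n ω ≠ ∞ := by
      refine hstep n ?_
      cases n with
      | zero =>
        have hf : Measurable fun z : (ℝ≥0 → ℝ) × ℝ≥0 =>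
            ({∞} : Set ℝ≥0∞).indicator (1 : ℝ≥0∞ → ℝ≥0∞) (exitTime β z.1 0) :=
          hg.comp (measurable_exitTime_comp measurable_fst measurable_const)
        have e := lintegral_threshold_zero (β := β) h hf
        simp only [hzero, lintegral_zero] at e
        exact e
      | succ m =>
        have e := lintegral_waitingTime_succ h m ih (X := fun _ => 1) measurable_const
          measurable_const hg
        simp only [hzero, lintegral_zero, one_mul, mul_zero] at e
        exact e
    filter_upwards [ih, hw] with ω h1 h2
    exact ENNReal.add_ne_top.2 ⟨h1, h2⟩

lemma ae_interSampling_thresholdPolicy (h : IsModel P W Y) (hβ : 0 ≤ β) (n : ℕ) :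
    interSampling (thresholdPolicy β W Y) n =ᵐ[P] waitingTime β W Y n := by
  filter_upwards [ae_thresholdPolicy_ne_top h hβ n] with ω hω
  rw [interSampling, thresholdPolicy_succ, ENNReal.add_sub_cancel_left hω]

lemma measurable_interSampling_thresholdPolicy (h : IsModel P W Y) (n : ℕ) :
    Measurable (interSampling (thresholdPolicy β W Y) n) :=
  (measurable_thresholdPolicy h (n + 1)).sub (measurable_thresholdPolicy h n)

omit mΩ in
lemma measurable_tsub_of {m : MeasurableSpace Ω} {f g : Ω → ℝ≥0∞} (hf : Measurable[m] f)
    (hg : Measurable[m] g) : Measurable[m] fun ω => f ω - g ω := hf.sub hg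

lemma measurable_pastOf_interSampling (h : IsModel P W Y) {i m : ℕ} (him : i ≤ m) :
    Measurable[pastOf (mΩ := mΩ) (isOptional_thresholdPolicy (β := β) h
      (Nat.le_succ_of_le (Nat.le_succ (m + 1))))] (interSampling (thresholdPolicy β W Y) i) := by
  have hopt : ∀ j ≤ m + 1, IsOptional (pathInfo W (serviceInfo Y (m + 2)))
      (thresholdPolicy β W Y j) := fun j hj => isOptional_thresholdPolicy h (by omega)
  have hj : ∀ j (hj : j ≤ m + 1), Measurable[pastOf (mΩ := mΩ) (hopt (m + 1) le_rfl)]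
      (thresholdPolicy β W Y j) := fun j hj =>
    ((hopt j hj).measurable_pastOf (mΩ := mΩ) pathInfo_mono (h.isBrownianWith _).pathInfo_le).mono
      (pastOf_mono _ _ fun ω => thresholdPolicy_mono ω hj) le_rfl
  exact measurable_tsub_of (hj (i + 1) (by omega)) (hj i (by omega))

lemma measurable_allInfo_interSampling (h : IsModel P W Y) {i m : ℕ} (him : i ≤ m) :
    Measurable[allInfo W (serviceInfo Y m)] (interSampling (thresholdPolicy β W Y) i) := by
  have hj : ∀ j ≤ m + 1, Measurable[allInfo W (serviceInfo Y m)]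
      (thresholdPolicy β W Y j) := fun j hj => (isOptional_thresholdPolicy h hj).measurable_allInfo
  exact measurable_tsub_of (hj (i + 1) (by omega)) (hj i (by omega))

omit mΩ in
lemma measurableSet_iInter_lt {m : MeasurableSpace Ω} {T : ℕ → Ω → ℝ≥0∞} {n : ℕ}
    (hT : ∀ i < n, Measurable (T i)) {B : ℕ → Set ℝ≥0∞} (hB : ∀ i, MeasurableSet (B i)) :
    MeasurableSet (⋂ i ∈ Finset.range n, T i ⁻¹' B i) :=
  Finset.measurableSet_biInter _ fun i hi => hT i (Finset.mem_range.1 hi) (hB i)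

omit mΩ in
lemma measurable_indicator_one_of {m : MeasurableSpace Ω} {A : Set Ω} (hA : MeasurableSet A) :
    Measurable (A.indicator (1 : Ω → ℝ≥0∞)) := measurable_one.indicator hA

/-- An inter-sampling time of the threshold policy is independent of the events `A` of the past, and
its law does not depend on the index. -/
lemma prob_interSampling_succ (h : IsModel P W Y) (hβ : 0 ≤ β) (m : ℕ) {A : Set Ω}
    (hA : MeasurableSet[pastOf (mΩ := mΩ) (isOptional_thresholdPolicy (β := β) h
      (Nat.le_succ_of_le (Nat.le_succ (m + 1))))] A)
    (hA' : MeasurableSet[allInfo W (serviceInfo Y m)] A) {B : Set ℝ≥0∞} (hB : MeasurableSet B) :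
    P (A ∩ interSampling (thresholdPolicy β W Y) (m + 1) ⁻¹' B) =
      P A * ∫⁻ ω', ∫⁻ ω, B.indicator 1 (exitTime β (fun s => W s ω) (Y 0 ω')) ∂P ∂P := by
  have hAm : MeasurableSet[mΩ] A := pastOf_le _ _ hA
  have e := lintegral_waitingTime_succ h m (ae_thresholdPolicy_ne_top h hβ (m + 1))
    (X := A.indicator 1) (measurable_indicator_one_of hA) (measurable_indicator_one_of hA')
    (g := B.indicator 1) (measurable_one.indicator hB)
  rw [lintegral_indicator_one hAm] at e
  rw [← e, ← lintegral_indicator_one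
    (hAm.inter (measurable_interSampling_thresholdPolicy h (m + 1) hB))]
  refine lintegral_congr_ae ?_
  filter_upwards [ae_interSampling_thresholdPolicy h hβ (m + 1)] with ω hω
  by_cases h1 : ω ∈ A
  · by_cases h2 : interSampling (thresholdPolicy β W Y) (m + 1) ω ∈ B
    · have h3 : ω ∈ A ∩ interSampling (thresholdPolicy β W Y) (m + 1) ⁻¹' B := ⟨h1, h2⟩
      rw [Set.indicator_of_mem h3, Set.indicator_of_mem h1,
        Set.indicator_of_mem (show waitingTime β W Y (m + 1) ω ∈ B from hω ▸ h2)]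
      simp
    · have h3 : ω ∉ A ∩ interSampling (thresholdPolicy β W Y) (m + 1) ⁻¹' B := fun h3 => h2 h3.2
      rw [Set.indicator_of_notMem h3,
        Set.indicator_of_notMem (show waitingTime β W Y (m + 1) ω ∉ B from hω ▸ h2)]
      simp
  · have h3 : ω ∉ A ∩ interSampling (thresholdPolicy β W Y) (m + 1) ⁻¹' B := fun h3 => h1 h3.1
    rw [Set.indicator_of_notMem h3, Set.indicator_of_notMem h1, zero_mul]

lemma prob_interSampling (h : IsModel P W Y) (hβ : 0 ≤ β) (m : ℕ) {B : Set ℝ≥0∞}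
    (hB : MeasurableSet B) : P (interSampling (thresholdPolicy β W Y) (m + 1) ⁻¹' B) =
      ∫⁻ ω', ∫⁻ ω, B.indicator 1 (exitTime β (fun s => W s ω) (Y 0 ω')) ∂P ∂P := by
  have := h.isProbabilityMeasure
  have e := prob_interSampling_succ h hβ m (A := Set.univ) .univ MeasurableSet.univ hB
  rwa [Set.univ_inter, measure_univ, one_mul] at e

/-- The inter-sampling times of the threshold policy are independent. -/
theorem iIndepFun_interSampling_thresholdPolicy (h : IsModel P W Y) (hβ : 0 ≤ β) :
    iIndepFun (interSampling (thresholdPolicy β W Y)) P := by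
  have := h.isProbabilityMeasure
  set T := interSampling (thresholdPolicy β W Y)
  have key : ∀ (B : ℕ → Set ℝ≥0∞), (∀ i, MeasurableSet (B i)) → ∀ n,
      P (⋂ i ∈ Finset.range n, T i ⁻¹' B i) = ∏ i ∈ Finset.range n, P (T i ⁻¹' B i) := by
    intro B hB n
    induction n with
    | zero => simp
    | succ n ih =>
      rw [Finset.prod_range_succ, ← ih, Finset.range_add_one, Finset.set_biInter_insert,
        Set.inter_comm]
      cases n with
      | zero => simp
      | succ m =>
        rw [prob_interSampling_succ h hβ m (measurableSet_iInter_lt (fun i hi =>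
          measurable_pastOf_interSampling h (Nat.lt_succ_iff.1 hi)) hB)
          (measurableSet_iInter_lt (fun i hi =>
          measurable_allInfo_interSampling h (Nat.lt_succ_iff.1 hi)) hB) (hB _),
          prob_interSampling h hβ m (hB _)]
  refine (iIndepFun_iff_measure_inter_preimage_eq_mul).2 fun s B hB => ?_
  classical
  obtain ⟨n, hn⟩ : ∃ n, s ⊆ Finset.range n := ⟨s.sup id + 1, fun i hi =>
    Finset.mem_range.2 (Nat.lt_succ_of_le (Finset.le_sup (f := id) hi))⟩
  have e := key (fun i => if i ∈ s then B i else Set.univ) (fun i => by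
    by_cases hi : i ∈ s
    · simp only [hi, if_true]; exact hB i hi
    · simp only [hi, if_false]; exact .univ) n
  have e1 : ⋂ i ∈ Finset.range n, T i ⁻¹' (if i ∈ s then B i else Set.univ) =
      ⋂ i ∈ s, T i ⁻¹' B i := by
    ext ω
    simp only [Set.mem_iInter, Set.mem_preimage]
    constructor
    · intro h1 i hi
      have := h1 i (hn hi)
      rwa [if_pos hi] at this
    · intro h1 i _
      split_ifs with hi
      · exact h1 i hi
      · trivial
  have e2 : ∏ i ∈ Finset.range n, P (T i ⁻¹' (if i ∈ s then B i else Set.univ)) =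
      ∏ i ∈ s, P (T i ⁻¹' B i) := by
    rw [← Finset.prod_subset hn]
    · exact Finset.prod_congr rfl fun i hi => by rw [if_pos hi]
    · intro i _ hi
      rw [if_neg hi]; simp
  rw [← e1, ← e2]
  exact e

end ThresholdRenewal

/-! ### Admissibility of the threshold policy -/

section ThresholdRegenerative

variable {Ω : Type*} [mΩ : MeasurableSpace Ω] {P : Measure Ω}
  {W : ℝ≥0 → Ω → ℝ} {Y : ℕ → Ω → ℝ≥0} {β : ℝ}

omit mΩ in
lemma measurable_pi_of {m : MeasurableSpace Ω} {ι E : Type*} [MeasurableSpace E]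
    {f : ι → Ω → E} (hf : ∀ i, Measurable[m] (f i)) : Measurable[m] fun ω i => f i ω :=
  measurable_pi_lambda _ hf

/-- A sequence of independent, from the index `1` on identically distributed inter-sampling times
regenerates at each index from `1` on. -/
lemma isRegenerativeSampling_of_iIndepFun [IsProbabilityMeasure P] {S : ℕ → Ω → ℝ≥0∞}
    (hT : ∀ i, Measurable (interSampling S i)) (hind : iIndepFun (interSampling S) P)
    (hident : ∀ i, P.map (interSampling S (i + 1)) = P.map (interSampling S 1))
    (h1 : ∫⁻ ω, S 1 ω ^ 2 ∂P < ∞)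
    (h2 : ∀ j, 0 < ∫⁻ ω, (interSampling S (j + 1) ω) ^ 2 ∂P ∧
      ∫⁻ ω, (interSampling S (j + 1) ω) ^ 2 ∂P < ∞) : IsRegenerativeSampling P S := by
  refine ⟨fun j _ => j + 1, fun j => measurable_const, fun j ω => Nat.lt_succ_self _, fun j => ?_,
    fun j => ?_, fun j => ?_, h1, h2⟩
  · have hm : ∀ j, Measurable fun ω i => interSampling S (j + 1 + i) ω := fun j =>
      measurable_pi_lambda _ fun i => hT _
    have hlaw : ∀ j, P.map (fun ω i => interSampling S (j + 1 + i) ω) =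
        Measure.infinitePi fun _ : ℕ => P.map (interSampling S 1) := fun j => by
      have hj : iIndepFun (fun i => interSampling S (j + 1 + i)) P :=
        hind.precomp (g := fun i => j + 1 + i) fun a b hab => Nat.add_left_cancel hab
      have e := (iIndepFun_iff_map_fun_eq_infinitePi_map fun i => hT (j + 1 + i)).1 hj
      rw [e]
      congr 1
      funext i
      rw [show j + 1 + i = (j + i) + 1 by ring]
      exact hident (j + i)
    have hid : IdentDistrib (fun ω i => interSampling S (j + 1 + i) ω)
        (fun ω i => interSampling S (0 + 1 + i) ω) P P :=
      ⟨(hm j).aemeasurable, (hm 0).aemeasurable, by rw [hlaw, hlaw]⟩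
    have hc := hid.comp (u := fun a : ℕ → ℝ≥0∞ => (a, fun _ : ℕ => 1))
      (measurable_id.prodMk measurable_const)
    convert! hc using 1
    · funext ω
      refine Prod.ext rfl (funext fun i => ?_)
      show j + i + 1 + 1 - (j + i + 1) = 1
      omega
    · funext ω
      refine Prod.ext rfl (funext fun i => ?_)
      show 0 + i + 1 + 1 - (0 + i + 1) = 1
      omega
  · have hI := indep_iSup_of_disjoint (fun i => (hT i).comap_le) hind.iIndep
      (S := {i | i < j + 1}) (T := {i | j + 1 ≤ i})
      (Set.disjoint_left.2 fun i hi hi' => absurd (show i < j + 1 from hi) (not_lt.2 hi'))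
    rw [IndepFun_iff_Indep]
    refine indep_of_indep_of_le_left (indep_of_indep_of_le_right hI ?_) ?_
    · refine Measurable.comap_le ?_
      refine measurable_prodMk_of (measurable_pi_of fun i => ?_)
        (measurable_pi_of fun i => measurable_const)
      exact Measurable.of_comap_le
        (le_iSup₂_of_le (f := fun i (_ : i ∈ {i | j + 1 ≤ i}) =>
          MeasurableSpace.comap (interSampling S i) inferInstance) (j + 1 + i)
          (show j + 1 ≤ j + 1 + i from Nat.le_add_right _ _) le_rfl)
    · refine Measurable.comap_le ?_
      refine measurable_prodMk_of (measurable_pi_of fun i => measurable_const)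
        (measurable_pi_of fun i => ?_)
      by_cases hi : i < j + 1
      · simp only [hi, if_true]
        exact Measurable.of_comap_le
          (le_iSup₂_of_le (f := fun i (_ : i ∈ {i | i < j + 1}) =>
            MeasurableSpace.comap (interSampling S i) inferInstance) i hi le_rfl)
      · simp only [hi, if_false]
        exact measurable_const
  · simp

/-- The mean inter-sampling time of the threshold policy, where `Z` is the service time. -/
def meanCycle (P : Measure Ω) (β : ℝ) (Z : Ω → ℝ≥0) : ℝ≥0∞ := ∫⁻ ω, meanExit β (Z ω) ∂P

lemma lintegral_waitingTime (h : IsModel P W Y) (hβ : 0 ≤ β) (m : ℕ) :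
    ∫⁻ ω, waitingTime β W Y (m + 1) ω ∂P = meanCycle P β (Y 0) := by
  have := h.isProbabilityMeasure
  have e := lintegral_waitingTime_succ h m (ae_thresholdPolicy_ne_top h hβ (m + 1))
    (X := fun _ => 1) measurable_const measurable_const measurable_id
  simp only [one_mul, lintegral_const, measure_univ, id_eq] at e
  rw [e]
  exact lintegral_congr fun ω' => ((h.isBrownianWith 0).lintegral_exitTime hβ (Y 0 ω')).2

lemma le_meanCycle [IsProbabilityMeasure P] (Z : Ω → ℝ≥0) : ofReal β ≤ meanCycle P β Z := by
  have h1 : ∀ y, ofReal β ≤ meanExit β y := fun y => by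
    calc ofReal β = ∫⁻ _, ofReal β ∂gaussianReal 0 y := by simp
      _ ≤ _ := lintegral_mono fun z => ENNReal.ofReal_le_ofReal (le_max_left _ _)
  calc ofReal β = ∫⁻ _, ofReal β ∂P := by simp
    _ ≤ _ := lintegral_mono fun ω => h1 _

/-- The threshold policy is an admissible policy without queueing. -/
theorem isNonQueueingPolicy_thresholdPolicy (h : IsModel P W Y) (hβ : 0 < β) :
    IsNonQueueingPolicy P W Y (thresholdPolicy β W Y) where
  zero _ := rfl
  mono _ _ := le_self_add
  causal := thresholdPolicy_causal h.cont
  idle := deliveryTime_le_thresholdPolicy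
  regenerative := by
    have := h.isProbabilityMeasure
    have hT := measurable_interSampling_thresholdPolicy (β := β) h
    have hB := h.isBrownianWith 0
    have hsq : ∀ j, ∫⁻ ω, interSampling (thresholdPolicy β W Y) (j + 1) ω ^ 2 ∂P =
        ∫⁻ ω', ∫⁻ ω, exitTime β (fun s => W s ω) (Y 0 ω') ^ 2 ∂P ∂P := fun j => by
      have e := lintegral_waitingTime_succ h j (ae_thresholdPolicy_ne_top h hβ.le (j + 1))
        (X := fun _ => 1) measurable_const measurable_const (g := fun t => t ^ 2) (by fun_prop)
      simp only [one_mul, lintegral_const, measure_univ] at e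
      rw [← e]
      refine lintegral_congr_ae ?_
      filter_upwards [ae_interSampling_thresholdPolicy h hβ.le (j + 1)] with ω hω
      rw [hω]
    refine isRegenerativeSampling_of_iIndepFun hT
      (iIndepFun_interSampling_thresholdPolicy h hβ.le) (fun i => ?_) ?_ fun j => ⟨?_, ?_⟩
    · refine Measure.ext fun B hB => ?_
      rw [Measure.map_apply (hT _) hB, Measure.map_apply (hT _) hB,
        prob_interSampling h hβ.le i hB, prob_interSampling h hβ.le 0 hB]
    · have hf : Measurable fun z : (ℝ≥0 → ℝ) × ℝ≥0 => exitTime β z.1 0 ^ 2 :=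
        (measurable_exitTime_comp measurable_fst measurable_const).pow_const 2
      have e := lintegral_threshold_zero (β := β) h hf
      simp only [lintegral_const, measure_univ, mul_one] at e
      have e2 : ∀ ω, thresholdPolicy β W Y 1 ω =
          exitTime β (shiftPath W (thresholdPolicy β W Y 0) ω) 0 := fun ω =>
        zero_add _
      simp_rw [e2]
      rw [e]
      refine (hB.lintegral_exitTime_sq_le hβ.le 0).trans_lt ?_
      exact lt_top_iff_ne_top.2 (by finiteness)
    · rw [pos_iff_ne_zero]
      intro h0
      rw [lintegral_eq_zero_iff ((hT _).pow_const 2)] at h0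
      have h1 : ∫⁻ ω, waitingTime β W Y (j + 1) ω ∂P = 0 := by
        refine (lintegral_congr_ae ?_).trans lintegral_zero
        filter_upwards [h0, ae_interSampling_thresholdPolicy h hβ.le (j + 1)] with ω h2 h3
        rw [← h3]
        exact pow_eq_zero_iff two_ne_zero |>.1 h2
      rw [lintegral_waitingTime h hβ.le] at h1
      have := le_meanCycle (P := P) (β := β) (Y 0)
      rw [h1] at this
      exact absurd (ENNReal.ofReal_pos.2 hβ) (not_lt.2 this)
    · rw [hsq]
      refine (lintegral_mono fun ω' => hB.lintegral_exitTime_sq_le hβ.le (Y 0 ω')).trans_lt ?_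
      have m1 : Measurable fun ω => (Y 0 ω : ℝ≥0∞) := (h.measY 0).coe_nnreal_ennreal
      have e2 : ∫⁻ ω, 2 * (Y 0 ω : ℝ≥0∞) ^ 2 ∂P = 2 * ∫⁻ ω, (Y 0 ω : ℝ≥0∞) ^ 2 ∂P :=
        lintegral_const_mul' _ _ (by simp)
      have e3 : ∫⁻ ω, 4 * ofReal β * (ofReal β + Y 0 ω) ∂P =
          4 * ofReal β * ∫⁻ ω, (ofReal β + Y 0 ω) ∂P :=
        lintegral_const_mul' _ _ (by finiteness)
      rw [lintegral_add_left ((m1.pow_const 2).const_mul 2), e2, e3,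
        lintegral_add_left measurable_const, lintegral_const, measure_univ, mul_one]
      have := h.lintegral_sq_ne_top
      have := h.lintegral_ne_top
      exact lt_top_iff_ne_top.2 (by finiteness)

/-- The threshold policy satisfies the rate constraint if its mean inter-sampling time is large. -/
lemma rateConstraint_thresholdPolicy (h : IsModel P W Y) (hβ : 0 ≤ β) {fmax : ℝ≥0∞}
    (hf : 1 / fmax ≤ meanCycle P β (Y 0)) : RateConstraint P fmax (thresholdPolicy β W Y) := by
  have hn : ∀ n : ℕ, n * meanCycle P β (Y 0) ≤ ∫⁻ ω, thresholdPolicy β W Y (n + 1) ω ∂P := by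
    intro n
    induction n with
    | zero => simp
    | succ n ih =>
      simp_rw [thresholdPolicy_succ (n + 1)]
      rw [lintegral_add_left (measurable_thresholdPolicy h (n + 1)), lintegral_waitingTime h hβ,
        Nat.cast_succ, add_mul, one_mul]
      gcongr
  refine hf.trans ?_
  set L := meanCycle P β (Y 0)
  have hlim : Tendsto (fun n : ℕ => L * (1 - (n : ℝ≥0∞)⁻¹)) atTop (nhds (L * (1 - 0))) :=
    ENNReal.Tendsto.const_mul (ENNReal.Tendsto.sub tendsto_const_nhds
      ENNReal.tendsto_inv_nat_nhds_zero (Or.inl ENNReal.one_ne_top)) (Or.inl (by simp))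
  rw [tsub_zero, mul_one] at hlim
  rw [← hlim.liminf_eq]
  refine liminf_le_liminf ((eventually_ge_atTop 1).mono fun n hn1 => ?_)
  obtain ⟨m, rfl⟩ := Nat.exists_eq_add_of_le' hn1
  have h0 : ((m + 1 : ℕ) : ℝ≥0∞) ≠ 0 := by exact_mod_cast Nat.succ_ne_zero m
  rw [ENNReal.le_div_iff_mul_le (Or.inl h0) (Or.inl (ENNReal.natCast_ne_top _))]
  refine le_trans (le_of_eq ?_) (hn m)
  rw [mul_assoc, ENNReal.sub_mul fun _ _ => ENNReal.natCast_ne_top _, one_mul,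
    ENNReal.inv_mul_cancel h0 (ENNReal.natCast_ne_top _), Nat.cast_succ,
    ENNReal.add_sub_cancel_right ENNReal.one_ne_top, mul_comm]

end ThresholdRegenerative

/-! ### The error accumulated in a cycle of the threshold policy -/

section ThresholdCost

variable {Ω : Type*} [mΩ : MeasurableSpace Ω] {P : Measure Ω}
  {W : ℝ≥0 → Ω → ℝ} {Y : ℕ → Ω → ℝ≥0} {β : ℝ}

/-- The squared error at the time `s` after a sample, if the time belongs to the cycle in which the
estimator uses this sample. The signal after the sample is `x`, the service times of this and of
the next sample are `y` and `y'`. -/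
def cycleError (β : ℝ) (s : ℝ) (z : (ℝ≥0 → ℝ) × ℝ≥0 × ℝ≥0) : ℝ≥0∞ :=
  (period z.2.1 (exitTime β z.1 z.2.1 + z.2.2)).indicator
    (fun r => ofReal (z.1 r.toNNReal ^ 2)) s

omit mΩ in
lemma measurable_cycleError_of {E : Type*} {mE : MeasurableSpace E} {s : E → ℝ}
    {x : E → ℝ≥0 → ℝ} {y y' : E → ℝ≥0} (hs : Measurable s) (hx : Measurable x)
    (hxs : Measurable fun e => x e (s e).toNNReal) (hy : Measurable y) (hy' : Measurable y') :
    Measurable fun e => cycleError β (s e) (x e, y e, y' e) := by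
  have he : Measurable fun e => exitTime β (x e) (y e) := measurable_exitTime_comp hx hy
  have hset : MeasurableSet {e | s e ∈ period (y e) (exitTime β (x e) (y e) + y' e)} :=
    (measurableSet_lt hy.coe_nnreal_ennreal (ENNReal.measurable_ofReal.comp hs)).inter
      (measurableSet_le (ENNReal.measurable_ofReal.comp hs) (he.add hy'.coe_nnreal_ennreal))
  exact (ENNReal.measurable_ofReal.comp (hxs.pow_const 2)).indicator hset

lemma measurable_cycleError (s : ℝ) : Measurable (cycleError β s) := by
  have := measurable_cycleError_of (β := β) (E := (ℝ≥0 → ℝ) × ℝ≥0 × ℝ≥0) (s := fun _ => s)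
    (x := fun z => z.1) (y := fun z => z.2.1) (y' := fun z => z.2.2) measurable_const
    measurable_fst ((measurable_pi_apply _).comp measurable_fst)
    (measurable_fst.comp measurable_snd) (measurable_snd.comp measurable_snd)
  exact this

/-- The mean cost of a cycle, for given service times. -/
def cycleCost (β : ℝ) (y y' : ℝ≥0) : ℝ≥0∞ :=
  meanExitCost β y + y' * meanExit β y + (y' : ℝ≥0∞) ^ 2 / 2

lemma IsBrownianWith.lintegral_cycleError_le {Ω : Type*} {𝒴 : MeasurableSpace Ω}
    [mΩ : MeasurableSpace Ω] {P : Measure Ω} {W : ℝ≥0 → Ω → ℝ} (h : IsBrownianWith 𝒴 P W)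
    (hβ : 0 ≤ β) (y y' : ℝ≥0) :
    ∫⁻ ω, (∫⁻ s, cycleError β s (fun r => W r ω, y, y')) ∂P ≤ cycleCost β y y' := by
  refine le_trans (le_of_eq (lintegral_congr fun ω => ?_)) (h.lintegral_cycleCost_le hβ y y')
  rw [← lintegral_indicator (measurableSet_period _ _)]
  rfl

/-- Tonelli's theorem for the error in a cycle with independent signal and service times. -/
lemma lintegral_cycleError (h : IsModel P W Y) (hβ : 0 ≤ β) :
    ∫⁻ s, ∫⁻ ω₁, ∫⁻ ω₂, ∫⁻ ω, cycleError β s (fun r => W r ω, Y 0 ω₁, Y 0 ω₂) ∂P ∂P ∂P ≤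
      ∫⁻ ω₁, ∫⁻ ω₂, cycleCost β (Y 0 ω₁) (Y 0 ω₂) ∂P ∂P := by
  have := h.isProbabilityMeasure
  have hB := h.isBrownianWith 0
  have hWm : Measurable fun ω s => W s ω := measurable_path h.meas
  set F₄ : ((ℝ × Ω) × Ω) × Ω → ℝ≥0∞ := fun p =>
    cycleError β p.1.1.1 (fun r => W r p.2, Y 0 p.1.1.2, Y 0 p.1.2)
  have h4 : Measurable F₄ := measurable_cycleError_of
    (measurable_fst.comp (measurable_fst.comp measurable_fst)) (hWm.comp measurable_snd)
    (hB.measurable_uncurry.comp ((measurable_real_toNNReal.comp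
      (measurable_fst.comp (measurable_fst.comp measurable_fst))).prodMk measurable_snd))
    ((h.measY 0).comp (measurable_snd.comp (measurable_fst.comp measurable_fst)))
    ((h.measY 0).comp (measurable_snd.comp measurable_fst))
  set F₃ : (ℝ × Ω) × Ω → ℝ≥0∞ := fun p => ∫⁻ ω, F₄ (p, ω) ∂P
  have h3 : Measurable F₃ := h4.lintegral_prod_right'
  set F₂ : ℝ × Ω → ℝ≥0∞ := fun p => ∫⁻ ω, F₃ (p, ω) ∂P
  have h2 : Measurable F₂ := h3.lintegral_prod_right'
  calc ∫⁻ s, ∫⁻ ω₁, F₂ (s, ω₁) ∂P = ∫⁻ ω₁, (∫⁻ s, F₂ (s, ω₁)) ∂P :=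
        lintegral_lintegral_swap (f := fun s ω₁ => F₂ (s, ω₁)) h2.aemeasurable
    _ = ∫⁻ ω₁, ∫⁻ ω₂, (∫⁻ s, F₃ ((s, ω₁), ω₂)) ∂P ∂P := lintegral_congr fun ω₁ =>
        lintegral_lintegral_swap (f := fun s ω₂ => F₃ ((s, ω₁), ω₂))
          (h3.comp ((measurable_fst.prodMk measurable_const).prodMk measurable_snd)).aemeasurable
    _ = ∫⁻ ω₁, ∫⁻ ω₂, ∫⁻ ω, (∫⁻ s, F₄ (((s, ω₁), ω₂), ω)) ∂P ∂P ∂P :=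
        lintegral_congr fun ω₁ => lintegral_congr fun ω₂ =>
        lintegral_lintegral_swap (f := fun s ω => F₄ (((s, ω₁), ω₂), ω))
          (h4.comp (((measurable_fst.prodMk measurable_const).prodMk measurable_const).prodMk
            measurable_snd)).aemeasurable
    _ ≤ _ := lintegral_mono fun ω₁ => lintegral_mono fun ω₂ =>
        hB.lintegral_cycleError_le hβ (Y 0 ω₁) (Y 0 ω₂)

lemma lintegral_cycleError_zero (h : IsModel P W Y) (hβ : 0 ≤ β) :
    ∫⁻ s, ∫⁻ ω₁, ∫⁻ ω, cycleError β s (fun r => W r ω, 0, Y 0 ω₁) ∂P ∂P ≤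
      ∫⁻ ω₁, cycleCost β 0 (Y 0 ω₁) ∂P := by
  have := h.isProbabilityMeasure
  have hB := h.isBrownianWith 0
  have hWm : Measurable fun ω s => W s ω := measurable_path h.meas
  set F₃ : (ℝ × Ω) × Ω → ℝ≥0∞ := fun p =>
    cycleError β p.1.1 (fun r => W r p.2, 0, Y 0 p.1.2)
  have h3 : Measurable F₃ := measurable_cycleError_of
    (measurable_fst.comp measurable_fst) (hWm.comp measurable_snd)
    (hB.measurable_uncurry.comp ((measurable_real_toNNReal.comp
      (measurable_fst.comp measurable_fst)).prodMk measurable_snd))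
    measurable_const ((h.measY 0).comp (measurable_snd.comp measurable_fst))
  set F₂ : ℝ × Ω → ℝ≥0∞ := fun p => ∫⁻ ω, F₃ (p, ω) ∂P
  have h2 : Measurable F₂ := h3.lintegral_prod_right'
  calc ∫⁻ s, ∫⁻ ω₁, F₂ (s, ω₁) ∂P = ∫⁻ ω₁, (∫⁻ s, F₂ (s, ω₁)) ∂P :=
        lintegral_lintegral_swap (f := fun s ω₁ => F₂ (s, ω₁)) h2.aemeasurable
    _ = ∫⁻ ω₁, ∫⁻ ω, (∫⁻ s, F₃ ((s, ω₁), ω)) ∂P ∂P := lintegral_congr fun ω₁ =>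
        lintegral_lintegral_swap (f := fun s ω => F₃ ((s, ω₁), ω))
          (h3.comp ((measurable_fst.prodMk measurable_const).prodMk measurable_snd)).aemeasurable
    _ ≤ _ := lintegral_mono fun ω₁ => hB.lintegral_cycleError_le hβ 0 (Y 0 ω₁)

/-- The squared error of the threshold policy that is accumulated with sample `n`. -/
def stageError (β : ℝ) (W : ℝ≥0 → Ω → ℝ) (Y : ℕ → Ω → ℝ≥0) (n : ℕ) (ω : Ω) : ℝ≥0∞ :=
  ∫⁻ s, cycleError β s (shiftPath W (thresholdPolicy β W Y n) ω, prevService Y n ω, Y n ω)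

lemma measurable_uncurry_cycleError (h : IsModel P W Y) (n : ℕ) :
    Measurable (Function.uncurry fun (ω : Ω) (s : ℝ) => cycleError β s
      (shiftPath W (thresholdPolicy β W Y n) ω, prevService Y n ω, Y n ω)) := by
  have hB := h.isBrownianWith n
  have hS := measurable_thresholdPolicy (β := β) h n
  have h1 : Measurable fun z : Ω × ℝ => ((thresholdPolicy β W Y n) z.1).toNNReal :=
    (hS.comp measurable_fst).ennreal_toNNReal
  exact measurable_cycleError_of measurable_snd ((hB.measurable_shiftPath hS).comp measurable_fst)
    ((hB.measurable_uncurry.comp ((h1.add (measurable_real_toNNReal.comp measurable_snd)).prodMk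
      measurable_fst)).sub (hB.measurable_uncurry.comp (h1.prodMk measurable_fst)))
    ((measurable_prevService h n).comp measurable_fst) ((h.measY n).comp measurable_fst)

lemma lintegral_stageError_zero_le (h : IsModel P W Y) (hβ : 0 ≤ β) :
    ∫⁻ ω, stageError β W Y 0 ω ∂P ≤ ∫⁻ ω₁, cycleCost β 0 (Y 0 ω₁) ∂P := by
  have := h.isProbabilityMeasure
  refine le_trans (le_of_eq ?_) (lintegral_cycleError_zero h hβ)
  have e := lintegral_lintegral_swap (μ := P) (ν := volume)
    (measurable_uncurry_cycleError (β := β) h 0).aemeasurable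
  refine Eq.trans e (lintegral_congr fun s => ?_)
  have hf : Measurable fun z : (ℝ≥0 → ℝ) × ℝ≥0 => cycleError β s (z.1, 0, z.2) :=
    (measurable_cycleError s).comp (measurable_fst.prodMk (measurable_const.prodMk measurable_snd))
  exact lintegral_threshold_zero (β := β) h hf

/-- The event that a sample is taken before time `T` is independent of the error that is accumulated
with this sample. -/
lemma lintegral_stageError_succ_le (h : IsModel P W Y) (hβ : 0 ≤ β) (m : ℕ) (T : ℝ≥0∞) :
    ∫⁻ ω, {ω | thresholdPolicy β W Y (m + 1) ω ≤ T}.indicator (stageError β W Y (m + 1)) ω ∂P ≤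
      P {ω | thresholdPolicy β W Y (m + 1) ω ≤ T} *
        ∫⁻ ω₁, ∫⁻ ω₂, cycleCost β (Y 0 ω₁) (Y 0 ω₂) ∂P ∂P := by
  have := h.isProbabilityMeasure
  set S := thresholdPolicy β W Y (m + 1)
  have hopt : IsOptional (pathInfo W (serviceInfo Y (m + 2))) S :=
    isOptional_thresholdPolicy h (by omega)
  set A := {ω | S ω ≤ T}
  have hA : MeasurableSet[pastOf (mΩ := mΩ) hopt] A :=
    (hopt.measurable_pastOf (mΩ := mΩ) pathInfo_mono (h.isBrownianWith _).pathInfo_le)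
      measurableSet_Iic
  have hA' : MeasurableSet[allInfo W (serviceInfo Y m)] A :=
    (isOptional_thresholdPolicy h le_rfl).measurable_allInfo measurableSet_Iic
  have hAm : MeasurableSet[mΩ] A := pastOf_le _ _ hA
  have hJ := measurable_uncurry_cycleError (β := β) h (m + 1)
  have e1 : ∀ ω, A.indicator (stageError β W Y (m + 1)) ω = ∫⁻ s, A.indicator 1 ω *
      cycleError β s (shiftPath W S ω, prevService Y (m + 1) ω, Y (m + 1) ω) := fun ω => by
    by_cases hω : ω ∈ A
    · simp only [Set.indicator_of_mem hω, Pi.one_apply, one_mul]; rfl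
    · simp only [Set.indicator_of_notMem hω, zero_mul, lintegral_zero]
  have hm : Measurable (Function.uncurry fun (ω : Ω) (s : ℝ) => A.indicator (1 : Ω → ℝ≥0∞) ω *
      cycleError β s (shiftPath W S ω, prevService Y (m + 1) ω, Y (m + 1) ω)) :=
    ((measurable_one.indicator hAm).comp measurable_fst).mul hJ
  simp_rw [e1]
  rw [lintegral_lintegral_swap hm.aemeasurable]
  have e2 : ∀ s, ∫⁻ ω, A.indicator (1 : Ω → ℝ≥0∞) ω *
      cycleError β s (shiftPath W S ω, prevService Y (m + 1) ω, Y (m + 1) ω) ∂P = P A *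
      ∫⁻ ω₁, ∫⁻ ω₂, ∫⁻ ω, cycleError β s (fun r => W r ω, Y 0 ω₁, Y 0 ω₂) ∂P ∂P ∂P := fun s => by
    have e3 := lintegral_threshold_cycle h m (ae_thresholdPolicy_ne_top h hβ (m + 1))
      (X := A.indicator 1) (measurable_indicator_one_of hA) (measurable_indicator_one_of hA')
      (measurable_cycleError (β := β) s)
    rw [lintegral_indicator_one hAm] at e3
    exact e3
  simp_rw [e2]
  rw [lintegral_const_mul' _ _ (measure_ne_top _ _)]
  gcongr
  exact lintegral_cycleError h hβ

/-- A bound on the mean number of samples of the threshold policy that are taken before time `T`.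
The waiting times are truncated at `b`, which bounds the overshoot of the last one. -/
lemma tsum_prob_thresholdPolicy_mul_le (h : IsModel P W Y) (hβ : 0 ≤ β) (T b : ℝ≥0∞) :
    (∑' m, P {ω | thresholdPolicy β W Y (m + 1) ω ≤ T}) *
      ∫⁻ ω, min (waitingTime β W Y 1 ω) b ∂P ≤ T + b := by
  have := h.isProbabilityMeasure
  have hg : Measurable fun t : ℝ≥0∞ => min t b := by fun_prop
  have hA : ∀ m, MeasurableSet {ω | thresholdPolicy β W Y (m + 1) ω ≤ T} := fun m =>
    measurableSet_le (measurable_thresholdPolicy h _) measurable_const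
  have e0 : ∫⁻ ω, min (waitingTime β W Y 1 ω) b ∂P =
      ∫⁻ ω', ∫⁻ ω, min (exitTime β (fun s => W s ω) (Y 0 ω')) b ∂P ∂P := by
    have e := lintegral_waitingTime_succ h 0 (ae_thresholdPolicy_ne_top h hβ 1)
      (X := fun _ => 1) measurable_const measurable_const hg
    simp only [one_mul, lintegral_const, measure_univ, zero_add] at e
    exact e
  have e : ∀ m, P {ω | thresholdPolicy β W Y (m + 1) ω ≤ T} *
      ∫⁻ ω, min (waitingTime β W Y 1 ω) b ∂P =
      ∫⁻ ω, {ω | thresholdPolicy β W Y (m + 1) ω ≤ T}.indicator 1 ω *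
        min (waitingTime β W Y (m + 1) ω) b ∂P := fun m => by
    have hopt : IsOptional (pathInfo W (serviceInfo Y (m + 2))) (thresholdPolicy β W Y (m + 1)) :=
      isOptional_thresholdPolicy h (by omega)
    rw [e0, lintegral_waitingTime_succ h m (ae_thresholdPolicy_ne_top h hβ (m + 1))
      (X := {ω | thresholdPolicy β W Y (m + 1) ω ≤ T}.indicator 1)
      (measurable_indicator_one_of ((hopt.measurable_pastOf (mΩ := mΩ) pathInfo_mono
        (h.isBrownianWith _).pathInfo_le) measurableSet_Iic))
      (measurable_indicator_one_of
        ((isOptional_thresholdPolicy h le_rfl).measurable_allInfo measurableSet_Iic)) hg,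
      lintegral_indicator_one (hA m)]
  rw [← ENNReal.tsum_mul_right]
  simp_rw [e]
  have hm : ∀ m, Measurable fun ω => {ω | thresholdPolicy β W Y (m + 1) ω ≤ T}.indicator
      (1 : Ω → ℝ≥0∞) ω * min (waitingTime β W Y (m + 1) ω) b := fun m =>
    (measurable_one.indicator (hA m)).mul (hg.comp (measurable_waitingTime h (m + 1)))
  rw [← lintegral_tsum fun m => (hm m).aemeasurable]
  calc _ ≤ ∫⁻ _, (T + b) ∂P := by
        refine lintegral_mono fun ω => ENNReal.tsum_le_of_sum_range_le fun J => ?_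
        have key : ∀ J, ∑ m ∈ Finset.range J,
            {ω | thresholdPolicy β W Y (m + 1) ω ≤ T}.indicator (1 : Ω → ℝ≥0∞) ω *
              min (waitingTime β W Y (m + 1) ω) b ≤
            if thresholdPolicy β W Y (J + 1) ω ≤ T then thresholdPolicy β W Y (J + 1) ω
              else T + b := by
          intro J
          induction J with
          | zero => simp
          | succ J ih =>
            rw [Finset.sum_range_succ]
            have hS := thresholdPolicy_succ (β := β) (W := W) (Y := Y) (J + 1) ω
            by_cases h1 : thresholdPolicy β W Y (J + 1) ω ≤ T
            · rw [if_pos h1] at ih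
              have h2 : ω ∈ {ω | thresholdPolicy β W Y (J + 1) ω ≤ T} := h1
              rw [Set.indicator_of_mem h2, Pi.one_apply, one_mul]
              split_ifs with h3
              · rw [hS]
                exact add_le_add ih (min_le_left _ _)
              · exact add_le_add (ih.trans h1) (min_le_right _ _)
            · rw [if_neg h1] at ih
              have h2 : ω ∉ {ω | thresholdPolicy β W Y (J + 1) ω ≤ T} := h1
              rw [Set.indicator_of_notMem h2, zero_mul, add_zero, if_neg]
              · exact ih
              · rw [hS]
                exact fun h3 => h1 (le_self_add.trans h3)
        refine (key J).trans ?_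
        split_ifs with h1
        · exact h1.trans le_self_add
        · exact le_rfl
    _ = _ := by simp

end ThresholdCost

/-! ### The mean-square error of the threshold policy -/

section ThresholdMse

variable {Ω : Type*} [mΩ : MeasurableSpace Ω] {P : Measure Ω}
  {W : ℝ≥0 → Ω → ℝ} {Y : ℕ → Ω → ℝ≥0} {S : ℕ → Ω → ℝ≥0∞} {β : ℝ}

/-- Almost surely, only finitely many samples are delivered in a bounded time. -/
lemma IsOnlinePolicy.ae_exists_lt_delivery (h : IsModel P W Y) (hS : IsOnlinePolicy P W Y S)
    (hY : ∫⁻ ω, (Y 0 ω : ℝ≥0∞) ∂P ≠ 0) :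
    ∀ᵐ ω ∂P, ∀ T : ℝ≥0, ∃ n, (T : ℝ≥0∞) < deliveryTime Y S n ω := by
  have hφ := h.lintegral_disc_lt_one hY one_pos
  set φ := ∫⁻ ω, disc 1 (Y 0 ω) ∂P
  have hm : ∀ i, Measurable fun ω => disc 1 (deliveryTime Y S (i + 1) ω) := fun i =>
    (measurable_disc 1).comp (hS.measurable_delivery h (i + 1))
  have hsum : ∫⁻ ω, ∑' i, disc 1 (deliveryTime Y S (i + 1) ω) ∂P ≠ ∞ := by
    rw [lintegral_tsum fun i => (hm i).aemeasurable]
    refine ne_top_of_le_ne_top ?_ (ENNReal.tsum_le_tsum (g := fun i => φ ^ i) fun i => ?_)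
    · rw [ENNReal.tsum_geometric]
      exact ENNReal.inv_ne_top.2 (tsub_pos_of_lt hφ).ne'
    · rw [hS.lintegral_disc_delivery h one_pos]
      calc φ * stageDisc 1 P Y S i ≤ 1 * φ ^ i :=
            mul_le_mul' hφ.le (hS.stageDisc_le_pow h one_pos i)
        _ = _ := one_mul _
  filter_upwards [ae_lt_top (Measurable.tsum hm) hsum] with ω hω T
  have ht := ENNReal.tendsto_atTop_zero_of_tsum_ne_top hω.ne
  have hpos : 0 < disc 1 (T : ℝ≥0∞) := by
    rw [disc_of_ne_top ENNReal.coe_ne_top]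
    exact ENNReal.ofReal_pos.2 (Real.exp_pos _)
  obtain ⟨i, hi⟩ := (ht.eventually (gt_mem_nhds hpos)).exists
  exact ⟨i + 1, lt_of_not_ge fun hle => absurd (disc_antitone zero_le_one hle) (not_le.2 hi)⟩

omit mΩ in
/-- The squared error of the estimator is the squared error of the freshest delivered sample. -/
lemma estError_le {ω : Ω} (hω : ∀ T : ℝ≥0, ∃ n, (T : ℝ≥0∞) < deliveryTime Y S n ω)
    (hSD : ∀ n, S n ω ≤ deliveryTime Y S n ω) (T : ℝ) :
    ∀ᵐ t : ℝ ∂volume.restrict (Set.Icc 0 T), estError W Y S t ω ≤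
      ∑' n, {ω | S n ω ≤ ofReal T}.indicator 1 ω *
        (period (deliveryTime Y S n ω) (deliveryTime Y S (n + 1) ω)).indicator
          (fun t => sqError W (S n) t ω) t := by
  have hc : (Set.range fun i => (deliveryTime Y S i ω).toReal).Countable := Set.countable_range _
  filter_upwards [ae_restrict_of_ae (hc.ae_notMem volume), ae_restrict_mem measurableSet_Icc]
    with t ht htT
  classical
  have hex := hω t.toNNReal
  have h1 := Nat.find_spec hex
  have h2 : Nat.find hex ≠ 0 := fun h0 => by
    rw [h0] at h1
    exact absurd h1 (not_lt.2 zero_le)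
  obtain ⟨n, hn⟩ := Nat.exists_eq_succ_of_ne_zero h2
  have h3 : deliveryTime Y S n ω ≤ (t.toNNReal : ℝ≥0∞) :=
    not_lt.1 (Nat.find_min hex (by omega))
  rw [hn] at h1
  have hper : t ∈ period (deliveryTime Y S n ω) (deliveryTime Y S (n + 1) ω) := by
    refine ⟨lt_of_le_of_ne h3 fun hh => ht ⟨n, ?_⟩, h1.le⟩
    simp only
    rw [hh]
    exact ENNReal.toReal_ofReal htT.1
  refine le_trans (le_of_eq ?_) (ENNReal.le_tsum n)
  have h4 : ω ∈ {ω | S n ω ≤ ofReal T} :=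
    (hSD n).trans (h3.trans (ENNReal.ofReal_le_ofReal htT.2))
  rw [Set.indicator_of_mem h4, Set.indicator_of_mem hper, Pi.one_apply, one_mul, estError,
    estimate_eq h3 h1, sqError]

omit mΩ in
lemma lintegral_period_sqError_threshold {n : ℕ} {ω : Ω} (hω : thresholdPolicy β W Y n ω ≠ ∞) :
    ∫⁻ t, (period (deliveryTime Y (thresholdPolicy β W Y) n ω)
      (deliveryTime Y (thresholdPolicy β W Y) (n + 1) ω)).indicator
        (fun t => sqError W (thresholdPolicy β W Y n) t ω) t = stageError β W Y n ω := by
  rw [deliveryTime_thresholdPolicy, deliveryTime_thresholdPolicy, thresholdPolicy_succ, add_assoc,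
    stageError]
  have e := lintegral_period_add (thresholdPolicy β W Y n ω).toNNReal (prevService Y n ω)
    (waitingTime β W Y n ω + prevService Y (n + 1) ω)
    (fun t => sqError W (thresholdPolicy β W Y n) t ω)
  rw [ENNReal.coe_toNNReal hω] at e
  rw [lintegral_indicator (measurableSet_period _ _), e]
  simp only [cycleError]
  rw [lintegral_indicator (measurableSet_period _ _)]
  refine setLIntegral_congr_fun (measurableSet_period _ _) fun s hs => ?_
  have hs0 : 0 ≤ s := (period_subset_Ioi _ _ hs).le
  simp only [sqError, shiftPath, Real.toNNReal_add (NNReal.coe_nonneg _) hs0, Real.toNNReal_coe]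

lemma measurable_stageError (h : IsModel P W Y) (n : ℕ) : Measurable (stageError β W Y n) :=
  Measurable.lintegral_prod_right' (measurable_uncurry_cycleError h n)

/-- The mean accumulated squared error of the threshold policy, in terms of the mean number of
samples. -/
lemma lintegral_estError_thresholdPolicy_le (h : IsModel P W Y) (hβ : 0 < β)
    (hY : ∫⁻ ω, (Y 0 ω : ℝ≥0∞) ∂P ≠ 0) (T : ℝ) :
    ∫⁻ ω, (∫⁻ t in Set.Icc (0 : ℝ) T, estError W Y (thresholdPolicy β W Y) t ω) ∂P ≤
      ∫⁻ ω₁, cycleCost β 0 (Y 0 ω₁) ∂P +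
        (∑' m, P {ω | thresholdPolicy β W Y (m + 1) ω ≤ ofReal T}) *
          ∫⁻ ω₁, ∫⁻ ω₂, cycleCost β (Y 0 ω₁) (Y 0 ω₂) ∂P ∂P := by
  have hS := (isNonQueueingPolicy_thresholdPolicy h hβ).toIsOnlinePolicy
  set S := thresholdPolicy β W Y with hSdef
  set A : ℕ → Set Ω := fun n => {ω | S n ω ≤ ofReal T}
  have hA : ∀ n, MeasurableSet (A n) := fun n =>
    measurableSet_le (measurable_thresholdPolicy h n) measurable_const
  have hfin : ∀ᵐ ω ∂P, ∀ n, S n ω ≠ ∞ := ae_all_iff.2 fun n => ae_thresholdPolicy_ne_top h hβ.le n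
  have hm : ∀ n ω, Measurable fun r : ℝ =>
      (period (deliveryTime Y S n ω) (deliveryTime Y S (n + 1) ω)).indicator
        (fun t => sqError W (S n) t ω) r := fun n ω =>
    (measurable_period_indicator (hS.measurable_delivery h n) (hS.measurable_delivery h (n + 1))
      ((h.isBrownianWith 0).measurable_sqError (hS.measurable_sampling h n))).comp
      (f := fun r : ℝ => (r, ω)) (by fun_prop)
  have key : ∀ᵐ ω ∂P, (∫⁻ t in Set.Icc (0 : ℝ) T, estError W Y S t ω) ≤
      ∑' n, (A n).indicator (stageError β W Y n) ω := by
    filter_upwards [hfin, hS.ae_exists_lt_delivery h hY] with ω h1 h2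
    have hSD : ∀ n, S n ω ≤ deliveryTime Y S n ω := fun n => by
      rw [hSdef, deliveryTime_thresholdPolicy]; exact le_self_add
    refine (lintegral_mono_ae (estError_le h2 hSD T)).trans
      ((setLIntegral_le_lintegral _ _).trans ?_)
    rw [lintegral_tsum fun n => ((hm n ω).const_mul _).aemeasurable]
    refine ENNReal.tsum_le_tsum fun n => ?_
    rw [lintegral_const_mul _ (hm n ω), lintegral_period_sqError_threshold (h1 n)]
    by_cases hω : ω ∈ A n
    · rw [Set.indicator_of_mem hω, Set.indicator_of_mem hω, Pi.one_apply, one_mul]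
    · rw [Set.indicator_of_notMem hω, zero_mul]; exact zero_le
  refine (lintegral_mono_ae key).trans ?_
  rw [lintegral_tsum fun n => ((measurable_stageError h n).indicator (hA n)).aemeasurable,
    tsum_eq_zero_add' ENNReal.summable, ← ENNReal.tsum_mul_right]
  refine add_le_add ?_ (ENNReal.tsum_le_tsum fun m => lintegral_stageError_succ_le h hβ.le m _)
  exact (lintegral_mono fun ω => Set.indicator_le_self _ _ _).trans
    (lintegral_stageError_zero_le h hβ.le)

lemma meanExitCost_le (y : ℝ≥0) : meanExitCost β y ≤ ofReal (β ^ 2 / 6) := by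
  calc meanExitCost β y ≤ ∫⁻ _, ofReal (β ^ 2 / 6) ∂gaussianReal 0 y := by
        refine lintegral_mono fun z => ENNReal.ofReal_le_ofReal ?_
        rcases max_cases β (z ^ 2) with ⟨h1, h2⟩ | ⟨h1, h2⟩ <;> rw [h1] <;>
          nlinarith [sq_nonneg (z ^ 2), sq_nonneg β]
    _ = _ := by simp

lemma cycleCost_le (hβ : 0 ≤ β) (y y' : ℝ≥0) : cycleCost β y y' ≤
    ofReal (β ^ 2 / 6) + y' * (ofReal β + y) + (y' : ℝ≥0∞) ^ 2 / 2 := by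
  unfold cycleCost
  gcongr
  · exact meanExitCost_le y
  · exact meanExit_le hβ y

lemma lintegral_cycleCost_le_moments (h : IsModel P W Y) (hβ : 0 ≤ β) {y : ℝ≥0} :
    ∫⁻ ω, cycleCost β y (Y 0 ω) ∂P ≤ ofReal (β ^ 2 / 6) +
      (∫⁻ ω, (Y 0 ω : ℝ≥0∞) ∂P) * (ofReal β + y) +
      (∫⁻ ω, (Y 0 ω : ℝ≥0∞) ^ 2 ∂P) / 2 := by
  have := h.isProbabilityMeasure
  have m1 : Measurable fun ω => (Y 0 ω : ℝ≥0∞) := (h.measY 0).coe_nnreal_ennreal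
  refine (lintegral_mono fun ω => cycleCost_le hβ y (Y 0 ω)).trans (le_of_eq ?_)
  simp only [div_eq_mul_inv]
  have e1 : ∫⁻ ω, (Y 0 ω : ℝ≥0∞) * (ofReal β + y) ∂P =
      (∫⁻ ω, (Y 0 ω : ℝ≥0∞) ∂P) * (ofReal β + y) := lintegral_mul_const _ m1
  have e2 : ∫⁻ ω, (Y 0 ω : ℝ≥0∞) ^ 2 * 2⁻¹ ∂P = (∫⁻ ω, (Y 0 ω : ℝ≥0∞) ^ 2 ∂P) * 2⁻¹ :=
    lintegral_mul_const _ (m1.pow_const 2)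
  rw [lintegral_add_right _ ((m1.pow_const 2).mul_const _), lintegral_add_left measurable_const,
    e1, e2, lintegral_const, measure_univ, mul_one]

lemma lintegral_lintegral_cycleCost_ne_top (h : IsModel P W Y) (hβ : 0 ≤ β) :
    ∫⁻ ω₁, ∫⁻ ω₂, cycleCost β (Y 0 ω₁) (Y 0 ω₂) ∂P ∂P ≠ ∞ := by
  have := h.isProbabilityMeasure
  refine ne_top_of_le_ne_top ?_
    (lintegral_mono fun ω₁ => lintegral_cycleCost_le_moments h hβ (y := Y 0 ω₁))
  have h1 := h.lintegral_ne_top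
  have h2 := h.lintegral_sq_ne_top
  rw [lintegral_add_right _ measurable_const, lintegral_add_left measurable_const,
    lintegral_const_mul' _ _ h1, lintegral_add_left measurable_const]
  simp only [lintegral_const, measure_univ, mul_one]
  finiteness

lemma limsup_add_div_le {c R M b : ℝ≥0∞} (hc : c ≠ ∞) (hR : R ≠ ∞) (hM : M ≠ 0) (hb : b ≠ ∞) :
    limsup (fun T : ℝ => (c + (ofReal T + b) / M * R) / ofReal T) atTop ≤
      R / M := by
  have hK : c + b / M * R ≠ ∞ := by
    have := ENNReal.div_ne_top hb hM
    finiteness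
  have e : ∀ᶠ T : ℝ in atTop, (c + (ofReal T + b) / M * R) / ofReal T =
      (c + b / M * R) / ofReal T + R / M := by
    filter_upwards [eventually_gt_atTop 0] with T hT
    have hT0 : ofReal T ≠ 0 := (ENNReal.ofReal_pos.2 hT).ne'
    have e1 : c + (ofReal T + b) / M * R = (c + b / M * R) + ofReal T / M * R := by
      rw [ENNReal.add_div, add_mul]; ring
    rw [e1, ENNReal.add_div]
    congr 1
    rw [div_eq_mul_inv, div_eq_mul_inv, div_eq_mul_inv]
    calc ofReal T * M⁻¹ * R * (ofReal T)⁻¹ =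
          (ofReal T * (ofReal T)⁻¹) * (R * M⁻¹) := by ring
      _ = _ := by rw [ENNReal.mul_inv_cancel hT0 ENNReal.ofReal_ne_top, one_mul]
  rw [limsup_congr e]
  have h1 : Tendsto (fun T : ℝ => (c + b / M * R) / ofReal T) atTop (nhds 0) := by
    have := ENNReal.Tendsto.const_div ENNReal.tendsto_ofReal_atTop (Or.inr hK)
    simpa using this
  have h2 := h1.add (tendsto_const_nhds (x := R / M))
  rw [zero_add] at h2
  exact h2.limsup_eq.le

/-- The mean square error of the threshold policy is at most the ratio of the mean cost and of the
mean length of a cycle. -/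
theorem mse_thresholdPolicy_le (h : IsModel P W Y) (hβ : 0 < β)
    (hY : ∫⁻ ω, (Y 0 ω : ℝ≥0∞) ∂P ≠ 0) :
    mse P W Y (thresholdPolicy β W Y) ≤
      (∫⁻ ω₁, ∫⁻ ω₂, cycleCost β (Y 0 ω₁) (Y 0 ω₂) ∂P ∂P) / meanCycle P β (Y 0) := by
  have hR := lintegral_lintegral_cycleCost_ne_top h hβ.le
  set R := ∫⁻ ω₁, ∫⁻ ω₂, cycleCost β (Y 0 ω₁) (Y 0 ω₂) ∂P ∂P
  have hc : ∫⁻ ω₁, cycleCost β 0 (Y 0 ω₁) ∂P ≠ ∞ := by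
    refine ne_top_of_le_ne_top ?_ (lintegral_cycleCost_le_moments h hβ.le)
    have h1 := h.lintegral_ne_top
    have h2 := h.lintegral_sq_ne_top
    finiteness
  have hL0 : meanCycle P β (Y 0) ≠ 0 := by
    have := h.isProbabilityMeasure
    exact ((ENNReal.ofReal_pos.2 hβ).trans_le (le_meanCycle (Y 0))).ne'
  set M : ℕ → ℝ≥0∞ := fun b => ∫⁻ ω, min (waitingTime β W Y 1 ω) b ∂P
  have hMlim : Tendsto M atTop (nhds (meanCycle P β (Y 0))) := by
    have e := lintegral_waitingTime h hβ.le 0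
    rw [← e]
    refine lintegral_tendsto_of_tendsto_of_monotone (fun b => ?_) (ae_of_all _ fun ω => ?_)
      (ae_of_all _ fun ω => ?_)
    · exact ((measurable_waitingTime h 1).min measurable_const).aemeasurable
    · exact fun a b hab => min_le_min_left _ (Nat.cast_le.2 hab)
    · have := (tendsto_const_nhds (x := waitingTime β W Y 1 ω)).min
        ENNReal.tendsto_nat_nhds_top
      rwa [min_eq_left le_top] at this
  have hb : ∀ b : ℕ, M b ≠ 0 → mse P W Y (thresholdPolicy β W Y) ≤ R / M b := by
    intro b hM
    have hMt : M b ≠ ∞ := by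
      have := h.isProbabilityMeasure
      refine ne_top_of_le_ne_top (ENNReal.natCast_ne_top b)
        ((lintegral_mono fun ω => min_le_right _ _).trans ?_)
      simp
    refine le_trans (limsup_le_limsup (Eventually.of_forall fun T => ?_))
      (limsup_add_div_le hc hR hM (ENNReal.natCast_ne_top b))
    refine ENNReal.div_le_div_right ?_ _
    refine (lintegral_estError_thresholdPolicy_le h hβ hY T).trans ?_
    gcongr
    rw [ENNReal.le_div_iff_mul_le (Or.inl hM) (Or.inl hMt)]
    exact tsum_prob_thresholdPolicy_mul_le h hβ.le _ _
  refine ge_of_tendsto (ENNReal.Tendsto.const_div hMlim (Or.inr hR)) ?_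
  filter_upwards [hMlim.eventually_ne hL0] with b hb0
  exact hb b hb0

end ThresholdMse

/-! ### The choice of the threshold -/

section Threshold

variable {Ω : Type*} [mΩ : MeasurableSpace Ω] {P : Measure Ω}
  {W : ℝ≥0 → Ω → ℝ} {Y : ℕ → Ω → ℝ≥0} {Z : Ω → ℝ≥0} {β : ℝ}

/-- The cost of a cycle is `β / 3` times its length, up to corrections for the service period. -/
lemma meanExitCost_add (hβ : 0 ≤ β) (y : ℝ≥0) :
    meanExitCost β y + ∫⁻ z, ofReal (corrector β z) ∂gaussianReal 0 y +
      ofReal (β / 3) * y = ofReal (β / 3) * meanExit β y := by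
  have hc := continuous_corrector β
  rw [← lintegral_sq_gaussian_zero y, meanExitCost, meanExit,
    ← lintegral_const_mul' _ _ ENNReal.ofReal_ne_top,
    ← lintegral_const_mul' _ _ ENNReal.ofReal_ne_top, ← lintegral_add_left (by fun_prop),
    ← lintegral_add_left (by fun_prop)]
  refine lintegral_congr fun z => ?_
  have h1 : 0 ≤ (max β (z ^ 2) ^ 2 - (z ^ 2) ^ 2) / 6 := by
    have : z ^ 2 ≤ max β (z ^ 2) := le_max_right _ _
    nlinarith [sq_nonneg z]
  rw [← ENNReal.ofReal_add h1 (corrector_nonneg β z),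
    ← ENNReal.ofReal_mul (by positivity), ← ENNReal.ofReal_mul (by positivity),
    ← ENNReal.ofReal_add (add_nonneg h1 (corrector_nonneg β z)) (by positivity)]
  congr 1
  unfold corrector
  rcases le_total (z ^ 2) β with h | h
  · rw [max_eq_left h, max_eq_left (by linarith)]; ring
  · rw [max_eq_right h, max_eq_right (by linarith)]; ring

lemma meanCycle_le [IsProbabilityMeasure P] (hβ : 0 ≤ β) (Z : Ω → ℝ≥0) :
    meanCycle P β Z ≤ ofReal β + ∫⁻ ω, (Z ω : ℝ≥0∞) ∂P := by
  calc meanCycle P β Z ≤ ∫⁻ ω, (ofReal β + Z ω) ∂P :=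
        lintegral_mono fun ω => meanExit_le hβ _
    _ = _ := by rw [lintegral_add_left measurable_const]; simp

lemma IsModel.meanCycle_ne_top (h : IsModel P W Y) (hβ : 0 ≤ β) : meanCycle P β (Y 0) ≠ ∞ := by
  have := h.isProbabilityMeasure
  have h1 := h.lintegral_ne_top
  exact ne_top_of_le_ne_top (by finiteness) (meanCycle_le hβ _)

lemma toReal_lintegral_coe_sq (hZ : Measurable Z) :
    (∫⁻ ω, (Z ω : ℝ≥0∞) ^ 2 ∂P).toReal = ∫ ω, (Z ω : ℝ) ^ 2 ∂P := by
  have := toReal_lintegral_coe (P := P) (hZ.pow_const 2)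
  simpa using this

/-- The mean cost of a cycle of the threshold policy. -/
lemma toReal_lintegral_cycleCost (h : IsModel P W Y) (hβ : 0 ≤ β) :
    (∫⁻ ω₁, ∫⁻ ω₂, cycleCost β (Y 0 ω₁) (Y 0 ω₂) ∂P ∂P).toReal =
      ((∫ ω, (Y 0 ω : ℝ) ∂P) + β / 3) * (meanCycle P β (Y 0)).toReal +
        cycleExcess P β (Y 0) := by
  have := h.isProbabilityMeasure
  have m1 : Measurable fun ω => (Y 0 ω : ℝ≥0∞) := (h.measY 0).coe_nnreal_ennreal
  have hL := h.meanCycle_ne_top hβ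
  have ha := h.lintegral_ne_top
  have hq := h.lintegral_sq_ne_top
  have hk := serviceCorrection_ne_top (P := P) hβ (Y 0)
  have hmc : Measurable fun ω => meanExitCost β (Y 0 ω) := measurable_meanExitCost.comp (h.measY 0)
  set C := ∫⁻ ω, meanExitCost β (Y 0 ω) ∂P with hCdef
  have hC : C ≠ ∞ := by
    refine ne_top_of_le_ne_top (b := ofReal (β ^ 2 / 6)) ENNReal.ofReal_ne_top
      ((lintegral_mono fun ω => meanExitCost_le (Y 0 ω)).trans (le_of_eq ?_))
    simp
  have e1 : C + serviceCorrection P β (Y 0) + ofReal (β / 3) * ∫⁻ ω, (Y 0 ω : ℝ≥0∞) ∂P =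
      ofReal (β / 3) * meanCycle P β (Y 0) := by
    rw [hCdef, serviceCorrection, meanCycle, ← lintegral_const_mul' _ _ ENNReal.ofReal_ne_top,
      ← lintegral_const_mul' _ _ ENNReal.ofReal_ne_top, ← lintegral_add_left hmc,
      ← lintegral_add_right _ (m1.const_mul _)]
    exact lintegral_congr fun ω => meanExitCost_add hβ _
  have e2 : ∫⁻ ω₁, ∫⁻ ω₂, cycleCost β (Y 0 ω₁) (Y 0 ω₂) ∂P ∂P =
      C + (∫⁻ ω, (Y 0 ω : ℝ≥0∞) ∂P) * meanCycle P β (Y 0) + (∫⁻ ω, (Y 0 ω : ℝ≥0∞) ^ 2 ∂P) / 2 := by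
    have e3 : ∀ ω₁, ∫⁻ ω₂, cycleCost β (Y 0 ω₁) (Y 0 ω₂) ∂P = meanExitCost β (Y 0 ω₁) +
        (∫⁻ ω, (Y 0 ω : ℝ≥0∞) ∂P) * meanExit β (Y 0 ω₁) +
        (∫⁻ ω, (Y 0 ω : ℝ≥0∞) ^ 2 ∂P) / 2 := fun ω₁ => by
      simp only [cycleCost, div_eq_mul_inv]
      have e4 : ∫⁻ ω, (Y 0 ω : ℝ≥0∞) * meanExit β (Y 0 ω₁) ∂P =
        (∫⁻ ω, (Y 0 ω : ℝ≥0∞) ∂P) * meanExit β (Y 0 ω₁) := lintegral_mul_const _ m1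
      have e5 : ∫⁻ ω, (Y 0 ω : ℝ≥0∞) ^ 2 * 2⁻¹ ∂P = (∫⁻ ω, (Y 0 ω : ℝ≥0∞) ^ 2 ∂P) * 2⁻¹ :=
        lintegral_mul_const _ (m1.pow_const 2)
      rw [lintegral_add_right _ ((m1.pow_const 2).mul_const _), lintegral_add_left measurable_const,
        e4, e5, lintegral_const, measure_univ, mul_one]
    simp_rw [e3]
    rw [lintegral_add_right _ measurable_const, lintegral_add_left hmc,
      lintegral_const_mul' _ _ ha, lintegral_const, measure_univ, mul_one]
    rfl
  have e6 := congrArg ENNReal.toReal e1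
  rw [ENNReal.toReal_add (by finiteness) (by finiteness), ENNReal.toReal_add hC hk,
    ENNReal.toReal_mul, ENNReal.toReal_mul, ENNReal.toReal_ofReal (by positivity),
    toReal_lintegral_coe (h.measY 0)] at e6
  have hq2 : (∫⁻ ω, (Y 0 ω : ℝ≥0∞) ^ 2 ∂P) / 2 ≠ ∞ := ENNReal.div_ne_top hq (by simp)
  rw [e2, ENNReal.toReal_add (by finiteness) hq2, ENNReal.toReal_add hC (by finiteness),
    ENNReal.toReal_mul, ENNReal.toReal_div, toReal_lintegral_coe (h.measY 0),
    toReal_lintegral_coe_sq (h.measY 0), cycleExcess, meanCorrection, ENNReal.toReal_ofNat]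
  linarith

/-- The mean square error of the threshold policy. -/
theorem mse_thresholdPolicy_le_ofReal (h : IsModel P W Y) (hβ : 0 < β)
    (hY : ∫⁻ ω, (Y 0 ω : ℝ≥0∞) ∂P ≠ 0) :
    mse P W Y (thresholdPolicy β W Y) ≤ ofReal ((∫ ω, (Y 0 ω : ℝ) ∂P) + β / 3 +
      cycleExcess P β (Y 0) / (meanCycle P β (Y 0)).toReal) := by
  have := h.isProbabilityMeasure
  refine (mse_thresholdPolicy_le h hβ hY).trans (le_of_eq ?_)
  have hL := h.meanCycle_ne_top hβ.le
  have hL0 : 0 < meanCycle P β (Y 0) := (ENNReal.ofReal_pos.2 hβ).trans_le (le_meanCycle (Y 0))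
  have hLpos := ENNReal.toReal_pos hL0.ne' hL
  rw [← ENNReal.ofReal_toReal (ENNReal.div_ne_top (lintegral_lintegral_cycleCost_ne_top h hβ.le)
    hL0.ne'), ENNReal.toReal_div, toReal_lintegral_cycleCost h hβ.le]
  congr 1
  field_simp

/-- A uniform perturbation of the integrand, in the form used for continuity in the threshold. -/
lemma lintegral_gaussian_le_add [IsProbabilityMeasure P] {f g : ℝ → ℝ} {c : ℝ≥0∞}
    (hfg : ∀ z, ofReal (f z) ≤ ofReal (g z) + c) :
    ∫⁻ ω, ∫⁻ z, ofReal (f z) ∂gaussianReal 0 (Z ω) ∂P ≤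
      ∫⁻ ω, ∫⁻ z, ofReal (g z) ∂gaussianReal 0 (Z ω) ∂P + c := by
  have h1 : ∀ y : ℝ≥0, ∫⁻ z, ofReal (f z) ∂gaussianReal 0 y ≤
      ∫⁻ z, ofReal (g z) ∂gaussianReal 0 y + c := fun y => by
    refine (lintegral_mono hfg).trans ?_
    rw [lintegral_add_right _ measurable_const]
    simp
  refine (lintegral_mono fun ω => h1 (Z ω)).trans ?_
  rw [lintegral_add_right _ measurable_const]
  simp

lemma meanCycle_le_add [IsProbabilityMeasure P] (β β' : ℝ) :
    meanCycle P β Z ≤ meanCycle P β' Z + ofReal (dist β β') := by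
  refine lintegral_gaussian_le_add fun z => ?_
  refine (ENNReal.ofReal_le_ofReal ?_).trans ENNReal.ofReal_add_le
  have h1 := abs_max_sub_max_le_abs β β' (z ^ 2)
  have h2 := le_abs_self (max β (z ^ 2) - max β' (z ^ 2))
  rw [Real.dist_eq]
  linarith

lemma continuousOn_meanCycle (h : IsModel P W Y) :
    ContinuousOn (fun β => (meanCycle P β (Y 0)).toReal) (Set.Ici 0) := by
  have := h.isProbabilityMeasure
  refine (LipschitzOnWith.of_le_add_mul 1 fun β hβ β' hβ' => ?_).continuousOn
  have h1 := meanCycle_le_add (P := P) (Z := Y 0) β β'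
  have h2 := h.meanCycle_ne_top hβ'
  have h3 := ENNReal.toReal_mono (by finiteness) h1
  rw [ENNReal.toReal_add h2 ENNReal.ofReal_ne_top, ENNReal.toReal_ofReal dist_nonneg] at h3
  simpa using h3

lemma serviceCorrection_le_add [IsProbabilityMeasure P] {B : ℝ} {β β' : ℝ}
    (hβ : β ∈ Set.Icc 0 B) (hβ' : β' ∈ Set.Icc 0 B) :
    serviceCorrection P β Z ≤ serviceCorrection P β' Z + ofReal (B / 3 * dist β β') := by
  have hB : 0 ≤ B := hβ.1.trans hβ.2
  refine lintegral_gaussian_le_add fun z => ?_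
  rw [← ENNReal.ofReal_add (corrector_nonneg _ _) (by positivity)]
  refine ENNReal.ofReal_le_ofReal ?_
  have h1 : max (β - z ^ 2) 0 - max (β' - z ^ 2) 0 ≤ dist β β' := by
    have := abs_max_sub_max_le_abs (β - z ^ 2) (β' - z ^ 2) 0
    rw [sub_sub_sub_cancel_right] at this
    exact (le_abs_self _).trans this
  have h2 : max (β - z ^ 2) 0 ≤ B := max_le (by nlinarith [hβ.2, sq_nonneg z]) hB
  have h3 : max (β' - z ^ 2) 0 ≤ B := max_le (by nlinarith [hβ'.2, sq_nonneg z]) hB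
  have h4 : 0 ≤ max (β - z ^ 2) 0 := le_max_right _ _
  have h5 : 0 ≤ max (β' - z ^ 2) 0 := le_max_right _ _
  have h6 : 0 ≤ dist β β' := dist_nonneg
  unfold corrector
  nlinarith [mul_le_mul_of_nonneg_right h1 (add_nonneg h4 h5),
    mul_le_mul_of_nonneg_left (add_le_add h2 h3) h6]

lemma continuousOn_cycleExcess [IsProbabilityMeasure P] (B : ℝ) :
    ContinuousOn (fun β => cycleExcess P β Z) (Set.Icc 0 B) := by
  rcases lt_or_ge B 0 with hB | hB
  · rw [Set.Icc_eq_empty (by linarith)]; exact continuousOn_empty _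
  have h1 : ContinuousOn (fun β => meanCorrection P β Z) (Set.Icc 0 B) := by
    refine (LipschitzOnWith.of_le_add_mul (B / 3).toNNReal fun β hβ β' hβ' => ?_).continuousOn
    have h1 := serviceCorrection_le_add (P := P) (Z := Z) hβ hβ'
    have h2 := serviceCorrection_ne_top (P := P) hβ'.1 Z
    have h3 := ENNReal.toReal_mono (by finiteness) h1
    rw [ENNReal.toReal_add h2 ENNReal.ofReal_ne_top, ENNReal.toReal_ofReal (by positivity)] at h3
    rw [Real.coe_toNNReal _ (by positivity)]
    exact h3
  unfold cycleExcess
  fun_prop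

lemma cycleExcess_antitone [IsProbabilityMeasure P] {β β' : ℝ} (hβ' : 0 ≤ β') (hle : β ≤ β') :
    cycleExcess P β' Z ≤ cycleExcess P β Z := by
  have h1 : meanCorrection P β Z ≤ meanCorrection P β' Z := by
    refine ENNReal.toReal_mono (serviceCorrection_ne_top hβ' Z) ?_
    refine lintegral_mono fun ω => lintegral_mono fun z => ENNReal.ofReal_le_ofReal ?_
    unfold corrector
    gcongr
  have h2 : 0 ≤ ∫ ω, (Z ω : ℝ) ∂P := integral_nonneg fun ω => (Z ω).coe_nonneg
  unfold cycleExcess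
  nlinarith

lemma cycleExcess_zero : cycleExcess P 0 Z = (∫ ω, (Z ω : ℝ) ^ 2 ∂P) / 2 := by
  have h1 : ∀ z, corrector 0 z = 0 := fun z => by
    unfold corrector
    rw [max_eq_right (by nlinarith [sq_nonneg z])]
    simp
  simp [cycleExcess, meanCorrection, serviceCorrection, h1]

/-- The choice of the threshold for a prescribed mean inter-sampling time `m`. If the threshold at
which the excess vanishes samples rarely enough, it is taken; otherwise the threshold is increased
until the mean inter-sampling time is `m`. -/
lemma exists_threshold (h : IsModel P W Y) (hY : ∫⁻ ω, (Y 0 ω : ℝ≥0∞) ∂P ≠ 0) (m : ℝ) :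
    ∃ β : ℝ, 0 < β ∧ cycleExcess P β (Y 0) ≤ 0 ∧ m ≤ (meanCycle P β (Y 0)).toReal ∧
      (cycleExcess P β (Y 0) ≠ 0 → (meanCycle P β (Y 0)).toReal = m) := by
  have := h.isProbabilityMeasure
  set a := ∫ ω, (Y 0 ω : ℝ) ∂P with hadef
  set q := ∫ ω, (Y 0 ω : ℝ) ^ 2 ∂P with hqdef
  have ha : 0 < a := by
    rw [hadef, ← toReal_lintegral_coe (h.measY 0)]
    exact ENNReal.toReal_pos hY h.lintegral_ne_top
  have hq : 0 < q := by
    rw [hqdef, ← toReal_lintegral_coe_sq (h.measY 0)]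
    refine ENNReal.toReal_pos (fun h0 => hY ?_) h.lintegral_sq_ne_top
    have m1 : Measurable fun ω => (Y 0 ω : ℝ≥0∞) := (h.measY 0).coe_nnreal_ennreal
    rw [lintegral_eq_zero_iff (m1.pow_const 2)] at h0
    rw [lintegral_eq_zero_iff m1]
    filter_upwards [h0] with ω hω using pow_eq_zero_iff two_ne_zero |>.1 hω
  -- a threshold at which the excess is at most zero, even without the mean correction
  set B := 3 * q / (2 * a) with hB
  have hB0 : 0 ≤ B := by positivity
  have hVB : cycleExcess P B (Y 0) ≤ 0 := by
    have h1 : a * B / 3 = q / 2 := by rw [hB]; field_simp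
    have h2 : 0 ≤ meanCorrection P B (Y 0) := ENNReal.toReal_nonneg
    unfold cycleExcess
    linarith
  have hV0 : 0 < cycleExcess P 0 (Y 0) := by rw [cycleExcess_zero]; positivity
  obtain ⟨β₀, hβ₀, hV⟩ := intermediate_value_Icc' hB0
    (continuousOn_cycleExcess (P := P) (Z := Y 0) B)
    (show (0 : ℝ) ∈ Set.Icc _ _ from ⟨hVB, hV0.le⟩)
  have hV : cycleExcess P β₀ (Y 0) = 0 := hV
  have hpos : 0 < β₀ := lt_of_le_of_ne hβ₀.1 fun h0 => by rw [← h0] at hV; linarith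
  rcases le_or_gt m (meanCycle P β₀ (Y 0)).toReal with hm | hm
  · exact ⟨β₀, hpos, hV.le, hm, fun hne => absurd hV hne⟩
  · have hle : ∀ β, 0 ≤ β → β ≤ (meanCycle P β (Y 0)).toReal := fun β hβ => by
      have := ENNReal.toReal_mono (h.meanCycle_ne_top hβ) (le_meanCycle (P := P) (β := β) (Y 0))
      rwa [ENNReal.toReal_ofReal hβ] at this
    have hβm : β₀ ≤ m := (hle β₀ hpos.le).trans hm.le
    obtain ⟨β, hβ, hβ2⟩ := intermediate_value_Icc hβm ((continuousOn_meanCycle h).mono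
      fun β hβ => hpos.le.trans hβ.1)
      (show m ∈ Set.Icc _ _ from ⟨hm.le, hle m (hpos.le.trans hβm)⟩)
    have hβ2 : (meanCycle P β (Y 0)).toReal = m := hβ2
    exact ⟨β, hpos.trans_le hβ.1, (cycleExcess_antitone (hpos.le.trans hβ.1) hβ.1).trans hV.le,
      hβ2.ge, fun _ => hβ2⟩

/-- A policy that may sample before deliveries is dominated by a threshold policy, unless all
service times vanish. -/
theorem exists_nonQueueing_of_service (h : IsModel P W Y)
    (hY : ∫⁻ ω, (Y 0 ω : ℝ≥0∞) ∂P ≠ 0) {fmax : ℝ≥0∞} {S : ℕ → Ω → ℝ≥0∞}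
    (hS : IsOnlinePolicy P W Y S) (hrate : RateConstraint P fmax S) :
    ∃ S' : ℕ → Ω → ℝ≥0∞, IsNonQueueingPolicy P W Y S' ∧ RateConstraint P fmax S' ∧
      mse P W Y S' ≤ mse P W Y S := by
  have := h.isProbabilityMeasure
  obtain ⟨k, hk⟩ := hS.exists_regenerationIndex h
  have hC := hk.meanCycle_ne_top
  have hC0 := ENNReal.toReal_pos hk.meanCycle_ne_zero hC
  have hK : ∫⁻ ω, cycleCount k 0 ω ∂P ≠ ∞ := hk.length_fin.ne
  have hK1 : 1 ≤ ∫⁻ ω, cycleCount k 0 ω ∂P := by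
    refine (hk.one_le_meanCount (b := 1) le_rfl).trans (lintegral_mono fun ω => ?_)
    exact Nat.cast_le.2 (min_le_left _ _)
  have hK0 := ENNReal.toReal_pos (zero_lt_one.trans_le hK1).ne' hK
  set C := ∫⁻ ω, cycleLength S k 0 ω ∂P
  set K := ∫⁻ ω, cycleCount k 0 ω ∂P
  obtain ⟨β, hβ, hV, hm, hVm⟩ := exists_threshold h hY (C.toReal / K.toReal)
  refine ⟨thresholdPolicy β W Y, isNonQueueingPolicy_thresholdPolicy h hβ,
    rateConstraint_thresholdPolicy h hβ.le ?_, ?_⟩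
  · calc 1 / fmax ≤ C / K := hrate.trans hk.liminf_le
      _ = ofReal (C.toReal / K.toReal) := by
        rw [← ENNReal.toReal_div, ENNReal.ofReal_toReal
          (ENNReal.div_ne_top hC (zero_lt_one.trans_le hK1).ne')]
      _ ≤ ofReal (meanCycle P β (Y 0)).toReal := ENNReal.ofReal_le_ofReal hm
      _ = _ := ENNReal.ofReal_toReal (h.meanCycle_ne_top hβ.le)
  · refine (mse_thresholdPolicy_le_ofReal h hβ hY).trans
      (le_trans (ENNReal.ofReal_le_ofReal (le_of_eq ?_)) (hS.lower_bound h hY hβ.le hV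
        (κ := K.toReal / C.toReal) fun _ ε hε => hS.eventually_totalDisc_le h hY hk hε))
    rcases eq_or_ne (cycleExcess P β (Y 0)) 0 with h0 | h0
    · rw [h0, zero_div, zero_mul]
    · rw [hVm h0, div_div_eq_mul_div, mul_div_assoc]

end Threshold

/-! ### Service times that vanish -/

section NoService

variable {Ω : Type*} {W : ℝ≥0 → Ω → ℝ} {Y : ℕ → Ω → ℝ≥0} {S : ℕ → Ω → ℝ≥0∞}

/-- The policy that takes each sample when its service would start under the policy `S`. -/
def delayedPolicy (Y : ℕ → Ω → ℝ≥0) (S : ℕ → Ω → ℝ≥0∞) : ℕ → Ω → ℝ≥0∞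
  | 0 => fun _ => 0
  | i + 1 => serviceStart Y S i

/-- The delay does not change the deliveries. -/
lemma deliveryTime_delayedPolicy : deliveryTime Y (delayedPolicy Y S) = deliveryTime Y S := by
  funext i ω
  induction i with
  | zero => rfl
  | succ i ih =>
    rw [deliveryTime, ih, deliveryTime, delayedPolicy, serviceStart, max_assoc, max_self]

lemma serviceStart_delayedPolicy : serviceStart Y (delayedPolicy Y S) = serviceStart Y S := by
  funext i ω
  rw [serviceStart, deliveryTime_delayedPolicy, delayedPolicy, serviceStart, max_assoc, max_self]

lemma samplerInfo_delayedPolicy (m : ℕ) (t : ℝ≥0) :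
    samplerInfo W Y (delayedPolicy Y S) m t = samplerInfo W Y S m t := by
  have e1 : serverState Y (delayedPolicy Y S) = serverState Y S := by
    funext m s ω
    rw [serverState, serverState, deliveryTime_delayedPolicy, serviceStart_delayedPolicy]
  have e2 : ackCount Y (delayedPolicy Y S) = ackCount Y S := by
    funext m s ω
    rw [ackCount, ackCount, deliveryTime_delayedPolicy]
  rw [samplerInfo, samplerInfo, e1, e2]

lemma delayedPolicy_mono (i : ℕ) (ω : Ω) : delayedPolicy Y S i ω ≤ delayedPolicy Y S (i + 1) ω := by
  cases i with
  | zero => exact zero_le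
  | succ i =>
    exact (serviceStart_le_deliveryTime i ω).trans (deliveryTime_le_serviceStart (i + 1) ω)

variable [mΩ : MeasurableSpace Ω] {P : Measure Ω}

lemma IsRegenerativeSampling.congr {S' : ℕ → Ω → ℝ≥0∞} (h : IsRegenerativeSampling P S)
    (hae : ∀ᵐ ω ∂P, ∀ i, S i ω = S' i ω) : IsRegenerativeSampling P S' := by
  obtain ⟨k, h1, h2, h3, h4, h5, h6, h7⟩ := h
  have hpost : ∀ j, postProcess (interSampling S) k j =ᵐ[P] postProcess (interSampling S') k j := by
    intro j
    filter_upwards [hae] with ω hω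
    simp only [postProcess, interSampling, hω]
  have hpre : ∀ j, preProcess (interSampling S) k j =ᵐ[P] preProcess (interSampling S') k j := by
    intro j
    filter_upwards [hae] with ω hω
    simp only [preProcess, interSampling, hω]
  refine ⟨k, h1, h2, fun j => ⟨(h3 j).aemeasurable_fst.congr (hpost j),
    (h3 j).aemeasurable_snd.congr (hpost 0), ?_⟩, fun j => (h4 j).congr (hpre j) (hpost j), h5, ?_,
    fun j => ?_⟩
  · rw [← Measure.map_congr (hpost j), ← Measure.map_congr (hpost 0)]
    exact (h3 j).map_eq
  · rwa [lintegral_congr_ae (g := fun ω => S (k 0 ω) ω ^ 2)]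
    filter_upwards [hae] with ω hω
    rw [hω]
  · rw [lintegral_congr_ae (g := fun ω => (S (k (j + 1) ω) ω - S (k j ω) ω) ^ 2)]
    · exact h7 j
    · filter_upwards [hae] with ω hω
      simp only [hω]

lemma RateConstraint.congr {S' : ℕ → Ω → ℝ≥0∞} {fmax : ℝ≥0∞} (h : RateConstraint P fmax S)
    (hae : ∀ᵐ ω ∂P, ∀ i, S i ω = S' i ω) : RateConstraint P fmax S' := by
  have e : ∀ n, ∫⁻ ω, S n ω ∂P = ∫⁻ ω, S' n ω ∂P := fun n =>
    lintegral_congr_ae (hae.mono fun ω hω => hω n)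
  unfold RateConstraint at h ⊢
  simpa only [e] using h

/-- If all service times vanish, then the delay changes the policy on a null set only. -/
theorem exists_nonQueueing_of_no_service (hS : IsOnlinePolicy P W Y S)
    (hY : ∀ᵐ ω ∂P, ∀ i, Y i ω = 0) {fmax : ℝ≥0∞} (hrate : RateConstraint P fmax S) :
    ∃ S' : ℕ → Ω → ℝ≥0∞, IsNonQueueingPolicy P W Y S' ∧ RateConstraint P fmax S' ∧
      mse P W Y S' ≤ mse P W Y S := by
  have hae : ∀ᵐ ω ∂P, ∀ i, S i ω = delayedPolicy Y S i ω := by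
    filter_upwards [hY] with ω hω i
    have hD : ∀ i, deliveryTime Y S i ω = S i ω := fun i => by
      induction i with
      | zero => rw [hS.zero]; rfl
      | succ i ih =>
        rw [deliveryTime, ih, hω, ENNReal.coe_zero, add_zero, max_eq_left (hS.mono i ω)]
    cases i with
    | zero => exact hS.zero ω
    | succ i => rw [delayedPolicy, serviceStart, hD, max_eq_left (hS.mono i ω)]
  refine ⟨delayedPolicy Y S, ⟨⟨fun _ => rfl, delayedPolicy_mono, fun m t => ?_,
    hS.regenerative.congr hae⟩, fun i ω => ?_⟩, hrate.congr hae, le_of_eq ?_⟩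
  · refine MeasurableSpace.measurableSet_iInf.2 fun u =>
      MeasurableSpace.measurableSet_iInf.2 fun hu => ?_
    rw [samplerInfo_delayedPolicy]
    have h1 := MeasurableSpace.measurableSet_iInf.1
      (MeasurableSpace.measurableSet_iInf.1 (hS.causal m t) u) hu
    have h2 : MeasurableSet[samplerInfo W Y S m u] {ω | deliveryTime Y S m ω ≤ t} :=
      (biSup_mono fun _ hs => le_trans hs hu.le : samplerInfo W Y S m t ≤ samplerInfo W Y S m u) _
        (measurableSet_deliveryTime_le le_rfl t)
    have e : {ω | delayedPolicy Y S (m + 1) ω ≤ t} =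
        {ω | S (m + 1) ω ≤ t} ∩ {ω | deliveryTime Y S m ω ≤ t} := by
      ext ω
      exact max_le_iff (a := S (m + 1) ω) (b := deliveryTime Y S m ω) (c := (t : ℝ≥0∞))
    rw [e]
    exact h1.inter h2
  · rw [deliveryTime_delayedPolicy]
    exact deliveryTime_le_serviceStart i ω
  · have e : ∀ T : ℝ, ∫⁻ ω, (∫⁻ t in Set.Icc (0 : ℝ) T,
        estError W Y (delayedPolicy Y S) t ω) ∂P =
        ∫⁻ ω, (∫⁻ t in Set.Icc (0 : ℝ) T, estError W Y S t ω) ∂P := fun T => by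
      refine lintegral_congr_ae ?_
      filter_upwards [hae] with ω hω
      simp only [estError, estimate, deliveryTime_delayedPolicy, hω]
    unfold mse
    unfold estError at e
    simp only [e]

end NoService

/-- A policy that may sample before deliveries is dominated by a policy that does not. -/
theorem exists_nonQueueing_mse_le {Ω : Type*} [MeasurableSpace Ω] {P : Measure Ω}
    {W : ℝ≥0 → Ω → ℝ} {Y : ℕ → Ω → ℝ≥0} (h : IsModel P W Y) {fmax : ℝ≥0∞}
    {S : ℕ → Ω → ℝ≥0∞} (hS : IsOnlinePolicy P W Y S) (hrate : RateConstraint P fmax S) :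
    ∃ S' : ℕ → Ω → ℝ≥0∞, IsNonQueueingPolicy P W Y S' ∧ RateConstraint P fmax S' ∧
      mse P W Y S' ≤ mse P W Y S := by
  by_cases hY : ∫⁻ ω, (Y 0 ω : ℝ≥0∞) ∂P = 0
  · refine exists_nonQueueing_of_no_service hS (ae_all_iff.2 fun i => ?_) hrate
    have h0 : ∀ᵐ ω ∂P, Y 0 ω = 0 := by
      rw [lintegral_eq_zero_iff (h.measY 0).coe_nnreal_ennreal] at hY
      filter_upwards [hY] with ω hω using ENNReal.coe_eq_zero.1 hω
    exact (h.identY i).symm.ae_mem_snd (measurableSet_singleton 0) h0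
  · exact exists_nonQueueing_of_service h hY hS hrate

end RemoteEstimation

end

theorem mainTheorem4 {Ω : Type*} [MeasurableSpace Ω] (P : Measure Ω)
    (W : ℝ≥0 → Ω → ℝ) (hW : IsBrownianReal W P) (hWmeas : ∀ t, Measurable (W t))
    (hWcont : ∀ ω, Continuous fun t => W t ω)
    (Y : ℕ → Ω → ℝ≥0) (hYmeas : ∀ i, Measurable (Y i)) (hYindep : iIndepFun Y P)
    (hYident : ∀ i, IdentDistrib (Y i) (Y 0) P P)
    (hYsq : MemLp (fun ω => (Y 0 ω : ℝ)) 2 P)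
    (hWY : IndepFun (fun ω t => W t ω) (fun ω i => Y i ω) P)
    (fmax : ℝ≥0∞) (hfmax : 0 < fmax) :
    (∀ S : ℕ → Ω → ℝ≥0∞, RemoteEstimation.IsOnlinePolicy P W Y S →
      RemoteEstimation.RateConstraint P fmax S →
      ∃ S' : ℕ → Ω → ℝ≥0∞, RemoteEstimation.IsNonQueueingPolicy P W Y S' ∧
        RemoteEstimation.RateConstraint P fmax S' ∧
        RemoteEstimation.mse P W Y S' ≤ RemoteEstimation.mse P W Y S) ∧
    RemoteEstimation.mseOpt P W Y fmax = RemoteEstimation.mseOptNonQueueing P W Y fmax := by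
  have h : RemoteEstimation.IsModel P W Y :=
    ⟨hW, hWmeas, hWcont, hYmeas, hYindep, hYident, hYsq, hWY⟩
  refine ⟨fun S hS hrate => RemoteEstimation.exists_nonQueueing_mse_le h hS hrate,
    le_antisymm ?_ ?_⟩
  · exact le_iInf₂ fun S hS => iInf₂_le S ⟨hS.1.toIsOnlinePolicy, hS.2⟩
  · refine le_iInf₂ fun S hS => ?_
    obtain ⟨S', h1, h2, h3⟩ := RemoteEstimation.exists_nonQueueing_mse_le h hS.1 hS.2
    exact (iInf₂_le S' ⟨h1, h2⟩).trans h3
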